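/- **Setting.** Let $(\mathcal V,\chi)$, $\chi=(\chi_1,\dots,\chi_P)$, $P\ge 2$, be a global-in-time varifold-BV solution of planar multiphase mean curvature flow: $\mathcal V_t$ are integral rectifiable $1$-varifolds in $\mathbb R^2$ with weight measures $\mu_t$ and generalized mean curvature vector $H_\mu(\cdot,t)\in L^2(\mu_t)$, forming a Brakke flow with $\mu_\tau(\mathbb R^2)+\int_s^\tau\int|H_\mu|^2d\mu_t\,dt\le\mu_s(\mathbb R^2)$; $\chi_i(\cdot,t)$ are indicator functions of sets of finite perimeter partitioning $\mathbb R^2$, with essentially bounded interface energy on bounded time intervals, $\frac12\sum_i|\nabla\chi_i(\cdot,t)|\le\mu_t$ and $\partial_t\chi_i+H_\mu\cdot\nabla\chi_i=0$ in the sense of distributions. Put $I_{i,j}=\partial^*\{\chi_i=1\}\cap\partial^*\{\chi_j=1\}$, $n_{i,j}=-\frac{\nabla\chi_i}{|\nabla\chi_i|}$ and $V_{i,j}=-H_\mu\cdot\frac{\nabla\chi_i}{|\nabla\chi_i|}$ on $I_{i,j}$. Let $(A(t))_{t\in[0,T_{ext})}$, $T_{ext}>0$, be a smooth evolution by mean curvature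 flow of bounded open sets with smooth simple closed boundary curve $\bar I(t)=\partial A(t)$, inner unit normal $n_{\bar I}$, scalar curvature $H_{\bar I}=-\nabla^{\tan}\cdot n_{\bar I}$, signed distance $s_{\bar I}$ (positive inside) and nearest-point projection $P_{\bar I}$; let $\bar\chi_1=1_{A(t)}$, $\bar\chi_P=1-\bar\chi_1$, $\bar\chi_i=0$ otherwise, and $r(t)=\sqrt{2(T_{ext}-t)}$. Assume that for every $t\in(0,T_{ext})$ the set $A(t)$ is *$\delta_{asymp}$-close to a circle of radius $r=r(t)$*: it is simply connected, $r/2$ is a tubular neighborhood width of $\partial A(t)$, and there is an arc-length parametrization $\gamma$ of $\partial A(t)$, with length $L$, such that $\frac{|L-2\pi r|}{2\pi r}\le\delta_{asymp}$ and, for all $\theta\in[0,L)$, $|n_{\bar I}(\gamma(\theta))+e^{2\pi i\theta/L}|\le\delta_{asymp}$, $r|H_{\bar I}(\gamma(\theta))-\frac1r|\le\delta_{asymp}$, $r^2|\nabla^{\tan}H_{\bar I}(\gamma(\theta))|\le\delta_{asymp}$. Let $\eta:\mathbb R\to[0,1]$ be smooth with $\eta=1$ on $\{|s|\le\frac18\}$,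 $\eta=0$ on $\{|s|\ge\frac14\}$, $|\eta'|\le16$; let $\bar\vartheta:\mathbb R\to[-1,1]$ be smooth with $\bar\vartheta(s)=-s$ for $|s|\le\frac14$, $\bar\vartheta=-1$ for $s\ge\frac12$, $\bar\vartheta=1$ for $s\le-\frac12$, $|\bar\vartheta'|\le4$; for $C_\zeta\ge1$ let $\zeta:\mathbb R\to[0,1]$ be smooth with $\zeta=1$ for $|s|\le\frac1{16C_\zeta}$, $\zeta=0$ for $|s|>\frac1{8C_\zeta}$. Put $\xi=\eta(s_{\bar I}/r)\,n_{\bar I}\circ P_{\bar I}$, $\xi_1=-\frac12\xi$, $\xi_P=\frac12\xi$, $\xi_i=0$ otherwise, $\xi_{i,j}=\xi_i-\xi_j$, $B=\eta(s_{\bar I}/r)(H_{\bar I}n_{\bar I})\circ P_{\bar I}$, $\vartheta_1=\frac1r\bar\vartheta(s_{\bar I}/r)$, and $\vartheta_i=1$ for $2\le i\le P-1$. Let $t_\chi>0$, $z:[0,t_\chi)\to\mathbb R^2$ locally Lipschitz and $T:[0,t_\chi)\to\mathbb R$ Lipschitz, restricting to a strictly increasing bijection $(0,t_\chi)\to(0,T_{ext})$,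 with $z(0)=0$, $T(0)=0$. Write $\mathfrak T=T-\mathrm{id}$, $r_T(t)=r(T(t))$, $f^{z,T}(x,t)=f(x-z(t),T(t))$, $\bar I^{z,T}(t)=z(t)+\bar I(T(t))$, with unit normal $n_{\bar I^{z,T}}(\cdot,t)$ pointing into $z(t)+A(T(t))$, and $$\rho(x,t)=\int_0^{r_T/2}(\bar\chi_1^{z,T}-\chi_1)(x+\ell n_{\bar I^{z,T}},t)\,\zeta(\tfrac{\ell}{r_T})\,d\ell-\int_{-r_T/2}^0(\chi_1-\bar\chi_1^{z,T})(x+\ell n_{\bar I^{z,T}},t)\,\zeta(\tfrac{\ell}{r_T})\,d\ell .$$ Assume that for a.e. $t\in(0,t_\chi)$ $$\dot z(t)=\frac{6}{r_T^2(t)}⨍_{\bar I^{z,T}(t)}\rho\,n_{\bar I^{z,T}}\,d\mathcal H^1,\qquad \dot{\mathfrak T}(t)=\frac{4}{r_T(t)}⨍_{\bar I^{z,T}(t)}\rho\,d\mathcal H^1\qquad(*)$$ (here $⨍$ denotes the average). With all quantities evaluated at time $t$, put $$E[\chi|\bar\chi^{z,T}]=\sum_{i\ne j}\frac12\int_{I_{i,j}}(1-n_{i,j}\cdot\xi^{z,T}_{i,j})\,d\mathcal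 H^1+\sum_{i=1}^{P-1}\int_{\mathbb R^2}|\chi_i-\bar\chi_i^{z,T}||\vartheta_i^{z,T}|\,dx,$$ and, dropping the superscripts $z,T$ of $\xi_{i,j},B,\vartheta_i,\bar\chi_i$ on the right-hand sides (where $\partial_t$ acts on the shifted functions), $$\mathcal D_{i,j}=\int_{I_{i,j}}\tfrac12|V_{i,j}+\nabla\cdot\xi_{i,j}|^2+\tfrac12|V_{i,j}n_{i,j}-(B\cdot\xi_{i,j})\xi_{i,j}|^2\,d\mathcal H^1,$$ $$\begin{aligned}RHS^{int}_{i,j}=\int_{I_{i,j}}&-(\partial_t\xi_{i,j}+(B\cdot\nabla)\xi_{i,j}+(\nabla B)^{\mathsf T}\xi_{i,j})\cdot(n_{i,j}-\xi_{i,j})-(\partial_t\xi_{i,j}+(B\cdot\nabla)\xi_{i,j})\cdot\xi_{i,j}\\&+\tfrac12|\nabla\cdot\xi_{i,j}+B\cdot\xi_{i,j}|^2-\tfrac12|B\cdot\xi_{i,j}|(1-|\xi_{i,j}|^2)-(1-n_{i,j}\cdot\xi_{i,j})(\nabla\cdot\xi_{i,j})(B\cdot\xi_{i,j})\\&+((\mathrm{Id}-\xi_{i,j}\otimes\xi_{i,j})B)\cdot(V_{i,j}+\nabla\cdot\xi_{i,j})n_{i,j}+(1-n_{i,j}\cdot\xi_{i,j})\nabla\cdot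 B\\&-(n_{i,j}-\xi_{i,j})\otimes(n_{i,j}-\xi_{i,j}):\nabla B\;d\mathcal H^1,\end{aligned}$$ $$\begin{aligned}RHS^{bulk}_i=&-\sum_{j\ne i}\int_{I_{i,j}}\vartheta_i(B\cdot\xi_{i,j}-V_{i,j})+\vartheta_iB\cdot(n_{i,j}-\xi_{i,j})\,d\mathcal H^1\\&+\int_{\mathbb R^2}(\chi_i-\bar\chi_i)\vartheta_i\nabla\cdot B+(\chi_i-\bar\chi_i)(\partial_t\vartheta_i+(B\cdot\nabla)\vartheta_i)\,dx.\end{aligned}$$ For $C,C'\ge1$, the solution is *in the perturbative graph regime at time $t\in(0,t_\chi)$* if $\chi_i(\cdot,t)=0$ a.e. for $i\notin\{1,P\}$; $\mathcal V_t=(\mathcal H^1\llcorner\operatorname{supp}|\nabla\chi_1(\cdot,t)|)\otimes(\delta_{\mathrm{Tan}_x\operatorname{supp}|\nabla\chi_1(\cdot,t)|})_x$; and there is $h\in H^2(\bar I^{z,T}(t))$ with $I_{1,P}(t)=\{x+h(x)n_{\bar I^{z,T}}(x,t):x\in\bar I^{z,T}(t)\}$, $\|h\|_{L^\infty}\le\frac{r_T(t)}{16\max\{C,C_\zeta\}}$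 and $\|h'\|_{L^\infty}\le\frac1{C'}$. **Statement.** For every $\alpha\in(1,5)$ there are constants $C_0,C_0',C_{\zeta,0}\ge1$ and $\delta_0\in(0,\frac12)$, depending only on $\alpha$, such that for all $C\ge C_0$, $C'\ge C_0'$, $C_\zeta\ge C_{\zeta,0}$, $\delta_{asymp}\in(0,\delta_0]$ the following holds in every setting as above. Let $t\in(0,t_\chi)$ be a time at which the solution is in the perturbative graph regime, the defining properties of a varifold-BV solution which are required at almost every time hold, $\{\chi_1(\cdot,t)=1\}$ has finite area, and $z,T$ are differentiable with $(*)$. Then, at time $t$, $$\sum_{i,j=1,\,i\ne j}^P\frac12\big(-\mathcal D_{i,j}+RHS^{int}_{i,j}\big)+\sum_{i=1}^{P-1}RHS^{bulk}_i\le-\frac{\alpha}{r_T^2}\,(1+\dot{\mathfrak T})\,E[\chi|\bar\chi^{z,T}].$$ -/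

import Mathlib

open MeasureTheory Set Filter Topology
open scoped ContDiff ENNReal InnerProductSpace

noncomputable section

namespace CircMCF

/-! ### The plane -/

/-- The Euclidean plane. -/
abbrev Plane : Type := EuclideanSpace ℝ (Fin 2)

/-- Counter-clockwise rotation by 90 degrees. -/
def rotJ (v : Plane) : Plane := !₂[-(v 1), v 0]

/-- Divergence of a vector field. -/
def divg (F : Plane → Plane) (x : Plane) : ℝ :=
  LinearMap.trace ℝ Plane (fderiv ℝ F x : Plane →ₗ[ℝ] Plane)

/-! ### Geometry of a planar domain `A` with smooth boundary `frontier A` -/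

/-- Signed distance to the boundary, positive inside `A`. -/
def sdist (A : Set Plane) (x : Plane) : ℝ :=
  Metric.infDist x Aᶜ - Metric.infDist x A

/-- The unit normal along `frontier A` pointing inside `A`, as the gradient of the signed
distance. -/
def nrm (A : Set Plane) (x : Plane) : Plane := gradient (sdist A) x

/-- Nearest point projection onto `frontier A`. -/
def proj (A : Set Plane) (x : Plane) : Plane :=
  Classical.epsilon fun p => p ∈ frontier A ∧ dist x p = Metric.infDist x (frontier A)

/-- The scalar mean curvature `H = - div_tan n` along `frontier A`: the tangential divergence is
the divergence of the extension of `n` which is constant in normal direction. It is positive for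
discs. -/
def curv (A : Set Plane) (x : Plane) : ℝ := -divg (fun y => nrm A (proj A y)) x

/-- Tangential gradient along `frontier A`: gradient of the extension which is constant in normal
direction. -/
def tanGrad (A : Set Plane) (f : Plane → ℝ) (x : Plane) : Plane :=
  gradient (fun y => f (proj A y)) x

/-- `γ` is a smooth `L`-periodic arc-length parametrization of the simple closed curve `Γ`. -/
structure IsArcLengthParam (Γ : Set Plane) (γ : ℝ → Plane) (L : ℝ) : Prop where
  pos : 0 < L
  smooth : ContDiff ℝ ∞ γ
  periodic : Function.Periodic γ L
  unit_speed : ∀ s, ‖deriv γ s‖ = 1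
  inj : InjOn γ (Ico 0 L)
  range_eq : range γ = Γ

/-- `A` is quantitatively `δ`-close to a circle of radius `r`. The field `tube` says that `r / 2` is
a tubular neighborhood width of the boundary. -/
structure CloseToCircle (δ r : ℝ) (A : Set Plane) : Prop where
  isOpen : IsOpen A
  bounded : Bornology.IsBounded A
  simplyConnected : SimplyConnectedSpace A
  tube : InjOn (fun p : Plane × ℝ => p.1 + p.2 • nrm A p.1)
    (frontier A ×ˢ Ioo (-(r / 2)) (r / 2))
  param : ∃ (γ : ℝ → Plane) (L : ℝ), IsArcLengthParam (frontier A) γ L ∧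
    1 / (2 * Real.pi * r) * |L - 2 * Real.pi * r| ≤ δ ∧
    (∀ θ ∈ Ico 0 L, ‖nrm A (γ θ) -
      (-!₂[Real.cos (2 * Real.pi * θ / L), Real.sin (2 * Real.pi * θ / L)])‖ ≤ δ) ∧
    (∀ θ ∈ Ico 0 L, r * |curv A (γ θ) - 1 / r| ≤ δ) ∧
    (∀ θ ∈ Ico 0 L, r ^ 2 * ‖tanGrad A (curv A) (γ θ)‖ ≤ δ)

/-- `(A t)`, for `0 ≤ t < Text`, is a smooth evolution by mean curvature of bounded open sets with
simple closed boundary curves. -/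
structure IsSmoothMCF (A : ℝ → Set Plane) (Text : ℝ) : Prop where
  isOpen : ∀ t ∈ Ico 0 Text, IsOpen (A t)
  bounded : ∀ t ∈ Ico 0 Text, Bornology.IsBounded (A t)
  evolution : ∃ γ : ℝ → ℝ → Plane,
    ContDiffOn ℝ ∞ (fun p : ℝ × ℝ => γ p.1 p.2) (univ ×ˢ Ico 0 Text) ∧
    (∀ t ∈ Ico 0 Text, Function.Periodic (fun u => γ u t) 1 ∧
      (∀ u, deriv (fun v => γ v t) u ≠ 0) ∧
      InjOn (fun u => γ u t) (Ico 0 1) ∧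
      range (fun u => γ u t) = frontier (A t)) ∧
    ∀ t ∈ Ioo 0 Text, ∀ u,
      ⟪deriv (fun s => γ u s) t, nrm (A t) (γ u t)⟫_ℝ = curv (A t) (γ u t)

/-! ### Sets of finite perimeter -/

/-- The distributional gradient of `f` is the finite vector measure `ν m`, with `|ν| = 1`; thus `m`
is the total variation `|∇f|` and `ν = ∇f / |∇f|`. -/
structure IsPolarGradient (f : Plane → ℝ) (m : Measure Plane) (ν : Plane → Plane) : Prop where
  finite : IsFiniteMeasure m
  measurable : Measurable ν
  unit : ∀ᵐ x ∂m, ‖ν x‖ = 1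
  gauss_green : ∀ φ : Plane → Plane, ContDiff ℝ 1 φ → HasCompactSupport φ →
    ∫ x, f x * divg φ x = -∫ x, ⟪φ x, ν x⟫_ℝ ∂m

/-- The distributional gradient of `f` is a finite vector measure. -/
def HasFinitePerimeter (f : Plane → ℝ) : Prop := ∃ m ν, IsPolarGradient f m ν

open Classical in
/-- The perimeter measure `|∇f|`. -/
def perim (f : Plane → ℝ) : Measure Plane :=
  if h : HasFinitePerimeter f then h.choose else 0

open Classical in
/-- The density `∇f / |∇f|`, defined up to `|∇f|`-null sets. -/
def polar (f : Plane → ℝ) : Plane → Plane :=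
  if h : HasFinitePerimeter f then h.choose_spec.choose else 0

/-- The reduced boundary (De Giorgi). -/
def redBdry (f : Plane → ℝ) : Set Plane :=
  {x | (∀ r > 0, 0 < perim f (Metric.ball x r)) ∧
    ∃ v : Plane, ‖v‖ = 1 ∧
      Tendsto (fun r : ℝ => ⨍ y in Metric.ball x r, polar f y ∂(perim f)) (𝓝[>] 0) (𝓝 v)}

/-- The precise representative of `∇f / |∇f|` on the reduced boundary (the measure theoretic inner
normal if `f` is the indicator function of a set). -/
def measNormal (f : Plane → ℝ) (x : Plane) : Plane :=
  limUnder (𝓝[>] (0 : ℝ)) fun r => ⨍ y in Metric.ball x r, polar f y ∂(perim f)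

/-! ### One-dimensional varifolds in the plane -/

/-- The orthogonal projection onto the line spanned by the unit vector `v`. -/
def lineProj (v : Plane) : Plane →L[ℝ] Plane := (innerSL ℝ v).smulRight v

/-- The Grassmannian of lines through the origin, a line being identified with the orthogonal
projection onto it. -/
abbrev Gr : Type := {S : Plane →L[ℝ] Plane // ∃ v : Plane, ‖v‖ = 1 ∧ S = lineProj v}

open Classical in
/-- The line spanned by a unit vector `v` (a default line for other vectors). -/
def lineOf (v : Plane) : Gr :=
  if h : ‖v‖ = 1 then ⟨lineProj v, v, h, rfl⟩
  else ⟨lineProj (EuclideanSpace.single 0 1), EuclideanSpace.single 0 1, by simp, rfl⟩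

/-- Integral rectifiable varifolds: `V` is given by a measurable set `M` which, up to an
`ℋ¹`-null set, is covered by countably many `C¹` curves of unit speed, an integer multiplicity
`θ`, and the approximate tangent lines of `M`. -/
def IsIntegralVarifold (V : Measure (Plane × Gr)) : Prop :=
  IsLocallyFiniteMeasure V ∧
  ∃ (c : ℕ → ℝ → Plane) (M : Set Plane) (θ : Plane → ℕ) (S : Plane → Gr),
    (∀ k, ContDiff ℝ 1 (c k) ∧ ∀ s, ‖deriv (c k) s‖ = 1) ∧
    MeasurableSet M ∧ Measurable θ ∧ Measurable S ∧
    μH[1] (M \ ⋃ k, range (c k)) = 0 ∧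
    (∀ k, ∀ᵐ x ∂(μH[1].restrict (M ∩ range (c k))), ∀ s, c k s = x →
      S x = lineOf (deriv (c k) s)) ∧
    V = ((μH[1].restrict M).withDensity fun x => (θ x : ℝ≥0∞)).map fun x => (x, S x)

/-- `H ∈ L²` is the generalized mean curvature vector of the varifold `V`. -/
def IsGeneralizedMeanCurvature (V : Measure (Plane × Gr)) (H : Plane → Plane) : Prop :=
  MemLp H 2 V.fst ∧
  ∀ B : Plane → Plane, ContDiff ℝ ∞ B → HasCompactSupport B →
    -∫ x, ⟪H x, B x⟫_ℝ ∂V.fst =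
      ∫ p, LinearMap.trace ℝ Plane ((p.2.1 ∘L fderiv ℝ B p.1 : Plane →L[ℝ] Plane) :
        Plane →ₗ[ℝ] Plane) ∂V

/-! ### Varifold-BV solutions with `n + 2` phases

The phases `1, …, P` are indexed by `Fin (n + 2)`, so that `0` is the first and `Fin.last (n + 1)`
the last phase. -/

/-- The properties which a varifold-BV solution has at almost every time. -/
structure IsRegularSlice {n : ℕ} (χ : Fin (n + 2) → Plane → ℝ) (V : Measure (Plane × Gr))
    (H : Plane → Plane) : Prop where
  perimeter : ∀ i, HasFinitePerimeter (χ i)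
  partition : ∀ᵐ x, ∑ i, χ i x = 1
  integral : IsIntegralVarifold V
  curvature : IsGeneralizedMeanCurvature V H
  compatible : (1 / 2 : ℝ≥0∞) • ∑ i, perim (χ i) ≤ V.fst

/-- Global-in-time varifold-BV solutions of multiphase mean curvature flow, with initial data given
by the values at time `0`. -/
structure IsVarifoldBVSolution {n : ℕ} (V : ℝ → Measure (Plane × Gr))
    (χ : Fin (n + 2) → Plane → ℝ → ℝ) (H : Plane → ℝ → Plane) : Prop where
  measurable_phase : ∀ i, Measurable fun p : Plane × ℝ => χ i p.1 p.2
  indicator : ∀ i x t, χ i x t = 0 ∨ χ i x t = 1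
  measurable_curvature : Measurable fun p : Plane × ℝ => H p.1 p.2
  measurable_varifold : ∀ φ : Plane × Gr → ℝ, Continuous φ → HasCompactSupport φ →
    AEMeasurable (fun t => ∫ p, φ p ∂(V t)) (volume.restrict (Ioi 0))
  initial_varifold : IsIntegralVarifold (V 0)
  initial_mass : V 0 univ < ⊤
  initial_perimeter : ∀ i, HasFinitePerimeter fun x => χ i x 0
  initial_partition : ∀ᵐ x, ∑ i, χ i x 0 = 1
  slice : ∀ᵐ t ∂(volume.restrict (Ioi (0 : ℝ))),
    IsRegularSlice (fun i x => χ i x t) (V t) fun x => H x t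
  energy_bound : ∀ τ : ℝ, ∃ C : ℝ≥0∞, C < ⊤ ∧ ∀ᵐ t ∂(volume.restrict (Ioo 0 τ)),
    (1 / 2 : ℝ≥0∞) * ∑ p ∈ (Finset.univ : Finset (Fin (n + 2))).offDiag,
      μH[1] (redBdry (fun x => χ p.1 x t) ∩ redBdry fun x => χ p.2 x t) ≤ C
  brakke : ∀ φ : Plane → ℝ → ℝ, ContDiff ℝ 1 (fun p : Plane × ℝ => φ p.1 p.2) →
    HasCompactSupport (fun p : Plane × ℝ => φ p.1 p.2) → (∀ x t, 0 ≤ φ x t) →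
    ∀ s τ : ℝ, 0 ≤ s → s < τ →
      (∫ x, φ x τ ∂(V τ).fst) - (∫ x, φ x s ∂(V s).fst) ≤
        ∫ t in s..τ, ∫ x, (⟪gradient (fun y => φ y t) x, H x t⟫_ℝ - φ x t * ‖H x t‖ ^ 2
          + deriv (fun t' => φ x t') t) ∂(V t).fst
  dissipation : ∀ s τ : ℝ, 0 ≤ s → s ≤ τ →
    V τ univ + ∫⁻ t in Ioc s τ, ∫⁻ x, ‖H x t‖ₑ ^ 2 ∂(V t).fst ≤ V s univ
  transport : ∀ i, ∀ φ : Plane → ℝ → ℝ, ContDiff ℝ ∞ (fun p : Plane × ℝ => φ p.1 p.2) →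
    HasCompactSupport (fun p : Plane × ℝ => φ p.1 p.2) →
    -(∫ x, χ i x 0 * φ x 0)
      - (∫ t in Ioi (0 : ℝ), ∫ x, χ i x t * deriv (fun t' => φ x t') t)
      + ∫ t in Ioi (0 : ℝ), ∫ x, φ x t * ⟪H x t, polar (fun y => χ i y t) x⟫_ℝ
          ∂(perim fun y => χ i y t) = 0

/-- A function on the real line is in `H²_loc` (for a continuous representative): it is
differentiable, and its derivative is an integral of a locally square integrable function. -/
def IsH2 (f : ℝ → ℝ) : Prop :=
  Differentiable ℝ f ∧ ∃ g : ℝ → ℝ, (∀ a b, MemLp g 2 (volume.restrict (Icc a b))) ∧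
    ∀ a b, deriv f b - deriv f a = ∫ s in a..b, g s

/-! ### Cutoff functions -/

/-- The cutoff in the definition of the interface error heights. -/
structure IsHeightCutoff (Cζ : ℝ) (ζ : ℝ → ℝ) : Prop where
  smooth : ContDiff ℝ ∞ ζ
  mem : ∀ s, ζ s ∈ Icc 0 1
  eq_one : ∀ s, |s| ≤ 1 / (16 * Cζ) → ζ s = 1
  eq_zero : ∀ s, 1 / (8 * Cζ) < |s| → ζ s = 0

/-- The cutoff in the definition of the calibration. -/
structure IsCalibrationCutoff (η : ℝ → ℝ) : Prop where
  smooth : ContDiff ℝ ∞ η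
  mem : ∀ s, η s ∈ Icc 0 1
  eq_one : ∀ s, |s| ≤ 1 / 8 → η s = 1
  eq_zero : ∀ s, 1 / 4 ≤ |s| → η s = 0
  deriv_le : ∀ s, |deriv η s| ≤ 16

/-- The truncated linear function in the definition of the bulk weight. -/
structure IsWeightProfile (w : ℝ → ℝ) : Prop where
  smooth : ContDiff ℝ ∞ w
  mem : ∀ s, w s ∈ Icc (-1) 1
  eq_neg : ∀ s, |s| ≤ 1 / 4 → w s = -s
  eq_neg_one : ∀ s, 1 / 2 ≤ s → w s = -1
  eq_one : ∀ s, s ≤ -(1 / 2) → w s = 1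
  deriv_le : ∀ s, |deriv w s| ≤ 4

/-! ### The objects of the relative energy method -/

/-- The data: a strong solution (`A t` is the region of its first phase, `Text` its extinction
time), a candidate varifold-BV solution `(V, χ)` with curvature vector `H`, a space-time shift
`(z, T)` on the time horizon `(0, tχ)`, and the cutoff functions. -/
structure Setting (n : ℕ) where
  A : ℝ → Set Plane
  Text : ℝ
  V : ℝ → Measure (Plane × Gr)
  χ : Fin (n + 2) → Plane → ℝ → ℝ
  H : Plane → ℝ → Plane
  tχ : ℝ
  z : ℝ → Plane
  T : ℝ → ℝ
  ζ : ℝ → ℝ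
  η : ℝ → ℝ
  w : ℝ → ℝ

namespace Setting

variable {n : ℕ} (S : Setting n)

/-- The radius `r(t) = √(2 (Text - t))`. -/
def r (t : ℝ) : ℝ := Real.sqrt (2 * (S.Text - t))

/-- The radius `r_T(t) = r(T(t))`. -/
def rT (t : ℝ) : ℝ := S.r (S.T t)

/-- The space-time shift `f^{z,T}(x, t) = f(x - z(t), T(t))`. -/
def shift {β : Type} (f : Plane → ℝ → β) (x : Plane) (t : ℝ) : β := f (x - S.z t) (S.T t)

/-- The region of the first phase of the shifted strong solution. -/
def shiftedA (t : ℝ) : Set Plane := {x | x - S.z t ∈ S.A (S.T t)}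

/-- The interface of the shifted strong solution. -/
def shiftedI (t : ℝ) : Set Plane := frontier (S.shiftedA t)

/-- The phase indicator functions of the strong solution; all phases but the first and the last are
empty. -/
def chiBar (i : Fin (n + 2)) (x : Plane) (t : ℝ) : ℝ :=
  if i = 0 then (S.A t).indicator 1 x
  else if i = Fin.last (n + 1) then 1 - (S.A t).indicator 1 x
  else 0

/-- The extension `ξ` of the unit normal. -/
def xi (x : Plane) (t : ℝ) : Plane :=
  S.η (sdist (S.A t) x / S.r t) • nrm (S.A t) (proj (S.A t) x)

/-- The vector fields `ξ_i`. -/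
def xiPhase (i : Fin (n + 2)) (x : Plane) (t : ℝ) : Plane :=
  if i = 0 then -((1 / 2 : ℝ) • S.xi x t)
  else if i = Fin.last (n + 1) then (1 / 2 : ℝ) • S.xi x t
  else 0

/-- The vector fields `ξ_{i,j} = ξ_i - ξ_j`. -/
def xiPair (i j : Fin (n + 2)) (x : Plane) (t : ℝ) : Plane := S.xiPhase i x t - S.xiPhase j x t

/-- The extension `B` of the normal velocity. -/
def vel (x : Plane) (t : ℝ) : Plane :=
  S.η (sdist (S.A t) x / S.r t) •
    (curv (S.A t) (proj (S.A t) x) • nrm (S.A t) (proj (S.A t) x))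

/-- The weights `ϑ_i`. -/
def weight (i : Fin (n + 2)) (x : Plane) (t : ℝ) : ℝ :=
  if i = 0 then 1 / S.r t * S.w (sdist (S.A t) x / S.r t) else 1

/-- The interface `I_{i,j}(t)` of the weak solution. -/
def iface (i j : Fin (n + 2)) (t : ℝ) : Set Plane :=
  redBdry (fun x => S.χ i x t) ∩ redBdry fun x => S.χ j x t

/-- The unit normal `n_{i,j} = - ∇χ_i / |∇χ_i|`, pointing from phase `i` to phase `j`. -/
def normal (i : Fin (n + 2)) (x : Plane) (t : ℝ) : Plane := -measNormal (fun y => S.χ i y t) x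

/-- The normal velocity `V_{i,j} = V_i = - H · ∇χ_i / |∇χ_i|`. -/
def speed (i : Fin (n + 2)) (x : Plane) (t : ℝ) : ℝ :=
  -⟪S.H x t, measNormal (fun y => S.χ i y t) x⟫_ℝ

/-- The interface error heights `ρ = ρ₊ - ρ₋`. -/
def height (x : Plane) (t : ℝ) : ℝ :=
  (∫ l in (0 : ℝ)..(S.rT t / 2),
    (S.shift (S.chiBar 0) (x + l • nrm (S.shiftedA t) x) t
      - S.χ 0 (x + l • nrm (S.shiftedA t) x) t) * S.ζ (l / S.rT t))
  - ∫ l in (-(S.rT t / 2))..(0 : ℝ),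
    (S.χ 0 (x + l • nrm (S.shiftedA t) x) t
      - S.shift (S.chiBar 0) (x + l • nrm (S.shiftedA t) x) t) * S.ζ (l / S.rT t)

/-- The ordinary differential equations for the shift, at time `t`; note `T = id + 𝔗`. -/
def ShiftODE (t : ℝ) : Prop :=
  HasDerivAt S.z ((6 / S.rT t ^ 2) •
    ⨍ x in S.shiftedI t, S.height x t • nrm (S.shiftedA t) x ∂μH[1]) t ∧
  HasDerivAt S.T (1 + 4 / S.rT t * ⨍ x in S.shiftedI t, S.height x t ∂μH[1]) t

/-- The standing assumptions, depending on the constants `δasymp` and `Cζ`. -/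
structure Standing (δasymp Cζ : ℝ) : Prop where
  weak : IsVarifoldBVSolution S.V S.χ S.H
  Text_pos : 0 < S.Text
  strong : IsSmoothMCF S.A S.Text
  circular : ∀ t ∈ Ioo 0 S.Text, CloseToCircle δasymp (S.r t) (S.A t)
  heightCutoff : IsHeightCutoff Cζ S.ζ
  calibrationCutoff : IsCalibrationCutoff S.η
  weightProfile : IsWeightProfile S.w
  horizon_pos : 0 < S.tχ
  z_lipschitz : LocallyLipschitzOn (Ico 0 S.tχ) S.z
  T_lipschitz : ∃ K, LipschitzOnWith K S.T (Ico 0 S.tχ)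
  T_mono : StrictMonoOn S.T (Ioo 0 S.tχ)
  T_bij : BijOn S.T (Ioo 0 S.tχ) (Ioo 0 S.Text)
  z_zero : S.z 0 = 0
  T_zero : S.T 0 = 0
  ode : ∀ᵐ t ∂(volume.restrict (Ioo 0 S.tχ)), S.ShiftODE t

/-- The perturbative graph regime at time `t`: only the first and the last phase are present, the
varifold is the unit density varifold of the interface, and the interface is the graph of a small
`H²` height function over the interface of the shifted strong solution. -/
structure PerturbativeRegime (C C' Cζ t : ℝ) : Prop where
  two_phase : ∀ i, i ≠ 0 → i ≠ Fin.last (n + 1) → ∀ᵐ x, S.χ i x t = 0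
  unit_density : S.V t = (μH[1].restrict (perim fun y => S.χ 0 y t).support).map
    fun x => (x, lineOf (rotJ (measNormal (fun y => S.χ 0 y t) x)))
  graph : ∃ h : Plane → ℝ,
    S.iface 0 (Fin.last (n + 1)) t =
      (fun x => x + h x • nrm (S.shiftedA t) x) '' S.shiftedI t ∧
    (∀ x ∈ S.shiftedI t, |h x| ≤ S.rT t / (16 * max C Cζ)) ∧
    ∃ (γ : ℝ → Plane) (L : ℝ), IsArcLengthParam (S.shiftedI t) γ L ∧
      IsH2 (fun s => h (γ s)) ∧ ∀ s, |deriv (fun s' => h (γ s')) s| ≤ 1 / C'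

/-! ### Error functionals, dissipation and right-hand sides -/

/-- The interface error `E_int[χ | χ̄^{z,T}](t)`. -/
def errInt (t : ℝ) : ℝ :=
  ∑ p ∈ (Finset.univ : Finset (Fin (n + 2))).offDiag, (1 / 2) *
    ∫ x in S.iface p.1 p.2 t,
      (1 - ⟪S.normal p.1 x t, S.shift (S.xiPair p.1 p.2) x t⟫_ℝ) ∂μH[1]

/-- The bulk error `E_bulk[χ | χ̄^{z,T}](t)`. -/
def errBulk (t : ℝ) : ℝ :=
  ∑ i ∈ (Finset.univ : Finset (Fin (n + 2))).erase (Fin.last (n + 1)),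
    ∫ x, |S.χ i x t - S.shift (S.chiBar i) x t| * |S.shift (S.weight i) x t|

/-- The total error `E[χ | χ̄^{z,T}](t)`. -/
def err (t : ℝ) : ℝ := S.errInt t + S.errBulk t

/-- The dissipation `𝒟_{i,j}`. -/
def dissip (i j : Fin (n + 2)) (t : ℝ) : ℝ :=
  let ξ := S.shift (S.xiPair i j);
  let B := S.shift S.vel;
  (∫ x in S.iface i j t, 1 / 2 * (S.speed i x t + divg (fun y => ξ y t) x) ^ 2 ∂μH[1])
  + ∫ x in S.iface i j t,
      1 / 2 * ‖S.speed i x t • S.normal i x t - ⟪B x t, ξ x t⟫_ℝ • ξ x t‖ ^ 2 ∂μH[1]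

/-- The right-hand side `RHS^int_{i,j}`; here `(∇B)_{kl} = ∂_l B_k`. -/
def rhsInt (i j : Fin (n + 2)) (t : ℝ) : ℝ :=
  let ξ := S.shift (S.xiPair i j);
  let B := S.shift S.vel;
  let ν := fun x => S.normal i x t;
  let divξ := fun x => divg (fun y => ξ y t) x;
  let DB := fun x => fderiv ℝ (fun y => B y t) x;
  let transport := fun x =>
    deriv (fun s => ξ x s) t + fderiv ℝ (fun y => ξ y t) x (B x t);
  -(∫ x in S.iface i j t,
      ⟪transport x + ContinuousLinearMap.adjoint (DB x) (ξ x t), ν x - ξ x t⟫_ℝ ∂μH[1])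
  - (∫ x in S.iface i j t, ⟪transport x, ξ x t⟫_ℝ ∂μH[1])
  + (∫ x in S.iface i j t, 1 / 2 * (divξ x + ⟪B x t, ξ x t⟫_ℝ) ^ 2 ∂μH[1])
  - (∫ x in S.iface i j t, 1 / 2 * |⟪B x t, ξ x t⟫_ℝ| * (1 - ‖ξ x t‖ ^ 2) ∂μH[1])
  - (∫ x in S.iface i j t, (1 - ⟪ν x, ξ x t⟫_ℝ) * divξ x * ⟪B x t, ξ x t⟫_ℝ ∂μH[1])
  + (∫ x in S.iface i j t,
      ⟪B x t - ⟪ξ x t, B x t⟫_ℝ • ξ x t, (S.speed i x t + divξ x) • ν x⟫_ℝ ∂μH[1])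
  + (∫ x in S.iface i j t, (1 - ⟪ν x, ξ x t⟫_ℝ) * divg (fun y => B y t) x ∂μH[1])
  - ∫ x in S.iface i j t, ⟪ν x - ξ x t, DB x (ν x - ξ x t)⟫_ℝ ∂μH[1]

/-- The right-hand side `RHS^bulk_i`. -/
def rhsBulk (i : Fin (n + 2)) (t : ℝ) : ℝ :=
  let B := S.shift S.vel;
  let ϑ := S.shift (S.weight i);
  let χbar := S.shift (S.chiBar i);
  -(∑ j ∈ (Finset.univ : Finset (Fin (n + 2))).erase i, ∫ x in S.iface i j t,
      ϑ x t * (⟪B x t, S.shift (S.xiPair i j) x t⟫_ℝ - S.speed i x t) ∂μH[1])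
  - (∑ j ∈ (Finset.univ : Finset (Fin (n + 2))).erase i, ∫ x in S.iface i j t,
      ϑ x t * ⟪B x t, S.normal i x t - S.shift (S.xiPair i j) x t⟫_ℝ ∂μH[1])
  + (∫ x, (S.χ i x t - χbar x t) * ϑ x t * divg (fun y => B y t) x)
  + ∫ x, (S.χ i x t - χbar x t) *
      (deriv (fun s => ϑ x s) t + ⟪B x t, gradient (fun y => ϑ y t) x⟫_ℝ)

end Setting

end CircMCF

end

open CircMCF

noncomputable section
namespace CircMCF

/-! ### Linear algebra in the plane -/

/-! At the fixed time everything happens in a tube around the shifted curve, so the inequality is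
turned into a statement about one periodic height function `f` and then decided by its Fourier
coefficients.

Geometry. Closeness to a circle makes `(u, l) ↦ γ u + l • n u` a coordinate system of half width `r
/ 2` (`CloseToCircle.tube_of_param`). For the flow, the signed distance `s` satisfies `∇s = n` and
`∂ₜ s = -H` in the whole tube, and symmetry of second derivatives then yields `∂ₜ n`
(`IsSmoothMCF.hasFDerivAt`). All cutoffs are inactive near the curve, so the calibration, the
velocity and the weight are explicit there.

Weak solution. Off the compact graph the first phase is locally constant; connected collars extend
this to the two regions beside the graph, and finite area selects the inner one
(`NormalGraph.phase_ae_eq`). Its normal is the classical normal at every point of the graph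
(`NormalGraph.measNormal_eq`), and the first variation identifies the generalized curvature with
that of the graph (`NormalGraph.curvature_ae`). The height `ρ` is exactly `f`, so the shift
equations become `z' = (6/r²) avg(f n)` and `θ := T' - 1 = (4/r) avg f`. All of this is collected by
`Setting.exists_graphSlice`.

Reduction. The left side plus `α T'/r²` times the relative energy is the integral over a period of
one density (`GraphSlice.relativeEnergy_eq`). In the scaled variables `y = f/r`, `p = f'`, `q = r
f''`, `X = r τ·z'`, `W = r n·z'` the zeroth and first order terms cancel (`scaledDensity_eq`), and
`r²` times the density is at most `-q² + (3+α)/2 y² + (1+α)/2 p² + pX - Wy - θy` up to a small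
multiple of the sum of the squares (`scaledDensity_le`).

Spectrum. On mode `m` the quadratic form has the symbol `-m⁴ + (1+α)/2 m² + (3+α)/2 = -(m²+1)(m² -
(3+α)/2)`. For `|m| ≥ 2` it is negative because `α < 5`. The modes `0` and `±1` are unstable, with
values `(3+α)/2 < 4` and `1+α < 6`, and the shift pays for them: `-θy` averages to `-4 (avg f)²/r²`,
and after an integration by parts `pX - Wy` averages to about `-12 |avg(f n)|²/r²`
(`GraphSlice.transport_average_le`). Since `n` almost rotates uniformly, `|avg(f n)|²` controls the
first Fourier mode (`Tube.fourierSq_one_le`). The three thresholds are all reached at `α = 5`; for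
smaller `α` there remains a gap proportional to `5 - α` (`spectral_gap`), which absorbs the errors
in `GraphSlice.integral_density_nonpos`. -/

lemma inner_plane (v w : Plane) : ⟪v, w⟫_ℝ = v 0 * w 0 + v 1 * w 1 := by
  simp [PiLp.inner_apply, Fin.sum_univ_two]
  ring

lemma norm_sq_plane (v : Plane) : ‖v‖ ^ 2 = v 0 ^ 2 + v 1 ^ 2 := by
  rw [← real_inner_self_eq_norm_sq, inner_plane]; ring

@[simp] lemma rotJ_zero (v : Plane) : rotJ v 0 = -(v 1) := rfl
@[simp] lemma rotJ_one (v : Plane) : rotJ v 1 = v 0 := rfl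

lemma norm_rotJ (v : Plane) : ‖rotJ v‖ = ‖v‖ := by
  have : ‖rotJ v‖ ^ 2 = ‖v‖ ^ 2 := by
    simp only [norm_sq_plane, rotJ_zero, rotJ_one]; ring
  exact (pow_left_inj₀ (norm_nonneg _) (norm_nonneg _) two_ne_zero).1 this

lemma inner_rotJ_self (v : Plane) : ⟪v, rotJ v⟫_ℝ = 0 := by
  simp only [inner_plane, rotJ_zero, rotJ_one]; ring

/-- `rotJ` as a continuous linear map. -/
def rotJL : Plane →L[ℝ] Plane :=
  LinearMap.toContinuousLinearMap
    { toFun := rotJ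
      map_add' := fun v w => by
        ext i; fin_cases i <;> simp [rotJ]; ring
      map_smul' := fun c v => by ext i; fin_cases i <;> simp [rotJ] }

@[simp] lemma rotJL_apply (v : Plane) : rotJL v = rotJ v := rfl

lemma rotJ_rotJ (v : Plane) : rotJ (rotJ v) = -v := by
  ext i; fin_cases i <;> simp [rotJ]

lemma rotJ_smul (c : ℝ) (v : Plane) : rotJ (c • v) = c • rotJ v := rotJL.map_smul c v

/-- A pair of orthogonal unit vectors of the plane, as an orthonormal basis. -/
lemma exists_orthonormalBasis {τ n : Plane} (hτ : ‖τ‖ = 1) (hn : ‖n‖ = 1) (h : ⟪τ, n⟫_ℝ = 0) :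
    ∃ b : OrthonormalBasis (Fin 2) ℝ Plane, b 0 = τ ∧ b 1 = n := by
  have ho : Orthonormal ℝ ![τ, n] := by
    refine ⟨fun i => by fin_cases i <;> simp [hτ, hn], fun i j hij => ?_⟩
    fin_cases i <;> fin_cases j <;> simp_all [real_inner_comm]
  have hc : Fintype.card (Fin 2) = Module.finrank ℝ Plane := by simp
  refine ⟨(basisOfOrthonormalOfCardEqFinrank ho hc).toOrthonormalBasis (by simpa using ho), ?_, ?_⟩
    <;> simp

lemma plane_decomp {τ n : Plane} (hτ : ‖τ‖ = 1) (hn : ‖n‖ = 1) (h : ⟪τ, n⟫_ℝ = 0) (v : Plane) :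
    v = ⟪τ, v⟫_ℝ • τ + ⟪n, v⟫_ℝ • n := by
  obtain ⟨b, rfl, rfl⟩ := exists_orthonormalBasis hτ hn h
  have := b.sum_repr v
  rw [Fin.sum_univ_two, b.repr_apply_apply, b.repr_apply_apply] at this
  exact this.symm

lemma trace_plane {τ n : Plane} (hτ : ‖τ‖ = 1) (hn : ‖n‖ = 1) (h : ⟪τ, n⟫_ℝ = 0)
    (f : Plane →ₗ[ℝ] Plane) : LinearMap.trace ℝ Plane f = ⟪τ, f τ⟫_ℝ + ⟪n, f n⟫_ℝ := by
  obtain ⟨b, rfl, rfl⟩ := exists_orthonormalBasis hτ hn h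
  rw [LinearMap.trace_eq_sum_inner f b, Fin.sum_univ_two]

lemma eq_smul_of_inner_eq_zero {τ n : Plane} (hτ : ‖τ‖ = 1) (hn : ‖n‖ = 1) (h : ⟪τ, n⟫_ℝ = 0)
    {v : Plane} (hv : ⟪τ, v⟫_ℝ = 0) : v = ⟪n, v⟫_ℝ • n := by
  have := plane_decomp hτ hn h v
  rwa [hv, zero_smul, zero_add] at this

/-! ### The signed distance -/

variable {Ω : Set Plane}

/-- A nearest point of the complement lies on the frontier, and the frontier is contained in the
closure of the complement. Hence the two distances in `sdist` are, up to sign, one distance to the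
boundary. -/
lemma infDist_compl_eq (hΩ : Ω ≠ univ) {x : Plane} (hx : x ∈ Ω) :
    Metric.infDist x Ωᶜ = Metric.infDist x (frontier Ω) := by
  obtain ⟨y, hy, hyd⟩ := exists_mem_frontier_infDist_compl_eq_dist hx hΩ
  refine le_antisymm ?_ (hyd ▸ Metric.infDist_le_dist_of_mem hy)
  rw [← Metric.infDist_closure (s := Ωᶜ)]
  refine Metric.infDist_le_infDist_of_subset ?_ ⟨y, hy⟩
  rw [← frontier_compl]
  exact frontier_subset_closure

lemma sdist_of_mem (hΩ : Ω ≠ univ) {x : Plane} (hx : x ∈ Ω) :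
    sdist Ω x = Metric.infDist x (frontier Ω) := by
  rw [sdist, infDist_compl_eq hΩ hx, Metric.infDist_zero_of_mem hx, sub_zero]

lemma sdist_of_notMem (hΩ : Ω.Nonempty) {x : Plane} (hx : x ∉ Ω) :
    sdist Ω x = -Metric.infDist x (frontier Ω) := by
  have := infDist_compl_eq (Ω := Ωᶜ) (compl_ne_univ.2 hΩ) (x := x) hx
  rw [compl_compl, frontier_compl] at this
  rw [sdist, Metric.infDist_zero_of_mem (show x ∈ Ωᶜ from hx), this, zero_sub]

lemma abs_sdist (hΩ : Ω ≠ univ) (hΩ' : Ω.Nonempty) (x : Plane) :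
    |sdist Ω x| = Metric.infDist x (frontier Ω) := by
  by_cases hx : x ∈ Ω
  · rw [sdist_of_mem hΩ hx, abs_of_nonneg Metric.infDist_nonneg]
  · rw [sdist_of_notMem hΩ' hx, abs_neg, abs_of_nonneg Metric.infDist_nonneg]

lemma sdist_pos_iff (hΩ : Ω ≠ univ) (hΩ' : Ω.Nonempty) (ho : IsOpen Ω)
    (hf : (frontier Ω).Nonempty) {x : Plane} : 0 < sdist Ω x ↔ x ∈ Ω := by
  constructor
  · intro h
    by_contra hx
    rw [sdist_of_notMem hΩ' hx] at h
    linarith [Metric.infDist_nonneg (x := x) (s := frontier Ω)]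
  · intro hx
    rw [sdist_of_mem hΩ hx]
    refine (isClosed_frontier.notMem_iff_infDist_pos hf).1 fun h => ?_
    rw [ho.frontier_eq] at h
    exact h.2 hx

lemma continuous_sdist : Continuous (sdist Ω) :=
  (Metric.continuous_infDist_pt _).sub (Metric.continuous_infDist_pt _)

lemma sdist_of_mem_frontier (hΩ : Ω ≠ univ) (hΩ' : Ω.Nonempty) {x : Plane}
    (hx : x ∈ frontier Ω) : sdist Ω x = 0 := by
  rw [← abs_eq_zero, abs_sdist hΩ hΩ', Metric.infDist_zero_of_mem hx]

/-! ### Periodic arc length parametrizations -/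

variable {Γ : Set Plane} {γ : ℝ → Plane} {L : ℝ}

namespace IsArcLengthParam

lemma hasDerivAt (h : IsArcLengthParam Γ γ L) (u : ℝ) : HasDerivAt γ (deriv γ u) u :=
  (h.smooth.differentiable (by simp)).differentiableAt.hasDerivAt

lemma smooth_deriv (h : IsArcLengthParam Γ γ L) : ContDiff ℝ ∞ (deriv γ) :=
  (contDiff_infty_iff_deriv.1 h.smooth).2

lemma periodic_deriv (h : IsArcLengthParam Γ γ L) : Function.Periodic (deriv γ) L := fun u => by
  rw [← deriv_comp_add_const, funext h.periodic]

lemma mem (h : IsArcLengthParam Γ γ L) (u : ℝ) : γ u ∈ Γ := h.range_eq ▸ mem_range_self u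

lemma exists_mem_Ico (h : IsArcLengthParam Γ γ L) (a : ℝ) {p : Plane} (hp : p ∈ Γ) :
    ∃ u ∈ Ico a (a + L), γ u = p := by
  rw [← h.range_eq] at hp
  obtain ⟨u, rfl⟩ := hp
  obtain ⟨y, hy, hy'⟩ := h.periodic.exists_mem_Ico h.pos u a
  exact ⟨y, hy, hy'.symm⟩

lemma eq_iff (h : IsArcLengthParam Γ γ L) {u v : ℝ} :
    γ u = γ v ↔ ∃ m : ℤ, v = u + m * L := by
  constructor
  · intro huv
    have e (x : ℝ) : γ (toIcoMod h.pos 0 x) = γ x := by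
      rw [toIcoMod]; exact h.periodic.sub_zsmul_eq _
    have hm (x : ℝ) : toIcoMod h.pos 0 x ∈ Ico 0 L := by
      simpa using toIcoMod_mem_Ico h.pos 0 x
    have := h.inj (hm u) (hm v) (by rw [e, e, huv])
    refine ⟨toIcoDiv h.pos 0 v - toIcoDiv h.pos 0 u, ?_⟩
    rw [toIcoMod, toIcoMod, zsmul_eq_mul, zsmul_eq_mul] at this
    push_cast; linarith
  · rintro ⟨m, rfl⟩
    have := (h.periodic.int_mul m) u
    exact this.symm

lemma isCompact (h : IsArcLengthParam Γ γ L) : IsCompact Γ := by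
  have : Γ = γ '' Icc 0 L := by
    refine Subset.antisymm (fun p hp => ?_) (image_subset_iff.2 fun u _ => h.mem u)
    obtain ⟨u, hu, rfl⟩ := h.exists_mem_Ico 0 hp
    exact ⟨u, ⟨hu.1, by linarith [hu.2]⟩, rfl⟩
  rw [this]
  exact isCompact_Icc.image h.smooth.continuous

lemma nonempty (h : IsArcLengthParam Γ γ L) : Γ.Nonempty := ⟨γ 0, h.mem 0⟩

/-- Points of the curve which are close to `γ u` have a parameter close to `u`. -/
lemma exists_dist_lt (h : IsArcLengthParam Γ γ L) (u : ℝ) {δ : ℝ} (hδ : 0 < δ) :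
    ∃ c > 0, ∀ p ∈ Γ, dist p (γ u) < c → ∃ w, |w - u| < δ ∧ γ w = p := by
  have hL := h.pos
  -- The parameters of one period around `u` at distance at least `δ` from `u`. By compactness and
  -- injectivity modulo `L`, the distance from `γ w` to `γ u` is bounded below by a positive
  -- constant there.
  set K := Icc (u - L / 2) (u + L / 2) ∩ {w | δ ≤ |w - u|} with hK
  have hKc : IsCompact K := isCompact_Icc.inter_right
    (isClosed_le continuous_const (by fun_prop))
  have hne : ∀ w ∈ K, 0 < dist (γ w) (γ u) := by
    rintro w ⟨hw, hw'⟩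
    refine dist_pos.2 fun he => ?_
    obtain ⟨m, hm⟩ := h.eq_iff.1 he
    have : m = 0 := by
      have h1 : (m : ℝ) < 1 := by
        by_contra! hc
        nlinarith [hw.1]
      have h2 : (-1 : ℝ) < m := by
        by_contra! hc
        nlinarith [hw.2]
      have h1' : m < 1 := by exact_mod_cast h1
      have h2' : -1 < m := by exact_mod_cast h2
      omega
    simp only [this, Int.cast_zero, zero_mul, add_zero] at hm
    simp only [mem_ofPred_eq, hm, sub_self, abs_zero] at hw'
    linarith
  obtain ⟨c, hc, hcK⟩ : ∃ c > 0, ∀ w ∈ K, c ≤ dist (γ w) (γ u) := by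
    rcases K.eq_empty_or_nonempty with hE | hE
    · exact ⟨1, one_pos, by simp [hE]⟩
    · obtain ⟨w, hw, hmin⟩ := hKc.exists_isMinOn hE
        (f := fun w => dist (γ w) (γ u)) (by have := h.smooth.continuous; fun_prop)
      exact ⟨_, hne w hw, fun v hv => hmin hv⟩
  refine ⟨c, hc, fun p hp hpc => ?_⟩
  obtain ⟨w, hw, rfl⟩ := h.exists_mem_Ico (u - L / 2) hp
  refine ⟨w, ?_, rfl⟩
  by_contra! hcon
  exact absurd (hcK w ⟨⟨hw.1, by linarith [hw.2]⟩, hcon⟩) (not_le.2 hpc)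

end IsArcLengthParam

end CircMCF

namespace CircMCF

variable {Ω : Set Plane} {γ : ℝ → Plane} {L : ℝ}

/-! ### The unit normal -/

/-- The default value of `gradient` at points of non-differentiability is zero, so a nonzero
gradient already certifies differentiability. This is how regularity of the signed distance on the
boundary is obtained. -/
lemma hasFDerivAt_of_gradient_ne_zero {f : Plane → ℝ} {x : Plane} (h : gradient f x ≠ 0) :
    HasFDerivAt f (innerSL ℝ (gradient f x)) x := by
  have hd : DifferentiableAt ℝ f x := by
    by_contra hc
    exact h (gradient_eq_zero_of_not_differentiableAt hc)
  exact hd.hasGradientAt.hasFDerivAt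

/-- The distance to a curve grows linearly in normal direction. -/
lemma IsArcLengthParam.le_infDist_normal {Γ : Set Plane} (h : IsArcLengthParam Γ γ L) (u : ℝ)
    {v : Plane} (hv : ‖v‖ = 1) (hvτ : ⟪deriv γ u, v⟫_ℝ = 0) {η : ℝ} (hη : 0 < η) :
    ∀ᶠ ε in 𝓝[>] (0 : ℝ), (1 - η) * ε ≤ Metric.infDist (γ u + ε • v) Γ := by
  -- The bound `1 / 2` gives `|w - u| ≤ 4 * ε` for the parameter `w` of a nearest point; the bound
  -- `η / 4` then makes the error `η' * (4 * ε)` in direction `v` at most `η * ε`.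
  set η' := min (η / 4) (1 / 2) with hη'
  have hη'0 : 0 < η' := by positivity
  have hlo := (hasDerivAt_iff_isLittleO.1 (h.hasDerivAt u)).def hη'0
  obtain ⟨δ, hδ, hball⟩ := Metric.eventually_nhds_iff.1 hlo
  obtain ⟨c, hc, hcp⟩ := h.exists_dist_lt u hδ
  filter_upwards [Ioo_mem_nhdsGT (show (0 : ℝ) < c / 3 by positivity)] with ε hε
  obtain ⟨p, hp, hpd⟩ := h.isCompact.exists_infDist_eq_dist h.nonempty (γ u + ε • v)
  rw [hpd]
  have hdle : dist (γ u + ε • v) p ≤ ε := by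
    rw [← hpd]
    refine (Metric.infDist_le_dist_of_mem (h.mem u)).trans ?_
    simp [norm_smul, hv, abs_of_pos hε.1]
  have hpu : dist p (γ u) ≤ 2 * ε := by
    calc dist p (γ u) ≤ dist p (γ u + ε • v) + dist (γ u + ε • v) (γ u) := dist_triangle _ _ _
      _ ≤ ε + ε := by
        refine add_le_add (by rwa [dist_comm]) ?_
        simp [norm_smul, hv, abs_of_pos hε.1]
      _ = 2 * ε := by ring
  obtain ⟨w, hw, rfl⟩ := hcp p hp (by linarith [hε.2, hε.1])
  have hb := hball (y := w) (by rwa [Real.dist_eq])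
  have hηη : η' ≤ η / 4 := min_le_left _ _
  have hηh : η' ≤ 1 / 2 := min_le_right _ _
  have hwu : |w - u| ≤ 4 * ε := by
    have h1 : ‖(w - u) • deriv γ u‖ ≤ ‖γ w - γ u‖ + ‖γ w - γ u - (w - u) • deriv γ u‖ := by
      have := norm_sub_le (γ w - γ u) (γ w - γ u - (w - u) • deriv γ u)
      rwa [sub_sub_cancel] at this
    rw [norm_smul, h.unit_speed, mul_one, ← dist_eq_norm (γ w)] at h1
    rw [Real.norm_eq_abs] at h1 hb
    nlinarith [abs_nonneg (w - u)]
  have hin : ⟪γ w - γ u, v⟫_ℝ ≤ η' * (4 * ε) := by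
    have : ⟪γ w - γ u, v⟫_ℝ = ⟪γ w - γ u - (w - u) • deriv γ u, v⟫_ℝ := by
      rw [inner_sub_left (γ w - γ u), inner_smul_left, hvτ]; simp
    rw [this]
    refine (real_inner_le_norm _ _).trans ?_
    rw [hv, mul_one]
    refine hb.trans ?_
    rw [Real.norm_eq_abs]
    gcongr
  have hlow : ε - ⟪γ w - γ u, v⟫_ℝ ≤ dist (γ u + ε • v) (γ w) := by
    have h1 := real_inner_le_norm (γ u + ε • v - γ w) v
    rw [hv, mul_one, ← dist_eq_norm] at h1
    refine le_trans (le_of_eq ?_) h1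
    rw [show γ u + ε • v - γ w = ε • v - (γ w - γ u) by abel, inner_sub_left (ε • v), inner_smul_left,
      real_inner_self_eq_norm_sq, hv]
    simp
  nlinarith [hε.1]

/-- The gradient of the signed distance at a boundary point is a unit normal. -/
lemma nrm_eq_or_of_ne_zero (h : IsArcLengthParam (frontier Ω) γ L) (hΩ : Ω ≠ univ)
    (hΩ' : Ω.Nonempty) {u : ℝ} (hne : nrm Ω (γ u) ≠ 0) :
    nrm Ω (γ u) = rotJ (deriv γ u) ∨ nrm Ω (γ u) = -rotJ (deriv γ u) := by
  have hf := hasFDerivAt_of_gradient_ne_zero (f := sdist Ω) hne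
  have hv : ‖rotJ (deriv γ u)‖ = 1 := by rw [norm_rotJ, h.unit_speed]
  have hvτ := inner_rotJ_self (deriv γ u)
  set v := rotJ (deriv γ u) with hvdef
  have h0 (w : ℝ) : sdist Ω (γ w) = 0 := sdist_of_mem_frontier hΩ hΩ' (h.mem w)
  have hτ : ⟪deriv γ u, nrm Ω (γ u)⟫_ℝ = 0 := by
    have h1 := hf.comp_hasDerivAt u (h.hasDerivAt u)
    have h2 : HasDerivAt (sdist Ω ∘ γ) 0 u := by
      rw [show sdist Ω ∘ γ = fun _ => 0 from funext h0]; exact hasDerivAt_const _ _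
    rw [real_inner_comm]
    exact h1.unique h2
  have hdec := eq_smul_of_inner_eq_zero (h.unit_speed u) hv hvτ hτ
  set l := ⟪v, nrm Ω (γ u)⟫_ℝ with hl
  have hd : HasDerivAt (fun ε : ℝ => sdist Ω (γ u + ε • v)) l 0 := by
    have hg : HasDerivAt (fun ε : ℝ => γ u + ε • v) v 0 := by
      simpa using ((hasDerivAt_id (0 : ℝ)).smul_const v).const_add (γ u)
    have := HasFDerivAt.comp_hasDerivAt_of_eq (0 : ℝ) hf hg (by simp)
    rw [hl, real_inner_comm]
    exact this
  have habs (ε : ℝ) : |sdist Ω (γ u + ε • v)| = Metric.infDist (γ u + ε • v) (frontier Ω) :=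
    abs_sdist hΩ hΩ' _
  -- The absolute value of the difference quotient is the distance to the curve divided by `ε`: at
  -- most `1` trivially, and at least `1 - η` by `IsArcLengthParam.le_infDist_normal`. Hence `|l| =
  -- 1`.
  have hslope := (hasDerivAt_iff_tendsto_slope_zero.1 hd).mono_left
    (nhdsWithin_mono (0 : ℝ) (fun x (hx : x ∈ Ioi (0 : ℝ)) => (ne_of_gt hx : x ≠ 0)))
  simp only [zero_add, zero_smul, add_zero, h0, sub_zero, smul_eq_mul] at hslope
  have hl1 : |l| ≤ 1 := by
    refine le_of_tendsto hslope.abs ?_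
    filter_upwards [self_mem_nhdsWithin] with ε hε
    rw [abs_mul, habs, abs_inv, abs_of_pos hε, inv_mul_le_iff₀ hε, mul_one]
    refine (Metric.infDist_le_dist_of_mem (h.mem u)).trans ?_
    simp [norm_smul, hv, abs_of_pos (show 0 < ε from hε)]
  have hl2 : 1 ≤ |l| := by
    refine le_of_forall_pos_sub_le fun η hη => ?_
    refine ge_of_tendsto hslope.abs ?_
    filter_upwards [self_mem_nhdsWithin, h.le_infDist_normal u hv hvτ hη] with ε hε hle
    rw [abs_mul, habs, abs_inv, abs_of_pos hε, le_inv_mul_iff₀ hε]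
    linarith
  rcases abs_eq (zero_le_one) |>.1 (le_antisymm hl1 hl2) with h1 | h1
  · left; rw [hdec, h1, one_smul]
  · right; rw [hdec, h1, neg_one_smul]

end CircMCF

/-! ### The tubular neighborhood of a nearly circular domain -/

namespace CircMCF

variable {Ω : Set Plane} {γ n : ℝ → Plane} {k : ℝ → ℝ} {L R : ℝ}

/-- An arc length parametrization `γ` of the boundary of a bounded open set `Ω`, together with the
inner unit normal `n`, the curvature `k`, and a tubular neighborhood of width `R`. -/
structure Tube (Ω : Set Plane) (R : ℝ) (γ n : ℝ → Plane) (k : ℝ → ℝ) (L : ℝ) : Prop where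
  isOpen : IsOpen Ω
  bounded : Bornology.IsBounded Ω
  param : IsArcLengthParam (frontier Ω) γ L
  width_pos : 0 < R
  normal_smooth : ContDiff ℝ ∞ n
  normal_periodic : Function.Periodic n L
  norm_normal : ∀ u, ‖n u‖ = 1
  orth : ∀ u, ⟪deriv γ u, n u⟫_ℝ = 0
  curv_smooth : ContDiff ℝ ∞ k
  curv_periodic : Function.Periodic k L
  hasDerivAt_tangent : ∀ u, HasDerivAt (deriv γ) (k u • n u) u
  hasDerivAt_normal : ∀ u, HasDerivAt n (-(k u) • deriv γ u) u
  inj : InjOn (fun p : ℝ × ℝ => γ p.1 + p.2 • n p.1) (Ico 0 L ×ˢ Ioo (-R) R)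
  sdist_eq : ∀ u, ∀ l ∈ Ioo (-R) R, sdist Ω (γ u + l • n u) = l
  surj : ∀ x, |sdist Ω x| < R → ∃ u ∈ Ico 0 L, x = γ u + sdist Ω x • n u

lemma ne_univ_of_isBounded (h : Bornology.IsBounded Ω) : Ω ≠ univ := by
  rintro rfl
  exact NormedSpace.unbounded_univ ℝ Plane h

/-- A nearest boundary point lies in normal direction. -/
lemma IsArcLengthParam.eq_add_smul_of_infDist {Γ : Set Plane} (h : IsArcLengthParam Γ γ L) {x : Plane}
    {u : ℝ} (hu : dist x (γ u) = Metric.infDist x Γ) {v : Plane} (hv : ‖v‖ = 1)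
    (hvτ : ⟪deriv γ u, v⟫_ℝ = 0) :
    ∃ l : ℝ, x = γ u + l • v ∧ |l| = Metric.infDist x Γ := by
  have hd : HasDerivAt (fun w => ‖x - γ w‖ ^ 2) (2 * ⟪x - γ u, -deriv γ u⟫_ℝ) u := by
    have := (h.hasDerivAt u).const_sub x
    exact this.norm_sq
  have hmin : IsLocalMin (fun w => ‖x - γ w‖ ^ 2) u := by
    refine Eventually.of_forall fun w => ?_
    have : dist x (γ u) ≤ dist x (γ w) := by
      rw [hu]; exact Metric.infDist_le_dist_of_mem (h.mem w)
    simp only [← dist_eq_norm]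
    gcongr
  have h0 := hmin.hasDerivAt_eq_zero hd
  have h1 : ⟪deriv γ u, x - γ u⟫_ℝ = 0 := by
    rw [inner_neg_right, real_inner_comm] at h0; linarith
  have h2 := eq_smul_of_inner_eq_zero (h.unit_speed u) hv hvτ h1
  refine ⟨⟪v, x - γ u⟫_ℝ, by rw [← h2]; abel, ?_⟩
  rw [← hu, dist_eq_norm, h2, norm_smul, hv, mul_one, Real.norm_eq_abs, ← h2]

lemma CloseToCircle.nonempty {δ r : ℝ} (h : CloseToCircle δ r Ω) : Ω.Nonempty := by
  have := h.simplyConnected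
  have : Nonempty Ω := inferInstance
  exact Set.nonempty_coe_sort.1 this

/-- The normal is within `δ < 1` of a unit vector, hence it is not the default value zero of the
gradient. Differentiability of the signed distance along the boundary rests on this. -/
lemma CloseToCircle.nrm_ne_zero {δ r : ℝ} (h : CloseToCircle δ r Ω) (hδ : δ < 1) {p : Plane}
    (hp : p ∈ frontier Ω) : nrm Ω p ≠ 0 := by
  obtain ⟨γ, L, hγ, -, hn, -, -⟩ := h.param
  obtain ⟨u, hu, rfl⟩ := hγ.exists_mem_Ico 0 hp
  rw [zero_add] at hu
  intro h0
  have := hn u hu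
  rw [h0, zero_sub, norm_neg, norm_neg] at this
  have h1 : ‖(!₂[Real.cos (2 * Real.pi * u / L), Real.sin (2 * Real.pi * u / L)] : Plane)‖ = 1 := by
    rw [← pow_eq_one_iff_of_nonneg (norm_nonneg _) two_ne_zero, norm_sq_plane]
    simp
  rw [h1] at this
  linarith

section CloseToCircle

variable {δ r : ℝ}

lemma CloseToCircle.norm_nrm (h : CloseToCircle δ r Ω) (hδ : δ < 1)
    (hγ : IsArcLengthParam (frontier Ω) γ L) (u : ℝ) :
    ‖nrm Ω (γ u)‖ = 1 ∧ ⟪deriv γ u, nrm Ω (γ u)⟫_ℝ = 0 := by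
  have hJ1 : ‖rotJ (deriv γ u)‖ = 1 := by rw [norm_rotJ, hγ.unit_speed]
  rcases nrm_eq_or_of_ne_zero hγ (ne_univ_of_isBounded h.bounded) h.nonempty
    (h.nrm_ne_zero hδ (hγ.mem u)) with e | e <;> simp [e, hJ1, inner_rotJ_self]

lemma CloseToCircle.exists_eq_add_smul (h : CloseToCircle δ r Ω) (hδ : δ < 1)
    (hγ : IsArcLengthParam (frontier Ω) γ L) (x : Plane) :
    ∃ u ∈ Ico 0 L, ∃ l, |l| = Metric.infDist x (frontier Ω) ∧ x = γ u + l • nrm Ω (γ u) := by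
  obtain ⟨p, hp, hpd⟩ := hγ.isCompact.exists_infDist_eq_dist hγ.nonempty x
  obtain ⟨u, hu, rfl⟩ := hγ.exists_mem_Ico 0 hp
  obtain ⟨h1, h0⟩ := h.norm_nrm hδ hγ u
  obtain ⟨l, hl, hl'⟩ := hγ.eq_add_smul_of_infDist hpd.symm h1 h0
  exact ⟨u, by simpa using hu, l, hl', hl⟩

/-- A nearest boundary point also represents the point in normal coordinates, with a height at most
`|l|` and hence inside the tube; injectivity of the tube map forces the two representations to
agree. -/
lemma CloseToCircle.abs_sdist_eq (h : CloseToCircle δ r Ω) (hδ : δ < 1)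
    (hγ : IsArcLengthParam (frontier Ω) γ L) (u : ℝ) {l : ℝ} (hl : l ∈ Ioo (-(r / 2)) (r / 2)) :
    |sdist Ω (γ u + l • nrm Ω (γ u))| = |l| := by
  rw [abs_sdist (ne_univ_of_isBounded h.bounded) h.nonempty]
  have hle : Metric.infDist (γ u + l • nrm Ω (γ u)) (frontier Ω) ≤ |l| := by
    refine (Metric.infDist_le_dist_of_mem (hγ.mem u)).trans ?_
    simp [norm_smul, (h.norm_nrm hδ hγ u).1]
  obtain ⟨w, -, l', hl', hx⟩ := h.exists_eq_add_smul hδ hγ (γ u + l • nrm Ω (γ u))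
  have hl2 : l' ∈ Ioo (-(r / 2)) (r / 2) :=
    abs_lt.1 (by rw [hl']; exact hle.trans_lt (abs_lt.2 hl))
  have h1 : (γ u, l) ∈ frontier Ω ×ˢ Ioo (-(r / 2)) (r / 2) := ⟨hγ.mem u, hl⟩
  have h2 : (γ w, l') ∈ frontier Ω ×ˢ Ioo (-(r / 2)) (r / 2) := ⟨hγ.mem w, hl2⟩
  rw [← hl']
  exact congrArg abs (Prod.ext_iff.1 (h.tube h1 h2 hx)).2.symm

/-- Only the sign is open after `CloseToCircle.abs_sdist_eq`. The derivative `1` at the boundary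
fixes it for small heights, and a later change of sign would, by the intermediate value theorem,
produce a zero at a nonzero height. -/
lemma CloseToCircle.sdist_eq (h : CloseToCircle δ r Ω) (hδ : δ < 1)
    (hγ : IsArcLengthParam (frontier Ω) γ L) (u : ℝ) {l : ℝ} (hl : l ∈ Ioo (-(r / 2)) (r / 2)) :
    sdist Ω (γ u + l • nrm Ω (γ u)) = l := by
  have hR : 0 < r / 2 := by linarith [hl.1, hl.2]
  have hn1 := (h.norm_nrm hδ hγ u).1
  have hf := hasFDerivAt_of_gradient_ne_zero (f := sdist Ω) (h.nrm_ne_zero hδ (hγ.mem u))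
  have hfr : sdist Ω (γ u) = 0 :=
    sdist_of_mem_frontier (ne_univ_of_isBounded h.bounded) h.nonempty (hγ.mem u)
  set f : ℝ → ℝ := fun ε => sdist Ω (γ u + ε • nrm Ω (γ u)) with hfdef
  have habs (l : ℝ) (hl : l ∈ Ioo (-(r / 2)) (r / 2)) : |f l| = |l| := h.abs_sdist_eq hδ hγ u hl
  have hd : HasDerivAt f 1 0 := by
    have hg : HasDerivAt (fun ε : ℝ => γ u + ε • nrm Ω (γ u)) (nrm Ω (γ u)) 0 := by
      simpa using ((hasDerivAt_id (0 : ℝ)).smul_const (nrm Ω (γ u))).const_add (γ u)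
    have := HasFDerivAt.comp_hasDerivAt_of_eq (0 : ℝ) hf hg (by simp)
    have e : (innerSL ℝ (gradient (sdist Ω) (γ u))) (nrm Ω (γ u)) = 1 := by
      rw [innerSL_apply_apply]
      change ⟪nrm Ω (γ u), nrm Ω (γ u)⟫_ℝ = 1
      rw [real_inner_self_eq_norm_sq, hn1, one_pow]
    rw [e] at this
    exact this
  have hcont : Continuous f := continuous_sdist.comp (by fun_prop)
  have hsl := hasDerivAt_iff_tendsto_slope_zero.1 hd
  have hf0 : f 0 = 0 := by simp [hfdef, hfr]
  simp only [zero_add, hf0, sub_zero, smul_eq_mul] at hsl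
  -- Where `f t = -t` the difference quotient equals `-1`, which is excluded near `0` because it
  -- tends to `1`.
  have hev : ∀ᶠ t in 𝓝[≠] (0 : ℝ), f t = t := by
    have hnh : ∀ᶠ t in 𝓝[≠] (0 : ℝ), t ∈ Ioo (-(r / 2)) (r / 2) :=
      nhdsWithin_le_nhds (Ioo_mem_nhds (by linarith) hR)
    filter_upwards [hsl.eventually (lt_mem_nhds zero_lt_one), hnh, self_mem_nhdsWithin]
      with t ht ht' ht0
    rcases abs_eq_abs.1 (habs t ht') with e | e
    · exact e
    · rw [e, mul_neg, inv_mul_cancel₀ ht0] at ht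
      linarith
  change f l = l
  rcases lt_trichotomy l 0 with hl0 | rfl | hl0
  · have hev' := hev.filter_mono (nhdsWithin_mono (0 : ℝ)
      (fun x (hx : x ∈ Iio (0 : ℝ)) => (ne_of_lt hx : x ≠ 0)))
    obtain ⟨t, ht, ht'⟩ := (hev'.and (Ioo_mem_nhdsLT hl0)).exists
    rcases abs_eq_abs.1 (habs l hl) with e | e
    · exact e
    · exfalso
      obtain ⟨s, hs, hs'⟩ := intermediate_value_Icc' ht'.1.le hcont.continuousOn
        (show (0 : ℝ) ∈ _ by rw [ht, e]; exact ⟨ht'.2.le, by linarith⟩)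
      have := habs s ⟨by linarith [hl.1, hs.1], by linarith [hs.2, ht'.2]⟩
      rw [hs', abs_zero] at this
      have := abs_eq_zero.1 this.symm
      linarith [hs.2, ht'.2]
  · exact hf0
  · have hev' := hev.filter_mono (nhdsWithin_mono (0 : ℝ)
      (fun x (hx : x ∈ Ioi (0 : ℝ)) => (ne_of_gt hx : x ≠ 0)))
    obtain ⟨t, ht, ht'⟩ := (hev'.and (Ioo_mem_nhdsGT hl0)).exists
    rcases abs_eq_abs.1 (habs l hl) with e | e
    · exact e
    · exfalso
      obtain ⟨s, hs, hs'⟩ := intermediate_value_Icc' ht'.2.le hcont.continuousOn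
        (show (0 : ℝ) ∈ _ by rw [ht, e]; exact ⟨by linarith, ht'.1.le⟩)
      have := habs s ⟨by linarith [hs.1, ht'.1], by linarith [hl.2, hs.2]⟩
      rw [hs', abs_zero] at this
      have := abs_eq_zero.1 this.symm
      linarith [hs.1, ht'.1]

/-- The inner normal is the tangent rotated by a fixed right angle. -/
lemma CloseToCircle.exists_sign (h : CloseToCircle δ r Ω) (hδ : δ < 1) (hr : 0 < r)
    (hγ : IsArcLengthParam (frontier Ω) γ L) :
    ∃ σ : ℝ, σ ^ 2 = 1 ∧ ∀ u, nrm Ω (γ u) = σ • rotJL (deriv γ u) := by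
  -- A probe at distance `r / 4`, well inside the tube. Its signed distance is `r / 4` or `-(r / 4)`
  -- according to the side, so the continuous `g` has no zero and the side cannot change along the
  -- curve.
  set g : ℝ → ℝ := fun u => sdist Ω (γ u + (r / 4) • rotJL (deriv γ u)) with hg
  have hgc : Continuous g := by
    refine continuous_sdist.comp (hγ.smooth.continuous.add ?_)
    exact Continuous.const_smul (rotJL.continuous.comp hγ.smooth_deriv.continuous) (r / 4)
  have hgv (u : ℝ) : (nrm Ω (γ u) = rotJL (deriv γ u) ∧ g u = r / 4) ∨
      (nrm Ω (γ u) = -rotJL (deriv γ u) ∧ g u = -(r / 4)) := by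
    rcases nrm_eq_or_of_ne_zero hγ (ne_univ_of_isBounded h.bounded) h.nonempty
      (h.nrm_ne_zero hδ (hγ.mem u)) with e | e
    · refine Or.inl ⟨e, ?_⟩
      have := h.sdist_eq hδ hγ u (l := r / 4) ⟨by linarith, by linarith⟩
      rwa [e] at this
    · refine Or.inr ⟨e, ?_⟩
      have := h.sdist_eq hδ hγ u (l := -(r / 4)) ⟨by linarith, by linarith⟩
      rw [e, neg_smul, smul_neg, neg_neg] at this
      exact this
  have hnz (u : ℝ) : g u ≠ 0 := by
    rcases hgv u with ⟨-, e⟩ | ⟨-, e⟩ <;> rw [e]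
    · positivity
    · exact neg_ne_zero.2 (by positivity)
  by_cases h0 : 0 < g 0
  · refine ⟨1, by norm_num, fun u => ?_⟩
    rcases hgv u with ⟨e, -⟩ | ⟨-, e⟩
    · rw [e, one_smul]
    · exfalso
      obtain ⟨s, hs⟩ := mem_range_of_exists_le_of_exists_ge hgc ⟨u, by rw [e]; linarith⟩
        ⟨0, h0.le⟩
      exact hnz s hs
  · refine ⟨-1, by norm_num, fun u => ?_⟩
    rcases hgv u with ⟨-, e⟩ | ⟨e, -⟩
    · exfalso
      obtain ⟨s, hs⟩ := mem_range_of_exists_le_of_exists_ge hgc ⟨0, not_lt.1 h0⟩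
        ⟨u, by rw [e]; linarith⟩
      exact hnz s hs
    · rw [e, neg_one_smul]

/-- The tubular neighborhood of a domain which is close to a circle. -/
lemma CloseToCircle.tube_of_param (h : CloseToCircle δ r Ω) (hδ : δ < 1) (hr : 0 < r)
    (hγ : IsArcLengthParam (frontier Ω) γ L) :
    Tube Ω (r / 2) γ (fun u => nrm Ω (γ u)) (fun u => ⟪deriv (deriv γ) u, nrm Ω (γ u)⟫_ℝ) L := by
  obtain ⟨σ, hσ, hσn⟩ := h.exists_sign hδ hr hγ
  have hn1 (u : ℝ) := (h.norm_nrm hδ hγ u).1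
  have hn0 (u : ℝ) := (h.norm_nrm hδ hγ u).2
  have hsd := fun u l hl => h.sdist_eq hδ hγ u (l := l) hl
  have hγ' := hγ.smooth_deriv
  have hγ'' : ContDiff ℝ ∞ (deriv (deriv γ)) := (contDiff_infty_iff_deriv.1 hγ').2
  have hper (u : ℝ) : nrm Ω (γ (u + L)) = nrm Ω (γ u) := by rw [hγ.periodic u]
  have htube := h.tube
  have hmem := hγ.mem
  have hinjγ := hγ.inj
  have hexi := h.exists_eq_add_smul hδ hγ
  have habs := abs_sdist (ne_univ_of_isBounded h.bounded) h.nonempty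
  generalize hN : (fun u => nrm Ω (γ u)) = N
  have hN' (u : ℝ) : nrm Ω (γ u) = N u := congrFun hN u
  simp only [hN'] at hn1 hn0 hsd hper hexi hσn ⊢
  have hnsm : ContDiff ℝ ∞ N := by
    rw [funext hσn]
    exact (rotJL.contDiff.comp hγ').const_smul σ
  have hτd (u : ℝ) : HasDerivAt (deriv γ) (deriv (deriv γ) u) u :=
    (hγ'.differentiable (by simp)).differentiableAt.hasDerivAt
  have hττ (u : ℝ) : ⟪deriv γ u, deriv (deriv γ) u⟫_ℝ = 0 := by
    have h1 := (hτd u).norm_sq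
    have h2 : HasDerivAt (fun w => ‖deriv γ w‖ ^ 2) 0 u := by
      simp only [hγ.unit_speed]; exact hasDerivAt_const _ _
    have := h1.unique h2
    linarith
  have hγγ (u : ℝ) : deriv (deriv γ) u = ⟪deriv (deriv γ) u, N u⟫_ℝ • N u := by
    rw [real_inner_comm]
    exact eq_smul_of_inner_eq_zero (hγ.unit_speed u) (hn1 u) (hn0 u) (hττ u)
  -- The Frenet equation for the normal: differentiate `N = σ • J γ'` and use `γ'' = k N`, `J² = -1`
  -- and `σ² = 1`.
  have hdn (u : ℝ) : HasDerivAt N (-⟪deriv (deriv γ) u, N u⟫_ℝ • deriv γ u) u := by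
    have h1 : HasDerivAt N (σ • rotJL (deriv (deriv γ) u)) u := by
      rw [funext hσn]
      exact (rotJL.hasFDerivAt.comp_hasDerivAt u (hτd u)).const_smul σ
    convert h1 using 1
    have e := hγγ u
    generalize ⟪deriv (deriv γ) u, N u⟫_ℝ = κ at e ⊢
    rw [e, hσn]
    simp only [rotJL_apply, rotJ_smul, rotJ_rotJ, smul_neg, neg_smul, smul_smul]
    congr 2
    linear_combination (-κ) * hσ
  refine
    { isOpen := h.isOpen, bounded := h.bounded, param := hγ, width_pos := by positivity
      normal_smooth := hnsm, normal_periodic := hper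
      norm_normal := hn1, orth := hn0, curv_smooth := hγ''.inner ℝ hnsm
      curv_periodic := fun u => ?_
      hasDerivAt_tangent := fun u => by rw [← hγγ]; exact hτd u
      hasDerivAt_normal := hdn
      inj := ?_, sdist_eq := hsd, surj := fun x hx => ?_ }
  · have : deriv (deriv γ) (u + L) = deriv (deriv γ) u := by
      rw [← deriv_comp_add_const, funext hγ.periodic_deriv]
    simp only [this, hper u]
  · intro p hp q hq hpq
    have h1 : (γ p.1, p.2) ∈ frontier Ω ×ˢ Ioo (-(r / 2)) (r / 2) := ⟨hmem _, hp.2⟩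
    have h2 : (γ q.1, q.2) ∈ frontier Ω ×ˢ Ioo (-(r / 2)) (r / 2) := ⟨hmem _, hq.2⟩
    have h3 := Prod.ext_iff.1 (htube h1 h2 (by simp only [hN']; exact hpq))
    exact Prod.ext (hinjγ hp.1 hq.1 h3.1) h3.2
  · rw [habs] at hx
    obtain ⟨u, hu, l, hl, hxl⟩ := hexi x
    refine ⟨u, hu, ?_⟩
    have : sdist Ω x = l := by rw [hxl]; exact hsd u l (abs_lt.1 (hl ▸ hx))
    rw [this]; exact hxl

end CloseToCircle

end CircMCF

/-! ### Smooth tubular coordinates and spatial derivatives -/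

namespace CircMCF

variable {Ω : Set Plane} {γ n : ℝ → Plane} {k : ℝ → ℝ} {L R : ℝ}

lemma exists_smooth_local_inverse {E F : Type*} [NormedAddCommGroup E] [NormedSpace ℝ E]
    [CompleteSpace E] [NormedAddCommGroup F] [NormedSpace ℝ F] {f : E → F} {a : E} {f' : E ≃L[ℝ] F}
    (hf : ContDiffAt ℝ ∞ f a) (hf' : HasFDerivAt f (f' : E →L[ℝ] F) a) :
    ∃ g : F → E, ContDiffAt ℝ ∞ g (f a) ∧ g (f a) = a ∧ ∀ᶠ y in 𝓝 (f a), f (g y) = y := by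
  have hs := hf.hasStrictFDerivAt' hf' (by simp)
  refine ⟨hf.localInverse hf' (by simp), hf.to_localInverse hf' (by simp), ?_, ?_⟩
  · exact hs.localInverse_apply_image
  · exact hs.eventually_right_inverse

/-- A bijective linear map given in an orthogonal frame. -/
lemma exists_frameEquiv {τ n : Plane} (hτ : ‖τ‖ = 1) (hn : ‖n‖ = 1) (h : ⟪τ, n⟫_ℝ = 0) {a : ℝ}
    (ha : a ≠ 0) : ∃ e : (ℝ × ℝ) ≃L[ℝ] Plane, ∀ p, e p = (p.1 * a) • τ + p.2 • n := by
  have h' : ⟪n, τ⟫_ℝ = 0 := by rw [real_inner_comm]; exact h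
  let f : (ℝ × ℝ) →L[ℝ] Plane :=
    ((ContinuousLinearMap.fst ℝ ℝ ℝ).smulRight (a • τ)) + (ContinuousLinearMap.snd ℝ ℝ ℝ).smulRight n
  let g : Plane →L[ℝ] (ℝ × ℝ) := (a⁻¹ • innerSL ℝ τ).prod (innerSL ℝ n)
  refine ⟨ContinuousLinearEquiv.equivOfInverse f g (fun p => ?_) (fun v => ?_), fun p => ?_⟩
  · ext <;> simp [f, g, inner_add_right, inner_smul_right, h, h', hτ, hn]
    field_simp
  · conv_rhs => rw [plane_decomp hτ hn h v]
    simp [f, g, smul_smul, mul_comm, ha]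
  · change f p = _
    simp [f, smul_smul]

namespace Tube

variable (T : Tube Ω R γ n k L)
include T

lemma norm_tangent (u : ℝ) : ‖deriv γ u‖ = 1 := T.param.unit_speed u

lemma hasDerivAt_offset (u l : ℝ) :
    HasDerivAt (fun w => γ w + l • n w) ((1 - k u * l) • deriv γ u) u := by
  have := (T.param.hasDerivAt u).add ((T.hasDerivAt_normal u).const_smul l)
  exact this.congr_deriv (by module)

lemma hasFDerivAt_coord (u l : ℝ) :
    HasFDerivAt (fun p : ℝ × ℝ => γ p.1 + p.2 • n p.1)
      (((ContinuousLinearMap.fst ℝ ℝ ℝ).smulRight ((1 - k u * l) • deriv γ u)) +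
        (ContinuousLinearMap.snd ℝ ℝ ℝ).smulRight (n u)) (u, l) := by
  have h0 : HasFDerivAt (fun p : ℝ × ℝ => p.1) (ContinuousLinearMap.fst ℝ ℝ ℝ) (u, l) :=
    hasFDerivAt_fst
  have h3 : HasFDerivAt (fun p : ℝ × ℝ => p.2) (ContinuousLinearMap.snd ℝ ℝ ℝ) (u, l) :=
    hasFDerivAt_snd
  have h1 := HasFDerivAt.comp (u, l) (T.param.hasDerivAt u).hasFDerivAt h0
  have h2 := HasFDerivAt.comp (u, l) (T.hasDerivAt_normal u).hasFDerivAt h0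
  refine (h1.add (h3.smul h2)).congr_fderiv ?_
  ext <;> simp; ring

/-- Two points in tubular coordinates agree only if the coordinates agree, up to periodicity. -/
lemma coord_inj {u w l l' : ℝ} (hl : l ∈ Ioo (-R) R) (hl' : l' ∈ Ioo (-R) R)
    (h : γ u + l • n u = γ w + l' • n w) : (∃ m : ℤ, w = u + m * L) ∧ l = l' := by
  have e (x : ℝ) : ∃ y ∈ Ico 0 L, ∃ m : ℤ, y = x + m * L := by
    refine ⟨toIcoMod T.param.pos 0 x, by simpa using toIcoMod_mem_Ico T.param.pos 0 x,
      -toIcoDiv T.param.pos 0 x, ?_⟩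
    rw [toIcoMod, zsmul_eq_mul]; push_cast; ring
  obtain ⟨u', hu', m, hm⟩ := e u
  obtain ⟨w', hw', m', hm'⟩ := e w
  have eγ (x : ℝ) (m : ℤ) : γ (x + m * L) = γ x := T.param.periodic.int_mul m x
  have en (x : ℝ) (m : ℤ) : n (x + m * L) = n x := T.normal_periodic.int_mul m x
  have h1 : (u', l) ∈ Ico 0 L ×ˢ Ioo (-R) R := ⟨hu', hl⟩
  have h2 : (w', l') ∈ Ico 0 L ×ˢ Ioo (-R) R := ⟨hw', hl'⟩
  have := Prod.ext_iff.1 (T.inj h1 h2 (by simp only [hm, hm', eγ, en]; exact h))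
  refine ⟨⟨m - m', ?_⟩, this.2⟩
  have h3 : u' = w' := this.1
  push_cast
  linarith

lemma nonempty : Ω.Nonempty := by
  by_contra h
  rw [Set.not_nonempty_iff_eq_empty] at h
  have := T.param.nonempty
  simp [h] at this

lemma ne_univ : Ω ≠ univ := ne_univ_of_isBounded T.bounded

/-- `proj` picks an arbitrary nearest boundary point. Such a point lies in normal direction at the
same distance, so `coord_inj` leaves only one candidate. -/
lemma proj_eq (u : ℝ) {l : ℝ} (hl : l ∈ Ioo (-R) R) : proj Ω (γ u + l • n u) = γ u := by
  set x := γ u + l • n u with hx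
  obtain ⟨p, hp, hpd⟩ := T.param.isCompact.exists_infDist_eq_dist T.param.nonempty x
  have hspec := Classical.epsilon_spec
    (p := fun p => p ∈ frontier Ω ∧ dist x p = Metric.infDist x (frontier Ω)) ⟨p, hp, hpd.symm⟩
  change proj Ω x ∈ frontier Ω ∧ dist x (proj Ω x) = _ at hspec
  obtain ⟨h1, h2⟩ := hspec
  obtain ⟨w, -, hw⟩ := T.param.exists_mem_Ico 0 h1
  rw [← hw] at h2
  obtain ⟨l', hl', hl2⟩ := T.param.eq_add_smul_of_infDist h2 (T.norm_normal w) (T.orth w)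
  rw [← abs_sdist T.ne_univ T.nonempty, T.sdist_eq u l hl] at hl2
  obtain ⟨⟨m, rfl⟩, -⟩ := T.coord_inj hl (l' := l') (abs_lt.1 (hl2 ▸ abs_lt.2 hl)) (hx.symm.trans hl')
  rw [← hw]
  exact T.param.periodic.int_mul m u

/-- A smooth local inverse of the tubular coordinates. -/
lemma exists_local_coord (u : ℝ) {l : ℝ} (hl : l ∈ Ioo (-R) R) (hkl : 1 - k u * l ≠ 0) :
    ∃ U : Plane → ℝ, ContDiffAt ℝ ∞ U (γ u + l • n u) ∧ U (γ u + l • n u) = u ∧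
      ContDiffAt ℝ ∞ (sdist Ω) (γ u + l • n u) ∧
      ∀ᶠ x in 𝓝 (γ u + l • n u), |sdist Ω x| < R ∧ x = γ (U x) + sdist Ω x • n (U x) := by
  obtain ⟨e, he⟩ := exists_frameEquiv (T.norm_tangent u) (T.norm_normal u) (T.orth u) hkl
  have hsm : ContDiffAt ℝ ∞ (fun p : ℝ × ℝ => γ p.1 + p.2 • n p.1) (u, l) := by
    have h1 := T.param.smooth
    have h2 := T.normal_smooth
    fun_prop
  have hder : HasFDerivAt (fun p : ℝ × ℝ => γ p.1 + p.2 • n p.1)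
      (e : (ℝ × ℝ) →L[ℝ] Plane) (u, l) := by
    refine (T.hasFDerivAt_coord u l).congr_fderiv ?_
    ext <;> simp [he]
  obtain ⟨g, hg, hg0, hgev⟩ := exists_smooth_local_inverse hsm hder
  simp only at hg hg0 hgev
  have hgR : ∀ᶠ x in 𝓝 (γ u + l • n u), (g x).2 ∈ Ioo (-R) R := by
    have : ContinuousAt (fun x => (g x).2) (γ u + l • n u) := hg.continuousAt.snd
    exact this.eventually_mem (by rw [hg0]; exact Ioo_mem_nhds hl.1 hl.2)
  have hev : ∀ᶠ x in 𝓝 (γ u + l • n u), sdist Ω x = (g x).2 := by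
    filter_upwards [hgev, hgR] with x hx hxR
    conv_lhs => rw [← hx]
    exact T.sdist_eq _ _ hxR
  refine ⟨fun x => (g x).1, hg.fst, congrArg Prod.fst hg0, hg.snd.congr_of_eventuallyEq hev, ?_⟩
  filter_upwards [hev, hgev, hgR] with x h1 h2 h3
  rw [h1]
  exact ⟨abs_lt.2 h3, h2.symm⟩

/-- The derivative of a function which is constant in normal direction. -/
lemma fderiv_apply_of_coord {E : Type*} [NormedAddCommGroup E] [NormedSpace ℝ E] {F : Plane → E}
    {F' : Plane →L[ℝ] E} {f : ℝ → E} {f' : E} {u l : ℝ} (hl : l ∈ Ioo (-R) R)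
    (hkl : 1 - k u * l ≠ 0) (hF : HasFDerivAt F F' (γ u + l • n u))
    (hFf : ∀ w, ∀ m ∈ Ioo (-R) R, F (γ w + m • n w) = f w) (hf : HasDerivAt f f' u) (v : Plane) :
    F' v = (⟪deriv γ u, v⟫_ℝ / (1 - k u * l)) • f' := by
  have h1 : (1 - k u * l) • F' (deriv γ u) = f' := by
    have h := hF.comp_hasDerivAt u (T.hasDerivAt_offset u l)
    rw [map_smul] at h
    refine h.unique ?_
    rw [show F ∘ (fun w => γ w + l • n w) = f from funext fun w => hFf w l hl]
    exact hf
  have h2 : F' (n u) = 0 := by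
    have hg : HasDerivAt (fun m : ℝ => γ u + m • n u) (n u) l := by
      simpa using ((hasDerivAt_id l).smul_const (n u)).const_add (γ u)
    have h := hF.comp_hasDerivAt l hg
    refine h.unique ((hasDerivAt_const l (f u)).congr_of_eventuallyEq ?_)
    filter_upwards [Ioo_mem_nhds hl.1 hl.2] with m hm
    exact hFf u m hm
  conv_lhs => rw [plane_decomp (T.norm_tangent u) (T.norm_normal u) (T.orth u) v]
  rw [map_add, map_smul, map_smul, h2, smul_zero, add_zero, ← h1, smul_smul, div_mul_cancel₀ _ hkl]

lemma eventually_eq_coord {E : Type*} {F : Plane → E} {f : ℝ → E} {u l : ℝ} (hl : l ∈ Ioo (-R) R)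
    (hkl : 1 - k u * l ≠ 0) (hFf : ∀ w, ∀ m ∈ Ioo (-R) R, F (γ w + m • n w) = f w) :
    ∃ U : Plane → ℝ, ContDiffAt ℝ ∞ U (γ u + l • n u) ∧ U (γ u + l • n u) = u ∧
      F =ᶠ[𝓝 (γ u + l • n u)] f ∘ U := by
  obtain ⟨U, hU, hU0, -, hev⟩ := T.exists_local_coord u hl hkl
  refine ⟨U, hU, hU0, ?_⟩
  filter_upwards [hev] with x hx
  conv_lhs => rw [hx.2]
  exact hFf _ _ (abs_lt.1 hx.1)

lemma differentiableAt_of_coord {E : Type*} [NormedAddCommGroup E] [NormedSpace ℝ E]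
    {F : Plane → E} {f : ℝ → E} {u l : ℝ} (hl : l ∈ Ioo (-R) R)
    (hkl : 1 - k u * l ≠ 0) (hFf : ∀ w, ∀ m ∈ Ioo (-R) R, F (γ w + m • n w) = f w)
    (hf : DifferentiableAt ℝ f u) : DifferentiableAt ℝ F (γ u + l • n u) := by
  obtain ⟨U, hU, hU0, hev⟩ := T.eventually_eq_coord hl hkl hFf
  refine DifferentiableAt.congr_of_eventuallyEq ?_ hev
  refine DifferentiableAt.comp _ (by rw [hU0]; exact hf) (hU.differentiableAt (by simp))

/-- The gradient of the signed distance in the tubular neighborhood. -/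
lemma hasFDerivAt_sdist (u : ℝ) {l : ℝ} (hl : l ∈ Ioo (-R) R) (hkl : 1 - k u * l ≠ 0) :
    HasFDerivAt (sdist Ω) (innerSL ℝ (n u)) (γ u + l • n u) := by
  obtain ⟨U, -, -, hs, -⟩ := T.exists_local_coord u hl hkl
  have hd := (hs.differentiableAt (by simp)).hasFDerivAt
  refine hd.congr_fderiv ?_
  ext v
  have h1 : fderiv ℝ (sdist Ω) (γ u + l • n u) (deriv γ u) = 0 := by
    have h := hd.comp_hasDerivAt u (T.hasDerivAt_offset u l)
    rw [map_smul] at h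
    have h0 : HasDerivAt (sdist Ω ∘ fun w => γ w + l • n w) 0 u := by
      rw [show sdist Ω ∘ (fun w => γ w + l • n w) = fun _ => l from
        funext fun w => T.sdist_eq w l hl]
      exact hasDerivAt_const _ _
    exact (smul_eq_zero.1 (h.unique h0)).resolve_left hkl
  have h2 : fderiv ℝ (sdist Ω) (γ u + l • n u) (n u) = 1 := by
    have hg : HasDerivAt (fun m : ℝ => γ u + m • n u) (n u) l := by
      simpa using ((hasDerivAt_id l).smul_const (n u)).const_add (γ u)
    have h := hd.comp_hasDerivAt l hg
    refine h.unique ((hasDerivAt_id l).congr_of_eventuallyEq ?_)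
    filter_upwards [Ioo_mem_nhds hl.1 hl.2] with m hm
    exact T.sdist_eq u m hm
  conv_lhs => rw [plane_decomp (T.norm_tangent u) (T.norm_normal u) (T.orth u) v]
  rw [map_add, map_smul, map_smul, h1, h2]
  simp

lemma hasDerivAt_curv (u : ℝ) : HasDerivAt k (deriv k u) u :=
  (T.curv_smooth.differentiable (by simp)).differentiableAt.hasDerivAt

section

variable (hn : ∀ u, nrm Ω (γ u) = n u)
include hn

lemma nrm_proj (u : ℝ) {l : ℝ} (hl : l ∈ Ioo (-R) R) :
    nrm Ω (proj Ω (γ u + l • n u)) = n u := by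
  rw [T.proj_eq u hl, hn]

/-- The derivative of the extended normal in the tubular neighborhood. -/
lemma hasFDerivAt_nrm_proj (u : ℝ) {l : ℝ} (hl : l ∈ Ioo (-R) R) (hkl : 1 - k u * l ≠ 0) :
    ∃ N' : Plane →L[ℝ] Plane,
      HasFDerivAt (fun x => nrm Ω (proj Ω x)) N' (γ u + l • n u) ∧
      ∀ v, N' v = (⟪deriv γ u, v⟫_ℝ / (1 - k u * l)) • (-(k u) • deriv γ u) := by
  have hd := T.differentiableAt_of_coord (F := fun x => nrm Ω (proj Ω x)) hl hkl
    (fun w m hm => T.nrm_proj hn w hm) (T.hasDerivAt_normal u).differentiableAt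
  exact ⟨_, hd.hasFDerivAt, fun v => T.fderiv_apply_of_coord hl hkl hd.hasFDerivAt
    (fun w m hm => T.nrm_proj hn w hm) (T.hasDerivAt_normal u) v⟩

/-- The extended normal varies only in tangential direction, with derivative `-k • γ'`, so minus its
trace is `k`. This joins the curvature defined by a divergence to the Frenet coefficient. -/
lemma curv_eq (u : ℝ) : curv Ω (γ u) = k u := by
  have h0 : (0 : ℝ) ∈ Ioo (-R) R := ⟨by linarith [T.width_pos], T.width_pos⟩
  obtain ⟨N', hN', hv⟩ := T.hasFDerivAt_nrm_proj hn u h0 (by simp)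
  rw [zero_smul, add_zero] at hN'
  rw [curv, divg, hN'.fderiv, trace_plane (T.norm_tangent u) (T.norm_normal u) (T.orth u)]
  simp [hv, T.norm_tangent, T.orth, inner_smul_right]

lemma curv_proj (u : ℝ) {l : ℝ} (hl : l ∈ Ioo (-R) R) :
    curv Ω (proj Ω (γ u + l • n u)) = k u := by
  rw [T.proj_eq u hl, T.curv_eq hn]

lemma norm_tanGrad_curv (u : ℝ) : ‖tanGrad Ω (curv Ω) (γ u)‖ = |deriv k u| := by
  have h0 : (0 : ℝ) ∈ Ioo (-R) R := ⟨by linarith [T.width_pos], T.width_pos⟩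
  have hd := T.differentiableAt_of_coord (F := fun x => curv Ω (proj Ω x)) h0 (by simp)
    (fun w m hm => T.curv_proj hn w hm) (T.hasDerivAt_curv u).differentiableAt
  have hv := T.fderiv_apply_of_coord h0 (by simp) hd.hasFDerivAt
    (fun w m hm => T.curv_proj hn w hm) (T.hasDerivAt_curv u)
  rw [zero_smul, add_zero] at hv hd
  have : tanGrad Ω (curv Ω) (γ u) = deriv k u • deriv γ u := by
    rw [tanGrad]
    refine ext_inner_right ℝ fun v => ?_
    have hg := hd.hasGradientAt.hasFDerivAt.fderiv
    have : ⟪gradient (fun y => curv Ω (proj Ω y)) (γ u), v⟫_ℝ =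
        fderiv ℝ (fun y => curv Ω (proj Ω y)) (γ u) v := by rw [hg]; rfl
    rw [this, hv]
    simp [inner_smul_left, mul_comm]
  rw [this, norm_smul, T.norm_tangent, mul_one, Real.norm_eq_abs]

end

end Tube

end CircMCF

/-! ### Curvature bounds and space-time coordinates along the flow -/

namespace CircMCF

variable {Ω : Set Plane} {γ n : ℝ → Plane} {k : ℝ → ℝ} {L R δ r : ℝ}

/-- The bounds in `CloseToCircle` refer to one particular parametrization, but they concern
functions of the boundary point alone, so they pass to any other parametrization. -/
lemma CloseToCircle.curv_bounds (h : CloseToCircle δ r Ω) (T : Tube Ω R γ n k L)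
    (hn : ∀ u, nrm Ω (γ u) = n u) (u : ℝ) :
    r * |k u - 1 / r| ≤ δ ∧ r ^ 2 * |deriv k u| ≤ δ := by
  obtain ⟨γ₂, L₂, hγ₂, -, -, hc, ht⟩ := h.param
  obtain ⟨w, hw, hwu⟩ := hγ₂.exists_mem_Ico 0 (T.param.mem u)
  rw [zero_add] at hw
  refine ⟨?_, ?_⟩
  · rw [← T.curv_eq hn, ← hwu]; exact hc w hw
  · rw [← T.norm_tanGrad_curv hn, ← hwu]; exact ht w hw

/-- From `r * k ≤ 1 + δ < 2` and `l < r / 2`: the focal distance lies outside the tube. This makes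
the Jacobian of the tubular coordinates positive. -/
lemma CloseToCircle.one_sub_pos (h : CloseToCircle δ r Ω) (hδ : δ < 1) (hr : 0 < r)
    (T : Tube Ω R γ n k L) (hn : ∀ u, nrm Ω (γ u) = n u) (u : ℝ) {l : ℝ}
    (hl : l ∈ Ioo (-(r / 2)) (r / 2)) : 0 < 1 - k u * l := by
  have h1 := (h.curv_bounds T hn u).1
  have h2 : |r * k u - 1| ≤ δ := by
    have : r * k u - 1 = r * (k u - 1 / r) := by field_simp
    rwa [this, abs_mul, abs_of_pos hr]
  obtain ⟨h3, h4⟩ := abs_le.1 h2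
  have hk : 0 < k u := by
    by_contra! hc
    nlinarith
  have : k u * l ≤ k u * (r / 2) := by
    have := hl.2
    gcongr
  nlinarith

/-- Since `r` times the curvature is within `δ < 1` of `1`. Positivity is what fixes the orientation
of the normal in time in `IsSmoothMCF.exists_local_coord`. -/
lemma CloseToCircle.curv_pos (h : CloseToCircle δ r Ω) (hδ : δ < 1) (hr : 0 < r) {p : Plane}
    (hp : p ∈ frontier Ω) : 0 < curv Ω p := by
  obtain ⟨γ₂, L₂, hγ₂, -, -, hc, -⟩ := h.param
  obtain ⟨w, hw, rfl⟩ := hγ₂.exists_mem_Ico 0 hp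
  rw [zero_add] at hw
  have h1 := hc w hw
  have h2 : |r * curv Ω (γ₂ w) - 1| ≤ δ := by
    have : r * curv Ω (γ₂ w) - 1 = r * (curv Ω (γ₂ w) - 1 / r) := by field_simp
    rwa [this, abs_mul, abs_of_pos hr]
  by_contra! hc'
  nlinarith [(abs_le.1 h2).1]

lemma inner_deriv_nrm_eq_zero (hΩ : Ω ≠ univ) (hΩ' : Ω.Nonempty) {c : ℝ → Plane}
    {v : Plane} {w : ℝ} (hc : HasDerivAt c v w) (hcΩ : ∀ w, c w ∈ frontier Ω)
    (hne : nrm Ω (c w) ≠ 0) : ⟪v, nrm Ω (c w)⟫_ℝ = 0 := by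
  have h1 := (hasFDerivAt_of_gradient_ne_zero (f := sdist Ω) hne).comp_hasDerivAt w hc
  have h2 : HasDerivAt (sdist Ω ∘ c) 0 w := by
    rw [show sdist Ω ∘ c = fun _ => 0 from
      funext fun w => sdist_of_mem_frontier hΩ hΩ' (hcΩ w)]
    exact hasDerivAt_const _ _
  rw [real_inner_comm]
  exact h1.unique h2

/-- The block triangular linear map `((a, b), c) ↦ (e (a, b) + c d, c)`. -/
lemma exists_blockEquiv (e : (ℝ × ℝ) ≃L[ℝ] Plane) (d : Plane) :
    ∃ E : ((ℝ × ℝ) × ℝ) ≃L[ℝ] (Plane × ℝ), ∀ p, E p = (e p.1 + p.2 • d, p.2) := by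
  let f : ((ℝ × ℝ) × ℝ) →L[ℝ] (Plane × ℝ) :=
    ((e : (ℝ × ℝ) →L[ℝ] Plane).comp (ContinuousLinearMap.fst ℝ (ℝ × ℝ) ℝ) +
      (ContinuousLinearMap.snd ℝ (ℝ × ℝ) ℝ).smulRight d).prod (ContinuousLinearMap.snd ℝ (ℝ × ℝ) ℝ)
  let g : (Plane × ℝ) →L[ℝ] ((ℝ × ℝ) × ℝ) :=
    ((e.symm : Plane →L[ℝ] (ℝ × ℝ)).comp (ContinuousLinearMap.fst ℝ Plane ℝ -
      (ContinuousLinearMap.snd ℝ Plane ℝ).smulRight d)).prod (ContinuousLinearMap.snd ℝ Plane ℝ)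
  refine ⟨ContinuousLinearEquiv.equivOfInverse f g (fun p => ?_) (fun p => ?_), fun p => rfl⟩
  · simp [f, g]
  · simp [f, g]

section SpaceTime

variable {A : ℝ → Set Plane} {Text : ℝ} {ρ : ℝ → ℝ}

/-- A space-time parametrization of the tubular neighborhoods of a solution of mean curvature
flow, near a given point. -/
lemma IsSmoothMCF.exists_local_coord (hA : IsSmoothMCF A Text) (hδ : δ < 1)
    (hρ : ∀ t ∈ Ioo 0 Text, 0 < ρ t) (hρc : Continuous ρ)
    (hclose : ∀ t ∈ Ioo 0 Text, CloseToCircle δ (ρ t) (A t)) {t₀ : ℝ} (ht₀ : t₀ ∈ Ioo 0 Text)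
    (T : Tube (A t₀) (ρ t₀ / 2) γ n k L) (hn : ∀ u, nrm (A t₀) (γ u) = n u)
    (u₀ : ℝ) {l₀ : ℝ} (hl₀ : l₀ ∈ Ioo (-(ρ t₀ / 2)) (ρ t₀ / 2)) :
    ∃ (P N : ℝ × ℝ → Plane) (g : Plane × ℝ → (ℝ × ℝ) × ℝ),
      ContDiffAt ℝ ∞ g (γ u₀ + l₀ • n u₀, t₀) ∧
      (∀ᶠ p in 𝓝 (γ u₀ + l₀ • n u₀, t₀), ContDiffAt ℝ ∞ P ((g p).1.1, p.2) ∧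
        ContDiffAt ℝ ∞ N ((g p).1.1, p.2) ∧ (g p).2 = p.2 ∧
        p.1 = P ((g p).1.1, p.2) + (g p).1.2 • N ((g p).1.1, p.2)) ∧
      (∀ᶠ p in 𝓝 (γ u₀ + l₀ • n u₀, t₀), ∀ᶠ q in 𝓝 (g p), q.2 ∈ Ioo 0 Text ∧
        q.1.2 ∈ Ioo (-(ρ q.2 / 2)) (ρ q.2 / 2) ∧
        P (q.1.1, q.2) ∈ frontier (A q.2) ∧ nrm (A q.2) (P (q.1.1, q.2)) = N (q.1.1, q.2) ∧
        ‖N (q.1.1, q.2)‖ = 1 ∧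
        curv (A q.2) (P (q.1.1, q.2)) = ⟪fderiv ℝ P (q.1.1, q.2) (0, 1), N (q.1.1, q.2)⟫_ℝ) := by
  obtain ⟨G, hG, hGt, hGev⟩ := hA.evolution
  have hρ₀ := hρ t₀ ht₀
  set P : ℝ × ℝ → Plane := fun p => G p.1 p.2 with hP
  have hPs (w t : ℝ) (ht : t ∈ Ioo 0 Text) : ContDiffAt ℝ ∞ P (w, t) :=
    hG.contDiffAt (prod_mem_nhds univ_mem (Ico_mem_nhds ht.1 ht.2))
  have hPw (w t : ℝ) (ht : t ∈ Ioo 0 Text) :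
      HasDerivAt (fun v => G v t) (fderiv ℝ P (w, t) (1, 0)) w := by
    have h1 := ((hPs w t ht).differentiableAt (by simp)).hasFDerivAt
    exact h1.comp_hasDerivAt w ((hasDerivAt_id w).prodMk (hasDerivAt_const w t))
  have hPt (w t : ℝ) (ht : t ∈ Ioo 0 Text) :
      HasDerivAt (fun s => G w s) (fderiv ℝ P (w, t) (0, 1)) t := by
    have h1 := ((hPs w t ht).differentiableAt (by simp)).hasFDerivAt
    exact h1.comp_hasDerivAt t ((hasDerivAt_const t w).prodMk (hasDerivAt_id t))
  have hPfr (w t : ℝ) (ht : t ∈ Ioo 0 Text) : G w t ∈ frontier (A t) := by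
    rw [← (hGt t ⟨ht.1.le, ht.2⟩).2.2.2]; exact ⟨w, rfl⟩
  have hPne (w t : ℝ) (ht : t ∈ Ioo 0 Text) : fderiv ℝ P (w, t) (1, 0) ≠ 0 := by
    rw [← (hPw w t ht).deriv]; exact (hGt t ⟨ht.1.le, ht.2⟩).2.1 w
  -- the rotated unit tangent
  set e : ℝ × ℝ → Plane := fun q => ‖fderiv ℝ P q (1, 0)‖⁻¹ • rotJL (fderiv ℝ P q (1, 0)) with he
  have hes (w t : ℝ) (ht : t ∈ Ioo 0 Text) : ContDiffAt ℝ ∞ e (w, t) := by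
    have h1 : ContDiffAt ℝ ∞ (fun q => fderiv ℝ P q (1, 0)) (w, t) :=
      ((hPs w t ht).fderiv_right (m := ∞) (by simp)).clm_apply contDiffAt_const
    exact ((h1.norm ℝ (hPne w t ht)).inv (norm_ne_zero_iff.2 (hPne w t ht))).smul
      (rotJL.contDiff.contDiffAt.comp _ h1)
  have he1 (w t : ℝ) (ht : t ∈ Ioo 0 Text) : ‖e (w, t)‖ = 1 := by
    simp only [he, norm_smul, rotJL_apply, norm_rotJ, norm_inv, norm_norm]
    exact inv_mul_cancel₀ (norm_ne_zero_iff.2 (hPne w t ht))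
  have hnrm (w t : ℝ) (ht : t ∈ Ioo 0 Text) : ‖nrm (A t) (G w t)‖ = 1 := by
    obtain ⟨γ₂, L₂, hγ₂, -⟩ := (hclose t ht).param
    obtain ⟨w', -, hw'⟩ := hγ₂.exists_mem_Ico 0 (hPfr w t ht)
    rw [← hw']
    exact ((hclose t ht).norm_nrm hδ hγ₂ w').1
  have hperp (w t : ℝ) (ht : t ∈ Ioo 0 Text) :
      ⟪fderiv ℝ P (w, t) (1, 0), nrm (A t) (G w t)⟫_ℝ = 0 := by
    refine inner_deriv_nrm_eq_zero (c := fun v => G v t)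
      (ne_univ_of_isBounded (hclose t ht).bounded) (hclose t ht).nonempty
      (hPw w t ht) (fun w => hPfr w t ht) ?_
    exact (hclose t ht).nrm_ne_zero hδ (hPfr w t ht)
  have hor (w t : ℝ) (ht : t ∈ Ioo 0 Text) :
      nrm (A t) (G w t) = e (w, t) ∨ nrm (A t) (G w t) = -e (w, t) := by
    set v := fderiv ℝ P (w, t) (1, 0) with hv
    have hv0 : ‖v‖ ≠ 0 := norm_ne_zero_iff.2 (hPne w t ht)
    have h1 : ‖‖v‖⁻¹ • v‖ = 1 := by
      rw [norm_smul, norm_inv, norm_norm, inv_mul_cancel₀ hv0]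
    have h2 : ⟪‖v‖⁻¹ • v, e (w, t)⟫_ℝ = 0 := by
      simp only [he, ← hv, inner_smul_left, inner_smul_right, rotJL_apply, inner_rotJ_self]
      simp
    have h3 : ⟪‖v‖⁻¹ • v, nrm (A t) (G w t)⟫_ℝ = 0 := by
      rw [inner_smul_left, hperp w t ht, mul_zero]
    have h4 := eq_smul_of_inner_eq_zero h1 (he1 w t ht) h2 h3
    have h5 : |⟪e (w, t), nrm (A t) (G w t)⟫_ℝ| = 1 := by
      have := hnrm w t ht
      rw [h4, norm_smul, he1 w t ht, mul_one, Real.norm_eq_abs] at this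
      exact this
    rcases abs_eq zero_le_one |>.1 h5 with h6 | h6
    · left; rw [h4, h6, one_smul]
    · right; rw [h4, h6, neg_one_smul]
  obtain ⟨w₀, hw₀⟩ : ∃ w₀, G w₀ t₀ = γ u₀ := by
    have : γ u₀ ∈ range (fun u => G u t₀) := by
      rw [(hGt t₀ ⟨ht₀.1.le, ht₀.2⟩).2.2.2]; exact T.param.mem u₀
    exact this
  -- The sign relating the inner normal to the rotated tangent is read off at the base point only;
  -- that it persists nearby is shown separately.
  obtain ⟨s, hs⟩ : ∃ s : ℝ, (s = 1 ∨ s = -1) ∧ nrm (A t₀) (G w₀ t₀) = s • e (w₀, t₀) := by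
    rcases hor w₀ t₀ ht₀ with h | h
    · exact ⟨1, Or.inl rfl, by rw [h, one_smul]⟩
    · exact ⟨-1, Or.inr rfl, by rw [h, neg_one_smul]⟩
  set N : ℝ × ℝ → Plane := fun q => s • e q with hN
  have hNs (w t : ℝ) (ht : t ∈ Ioo 0 Text) : ContDiffAt ℝ ∞ N (w, t) := (hes w t ht).const_smul s
  have hN1 (w t : ℝ) (ht : t ∈ Ioo 0 Text) : ‖N (w, t)‖ = 1 := by
    rcases hs.1 with h | h <;> simp [hN, h, he1 w t ht]
  have hNor (w t : ℝ) (ht : t ∈ Ioo 0 Text) :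
      nrm (A t) (G w t) = N (w, t) ∨ nrm (A t) (G w t) = -N (w, t) := by
    rcases hs.1 with h | h
    · simpa [hN, h] using hor w t ht
    · simpa [hN, h] using (hor w t ht).symm
  have hcurv (w t : ℝ) (ht : t ∈ Ioo 0 Text) :
      ⟪fderiv ℝ P (w, t) (0, 1), nrm (A t) (G w t)⟫_ℝ = curv (A t) (G w t) := by
    rw [← (hPt w t ht).deriv]; exact hGev t ht w
  have hopen : ∀ᶠ q in 𝓝 (w₀, t₀), q.2 ∈ Ioo 0 Text :=
    continuousAt_snd.eventually_mem (Ioo_mem_nhds ht₀.1 ht₀.2)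
  -- The normal speed `⟪∂ₜ P, N⟫` is continuous and equals the positive curvature at the base point,
  -- so it stays positive nearby. If the inner normal were `-N` there, the same speed would be minus
  -- a positive curvature.
  have hNnrm : ∀ᶠ q in 𝓝 (w₀, t₀), nrm (A q.2) (G q.1 q.2) = N q := by
    have hc : ContinuousAt (fun q => ⟪fderiv ℝ P q (0, 1), N q⟫_ℝ) (w₀, t₀) := by
      refine ContinuousAt.inner ?_ (hNs w₀ t₀ ht₀).continuousAt
      exact (((hPs w₀ t₀ ht₀).fderiv_right (m := ∞) (by simp)).clm_apply
        contDiffAt_const).continuousAt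
    have hpos : 0 < ⟪fderiv ℝ P (w₀, t₀) (0, 1), N (w₀, t₀)⟫_ℝ := by
      have := hcurv w₀ t₀ ht₀
      rw [hs.2] at this
      change ⟪_, N (w₀, t₀)⟫_ℝ = _ at this
      rw [this]
      exact (hclose t₀ ht₀).curv_pos hδ hρ₀ (hPfr w₀ t₀ ht₀)
    filter_upwards [hc.eventually (lt_mem_nhds hpos), hopen] with q hq hqt
    rcases hNor q.1 q.2 hqt with h | h
    · exact h
    · exfalso
      have h1 := hcurv q.1 q.2 hqt
      rw [h, inner_neg_right] at h1
      have h2 := (hclose q.2 hqt).curv_pos hδ (hρ q.2 hqt) (hPfr q.1 q.2 hqt)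
      simp only [Prod.mk.eta] at h1
      linarith
  -- the space-time map
  have h0 : (0 : ℝ) ∈ Ioo (-(ρ t₀ / 2)) (ρ t₀ / 2) := ⟨by linarith, by linarith⟩
  have hN₀ : N (w₀, t₀) = n u₀ := by rw [← hn, ← hw₀]; exact hs.2.symm
  clear_value N
  have hkl := (hclose t₀ ht₀).one_sub_pos hδ hρ₀ T hn u₀ hl₀
  obtain ⟨c₁, hc₁, hPc⟩ : ∃ c₁ : ℝ, c₁ ≠ 0 ∧ fderiv ℝ P (w₀, t₀) (1, 0) = c₁ • deriv γ u₀ := by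
    have h1 := hperp w₀ t₀ ht₀
    rw [hw₀, hn, real_inner_comm] at h1
    have h2 := eq_smul_of_inner_eq_zero (T.norm_normal u₀) (T.norm_tangent u₀)
      (by rw [real_inner_comm]; exact T.orth u₀) h1
    refine ⟨_, fun hc => hPne w₀ t₀ ht₀ ?_, h2⟩
    rw [h2, hc, zero_smul]
  -- At the frozen time `t₀`, near `w₀`, `N` is the extended normal composed with the curve, so its
  -- derivative is `-k` times the velocity `c₁ • γ'`.
  have hNw : HasDerivAt (fun w => N (w, t₀)) (-(c₁ * k u₀) • deriv γ u₀) w₀ := by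
    obtain ⟨N', hN', hN'v⟩ := T.hasFDerivAt_nrm_proj hn u₀ h0 (by simp)
    rw [zero_smul, add_zero, ← hw₀] at hN'
    have h1 := hN'.comp_hasDerivAt w₀ (hPw w₀ t₀ ht₀)
    rw [hPc, hN'v] at h1
    have h2 : (fun w => N (w, t₀)) =ᶠ[𝓝 w₀]
        (fun x => nrm (A t₀) (proj (A t₀) x)) ∘ fun v => G v t₀ := by
      have h3 : Tendsto (fun w : ℝ => (w, t₀)) (𝓝 w₀) (𝓝 (w₀, t₀)) :=
        (Continuous.prodMk_left t₀).tendsto w₀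
      filter_upwards [h3.eventually hNnrm] with w hw
      rw [← hw]
      obtain ⟨w', -, hw'⟩ := T.param.exists_mem_Ico 0 (hPfr w t₀ ht₀)
      simp only [Function.comp]
      have := T.proj_eq w' h0
      rw [zero_smul, add_zero, hw'] at this
      rw [this]
    refine (h1.congr_of_eventuallyEq h2).congr_deriv ?_
    simp only [inner_smul_right, real_inner_self_eq_norm_sq, T.norm_tangent]
    rw [smul_smul]; congr 1; simp
  -- The spatial part of the differential is diagonal in the frame, with tangential entry `c₁ * (1 -
  -- k l₀)` and normal entry `1`; adding the time variable makes it block triangular, hence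
  -- invertible.
  obtain ⟨e₁, he₁⟩ := exists_frameEquiv (T.norm_tangent u₀) (T.norm_normal u₀) (T.orth u₀)
    (mul_ne_zero hc₁ hkl.ne')
  obtain ⟨E, hE⟩ := exists_blockEquiv e₁
    (fderiv ℝ P (w₀, t₀) (0, 1) + l₀ • fderiv ℝ N (w₀, t₀) (0, 1))
  set f : (ℝ × ℝ) × ℝ → Plane × ℝ := fun q => (P (q.1.1, q.2) + q.1.2 • N (q.1.1, q.2), q.2) with hf
  have hfs : ContDiffAt ℝ ∞ f ((w₀, l₀), t₀) := by
    have hin : ContDiffAt ℝ ∞ (fun q : (ℝ × ℝ) × ℝ => (q.1.1, q.2)) ((w₀, l₀), t₀) := by fun_prop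
    have h1 : ContDiffAt ℝ ∞ (fun q : (ℝ × ℝ) × ℝ => P (q.1.1, q.2)) ((w₀, l₀), t₀) :=
      ContDiffAt.comp (g := P) ((w₀, l₀), t₀) (hPs w₀ t₀ ht₀) hin
    have h2 : ContDiffAt ℝ ∞ (fun q : (ℝ × ℝ) × ℝ => N (q.1.1, q.2)) ((w₀, l₀), t₀) :=
      ContDiffAt.comp (g := N) ((w₀, l₀), t₀) (hNs w₀ t₀ ht₀) hin
    have h3 : ContDiffAt ℝ ∞ (fun q : (ℝ × ℝ) × ℝ => q.1.2) ((w₀, l₀), t₀) := by fun_prop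
    exact (h1.add (h3.smul h2)).prodMk contDiffAt_snd
  have hfd : HasFDerivAt f (E : ((ℝ × ℝ) × ℝ) →L[ℝ] (Plane × ℝ)) ((w₀, l₀), t₀) := by
    have hin : HasFDerivAt (fun q : (ℝ × ℝ) × ℝ => (q.1.1, q.2))
        (((ContinuousLinearMap.fst ℝ ℝ ℝ).comp (ContinuousLinearMap.fst ℝ (ℝ × ℝ) ℝ)).prod
          (ContinuousLinearMap.snd ℝ (ℝ × ℝ) ℝ)) ((w₀, l₀), t₀) :=
      ContinuousLinearMap.hasFDerivAt (((ContinuousLinearMap.fst ℝ ℝ ℝ).comp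
        (ContinuousLinearMap.fst ℝ (ℝ × ℝ) ℝ)).prod (ContinuousLinearMap.snd ℝ (ℝ × ℝ) ℝ))
    have hl : HasFDerivAt (fun q : (ℝ × ℝ) × ℝ => q.1.2)
        ((ContinuousLinearMap.snd ℝ ℝ ℝ).comp (ContinuousLinearMap.fst ℝ (ℝ × ℝ) ℝ))
        ((w₀, l₀), t₀) :=
      ContinuousLinearMap.hasFDerivAt ((ContinuousLinearMap.snd ℝ ℝ ℝ).comp
        (ContinuousLinearMap.fst ℝ (ℝ × ℝ) ℝ))
    have h1 := HasFDerivAt.comp ((w₀, l₀), t₀)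
      (((hPs w₀ t₀ ht₀).differentiableAt (by simp)).hasFDerivAt) hin
    have hNd := ((hNs w₀ t₀ ht₀).differentiableAt (by simp)).hasFDerivAt
    have h2 := HasFDerivAt.comp ((w₀, l₀), t₀) hNd hin
    have hNw' : fderiv ℝ N (w₀, t₀) (1, 0) = -(c₁ * k u₀) • deriv γ u₀ :=
      (HasFDerivAt.comp_hasDerivAt (f := fun w => (w, t₀)) w₀ hNd ((hasDerivAt_id w₀).prodMk (hasDerivAt_const w₀ t₀))).unique hNw
    refine ((h1.add (hl.smul h2)).prodMk hasFDerivAt_snd).congr_fderiv ?_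
    refine ContinuousLinearMap.ext fun q => ?_
    have hq : ∀ M : ℝ × ℝ →L[ℝ] Plane, M (q.1.1, q.2) = q.1.1 • M (1, 0) + q.2 • M (0, 1) := by
      intro M
      rw [← map_smul, ← map_smul, ← map_add]
      simp
    change (_, _) = E q
    rw [hE, he₁]
    refine Prod.ext ?_ rfl
    change fderiv ℝ P (w₀, t₀) (q.1.1, q.2) + (l₀ • fderiv ℝ N (w₀, t₀) (q.1.1, q.2)
      + q.1.2 • N (w₀, t₀)) = _
    rw [hq, hq, hPc, hNw', hN₀]
    module
  obtain ⟨g, hg, hg0, hgev⟩ := exists_smooth_local_inverse hfs hfd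
  have hf0 : f ((w₀, l₀), t₀) = (γ u₀ + l₀ • n u₀, t₀) := by
    simp only [hf, hN₀]
    rw [← hw₀]
  rw [hf0] at hg hg0 hgev
  have hgc : Tendsto g (𝓝 (γ u₀ + l₀ • n u₀, t₀)) (𝓝 ((w₀, l₀), t₀)) := by
    have := hg.continuousAt.tendsto
    rwa [hg0] at this
  have hall : ∀ᶠ q in 𝓝 ((w₀, l₀), t₀), q.2 ∈ Ioo 0 Text ∧
        q.1.2 ∈ Ioo (-(ρ q.2 / 2)) (ρ q.2 / 2) ∧
        P (q.1.1, q.2) ∈ frontier (A q.2) ∧ nrm (A q.2) (P (q.1.1, q.2)) = N (q.1.1, q.2) ∧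
        ‖N (q.1.1, q.2)‖ = 1 ∧
        curv (A q.2) (P (q.1.1, q.2)) = ⟪fderiv ℝ P (q.1.1, q.2) (0, 1), N (q.1.1, q.2)⟫_ℝ := by
    have hin : Tendsto (fun q : (ℝ × ℝ) × ℝ => (q.1.1, q.2)) (𝓝 ((w₀, l₀), t₀)) (𝓝 (w₀, t₀)) :=
      Continuous.tendsto (by fun_prop) ((w₀, l₀), t₀)
    have hlo : ∀ᶠ q : (ℝ × ℝ) × ℝ in 𝓝 ((w₀, l₀), t₀), q.1.2 ∈ Ioo (-(ρ q.2 / 2)) (ρ q.2 / 2) := by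
      have h1 : Continuous (fun q : (ℝ × ℝ) × ℝ => -(ρ q.2 / 2)) := by fun_prop
      have h2 : Continuous (fun q : (ℝ × ℝ) × ℝ => ρ q.2 / 2) := by fun_prop
      have h3 : Continuous (fun q : (ℝ × ℝ) × ℝ => q.1.2) := by fun_prop
      exact ((isOpen_lt h1 h3).inter (isOpen_lt h3 h2)).mem_nhds hl₀
    filter_upwards [hin.eventually hNnrm, hin.eventually hopen, hlo] with q h1 h2 h3
    refine ⟨h2, h3, hPfr q.1.1 q.2 h2, h1, hN1 q.1.1 q.2 h2, ?_⟩
    rw [← h1]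
    exact (hcurv q.1.1 q.2 h2).symm
  have hallg := hgc.eventually hall.eventually_nhds
  refine ⟨P, N, g, hg, ?_, hallg⟩
  filter_upwards [hgev, hallg] with p hp hp'
  have h2 : (g p).2 = p.2 := congrArg Prod.snd hp
  have h3 := hp'.self_of_nhds.1
  rw [h2] at h3
  refine ⟨hPs _ _ h3, hNs _ _ h3, h2, ?_⟩
  have h4 : P ((g p).1.1, (g p).2) + (g p).1.2 • N ((g p).1.1, (g p).2) = p.1 :=
    congrArg Prod.fst hp
  rw [h2] at h4
  exact h4.symm

end SpaceTime

end CircMCF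

/-! ### Space-time derivatives of the distance, the normal and the curvature -/

namespace CircMCF

variable {Ω : Set Plane} {γ n : ℝ → Plane} {k : ℝ → ℝ} {L δ r : ℝ}

/-- A tubular neighborhood based at a given boundary point. -/
lemma CloseToCircle.exists_tube (h : CloseToCircle δ r Ω) (hδ : δ < 1) (hr : 0 < r) {p : Plane}
    (hp : p ∈ frontier Ω) : ∃ (γ n : ℝ → Plane) (k : ℝ → ℝ) (L u : ℝ), Tube Ω (r / 2) γ n k L ∧
      (∀ u, nrm Ω (γ u) = n u) ∧ γ u = p := by
  obtain ⟨γ, L, hγ, -⟩ := h.param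
  obtain ⟨u, -, hu⟩ := hγ.exists_mem_Ico 0 hp
  exact ⟨γ, _, _, L, u, h.tube_of_param hδ hr hγ, fun _ => rfl, hu⟩

section SpaceTime

variable {A : ℝ → Set Plane} {Text : ℝ} {ρ : ℝ → ℝ}

/-- First order derivatives in space-time of the signed distance, the extended normal and the
extended curvature. -/
lemma IsSmoothMCF.hasFDerivAt (hA : IsSmoothMCF A Text) (hδ : δ < 1)
    (hρ : ∀ t ∈ Ioo 0 Text, 0 < ρ t) (hρc : Continuous ρ)
    (hclose : ∀ t ∈ Ioo 0 Text, CloseToCircle δ (ρ t) (A t)) {t₀ : ℝ} (ht₀ : t₀ ∈ Ioo 0 Text)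
    (T : Tube (A t₀) (ρ t₀ / 2) γ n k L) (hn : ∀ u, nrm (A t₀) (γ u) = n u)
    (u₀ : ℝ) {l₀ : ℝ} (hl₀ : l₀ ∈ Ioo (-(ρ t₀ / 2)) (ρ t₀ / 2)) :
    ∃ (σ' κ' : Plane × ℝ →L[ℝ] ℝ) (N' : Plane × ℝ →L[ℝ] Plane),
      HasFDerivAt (fun p : Plane × ℝ => sdist (A p.2) p.1) σ' (γ u₀ + l₀ • n u₀, t₀) ∧
      HasFDerivAt (fun p : Plane × ℝ => curv (A p.2) (proj (A p.2) p.1)) κ'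
        (γ u₀ + l₀ • n u₀, t₀) ∧
      HasFDerivAt (fun p : Plane × ℝ => nrm (A p.2) (proj (A p.2) p.1)) N'
        (γ u₀ + l₀ • n u₀, t₀) ∧
      (∀ v w, σ' (v, w) = ⟪n u₀, v⟫_ℝ - w * k u₀) ∧
      (∀ v, κ' (v, 0) = ⟪deriv γ u₀, v⟫_ℝ / (1 - k u₀ * l₀) * deriv k u₀) ∧
      (∀ v w, N' (v, w) = (-((k u₀ * ⟪deriv γ u₀, v⟫_ℝ + w * deriv k u₀) / (1 - k u₀ * l₀))) •
        deriv γ u₀) := by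
  obtain ⟨P, N, g, hg, hgP, hgq⟩ := hA.exists_local_coord hδ hρ hρc hclose ht₀ T hn u₀ hl₀
  set X₀ : Plane × ℝ := (γ u₀ + l₀ • n u₀, t₀) with hX₀
  set σ : Plane × ℝ → ℝ := fun p => sdist (A p.2) p.1 with hσ
  set κ : Plane × ℝ → ℝ := fun p => curv (A p.2) (proj (A p.2) p.1) with hκ
  set M : Plane × ℝ → Plane := fun p => nrm (A p.2) (proj (A p.2) p.1) with hM
  have hkl := (hclose t₀ ht₀).one_sub_pos hδ (hρ t₀ ht₀) T hn u₀ hl₀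
  -- evaluation along the tube
  have hsd {t : ℝ} (ht : t ∈ Ioo 0 Text) {p : Plane} (hp : p ∈ frontier (A t)) {l : ℝ}
      (hl : l ∈ Ioo (-(ρ t / 2)) (ρ t / 2)) :
      sdist (A t) (p + l • nrm (A t) p) = l ∧ proj (A t) (p + l • nrm (A t) p) = p ∧
      HasFDerivAt (sdist (A t)) (innerSL ℝ (nrm (A t) p)) (p + l • nrm (A t) p) := by
    obtain ⟨γ, n, k, L, u, T, hn, rfl⟩ := (hclose t ht).exists_tube hδ (hρ t ht) hp
    rw [hn]
    exact ⟨T.sdist_eq u l hl, T.proj_eq u hl, T.hasFDerivAt_sdist u hl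
      ((hclose t ht).one_sub_pos hδ (hρ t ht) T hn u hl).ne'⟩
  have hE1 : ∀ᶠ p in 𝓝 X₀, σ p = (g p).1.2 ∧ M p = N ((g p).1.1, p.2) ∧
      κ p = ⟪fderiv ℝ P ((g p).1.1, p.2) (0, 1), N ((g p).1.1, p.2)⟫_ℝ := by
    filter_upwards [hgP, hgq] with p hp hp'
    obtain ⟨-, -, h2, h3⟩ := hp
    obtain ⟨h4, h5, h6, h7, -, h8⟩ := hp'.self_of_nhds
    rw [h2] at h4 h5 h6 h7 h8
    have h9 := hsd h4 h6 h5
    rw [h7, ← h3] at h9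
    simp only [hσ, hM, hκ]
    exact ⟨h9.1, by rw [h9.2.1, h7], by rw [h9.2.1, h8]⟩
  have hg3 : ∀ᶠ p in 𝓝 X₀, ContDiffAt ℝ 1 g p := (hg.of_le (by simp)).eventually (by simp)
  have hσs : ContDiffAt ℝ ∞ σ X₀ := by
    refine (hg.fst.snd).congr_of_eventuallyEq ?_
    filter_upwards [hE1] with p hp using hp.1
  -- The identity `dσ = ⟪n, dx⟫ - κ dt` is proved on a neighborhood and not just at `X₀`, because it
  -- is differentiated once more below.
  have hE2 : ∀ᶠ p in 𝓝 X₀, ∀ v w, fderiv ℝ σ p (v, w) = ⟪M p, v⟫_ℝ - w * κ p := by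
    filter_upwards [hgP, hgq, hE1.eventually_nhds, hg3] with p hp hp' hp1 hp3
    obtain ⟨hPs, hNs, h2, h3⟩ := hp
    obtain ⟨h4, h5, h6, h7, h7', h8⟩ := hp'.self_of_nhds
    have hσd : DifferentiableAt ℝ σ p := by
      refine ((hp3.differentiableAt (by simp)).fst.snd).congr_of_eventuallyEq ?_
      filter_upwards [hp1] with q hq using hq.1
    have hd := hσd.hasFDerivAt
    have hsp : ∀ v, fderiv ℝ σ p (v, 0) = ⟪M p, v⟫_ℝ := by
      rw [h2] at h4 h5 h6 h7
      have h9 := (hsd h4 h6 h5).2.2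
      rw [h7, ← h3] at h9
      have h10 : HasFDerivAt (fun x => σ (x, p.2)) _ p.1 :=
        HasFDerivAt.comp (g := σ) p.1 hd (hasFDerivAt_prodMk_left p.1 p.2)
      have h11 := h10.unique h9
      intro v
      rw [hp1.self_of_nhds.2.1]
      exact congrArg (fun D => D v) h11
    -- The signed distance is constant along `s ↦ P (w, s) + l • N (w, s)`. The velocity of this
    -- path has normal component `κ`, since `N` has unit length and so `∂ₜ N` does not contribute.
    have hti : fderiv ℝ σ p (0, 1) = -κ p := by
      set w := (g p).1.1 with hw
      set l := (g p).1.2 with hl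
      set t := p.2 with ht
      have hc : HasDerivAt (fun s : ℝ => (P (w, s) + l • N (w, s), s))
          (fderiv ℝ P (w, t) (0, 1) + l • fderiv ℝ N (w, t) (0, 1), 1) t := by
        have e1 : HasDerivAt (fun s : ℝ => (w, s)) (0, 1) t :=
          (hasDerivAt_const t w).prodMk (hasDerivAt_id t)
        have e2 := HasFDerivAt.comp_hasDerivAt t
          ((hPs.differentiableAt (by simp)).hasFDerivAt) e1
        have e3 := HasFDerivAt.comp_hasDerivAt t
          ((hNs.differentiableAt (by simp)).hasFDerivAt) e1
        exact (e2.add (e3.const_smul l)).prodMk (hasDerivAt_id t)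
      have hp0 : (P (w, t) + l • N (w, t), t) = p := by rw [← h3]
      have h10 := HasFDerivAt.comp_hasDerivAt_of_eq (l := σ) t hd hc hp0.symm
      have hin : Tendsto (fun s : ℝ => ((w, l), s)) (𝓝 t) (𝓝 (g p)) := by
        have : g p = ((w, l), t) := Prod.ext (Prod.ext rfl rfl) h2
        rw [this]
        exact (Continuous.prodMk_right _).tendsto t
      have hev := hin.eventually hp'
      have h11 : (σ ∘ fun s : ℝ => (P (w, s) + l • N (w, s), s)) =ᶠ[𝓝 t] fun _ => l := by
        filter_upwards [hev] with s hs
        obtain ⟨q4, q5, q6, q7, -⟩ := hs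
        have := (hsd q4 q6 q5).1
        rw [q7] at this
        exact this
      have h12 := h10.unique ((hasDerivAt_const t l).congr_of_eventuallyEq h11)
      have hNN : ⟪N (w, t), fderiv ℝ N (w, t) (0, 1)⟫_ℝ = 0 := by
        have e1 : HasDerivAt (fun s : ℝ => (w, s)) (0, 1) t :=
          (hasDerivAt_const t w).prodMk (hasDerivAt_id t)
        have e3 := (HasFDerivAt.comp_hasDerivAt t
          ((hNs.differentiableAt (by simp)).hasFDerivAt) e1).norm_sq
        have e4 : (fun s => ‖(N ∘ fun s => (w, s)) s‖ ^ 2) =ᶠ[𝓝 t] fun _ => 1 := by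
          filter_upwards [hev] with s hs
          obtain ⟨-, -, -, -, q8, -⟩ := hs
          simp only [Function.comp]
          rw [q8, one_pow]
        have e5 := e3.unique ((hasDerivAt_const t (1 : ℝ)).congr_of_eventuallyEq e4)
        have e6 : 2 * ⟪N (w, t), fderiv ℝ N (w, t) (0, 1)⟫_ℝ = 0 := e5
        linarith
      have h13 : ∀ v : Plane, fderiv ℝ σ p (v, 1) = fderiv ℝ σ p (v, 0) + fderiv ℝ σ p (0, 1) := by
        intro v
        rw [← map_add]; simp
      rw [h13, hsp, hp1.self_of_nhds.2.1, inner_add_right, inner_smul_right, hNN,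
        real_inner_comm] at h12
      rw [hp1.self_of_nhds.2.2]
      linarith
    intro v w
    have : ((v, w) : Plane × ℝ) = (v, 0) + w • (0, 1) := by simp
    rw [this, map_add, map_smul, hsp, hti, smul_eq_mul]
    ring
  -- second derivatives
  have hd2 : HasFDerivAt (fderiv ℝ σ) (fderiv ℝ (fderiv ℝ σ) X₀) X₀ :=
    ((hσs.fderiv_right (m := ∞) (by simp)).differentiableAt (by simp)).hasFDerivAt
  -- Exchanging the order of differentiation expresses the time derivative of the normal by the
  -- spatial derivative of the curvature, which is already known.
  have hsymm : IsSymmSndFDerivAt ℝ σ X₀ := hσs.isSymmSndFDerivAt (by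
    simp only [minSmoothness_of_isRCLikeNormedField]; exact WithTop.coe_le_coe.2 (le_top : (2 : ℕ∞) ≤ ⊤))
  have hκd : HasFDerivAt κ (-(ContinuousLinearMap.apply ℝ ℝ ((0, 1) : Plane × ℝ)).comp
      (fderiv ℝ (fderiv ℝ σ) X₀)) X₀ := by
    have h1 := ((ContinuousLinearMap.apply ℝ ℝ ((0, 1) : Plane × ℝ)).hasFDerivAt.comp X₀ hd2).neg
    refine h1.congr_of_eventuallyEq ?_
    filter_upwards [hE2] with p hp
    change κ p = -(fderiv ℝ σ p (0, 1))
    rw [hp]; simp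
  have hMd : DifferentiableAt ℝ M X₀ := by
    have hev : M =ᶠ[𝓝 X₀] N ∘ fun p => ((g p).1.1, p.2) := by
      filter_upwards [hE1] with p hp using hp.2.1
    refine DifferentiableAt.congr_of_eventuallyEq ?_ hev
    refine DifferentiableAt.comp X₀ (hgP.self_of_nhds.2.1.differentiableAt (by simp)) ?_
    exact (hg.fst.fst.differentiableAt (by simp)).prodMk differentiableAt_snd
  have hκv : ∀ v, (-(ContinuousLinearMap.apply ℝ ℝ ((0, 1) : Plane × ℝ)).comp
      (fderiv ℝ (fderiv ℝ σ) X₀)) (v, 0) =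
        ⟪deriv γ u₀, v⟫_ℝ / (1 - k u₀ * l₀) * deriv k u₀ := by
    have h10 := HasFDerivAt.comp (g := κ) (f := fun x => (x, t₀)) (γ u₀ + l₀ • n u₀) hκd
      (hasFDerivAt_prodMk_left (γ u₀ + l₀ • n u₀) t₀)
    intro v
    exact T.fderiv_apply_of_coord hl₀ hkl.ne' h10 (fun w m hm => T.curv_proj hn w hm)
      (T.hasDerivAt_curv u₀) v
  refine ⟨fderiv ℝ σ X₀, _, fderiv ℝ M X₀, (hσs.differentiableAt (by simp)).hasFDerivAt, hκd,
    hMd.hasFDerivAt, ?_, hκv, ?_⟩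
  · intro v w
    rw [hE2.self_of_nhds]
    simp only [hM, hκ, hX₀]
    rw [T.nrm_proj hn u₀ hl₀, T.curv_proj hn u₀ hl₀]
  · have hsp : ∀ v, fderiv ℝ M X₀ (v, 0) =
        (⟪deriv γ u₀, v⟫_ℝ / (1 - k u₀ * l₀)) • (-(k u₀) • deriv γ u₀) := by
      have h10 := HasFDerivAt.comp (g := M) (f := fun x => (x, t₀)) (γ u₀ + l₀ • n u₀) hMd.hasFDerivAt
        (hasFDerivAt_prodMk_left (γ u₀ + l₀ • n u₀) t₀)
      intro v
      exact T.fderiv_apply_of_coord hl₀ hkl.ne' h10 (fun w m hm => T.nrm_proj hn w hm)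
        (T.hasDerivAt_normal u₀) v
    -- Here `⟪∂ₜ n, v⟫ = ∂ₜ ∂ᵥ σ = ∂ᵥ ∂ₜ σ = -∂ᵥ κ`.
    have hti : fderiv ℝ M X₀ (0, 1) = (-(deriv k u₀ / (1 - k u₀ * l₀))) • deriv γ u₀ := by
      refine ext_inner_right ℝ fun v => ?_
      have h1 : HasFDerivAt (fun p => ⟪M p, v⟫_ℝ)
          ((ContinuousLinearMap.apply ℝ ℝ ((v, 0) : Plane × ℝ)).comp
            (fderiv ℝ (fderiv ℝ σ) X₀)) X₀ := by
        refine ((ContinuousLinearMap.apply ℝ ℝ ((v, 0) : Plane × ℝ)).hasFDerivAt.comp X₀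
          hd2).congr_of_eventuallyEq ?_
        filter_upwards [hE2] with p hp
        change _ = fderiv ℝ σ p (v, 0)
        rw [hp]; simp
      have h2 := hMd.hasFDerivAt.inner ℝ (hasFDerivAt_const v X₀)
      have h3 := congrArg (fun D => D ((0, 1) : Plane × ℝ)) (h2.unique h1)
      have h4 : ⟪M X₀, (0 : Plane)⟫_ℝ + ⟪fderiv ℝ M X₀ (0, 1), v⟫_ℝ =
        fderiv ℝ (fderiv ℝ σ) X₀ (0, 1) (v, 0) := h3
      rw [inner_zero_right, zero_add, hsymm.eq] at h4
      have h5 := hκv v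
      change -(fderiv ℝ (fderiv ℝ σ) X₀ (v, 0) (0, 1)) = _ at h5
      rw [h4, inner_smul_left]
      simp only [conj_trivial]
      linear_combination -h5
    intro v w
    have : ((v, w) : Plane × ℝ) = (v, 0) + w • (0, 1) := by simp
    rw [this, map_add, map_smul, hsp, hti, smul_smul, smul_smul, ← add_smul]
    congr 1
    ring

end SpaceTime

end CircMCF

namespace CircMCF

/-! ### The area formula for injective `C¹` curves -/

section AreaFormula

variable {c : ℝ → Plane} {a b : ℝ}

/-- The mean value inequality for `x ↦ c x - x • c' p`, whose derivative has norm at most `η`. -/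
lemma norm_sub_sub_smul_le {p q η : ℝ} (hc : ContDiff ℝ 1 c)
    (hη : ∀ t ∈ Icc p q, ‖deriv c t - deriv c p‖ ≤ η) {s t : ℝ} (hs : s ∈ Icc p q)
    (ht : t ∈ Icc p q) : ‖c t - c s - (t - s) • deriv c p‖ ≤ η * |t - s| := by
  have hd (x : ℝ) : HasDerivAt (fun x => c x - x • deriv c p) (deriv c x - deriv c p) x := by
    have h1 := (hc.differentiable (by simp)).differentiableAt (x := x) |>.hasDerivAt
    have h2 := (hasDerivAt_id x).smul_const (deriv c p)
    exact (h1.sub h2).congr_deriv (by rw [one_smul])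
  have := (convex_Icc p q).norm_image_sub_le_of_norm_hasDerivWithin_le (C := η)
    (fun x hx => (hd x).hasDerivWithinAt) (fun x hx => hη x hx) hs ht
  rw [Real.norm_eq_abs] at this
  refine le_of_eq_of_le (congrArg norm ?_) this
  module

/-- With `m = ‖c' p‖`, the curve changes distances by a factor between `m - η` and `m + η` on the
short interval. Lipschitz bounds for `c` and for its inverse compare the measure of the image with
`m * volume E`, and the integral of the speed is compared with the same quantity. -/
lemma hausdorffMeasure_image_near {p q η : ℝ} (hη0 : 0 ≤ η) (hc : ContDiff ℝ 1 c)
    (hη : ∀ t ∈ Icc p q, ‖deriv c t - deriv c p‖ ≤ η) {E : Set ℝ} (hE : E ⊆ Icc p q)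
    (hEm : MeasurableSet E) :
    μH[1] (c '' E) ≤ (∫⁻ u in E, ‖deriv c u‖ₑ) + ENNReal.ofReal (2 * η) * volume E ∧
    (∫⁻ u in E, ‖deriv c u‖ₑ) ≤ μH[1] (c '' E) + ENNReal.ofReal (2 * η) * volume E := by
  set m := ‖deriv c p‖ with hm
  have hdc : Measurable fun u => ‖deriv c u‖ₑ := by
    have := hc.continuous_deriv (by simp)
    fun_prop
  have hsp {t : ℝ} (ht : t ∈ E) : |‖deriv c t‖ - m| ≤ η :=
    (abs_norm_sub_norm_le _ _).trans (hη t (hE ht))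
  have hest {s t : ℝ} (hs : s ∈ E) (ht : t ∈ E) :
      abs (‖c t - c s‖ - m * |t - s|) ≤ η * |t - s| := by
    have h1 := norm_sub_sub_smul_le hc hη (hE hs) (hE ht)
    have h2 := abs_norm_sub_norm_le (c t - c s) ((t - s) • deriv c p)
    rw [norm_smul, Real.norm_eq_abs, mul_comm |t - s|] at h2
    exact h2.trans h1
  constructor
  · have hL : LipschitzOnWith (Real.toNNReal (m + η)) c E := by
      refine LipschitzOnWith.of_dist_le_mul fun t ht s hs => ?_
      rw [Real.coe_toNNReal _ (by positivity), dist_eq_norm, Real.dist_eq]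
      linarith [(abs_le.1 (hest hs ht)).2]
    have h1 := hL.hausdorffMeasure_image_le (d := 1) zero_le_one
    rw [hausdorffMeasure_real, ENNReal.rpow_one] at h1
    refine h1.trans ?_
    change ENNReal.ofReal (m + η) * volume E ≤ _
    rw [← setLIntegral_const, ← setLIntegral_const, ← lintegral_add_left hdc]
    refine setLIntegral_mono' hEm fun t ht => ?_
    rw [← ofReal_norm, ← ENNReal.ofReal_add (norm_nonneg _) (by positivity)]
    exact ENNReal.ofReal_le_ofReal (by linarith [(abs_le.1 (hsp ht)).1])
  · have h2 : (∫⁻ u in E, ‖deriv c u‖ₑ) ≤ ENNReal.ofReal (m + η) * volume E := by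
      rw [← setLIntegral_const]
      refine setLIntegral_mono' hEm fun t ht => ?_
      rw [← ofReal_norm]
      exact ENNReal.ofReal_le_ofReal (by linarith [(abs_le.1 (hsp ht)).2])
    refine h2.trans ?_
    -- If `m ≤ η`, the speed is at most `2 * η` and the error term alone suffices; otherwise the
    -- curve is injective on `E` with a Lipschitz inverse.
    rcases le_or_gt m η with hmη | hmη
    · refine le_trans ?_ le_add_self
      gcongr
      linarith
    · have h3 : ENNReal.ofReal (m - η) * volume E ≤ μH[1] (c '' E) := by
        have hinj : InjOn c E := fun s hs t ht hst => by
          have := (abs_le.1 (hest hs ht)).1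
          rw [hst, sub_self, norm_zero] at this
          have h0 : |t - s| ≤ 0 := by
            by_contra! hcon
            nlinarith
          linarith [abs_nonpos_iff.1 h0]
        have hg : LipschitzOnWith (Real.toNNReal (m - η)⁻¹) (Function.invFunOn c E) (c '' E) := by
          refine LipschitzOnWith.of_dist_le_mul ?_
          rintro _ ⟨t, ht, rfl⟩ _ ⟨s, hs, rfl⟩
          rw [hinj.leftInvOn_invFunOn ht, hinj.leftInvOn_invFunOn hs,
            Real.coe_toNNReal _ (by rw [inv_nonneg]; linarith), dist_eq_norm (c t), Real.dist_eq,
            le_inv_mul_iff₀ (by linarith)]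
          linarith [(abs_le.1 (hest hs ht)).1]
        have h4 := hg.hausdorffMeasure_image_le (d := 1) zero_le_one
        rw [hausdorffMeasure_real, ENNReal.rpow_one, hinj.leftInvOn_invFunOn.image_image] at h4
        calc ENNReal.ofReal (m - η) * volume E
            ≤ ENNReal.ofReal (m - η) * (ENNReal.ofReal (m - η)⁻¹ * μH[1] (c '' E)) := by
              gcongr; exact h4
          _ = μH[1] (c '' E) := by
              rw [← mul_assoc, ← ENNReal.ofReal_mul (by linarith), mul_inv_cancel₀ (by linarith),
                ENNReal.ofReal_one, one_mul]
      calc ENNReal.ofReal (m + η) * volume E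
          = ENNReal.ofReal (m - η) * volume E + ENNReal.ofReal (2 * η) * volume E := by
            rw [← add_mul, ← ENNReal.ofReal_add (by linarith) (by linarith)]
            congr 2; ring
        _ ≤ _ := by gcongr

/-- By uniform continuity of `c'`, a fine subdivision reduces to `hausdorffMeasure_image_near`; the
errors add up to at most `2 * η * volume E`, and `η` is arbitrary. Half-open pieces keep the images
disjoint. -/
lemma hausdorffMeasure_image_eq (hc : ContDiff ℝ 1 c) (hinj : InjOn c (Ico a b)) {E : Set ℝ}
    (hE : E ⊆ Ico a b) (hEm : MeasurableSet E) :
    μH[1] (c '' E) = ∫⁻ u in E, ‖deriv c u‖ₑ := by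
  rcases le_or_gt b a with hab | hab
  · have : E = ∅ := by
      rw [Ico_eq_empty (not_lt.2 hab)] at hE
      exact subset_empty_iff.1 hE
    simp [this]
  have hcd := hc.continuous_deriv (by simp)
  have hvol : volume E ≤ ENNReal.ofReal (b - a) := by
    simpa using measure_mono (μ := volume) hE
  have key (η : ℝ) (hη : 0 < η) :
      μH[1] (c '' E) ≤ (∫⁻ u in E, ‖deriv c u‖ₑ) + ENNReal.ofReal (2 * η) * volume E ∧
      (∫⁻ u in E, ‖deriv c u‖ₑ) ≤ μH[1] (c '' E) + ENNReal.ofReal (2 * η) * volume E := by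
    obtain ⟨δ, hδ, hδη⟩ := Metric.uniformContinuousOn_iff_le.1
      (isCompact_Icc.uniformContinuousOn_of_continuous (s := Icc a b) hcd.continuousOn) η hη
    obtain ⟨N, hN⟩ := exists_nat_gt ((b - a) / δ)
    have hN0 : (0 : ℝ) < N := lt_of_le_of_lt (by have := sub_pos.2 hab; positivity) hN
    have hNδ : (b - a) / N ≤ δ := by
      rw [div_lt_iff₀ hδ] at hN
      rw [div_le_iff₀ hN0]; linarith
    set x : ℕ → ℝ := fun j => a + j * ((b - a) / N) with hx
    have hxm : Monotone x := fun i j hij => by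
      have : (i : ℝ) ≤ j := by exact_mod_cast hij
      have h0 : 0 ≤ (b - a) / N := div_nonneg (by linarith) hN0.le
      simp only [hx]
      gcongr
    have hx0 : x 0 = a := by simp [hx]
    have hxN : x N = b := by simp only [hx]; field_simp; ring
    set F : ℕ → Set ℝ := fun j => E ∩ Ico (x j) (x (j + 1)) with hF
    have hFm (j : ℕ) : MeasurableSet (F j) := hEm.inter measurableSet_Ico
    have hU : E = ⋃ j ∈ Finset.range N, F j := by
      have h1 : ⋃ j ∈ Finset.range N, Ico (x j) (x (j + 1)) = Ico a b := by
        have := hxm.biUnion_Ico_Ioc_map_succ 0 N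
        have h2 : ∀ M : ℕ, ⋃ j ∈ Finset.range M, Ico (x j) (x (j + 1)) = Ico (x 0) (x M) := by
          intro M
          induction M with
          | zero => simp
          | succ M ih =>
            rw [Finset.range_add_one, Finset.set_biUnion_insert, ih, union_comm,
              Ico_union_Ico_eq_Ico (hxm (Nat.zero_le _)) (hxm (Nat.le_succ _))]
        rw [h2, hx0, hxN]
      simp only [hF]
      rw [← inter_iUnion₂, h1, inter_eq_left.2 hE]
    have hdisj : (↑(Finset.range N) : Set ℕ).PairwiseDisjoint F := by
      intro i _ j _ hij
      refine Disjoint.mono inter_subset_right inter_subset_right ?_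
      rcases lt_or_gt_of_ne hij with h | h
      · exact Set.disjoint_left.2 fun y hy hy' =>
          absurd (hy.2.trans_le (hxm (Nat.succ_le_of_lt h))) (not_lt.2 hy'.1)
      · exact Set.disjoint_left.2 fun y hy hy' =>
          absurd (hy'.2.trans_le (hxm (Nat.succ_le_of_lt h))) (not_lt.2 hy.1)
    have hFE (j : ℕ) : F j ⊆ Ico a b := inter_subset_left.trans hE
    have hsum1 : μH[1] (c '' E) = ∑ j ∈ Finset.range N, μH[1] (c '' F j) := by
      conv_lhs => rw [hU, image_iUnion₂]
      refine measure_biUnion_finset ?_ fun j _ =>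
        (hFm j).image_of_continuousOn_injOn hc.continuous.continuousOn (hinj.mono (hFE j))
      intro i hi j hj hij
      refine Set.disjoint_left.2 ?_
      rintro _ ⟨s, hs, rfl⟩ ⟨t, ht, hst⟩
      exact Set.disjoint_left.1 (hdisj hi hj hij) hs (hinj (hFE j ht) (hFE i hs) hst ▸ ht)
    have hsum2 (f : ℝ → ℝ≥0∞) :
        ∫⁻ u in E, f u = ∑ j ∈ Finset.range N, ∫⁻ u in F j, f u := by
      conv_lhs => rw [hU]
      exact lintegral_biUnion_finset hdisj (fun j _ => hFm j) _
    have hsum3 : ENNReal.ofReal (2 * η) * volume E =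
        ∑ j ∈ Finset.range N, ENNReal.ofReal (2 * η) * volume (F j) := by
      rw [← setLIntegral_const, hsum2]
      simp only [setLIntegral_const]
    have hpc (j : ℕ) (hj : j ∈ Finset.range N) :=
      hausdorffMeasure_image_near (c := c) (p := x j) (q := x (j + 1)) (E := F j) hη.le hc
      (fun t ht => by
        have hxj : x (j + 1) = x j + (b - a) / N := by simp only [hx]; push_cast; ring
        have hjN : x (j + 1) ≤ b := hxN ▸ hxm (Nat.succ_le_of_lt (Finset.mem_range.1 hj))
        have hja : a ≤ x j := hx0 ▸ hxm (Nat.zero_le j)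
        have := hδη t ⟨by linarith [ht.1], by linarith [ht.2]⟩ (x j)
          ⟨hja, by linarith [ht.1, ht.2]⟩ (by
            rw [Real.dist_eq, abs_of_nonneg (by linarith [ht.1])]; linarith [ht.2])
        rwa [dist_eq_norm] at this)
      (inter_subset_right.trans Ico_subset_Icc_self) (hFm j)
    rw [hsum1, hsum2, hsum3, ← Finset.sum_add_distrib, ← Finset.sum_add_distrib]
    exact ⟨Finset.sum_le_sum fun j hj => (hpc j hj).1, Finset.sum_le_sum fun j hj => (hpc j hj).2⟩
  have hlim (X Y : ℝ≥0∞) (h : ∀ η > 0, X ≤ Y + ENNReal.ofReal (2 * η) * volume E) : X ≤ Y := by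
    refine ENNReal.le_of_forall_pos_le_add fun ε hε _ => ?_
    have hba : 0 < b - a := sub_pos.2 hab
    refine (h (ε / (2 * (b - a))) (by positivity)).trans ?_
    gcongr
    calc _ ≤ ENNReal.ofReal (2 * (ε / (2 * (b - a)))) * ENNReal.ofReal (b - a) := by gcongr
      _ = ε := by
        rw [← ENNReal.ofReal_mul (by positivity),
          show 2 * ((ε : ℝ) / (2 * (b - a))) * (b - a) = ε by field_simp]
        exact ENNReal.ofReal_coe_nnreal
  exact le_antisymm (hlim _ _ fun η hη => (key η hη).1) (hlim _ _ fun η hη => (key η hη).2)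

lemma map_curve_eq (hc : ContDiff ℝ 1 c) (hinj : InjOn c (Ico a b)) :
    Measure.map c ((volume.restrict (Ico a b)).withDensity fun u => ‖deriv c u‖ₑ) =
      μH[1].restrict (c '' Ico a b) := by
  have hcm := hc.continuous.measurable
  ext B hB
  rw [Measure.map_apply hcm hB, withDensity_apply _ (hcm hB), Measure.restrict_apply hB,
    Measure.restrict_restrict (hcm hB), inter_comm B, ← image_inter_preimage,
    hausdorffMeasure_image_eq hc hinj inter_subset_left (measurableSet_Ico.inter (hcm hB)),
    inter_comm]

/-- The restriction of `c` to the interval as a subtype is a measurable embedding. This allows the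
area formula for arbitrary integrands, without any measurability assumption. -/
lemma map_curve_domRestrict_eq (hc : ContDiff ℝ 1 c) (hinj : InjOn c (Ico a b)) :
    Measure.map ((Ico a b).domRestrict c)
      (Measure.comap (↑) (volume.withDensity fun u => ‖deriv c u‖ₑ)) =
      μH[1].restrict (c '' Ico a b) := by
  rw [← map_curve_eq hc hinj, domRestrict_eq,
    ← Measure.map_map hc.continuous.measurable measurable_subtype_coe,
    map_comap_subtype_coe measurableSet_Ico, restrict_withDensity measurableSet_Ico]

variable {F : Type*} [NormedAddCommGroup F] [NormedSpace ℝ F]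

lemma measurable_nnnorm_deriv (hc : ContDiff ℝ 1 c) : Measurable fun u => ‖deriv c u‖₊ :=
  (hc.continuous_deriv (by simp)).nnnorm.measurable

/-- The area formula for injective `C¹` curves. -/
theorem integral_curve (hc : ContDiff ℝ 1 c) (hinj : InjOn c (Ico a b)) (f : Plane → F) :
    ∫ x in c '' Ico a b, f x ∂μH[1] = ∫ u in Ico a b, ‖deriv c u‖ • f (c u) := by
  have hemb := hc.continuous.continuousOn.measurableEmbedding (measurableSet_Ico (a := a) (b := b)) hinj
  rw [← map_curve_domRestrict_eq hc hinj, hemb.integral_map]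
  simp only [Set.domRestrict_apply]
  rw [← (MeasurableEmbedding.subtype_coe measurableSet_Ico).integral_map
    (g := fun u => f (c u)), map_comap_subtype_coe measurableSet_Ico]
  have := setIntegral_withDensity_eq_setIntegral_smul (μ := volume) (measurable_nnnorm_deriv hc)
    (fun u => f (c u)) (measurableSet_Ico (a := a) (b := b))
  exact this

theorem integrableOn_curve (hc : ContDiff ℝ 1 c) (hinj : InjOn c (Ico a b)) (f : Plane → F) :
    IntegrableOn f (c '' Ico a b) μH[1] ↔
      IntegrableOn (fun u => ‖deriv c u‖ • f (c u)) (Ico a b) := by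
  have hemb := hc.continuous.continuousOn.measurableEmbedding (measurableSet_Ico (a := a) (b := b)) hinj
  rw [IntegrableOn, ← map_curve_domRestrict_eq hc hinj, hemb.integrable_map_iff]
  simp only [Set.domRestrict_eq, ← Function.comp_assoc]
  rw [← (MeasurableEmbedding.subtype_coe measurableSet_Ico).integrable_map_iff,
    map_comap_subtype_coe measurableSet_Ico, restrict_withDensity measurableSet_Ico]
  exact integrable_withDensity_iff_integrable_smul (measurable_nnnorm_deriv hc)

end AreaFormula

end CircMCF

namespace CircMCF

variable {Ω : Set Plane} {γ n : ℝ → Plane} {k : ℝ → ℝ} {L R : ℝ}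

/-! ### Change of variables in the tubular neighborhood -/

/-- Cartesian coordinates. -/
def cartesian (x : Plane) : ℝ × ℝ := (x 0, x 1)

lemma measurePreserving_cartesian : MeasurePreserving cartesian :=
  (volume_preserving_finTwoArrow ℝ).comp (PiLp.volume_preserving_ofLp (Fin 2))

lemma measurableEmbedding_cartesian : MeasurableEmbedding cartesian :=
  (MeasurableEquiv.finTwoArrow (α := ℝ)).measurableEmbedding.comp
    (MeasurableEquiv.toLp 2 (Fin 2 → ℝ)).symm.measurableEmbedding

lemma isOpen_abs_sdist_lt (Ω : Set Plane) (R : ℝ) : IsOpen {x | |sdist Ω x| < R} :=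
  isOpen_lt continuous_sdist.abs continuous_const

namespace Tube

variable (T : Tube Ω R γ n k L)
include T

/-- The derivative of the tubular coordinates, in Cartesian coordinates. -/
lemma hasFDerivAt_cartesian_coord (p : ℝ × ℝ) :
    ∃ f' : ℝ × ℝ →L[ℝ] ℝ × ℝ,
      HasFDerivAt (fun p : ℝ × ℝ => cartesian (γ p.1 + p.2 • n p.1)) f' p ∧
      |f'.det| = |1 - k p.1 * p.2| := by
  obtain ⟨u, l⟩ := p
  have h := T.hasFDerivAt_coord u l
  let M : Matrix (Fin 2) (Fin 2) ℝ := !![(1 - k u * l) * deriv γ u 0, n u 0;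
    (1 - k u * l) * deriv γ u 1, n u 1]
  refine ⟨(Matrix.toLin (.finTwoProd ℝ) (.finTwoProd ℝ) M).toContinuousLinearMap, ?_, ?_⟩
  · have h0 := (EuclideanSpace.proj (𝕜 := ℝ) (0 : Fin 2)).hasFDerivAt.comp (u, l) h
    have h1 := (EuclideanSpace.proj (𝕜 := ℝ) (1 : Fin 2)).hasFDerivAt.comp (u, l) h
    refine (h0.prodMk h1).congr_fderiv ?_
    rw [Matrix.toLin_finTwoProd_toContinuousLinearMap]
    ext <;> simp
  · rw [ContinuousLinearMap.det, LinearMap.coe_toContinuousLinearMap, LinearMap.det_toLin,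
      Matrix.det_fin_two_of]
    have h1 := norm_sq_plane (deriv γ u)
    have h2 := norm_sq_plane (n u)
    have h3 := T.orth u
    rw [inner_plane] at h3
    rw [T.norm_tangent] at h1
    rw [T.norm_normal] at h2
    rw [show (1 - k u * l) * deriv γ u 0 * n u 1 - n u 0 * ((1 - k u * l) * deriv γ u 1) =
      (1 - k u * l) * (deriv γ u 0 * n u 1 - n u 0 * deriv γ u 1) by ring, abs_mul]
    -- Lagrange's identity: the squared determinant of two vectors is the product of their squared
    -- norms minus their squared inner product.
    have : |deriv γ u 0 * n u 1 - n u 0 * deriv γ u 1| = 1 := by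
      rw [← abs_one, ← sq_eq_sq_iff_abs_eq_abs]
      nlinarith
    rw [this, mul_one]

lemma injOn_cartesian_coord : InjOn (fun p : ℝ × ℝ => cartesian (γ p.1 + p.2 • n p.1))
    (Ico 0 L ×ˢ Ioo (-R) R) :=
  fun _ hp _ hq h => T.inj hp hq (measurableEmbedding_cartesian.injective h)

lemma image_coord : (fun p : ℝ × ℝ => γ p.1 + p.2 • n p.1) '' (Ico 0 L ×ˢ Ioo (-R) R) =
    {x | |sdist Ω x| < R} := by
  ext x
  constructor
  · rintro ⟨p, ⟨-, hp⟩, rfl⟩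
    change |sdist Ω (γ p.1 + p.2 • n p.1)| < R
    rw [T.sdist_eq _ _ hp]
    exact abs_lt.2 hp
  · intro hx
    obtain ⟨u, hu, h⟩ := T.surj x hx
    exact ⟨(u, sdist Ω x), ⟨hu, abs_lt.1 hx⟩, h.symm⟩

variable (hpos : ∀ u, ∀ l ∈ Ioo (-R) R, 0 < 1 - k u * l)
include hpos

section

variable {E : Type*} [NormedAddCommGroup E] [NormedSpace ℝ E]

theorem integral_tube (F : Plane → E) :
    ∫ x in {x | |sdist Ω x| < R}, F x =
      ∫ p in Ico 0 L ×ˢ Ioo (-R) R, (1 - k p.1 * p.2) • F (γ p.1 + p.2 • n p.1) := by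
  choose f' hf' hdet using T.hasFDerivAt_cartesian_coord
  -- The change of variables needs source and target to be the same space, so `F` is first written
  -- in Cartesian coordinates.
  obtain ⟨G, hG⟩ : ∃ G : ℝ × ℝ → E, ∀ x, F x = G (cartesian x) :=
    ⟨fun y => F (Function.invFun cartesian y), fun x => by
      simp only [Function.leftInverse_invFun measurableEmbedding_cartesian.injective x]⟩
  have hms : MeasurableSet (Ico 0 L ×ˢ Ioo (-R) R) := measurableSet_Ico.prod measurableSet_Ioo
  simp only [hG]
  rw [← T.image_coord, ← measurePreserving_cartesian.setIntegral_image_emb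
    measurableEmbedding_cartesian, image_image,
    integral_image_eq_integral_abs_det_fderiv_smul volume hms
      (fun p _ => (hf' p).hasFDerivWithinAt) T.injOn_cartesian_coord]
  refine setIntegral_congr_fun hms fun p hp => ?_
  simp only [hdet, abs_of_pos (hpos p.1 p.2 hp.2)]

end

/-- The integral of the Jacobian over the preimage is the area of its image, which is null; as the
Jacobian is strictly positive on the tube, the preimage is null. Almost everywhere statements on the
plane can therefore be read in coordinates. -/
lemma volume_preimage_coord {N : Set Plane} (hN : volume N = 0) :
    volume ((fun p : ℝ × ℝ => γ p.1 + p.2 • n p.1) ⁻¹' N ∩ Ico 0 L ×ˢ Ioo (-R) R) = 0 := by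
  choose f' hf' hdet using T.hasFDerivAt_cartesian_coord
  have hc : Measurable (fun p : ℝ × ℝ => γ p.1 + p.2 • n p.1) := by
    have := T.param.smooth.continuous
    have := T.normal_smooth.continuous
    exact Continuous.measurable (by fun_prop)
  set N' := toMeasurable volume N
  set D := (fun p : ℝ × ℝ => γ p.1 + p.2 • n p.1) ⁻¹' N' ∩ Ico 0 L ×ˢ Ioo (-R) R with hD
  have hms : MeasurableSet D := (hc (measurableSet_toMeasurable _ _)).inter
    (measurableSet_Ico.prod measurableSet_Ioo)
  refine measure_mono_null (inter_subset_inter_left _ (preimage_mono (subset_toMeasurable volume N))) ?_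
  change volume D = 0
  have h1 : volume ((fun p : ℝ × ℝ => cartesian (γ p.1 + p.2 • n p.1)) '' D) = 0 := by
    rw [← image_image cartesian, ← measurePreserving_cartesian.measure_preimage_emb
      measurableEmbedding_cartesian, preimage_image_eq _ measurableEmbedding_cartesian.injective]
    refine measure_mono_null ?_ ((measure_toMeasurable N).trans hN)
    rintro _ ⟨p, hp, rfl⟩
    exact hp.1
  have h2 := lintegral_image_eq_lintegral_abs_det_fderiv_mul volume hms
    (fun p _ => (hf' p).hasFDerivWithinAt) (T.injOn_cartesian_coord.mono inter_subset_right)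
    (fun _ => 1)
  simp only [lintegral_const, Measure.restrict_apply_univ, h1, mul_zero, mul_one] at h2
  have hm : Measurable fun p : ℝ × ℝ => ENNReal.ofReal |1 - k p.1 * p.2| := by
    have := T.curv_smooth.continuous
    exact ENNReal.measurable_ofReal.comp (Continuous.measurable (by fun_prop))
  simp only [hdet] at h2
  by_contra h0
  refine ((setLIntegral_pos_iff hm).2 ?_).ne h2
  refine (pos_iff_ne_zero.2 h0).trans_le (measure_mono fun p hp => ⟨?_, hp⟩)
  have := hpos p.1 p.2 hp.2.2
  simpa using this.ne'

lemma ae_coord {P : Plane → Prop} (hP : ∀ᵐ x, P x) :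
    ∀ᵐ u ∂(volume.restrict (Ico 0 L)), ∀ᵐ l ∂(volume.restrict (Ioo (-R) R)),
      P (γ u + l • n u) := by
  have h := T.volume_preimage_coord hpos (N := {x | ¬ P x}) hP
  have h2 : ∀ᵐ p ∂((volume.restrict (Ico 0 L)).prod (volume.restrict (Ioo (-R) R))),
      P (γ p.1 + p.2 • n p.1) := by
    rw [Measure.prod_restrict, ae_iff]
    rw [Measure.restrict_apply' (measurableSet_Ico.prod measurableSet_Ioo)]
    exact h
  exact Measure.ae_ae_of_ae_prod h2

end Tube

end CircMCF

namespace CircMCF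

/-! ### Integration by parts -/

lemma divg_eq_sum (φ : Plane → Plane) (x : Plane) :
    divg φ x = ∑ i, (fderiv ℝ φ x (EuclideanSpace.single i 1)) i := by
  have h (i j : Fin 2) : ⟪(EuclideanSpace.single i 1 : Plane), EuclideanSpace.single j 1⟫_ℝ =
      if i = j then 1 else 0 := by
    simp [EuclideanSpace.inner_single_left]
  rw [divg, trace_plane (τ := EuclideanSpace.single 0 1) (n := EuclideanSpace.single 1 1)
    (by simp) (by simp) (by rw [h]; simp), Fin.sum_univ_two]
  simp [EuclideanSpace.inner_single_left]

lemma fderiv_coord {φ : Plane → Plane} {x : Plane} (hφ : DifferentiableAt ℝ φ x) (i : Fin 2)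
    (v : Plane) : fderiv ℝ (fun y => φ y i) x v = fderiv ℝ φ x v i := by
  have := ((EuclideanSpace.proj (𝕜 := ℝ) i).hasFDerivAt (x := φ x)).comp x hφ.hasFDerivAt
  rw [show (fun y => φ y i) = (EuclideanSpace.proj (𝕜 := ℝ) i) ∘ φ from rfl, this.fderiv]
  rfl

lemma continuous_divg {φ : Plane → Plane} (hφ : ContDiff ℝ 1 φ) : Continuous (divg φ) := by
  have h := hφ.continuous_fderiv (by simp)
  rw [show divg φ = fun x => ∑ i, (fderiv ℝ φ x (EuclideanSpace.single i 1)) i from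
    funext (divg_eq_sum φ)]
  fun_prop

lemma hasCompactSupport_divg {φ : Plane → Plane} (hφ : HasCompactSupport φ) :
    HasCompactSupport (divg φ) := by
  refine hφ.fderiv (𝕜 := ℝ) |>.mono fun x hx h0 => hx ?_
  simp [divg, h0]

/-- Integration by parts against a compactly supported vector field. -/
lemma integral_mul_divg {w : Plane → ℝ} (hw : ContDiff ℝ 1 w) {φ : Plane → Plane}
    (hφ : ContDiff ℝ 1 φ) (hc : HasCompactSupport φ) :
    ∫ x, w x * divg φ x = -∫ x, fderiv ℝ w x (φ x) := by
  have hwf := hw.continuous_fderiv (by simp)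
  have hφf := hφ.continuous_fderiv (by simp)
  have hwc := hw.continuous
  have hφc := hφ.continuous
  have hφi (i : Fin 2) : Continuous fun x => φ x i := by fun_prop
  have hci (i : Fin 2) : HasCompactSupport fun x => φ x i :=
    hc.comp_left (g := fun v : Plane => v i) rfl
  have hdi (i : Fin 2) : ContDiff ℝ 1 fun x => φ x i :=
    (EuclideanSpace.proj (𝕜 := ℝ) i).contDiff.comp hφ
  have hdfi (i : Fin 2) := (hdi i).continuous_fderiv (by simp)
  have h1 (i : Fin 2) : Integrable fun x => w x * fderiv ℝ (fun y => φ y i) x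
      (EuclideanSpace.single i 1) :=
    (by fun_prop : Continuous _).integrable_of_hasCompactSupport
      ((((hci i).fderiv (𝕜 := ℝ)).comp_left
        (g := fun f : Plane →L[ℝ] ℝ => f (EuclideanSpace.single i 1)) rfl).mul_left)
  have h2 (i : Fin 2) : Integrable fun x => fderiv ℝ w x (EuclideanSpace.single i 1) * φ x i :=
    (by fun_prop : Continuous _).integrable_of_hasCompactSupport ((hci i).mul_left)
  have h3 (i : Fin 2) : Integrable fun x => w x * φ x i :=
    (by fun_prop : Continuous _).integrable_of_hasCompactSupport ((hci i).mul_left)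
  have e1 (x : Plane) : w x * divg φ x = ∑ i, w x * fderiv ℝ (fun y => φ y i) x
      (EuclideanSpace.single i 1) := by
    rw [divg_eq_sum, Finset.mul_sum]
    simp only [fderiv_coord (hφ.differentiable (by simp) x)]
  have e2 (x : Plane) : fderiv ℝ w x (φ x) =
      ∑ i, fderiv ℝ w x (EuclideanSpace.single i 1) * φ x i := by
    have : φ x = ∑ i, φ x i • (EuclideanSpace.single i 1 : Plane) := by
      ext j; fin_cases j <;> simp [Fin.sum_univ_two]
    conv_lhs => rw [this]
    simp [mul_comm]
  simp only [e1, e2]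
  rw [integral_finsetSum _ fun i _ => h1 i, integral_finsetSum _ fun i _ => h2 i,
    ← Finset.sum_neg_distrib]
  refine Finset.sum_congr rfl fun i _ => ?_
  exact integral_mul_fderiv_eq_neg_fderiv_mul_of_integrable (h2 i) (h1 i) (h3 i)
    (fun x _ => hw.differentiable (by simp) x) (fun x _ => (hdi i).differentiable (by simp) x)

lemma integral_divg {φ : Plane → Plane} (hφ : ContDiff ℝ 1 φ) (hc : HasCompactSupport φ) :
    ∫ x, divg φ x = 0 := by
  have := integral_mul_divg (w := fun _ => 1) contDiff_const hφ hc
  simpa using this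

/-! ### Uniqueness of the polar decomposition of the gradient -/

/-- Write both vector measures with densities relative to `m + m'`. Testing identifies the vector
densities almost everywhere; their norms are the scalar densities because the directions are unit
vectors, and the directions then agree where the density is nonzero. -/
lemma polar_decomposition_unique {m m' : Measure Plane} [IsFiniteMeasure m] [IsFiniteMeasure m']
    {ν ν' : Plane → Plane} (hν : Measurable ν) (hν' : Measurable ν') (h1 : ∀ᵐ x ∂m, ‖ν x‖ = 1)
    (h1' : ∀ᵐ x ∂m', ‖ν' x‖ = 1)
    (h : ∀ φ : Plane → Plane, ContDiff ℝ 1 φ → HasCompactSupport φ →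
      ∫ x, ⟪φ x, ν x⟫_ℝ ∂m = ∫ x, ⟪φ x, ν' x⟫_ℝ ∂m') :
    m = m' ∧ ν =ᵐ[m] ν' := by
  set σ := m + m' with hσ
  have : IsFiniteMeasure σ := by rw [hσ]; infer_instance
  have hm : m ≪ σ := Measure.absolutelyContinuous_of_le (Measure.le_add_right le_rfl)
  have hm' : m' ≪ σ := Measure.absolutelyContinuous_of_le (Measure.le_add_left le_rfl)
  have i1 := Measure.haveLebesgueDecomposition_of_sigmaFinite m σ
  have i2 := Measure.haveLebesgueDecomposition_of_sigmaFinite m' σ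
  have key {m : Measure Plane} [IsFiniteMeasure m] {ν : Plane → Plane} (hm : m ≪ σ)
      (hν : Measurable ν) (h1 : ∀ᵐ x ∂m, ‖ν x‖ = 1) :
      (∀ᵐ x ∂σ, ‖(m.rnDeriv σ x).toReal • ν x‖ = (m.rnDeriv σ x).toReal) ∧
      Integrable (fun x => (m.rnDeriv σ x).toReal • ν x) σ ∧
      ∀ (g : Plane → ℝ) (e : Plane),
        ∫ x, ⟪g x • e, ν x⟫_ℝ ∂m = ∫ x, ⟪e, g x • (m.rnDeriv σ x).toReal • ν x⟫_ℝ ∂σ := by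
    have := Measure.haveLebesgueDecomposition_of_sigmaFinite m σ
    have a1 : ∀ᵐ x ∂σ, ‖(m.rnDeriv σ x).toReal • ν x‖ = (m.rnDeriv σ x).toReal := by
      rw [← Measure.withDensity_rnDeriv_eq m σ hm,
        ae_withDensity_iff (Measure.measurable_rnDeriv m σ)] at h1
      filter_upwards [h1] with x hx
      rw [norm_smul, Real.norm_eq_abs, abs_of_nonneg ENNReal.toReal_nonneg]
      by_cases h0 : m.rnDeriv σ x = 0
      · simp [h0]
      · rw [hx h0, mul_one]
    refine ⟨a1, ?_, fun g e => ?_⟩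
    · refine Integrable.mono' (Measure.integrable_toReal_rnDeriv (μ := m) (ν := σ)) ?_
        (a1.mono fun x hx => hx.le)
      exact ((Measure.measurable_rnDeriv m σ).ennreal_toReal.smul hν).aestronglyMeasurable
    · rw [← integral_rnDeriv_smul hm]
      refine integral_congr_ae (Eventually.of_forall fun x => ?_)
      simp only [inner_smul_left, inner_smul_right, smul_eq_mul, RCLike.conj_to_real]
      ring
  obtain ⟨a1, a2, a3⟩ := key hm hν h1
  obtain ⟨b1, b2, b3⟩ := key hm' hν' h1'
  have hae := ae_eq_of_integral_contDiff_smul_eq a2.locallyIntegrable b2.locallyIntegrable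
    (fun g hg hgc => by
      have gi {w : Plane → Plane} (hw : Integrable w σ) : Integrable (fun x => g x • w x) σ := by
        obtain ⟨C, hC⟩ := hgc.exists_bound_of_continuous hg.continuous
        exact hw.bdd_smul C hg.continuous.aestronglyMeasurable (Eventually.of_forall hC)
      refine ext_inner_left ℝ fun e => ?_
      rw [← integral_inner (gi a2), ← integral_inner (gi b2), ← a3, ← b3]
      exact h _ ((hg.of_le (by simp)).smul contDiff_const) (hgc.smul_right))
  have hrn : m.rnDeriv σ =ᵐ[σ] m'.rnDeriv σ := by
    filter_upwards [a1, b1, hae, Measure.rnDeriv_lt_top m σ, Measure.rnDeriv_lt_top m' σ]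
      with x h1 h2 h3 h4 h5
    rw [h3, h2] at h1
    exact ((ENNReal.toReal_eq_toReal_iff' h4.ne h5.ne).1 h1.symm)
  constructor
  · rw [← Measure.withDensity_rnDeriv_eq m σ hm, ← Measure.withDensity_rnDeriv_eq m' σ hm']
    exact withDensity_congr_ae hrn
  · have h0 := hm.ae_le (hae.and hrn)
    filter_upwards [h0, Measure.rnDeriv_pos hm, hm.ae_le (Measure.rnDeriv_lt_top m σ)]
      with x hx hp hl
    have : (m.rnDeriv σ x).toReal ≠ 0 := (ENNReal.toReal_pos hp.ne' hl.ne).ne'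
    have h2 := hx.1
    rw [← hx.2] at h2
    exact smul_right_injective _ this h2

/-! ### The perimeter measure, the reduced boundary and the measure theoretic normal -/

section Perimeter

variable {f g : Plane → ℝ} {m m' : Measure Plane} {ν ν' : Plane → Plane}

/-- `perim` and `polar` come from a choice. Uniqueness allows them to be computed from any explicit
representing pair. -/
lemma IsPolarGradient.unique (h : IsPolarGradient f m ν) (h' : IsPolarGradient f m' ν') :
    m = m' ∧ ν =ᵐ[m] ν' := by
  have := h.finite
  have := h'.finite
  refine polar_decomposition_unique h.measurable h'.measurable h.unit h'.unit fun φ hφ hc => ?_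
  rw [← neg_inj, ← h.gauss_green φ hφ hc, h'.gauss_green φ hφ hc]

lemma IsPolarGradient.congr (h : IsPolarGradient f m ν) (hfg : f =ᵐ[volume] g) :
    IsPolarGradient g m ν where
  finite := h.finite
  measurable := h.measurable
  unit := h.unit
  gauss_green φ hφ hc := by
    rw [← h.gauss_green φ hφ hc]
    exact integral_congr_ae (by filter_upwards [hfg] with x hx; rw [hx])

lemma HasFinitePerimeter.isPolarGradient (h : HasFinitePerimeter f) :
    IsPolarGradient f (perim f) (polar f) := by
  rw [perim, polar, dif_pos h, dif_pos h]
  exact h.choose_spec.choose_spec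

lemma IsPolarGradient.perim_eq (h : IsPolarGradient f m ν) : perim f = m :=
  ((HasFinitePerimeter.isPolarGradient ⟨m, ν, h⟩).unique h).1

lemma IsPolarGradient.polar_ae_eq (h : IsPolarGradient f m ν) : polar f =ᵐ[m] ν := by
  have := ((HasFinitePerimeter.isPolarGradient ⟨m, ν, h⟩).unique h).2
  rwa [h.perim_eq] at this

lemma IsPolarGradient.average_eq (h : IsPolarGradient f m ν) (x : Plane) (r : ℝ) :
    ⨍ y in Metric.ball x r, polar f y ∂(perim f) = ⨍ y in Metric.ball x r, ν y ∂m := by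
  rw [h.perim_eq]
  exact average_congr (ae_restrict_of_ae h.polar_ae_eq)

lemma IsPolarGradient.mem_redBdry_iff (h : IsPolarGradient f m ν) {x : Plane} :
    x ∈ redBdry f ↔ (∀ r > 0, 0 < m (Metric.ball x r)) ∧ ∃ v : Plane, ‖v‖ = 1 ∧
      Tendsto (fun r : ℝ => ⨍ y in Metric.ball x r, ν y ∂m) (𝓝[>] 0) (𝓝 v) := by
  simp only [redBdry, mem_ofPred_eq, h.average_eq]
  simp only [h.perim_eq]

lemma tendsto_measNormal {x : Plane} (hx : x ∈ redBdry f) :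
    Tendsto (fun r : ℝ => ⨍ y in Metric.ball x r, polar f y ∂(perim f)) (𝓝[>] 0)
      (𝓝 (measNormal f x)) := by
  obtain ⟨-, v, -, hv⟩ := hx
  rwa [measNormal, hv.limUnder_eq]

lemma IsPolarGradient.measNormal_eq (h : IsPolarGradient f m ν) {x v : Plane}
    (hv : Tendsto (fun r : ℝ => ⨍ y in Metric.ball x r, ν y ∂m) (𝓝[>] 0) (𝓝 v)) :
    measNormal f x = v := by
  simp only [measNormal, h.average_eq]
  exact hv.limUnder_eq

lemma isPolarGradient_zero : IsPolarGradient 0 0 0 where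
  finite := inferInstance
  measurable := measurable_const
  unit := by simp
  gauss_green := by simp

lemma redBdry_eq_empty (hf : f =ᵐ[volume] 0) : redBdry f = ∅ := by
  have h := isPolarGradient_zero.congr hf.symm
  refine eq_empty_of_forall_notMem fun x hx => ?_
  have := (h.mem_redBdry_iff.1 hx).1 1 one_pos
  simp at this

/-- The gradient of the complementary phase. -/
lemma IsPolarGradient.one_sub (h : IsPolarGradient f m ν) (hf : Measurable f)
    (hb : ∀ x, f x = 0 ∨ f x = 1) : IsPolarGradient (fun x => 1 - f x) m (-ν) where
  finite := h.finite
  measurable := h.measurable.neg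
  unit := by simpa using h.unit
  gauss_green φ hφ hc := by
    have hi : Integrable (divg φ) :=
      (continuous_divg hφ).integrable_of_hasCompactSupport (hasCompactSupport_divg hc)
    have hfi : Integrable fun x => f x * divg φ x :=
      hi.bdd_mul hf.aestronglyMeasurable (c := 1) (Eventually.of_forall fun x => by
        rcases hb x with h | h <;> simp [h])
    simp only [sub_mul, one_mul, Pi.neg_apply, inner_neg_right]
    rw [integral_sub hi hfi, integral_divg hφ hc, h.gauss_green φ hφ hc, integral_neg]
    simp

/-- The complementary phase has the same reduced boundary, and the opposite normal. -/
lemma redBdry_one_sub (hf : Measurable f) (hb : ∀ x, f x = 0 ∨ f x = 1)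
    (h : HasFinitePerimeter f) (hg : (fun x => 1 - f x) =ᵐ[volume] g) :
    redBdry g = redBdry f ∧ (∀ x ∈ redBdry f, measNormal g x = -measNormal f x) ∧
      perim g = perim f := by
  have h1 := h.isPolarGradient
  have h2 := (h1.one_sub hf hb).congr hg
  have e (x : Plane) (r : ℝ) : ⨍ y in Metric.ball x r, (-polar f) y ∂(perim f) =
      -⨍ y in Metric.ball x r, polar f y ∂(perim f) := by
    simp only [setAverage_eq, Pi.neg_apply, integral_neg, smul_neg]
  refine ⟨?_, fun x hx => h2.measNormal_eq ?_, h2.perim_eq⟩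
  · ext x
    rw [h1.mem_redBdry_iff, h2.mem_redBdry_iff]
    refine and_congr_right fun _ => ?_
    simp only [e]
    constructor
    · rintro ⟨v, hv, ht⟩; exact ⟨-v, by simpa using hv, by simpa using ht.neg⟩
    · rintro ⟨v, hv, ht⟩; exact ⟨-v, by simpa using hv, ht.neg⟩
  · simp only [e]
    exact (tendsto_measNormal hx).neg

/-- Averages over open balls converge if those over closed balls do. -/
lemma tendsto_average_ball [IsFiniteMeasure m] (hν : Integrable ν m) {x v : Plane}
    (hpos : ∀ r > 0, m (Metric.ball x r) ≠ 0)
    (h : Tendsto (fun r : ℝ => ⨍ y in Metric.closedBall x r, ν y ∂m) (𝓝[>] 0) (𝓝 v)) :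
    Tendsto (fun r : ℝ => ⨍ y in Metric.ball x r, ν y ∂m) (𝓝[>] 0) (𝓝 v) := by
  refine Metric.nhds_basis_closedBall.tendsto_right_iff.2 fun ε hε => ?_
  have h1 := Metric.nhds_basis_closedBall.tendsto_right_iff.1 h ε hε
  obtain ⟨δ, hδ, hsub⟩ := (mem_nhdsGT_iff_exists_Ioo_subset).1 h1
  filter_upwards [Ioo_mem_nhdsGT (hδ : (0 : ℝ) < δ)] with r hr
  -- Positive radii increasing to `r`, so that the closed balls exhaust the open one; the `2` keeps
  -- the radius positive at `j = 0`.
  let ρ : ℕ → ℝ := fun j => r - r / (j + 2)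
  have hρr (j : ℕ) : ρ j ∈ Ioo 0 r := by
    have : (0 : ℝ) < j + 2 := by positivity
    constructor
    · change 0 < r - r / (j + 2)
      rw [sub_pos, div_lt_iff₀ this]; nlinarith [hr.1, (Nat.cast_nonneg j : (0 : ℝ) ≤ j)]
    · change r - r / (j + 2) < r
      have := div_pos hr.1 this; linarith
  have hmono : Monotone fun j => Metric.closedBall x (ρ j) := by
    intro i j hij
    refine Metric.closedBall_subset_closedBall ?_
    have : (i : ℝ) ≤ j := by exact_mod_cast hij
    have h0 := hr.1.le
    change r - r / (i + 2) ≤ r - r / (j + 2)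
    gcongr
  have hρ : Tendsto ρ atTop (𝓝 r) := by
    have : Tendsto (fun j : ℕ => r / ((j : ℝ) + 2)) atTop (𝓝 0) :=
      Tendsto.div_atTop tendsto_const_nhds
        (tendsto_atTop_add_const_right _ _ tendsto_natCast_atTop_atTop)
    simpa using tendsto_const_nhds (x := r).sub this
  have hU : ⋃ j, Metric.closedBall x (ρ j) = Metric.ball x r := by
    ext y
    simp only [mem_iUnion, Metric.mem_closedBall, Metric.mem_ball]
    constructor
    · rintro ⟨j, hj⟩; exact hj.trans_lt (hρr j).2
    · intro hy
      obtain ⟨j, hj⟩ := (hρ.eventually (lt_mem_nhds hy)).exists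
      exact ⟨j, le_of_lt hj⟩
  have l1 := tendsto_setIntegral_of_monotone (f := ν) (μ := m)
    (fun j => Metric.isClosed_closedBall.measurableSet) hmono hν.integrableOn
  have l2 := tendsto_measure_iUnion_atTop (μ := m) hmono
  rw [hU] at l1 l2
  have l3 := (ENNReal.tendsto_toReal (measure_ne_top m _)).comp l2
  have hne : (m (Metric.ball x r)).toReal ≠ 0 :=
    (ENNReal.toReal_pos (hpos r hr.1) (measure_ne_top _ _)).ne'
  have l4 := (l3.inv₀ hne).smul l1
  refine Metric.isClosed_closedBall.mem_of_tendsto (b := atTop)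
    (f := fun j => ⨍ y in Metric.closedBall x (ρ j), ν y ∂m) ?_ (Eventually.of_forall fun j =>
      hsub ⟨(hρr j).1, (hρr j).2.trans hr.2⟩)
  simp only [setAverage_eq]
  exact l4

/-- The perimeter measure is concentrated on the reduced boundary. -/
lemma HasFinitePerimeter.ae_mem_redBdry (h : HasFinitePerimeter f) :
    ∀ᵐ x ∂(perim f), x ∈ redBdry f := by
  have h1 := h.isPolarGradient
  have := h1.finite
  have hi : Integrable (polar f) (perim f) :=
    Integrable.of_bound h1.measurable.aestronglyMeasurable 1 (h1.unit.mono fun x hx => hx.le)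
  -- Lebesgue differentiation for a general finite measure is available along closed balls, whereas
  -- `redBdry` uses open balls; `tendsto_average_ball` bridges the two.
  let v := Besicovitch.vitaliFamily (perim f)
  filter_upwards [h1.unit, v.ae_tendsto_average hi.locallyIntegrable,
    v.ae_eventually_measure_pos] with x hx1 hx2 hx3
  have hpos : ∀ r > 0, 0 < perim f (Metric.ball x r) := by
    intro r hr
    have h4 := (Besicovitch.tendsto_filterAt (perim f) x).eventually hx3
    obtain ⟨s, hs, hs'⟩ := (h4.and (Ioo_mem_nhdsGT hr)).exists
    exact hs.trans_le (measure_mono (Metric.closedBall_subset_ball hs'.2))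
  exact ⟨hpos, polar f x, hx1, tendsto_average_ball hi (fun r hr => (hpos r hr).ne')
    (hx2.comp (Besicovitch.tendsto_filterAt (perim f) x))⟩

end Perimeter

end CircMCF

namespace CircMCF

/-! ### Functions with vanishing gradient -/

/-- A function whose gradient vanishes on a ball is almost everywhere constant on a smaller ball. -/
lemma IsPolarGradient.ae_const_on_ball {f : Plane → ℝ} {m : Measure Plane} {ν : Plane → Plane}
    (h : IsPolarGradient f m ν) (hf : Measurable f) (hb : ∀ x, f x = 0 ∨ f x = 1) {x₀ : Plane}
    {ρ : ℝ} (hρ : 0 < ρ) (hm : m (Metric.ball x₀ ρ) = 0) :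
    ∃ y₀, ∀ᵐ y ∂(volume.restrict (Metric.ball x₀ (ρ / 2))), f y = f y₀ := by
  have hfl : LocallyIntegrable f := by
    refine (locallyIntegrable_const (1 : ℝ)).mono hf.aestronglyMeasurable ?_
    exact Eventually.of_forall fun x => by rcases hb x with h | h <;> simp [h]
  have hjp (j : ℕ) : (0 : ℝ) < ρ / (2 * (j + 1)) := by positivity
  -- Mollifiers of radius at most `ρ / 2`: at points of the half ball the mollification sees `f`
  -- only inside the ball where the gradient vanishes.
  let φ : ℕ → ContDiffBump (0 : Plane) := fun j =>
    ⟨ρ / (2 * (j + 1)) / 2, ρ / (2 * (j + 1)), half_pos (hjp j), half_lt_self (hjp j)⟩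
  have hout (j : ℕ) : (φ j).rOut ≤ ρ / 2 := by
    change ρ / (2 * ((j : ℝ) + 1)) ≤ ρ / 2
    have : (0 : ℝ) ≤ j := Nat.cast_nonneg j
    exact div_le_div_of_nonneg_left hρ.le two_pos (by linarith)
  have hφ0 : Tendsto (fun j => (φ j).rOut) atTop (𝓝 0) := by
    change Tendsto (fun j : ℕ => ρ / (2 * ((j : ℝ) + 1))) atTop (𝓝 0)
    refine Tendsto.div_atTop tendsto_const_nhds ?_
    exact (tendsto_atTop_add_const_right _ _ tendsto_natCast_atTop_atTop).const_mul_atTop two_pos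
  have hlim := ContDiffBump.ae_convolution_tendsto_right_of_locallyIntegrable (K := 2) hφ0
    (Eventually.of_forall fun j => by
      change ρ / (2 * ((j : ℝ) + 1)) ≤ 2 * (ρ / (2 * (j + 1)) / 2); linarith) hfl
  have hconst (j : ℕ) {x y : Plane} (hx : x ∈ Metric.ball x₀ (ρ / 2))
      (hy : y ∈ Metric.ball x₀ (ρ / 2)) :
      convolution ((φ j).normed volume) f (ContinuousLinearMap.lsmul ℝ ℝ) volume x =
        convolution ((φ j).normed volume) f (ContinuousLinearMap.lsmul ℝ ℝ) volume y := by
    set ψ := (φ j).normed (volume : Measure Plane) with hψ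
    have hψs : ContDiff ℝ 1 ψ := (φ j).contDiff_normed
    have hψc : HasCompactSupport ψ := (φ j).hasCompactSupport_normed
    have e (x : Plane) : convolution ψ f (ContinuousLinearMap.lsmul ℝ ℝ) volume x =
        convolution f ψ (ContinuousLinearMap.mul ℝ ℝ) volume x := by
      rw [convolution_lsmul_swap, convolution_def]
      simp [mul_comm]
    rw [e, e]
    have hd := hψc.hasFDerivAt_convolution_right (ContinuousLinearMap.mul ℝ ℝ) hfl hψs
    refine Metric.isOpen_ball.is_const_of_fderiv_eq_zero (𝕜 := ℝ)
      (convex_ball x₀ (ρ / 2)).isPreconnected (fun x _ => (hd x).differentiableAt.differentiableWithinAt)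
      (fun x hx => ?_) hx hy
    rw [(hd x).fderiv]
    ext v
    rw [convolution_precompR_apply _ hfl (hψc.fderiv ℝ) (hψs.continuous_fderiv (by simp)),
      convolution_def]
    simp only [ContinuousLinearMap.mul_apply', Pi.zero_apply, zero_apply]
    have hcd : ContDiff ℝ 1 fun t => ψ (x - t) := hψs.comp (contDiff_const.sub contDiff_id)
    have hcc : HasCompactSupport fun t => ψ (x - t) := hψc.comp_homeomorph (Homeomorph.subLeft x)
    -- The derivative of the mollification is minus an integral against `m` of a field supported in
    -- the ball of radius `ρ`, which is `m`-null. So each mollification is constant on the half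
    -- ball, and hence so is its almost everywhere limit.
    have hg := h.gauss_green (fun t => -(ψ (x - t)) • v) (hcd.neg.smul contDiff_const)
      (hcc.neg.smul_right)
    have hdiv (t : Plane) : divg (fun t => -(ψ (x - t)) • v) t = fderiv ℝ ψ (x - t) v := by
      have h1 : HasFDerivAt (fun t => ψ (x - t)) (-(fderiv ℝ ψ (x - t))) t := by
        have := (hψs.differentiable (by simp) (x - t)).hasFDerivAt.comp t
          ((hasFDerivAt_id t).const_sub x)
        exact this.congr_fderiv (by ext; simp)
      have h2 : HasFDerivAt (fun t => -(ψ (x - t)) • v) ((- -(fderiv ℝ ψ (x - t))).smulRight v) t :=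
        h1.neg.smul_const v
      rw [divg, h2.fderiv, neg_neg, ContinuousLinearMap.coe_smulRight, LinearMap.trace_smulRight]
      rfl
    simp only [hdiv] at hg
    rw [hg, neg_eq_zero]
    refine integral_eq_zero_of_ae ?_
    have : ∀ᵐ t ∂m, t ∉ Metric.ball x₀ ρ := measure_eq_zero_iff_ae_notMem.1 hm
    filter_upwards [this] with t ht
    have h0 : ψ (x - t) = 0 := by
      have hs : x - t ∉ Function.support ψ := by
        rw [hψ, ContDiffBump.support_normed_eq]
        intro hmem
        apply ht
        rw [mem_ball_zero_iff] at hmem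
        rw [Metric.mem_ball, dist_comm] at hx ⊢
        have h3 := dist_triangle x₀ x t
        rw [dist_eq_norm x t] at h3
        linarith [hout j]
      simpa using hs
    simp [h0]
  have hlim' := ae_restrict_of_ae (s := Metric.ball x₀ (ρ / 2)) hlim
  have hmem := ae_restrict_mem (μ := volume) (Metric.isOpen_ball (x := x₀) (ε := ρ / 2)).measurableSet
  have hne : (volume.restrict (Metric.ball x₀ (ρ / 2))) ≠ 0 := by
    rw [Ne, Measure.restrict_eq_zero]
    exact (Metric.measure_ball_pos volume x₀ (half_pos hρ)).ne'
  have : (ae (volume.restrict (Metric.ball x₀ (ρ / 2)))).NeBot := ae_neBot.2 hne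
  obtain ⟨y₀, hy₀, hy₀m⟩ := (hlim'.and hmem).exists
  refine ⟨y₀, ?_⟩
  filter_upwards [hlim', hmem] with y hy hym
  refine tendsto_nhds_unique (hy.congr fun j => hconst j hym hy₀m) hy₀

/-- The open set near which `f` is almost everywhere equal to `c`. -/
def locallyEq (f : Plane → ℝ) (c : ℝ) : Set Plane :=
  {x | ∃ ε > 0, ∀ᵐ y ∂(volume.restrict (Metric.ball x ε)), f y = c}

lemma isOpen_locallyEq (f : Plane → ℝ) (c : ℝ) : IsOpen (locallyEq f c) := by
  refine Metric.isOpen_iff.2 fun x ⟨ε, hε, h⟩ => ⟨ε / 2, half_pos hε, fun y hy => ?_⟩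
  refine ⟨ε / 2, half_pos hε, ae_restrict_of_ae_restrict_of_subset ?_ h⟩
  intro w hw
  rw [Metric.mem_ball] at *
  linarith [dist_triangle w y x]

lemma disjoint_locallyEq {f : Plane → ℝ} {c d : ℝ} (hcd : c ≠ d) :
    Disjoint (locallyEq f c) (locallyEq f d) := by
  refine Set.disjoint_left.2 fun x ⟨ε, hε, h⟩ ⟨δ, hδ, h'⟩ => hcd ?_
  have hs (ρ : ℝ) (hρ : min ε δ ≤ ρ) : Metric.ball x (min ε δ) ⊆ Metric.ball x ρ :=
    Metric.ball_subset_ball hρ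
  have h1 := ae_restrict_of_ae_restrict_of_subset (hs ε (min_le_left _ _)) h
  have h2 := ae_restrict_of_ae_restrict_of_subset (hs δ (min_le_right _ _)) h'
  have hne : (volume.restrict (Metric.ball x (min ε δ))) ≠ 0 := by
    rw [Ne, Measure.restrict_eq_zero]
    exact (Metric.measure_ball_pos volume x (lt_min hε hδ)).ne'
  have : (ae (volume.restrict (Metric.ball x (min ε δ)))).NeBot := ae_neBot.2 hne
  obtain ⟨y, hy, hy'⟩ := (h1.and h2).exists
  exact hy.symm.trans hy'

/-- The exceptional set is null near each of its points, and in a second countable space this makes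
it null globally. -/
lemma ae_eq_of_subset_locallyEq {f : Plane → ℝ} {c : ℝ} {s : Set Plane} (hs : s ⊆ locallyEq f c) :
    volume (s ∩ {x | f x ≠ c}) = 0 := by
  refine measure_null_of_locally_null _ fun x hx => ?_
  obtain ⟨ε, hε, h⟩ := hs hx.1
  refine ⟨Metric.ball x ε ∩ (s ∩ {x | f x ≠ c}),
    inter_mem (mem_nhdsWithin_of_mem_nhds (Metric.ball_mem_nhds x hε)) self_mem_nhdsWithin, ?_⟩
  rw [ae_restrict_iff' Metric.isOpen_ball.measurableSet] at h
  refine measure_mono_null ?_ (ae_iff.1 h)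
  rintro y ⟨hy, -, hy'⟩ h0
  exact hy' (h0 hy)

/-- A locally constant alternative is global on an open set with connected boundary collar. -/
lemma subset_or_subset_of_collar {s N V W : Set Plane} (hs : IsOpen s) (hN : IsOpen N)
    (hfr : frontier s ⊆ N) (hcol : IsPreconnected (N ∩ s)) (hV : IsOpen V) (hW : IsOpen W)
    (hVW : Disjoint V W) (hsub : s ⊆ V ∪ W) (hne : s ≠ univ) : s ⊆ V ∨ s ⊆ W := by
  -- If the collar lies in `V`, then `s ∩ W` stays away from the boundary of `s`, so it is open and
  -- closed in the plane. Connectedness of the plane makes it empty; thus `s` itself need not be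
  -- connected.
  have key {V W : Set Plane} (hV : IsOpen V) (hW : IsOpen W) (hVW : Disjoint V W)
      (hsub : s ⊆ V ∪ W) (hc : N ∩ s ⊆ V) : s ⊆ V := by
    have hclopen : IsClopen (s ∩ W) := by
      refine ⟨closure_subset_iff_isClosed.1 fun x hx => ?_, hs.inter hW⟩
      have hxs : x ∈ closure s := closure_mono inter_subset_left hx
      by_cases hxs' : x ∈ s
      · rcases hsub hxs' with hxV | hxW
        · obtain ⟨y, hy, hy'⟩ := mem_closure_iff.1 hx V hV hxV
          exact absurd hy'.2 (Set.disjoint_left.1 hVW hy)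
        · exact ⟨hxs', hxW⟩
      · have hxN : x ∈ N := hfr ⟨hxs, by rwa [hs.interior_eq]⟩
        obtain ⟨y, hy, hy'⟩ := mem_closure_iff.1 hx N hN hxN
        exact absurd hy'.2 (Set.disjoint_left.1 hVW (hc ⟨hy, hy'.1⟩))
    rcases isClopen_iff.1 hclopen with h | h
    · intro x hx
      rcases hsub hx with h' | h'
      · exact h'
      · have : x ∈ s ∩ W := ⟨hx, h'⟩
        rw [h] at this
        exact this.elim
    · exact absurd (univ_subset_iff.1 (h ▸ inter_subset_left)) hne
  rcases IsPreconnected.subset_or_subset hV hW hVW (inter_subset_right.trans hsub) hcol with h | h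
  · exact Or.inl (key hV hW hVW hsub h)
  · exact Or.inr (key hW hV hVW.symm (by rwa [union_comm]) h)

end CircMCF

namespace CircMCF

/-! ### Normal graphs over the boundary of a domain -/

/-- The small `C¹` normal graph with height `h`, which is `f` in terms of the parametrization. -/
structure NormalGraph (Ω : Set Plane) (R : ℝ) (γ n : ℝ → Plane) (k : ℝ → ℝ) (L : ℝ) (h : Plane → ℝ)
    (f : ℝ → ℝ) : Prop where
  tube : Tube Ω R γ n k L
  pos : ∀ u, ∀ l ∈ Ioo (-R) R, 0 < 1 - k u * l
  nrm_eq : ∀ u, nrm Ω (γ u) = n u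
  height : ∀ u, h (γ u) = f u
  smooth : ContDiff ℝ 1 f
  le : ∀ u, |f u| ≤ R / 8

/-- The height of a point over the graph. -/
def level (Ω : Set Plane) (h : Plane → ℝ) (x : Plane) : ℝ := sdist Ω x - h (proj Ω x)

/-- The domain inside of the graph. -/
def innerRegion (Ω : Set Plane) (R : ℝ) (h : Plane → ℝ) : Set Plane :=
  ({x | |sdist Ω x| < R} ∩ {x | 0 < level Ω h x}) ∪ {x | R / 2 < sdist Ω x}

/-- The domain outside of the graph. -/
def outerRegion (Ω : Set Plane) (R : ℝ) (h : Plane → ℝ) : Set Plane :=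
  ({x | |sdist Ω x| < R} ∩ {x | level Ω h x < 0}) ∪ {x | sdist Ω x < -(R / 2)}

/-- The parametrization of the graph. -/
def graphCurve (γ n : ℝ → Plane) (f : ℝ → ℝ) (u : ℝ) : Plane := γ u + f u • n u

namespace NormalGraph

variable {Ω : Set Plane} {γ n : ℝ → Plane} {k f : ℝ → ℝ} {L R : ℝ} {h : Plane → ℝ}
variable (G : NormalGraph Ω R γ n k L h f)
include G

lemma mem_Ioo (u : ℝ) : f u ∈ Ioo (-R) R := by
  have := abs_le.1 (G.le u)
  have := G.tube.width_pos
  constructor <;> linarith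

lemma periodic : Function.Periodic f L := fun u => by
  rw [← G.height, ← G.height, G.tube.param.periodic]

lemma hasDerivAt (u : ℝ) : HasDerivAt f (deriv f u) u :=
  (G.smooth.differentiable (by simp) u).hasDerivAt

lemma level_coord (u : ℝ) {l : ℝ} (hl : l ∈ Ioo (-R) R) :
    level Ω h (γ u + l • n u) = l - f u := by
  rw [level, G.tube.sdist_eq u l hl, G.tube.proj_eq u hl, G.height]

lemma exists_coord {x : Plane} (hx : |sdist Ω x| < R) :
    ∃ u ∈ Ico 0 L, ∃ l ∈ Ioo (-R) R, x = γ u + l • n u ∧ sdist Ω x = l := by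
  obtain ⟨u, hu, h⟩ := G.tube.surj x hx
  exact ⟨u, hu, _, abs_lt.1 hx, h, rfl⟩

lemma contDiffAt_level {x : Plane} (hx : |sdist Ω x| < R) : ContDiffAt ℝ 1 (level Ω h) x := by
  obtain ⟨u, -, l, hl, rfl, -⟩ := G.exists_coord hx
  obtain ⟨U, hU, hU0, hs, hev⟩ := G.tube.exists_local_coord u hl (G.pos u l hl).ne'
  have h1 : ContDiffAt ℝ 1 (fun x => sdist Ω x - f (U x)) (γ u + l • n u) :=
    (hs.of_le (by simp)).sub (G.smooth.contDiffAt.comp _ (hU.of_le (by simp)))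
  refine h1.congr_of_eventuallyEq ?_
  filter_upwards [hev] with x hx
  have := G.tube.proj_eq (U x) (abs_lt.1 hx.1)
  rw [← hx.2] at this
  rw [level, this, G.height]

lemma hasFDerivAt_level (u : ℝ) {l : ℝ} (hl : l ∈ Ioo (-R) R) :
    HasFDerivAt (level Ω h)
      (innerSL ℝ (n u) - (deriv f u / (1 - k u * l)) • innerSL ℝ (deriv γ u)) (γ u + l • n u) := by
  have h0 := (G.pos u l hl).ne'
  have hF : ∀ w, ∀ m ∈ Ioo (-R) R, (fun x => h (proj Ω x)) (γ w + m • n w) = f w := by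
    intro w m hm
    change h (proj Ω (γ w + m • n w)) = f w
    rw [G.tube.proj_eq w hm, G.height]
  have hd := G.tube.differentiableAt_of_coord (F := fun x => h (proj Ω x)) hl h0 hF (G.hasDerivAt u).differentiableAt
  have hv := G.tube.fderiv_apply_of_coord hl h0 hd.hasFDerivAt hF (G.hasDerivAt u)
  refine ((G.tube.hasFDerivAt_sdist u hl h0).sub hd.hasFDerivAt).congr_fderiv ?_
  ext v
  simp only [sub_apply, smul_apply, hv, smul_eq_mul, innerSL_apply_apply]
  ring

lemma isOpen_innerRegion : IsOpen (innerRegion Ω R h) := by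
  refine IsOpen.union ?_ (isOpen_lt continuous_const continuous_sdist)
  have hc : ContinuousOn (level Ω h) {x | |sdist Ω x| < R} := fun x hx =>
    (G.contDiffAt_level hx).continuousAt.continuousWithinAt
  exact hc.isOpen_inter_preimage (isOpen_abs_sdist_lt Ω R) isOpen_Ioi

lemma isOpen_outerRegion : IsOpen (outerRegion Ω R h) := by
  refine IsOpen.union ?_ (isOpen_lt continuous_sdist continuous_const)
  have hc : ContinuousOn (level Ω h) {x | |sdist Ω x| < R} := fun x hx =>
    (G.contDiffAt_level hx).continuousAt.continuousWithinAt
  exact hc.isOpen_inter_preimage (isOpen_abs_sdist_lt Ω R) isOpen_Iio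

/-- Inside the tube the second piece of the region is redundant: above height `R / 2` a point lies
above the graph, whose height is at most `R / 8`. -/
lemma mem_innerRegion_iff {x : Plane} (hx : |sdist Ω x| < R) :
    x ∈ innerRegion Ω R h ↔ 0 < level Ω h x := by
  refine ⟨?_, fun h0 => Or.inl ⟨hx, h0⟩⟩
  rintro (h0 | h0)
  · exact h0.2
  · obtain ⟨u, -, l, hl, rfl, hs⟩ := G.exists_coord hx
    rw [G.level_coord u hl]
    rw [mem_ofPred_eq, hs] at h0
    have := abs_le.1 (G.le u)
    linarith [G.tube.width_pos]

lemma mem_outerRegion_iff {x : Plane} (hx : |sdist Ω x| < R) :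
    x ∈ outerRegion Ω R h ↔ level Ω h x < 0 := by
  refine ⟨?_, fun h0 => Or.inl ⟨hx, h0⟩⟩
  rintro (h0 | h0)
  · exact h0.2
  · obtain ⟨u, -, l, hl, rfl, hs⟩ := G.exists_coord hx
    rw [G.level_coord u hl]
    rw [mem_ofPred_eq, hs] at h0
    have := abs_le.1 (G.le u)
    linarith [G.tube.width_pos]

lemma innerRegion_subset : innerRegion Ω R h ⊆ {x | -(R / 8) ≤ sdist Ω x} := by
  rintro x (h0 | h0)
  · obtain ⟨u, -, l, hl, rfl, hs⟩ := G.exists_coord h0.1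
    have h1 := h0.2
    rw [mem_ofPred_eq, G.level_coord u hl] at h1
    rw [mem_ofPred_eq, hs]
    linarith [abs_le.1 (G.le u)]
  · rw [mem_ofPred_eq] at *
    linarith [G.tube.width_pos]

lemma outerRegion_subset : outerRegion Ω R h ⊆ {x | sdist Ω x ≤ R / 8} := by
  rintro x (h0 | h0)
  · obtain ⟨u, -, l, hl, rfl, hs⟩ := G.exists_coord h0.1
    have h1 := h0.2
    rw [mem_ofPred_eq, G.level_coord u hl] at h1
    rw [mem_ofPred_eq, hs]
    linarith [abs_le.1 (G.le u)]
  · rw [mem_ofPred_eq] at *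
    linarith [G.tube.width_pos]

lemma disjoint_regions : Disjoint (innerRegion Ω R h) (outerRegion Ω R h) := by
  refine Set.disjoint_left.2 fun x hx hx' => ?_
  have h1 := G.innerRegion_subset hx
  have h2 := G.outerRegion_subset hx'
  rw [mem_ofPred_eq] at h1 h2
  have hR := G.tube.width_pos
  have h3 : |sdist Ω x| < R := abs_lt.2 ⟨by linarith, by linarith⟩
  rw [G.mem_innerRegion_iff h3] at hx
  rw [G.mem_outerRegion_iff h3] at hx'
  linarith

lemma mem_regions (x : Plane) :
    x ∈ innerRegion Ω R h ∨ x ∈ outerRegion Ω R h ∨ x ∈ graphCurve γ n f '' Ico 0 L := by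
  have hR := G.tube.width_pos
  by_cases hx : |sdist Ω x| < R
  · rw [G.mem_innerRegion_iff hx, G.mem_outerRegion_iff hx]
    obtain ⟨u, hu, l, hl, rfl, hs⟩ := G.exists_coord hx
    rw [G.level_coord u hl]
    rcases lt_trichotomy 0 (l - f u) with h0 | h0 | h0
    · exact Or.inl h0
    · refine Or.inr (Or.inr ⟨u, hu, ?_⟩)
      rw [graphCurve, show f u = l by linarith]
    · exact Or.inr (Or.inl h0)
  · rw [not_lt] at hx
    rcases le_abs.1 hx with h0 | h0
    · exact Or.inl (Or.inr (by rw [mem_ofPred_eq]; linarith))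
    · exact Or.inr (Or.inl (Or.inr (by rw [mem_ofPred_eq]; linarith)))

lemma contDiff_graphCurve : ContDiff ℝ 1 (graphCurve γ n f) :=
  (G.tube.param.smooth.of_le (by simp)).add (G.smooth.smul (G.tube.normal_smooth.of_le (by simp)))

lemma hasDerivAt_graphCurve (u : ℝ) :
    HasDerivAt (graphCurve γ n f) ((1 - k u * f u) • deriv γ u + deriv f u • n u) u := by
  have := (G.tube.param.hasDerivAt u).add ((G.hasDerivAt u).smul (G.tube.hasDerivAt_normal u))
  exact this.congr_deriv (by module)

lemma injOn_graphCurve : InjOn (graphCurve γ n f) (Ico 0 L) := by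
  intro u hu w hw huw
  have := G.tube.inj (x₁ := (u, f u)) (x₂ := (w, f w)) ⟨hu, G.mem_Ioo u⟩ ⟨hw, G.mem_Ioo w⟩ huw
  exact congrArg Prod.fst this

lemma periodic_graphCurve : Function.Periodic (graphCurve γ n f) L := fun u => by
  rw [graphCurve, graphCurve, G.periodic, G.tube.normal_periodic, G.tube.param.periodic]

lemma image_graphCurve : graphCurve γ n f '' Ico 0 L = range (graphCurve γ n f) := by
  refine (image_subset_range _ _).antisymm ?_
  rintro _ ⟨u, rfl⟩
  obtain ⟨w, hw, h⟩ := G.periodic_graphCurve.exists_mem_Ico₀ G.tube.param.pos u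
  exact ⟨w, hw, h.symm⟩

lemma isCompact_graph : IsCompact (graphCurve γ n f '' Ico 0 L) := by
  have := G.periodic_graphCurve.image_Icc G.tube.param.pos 0
  rw [G.image_graphCurve, ← this]
  exact isCompact_Icc.image G.contDiff_graphCurve.continuous

lemma isPreconnected_collar (l₀ : ℝ) :
    IsPreconnected ((fun p : ℝ × ℝ => γ p.1 + (f p.1 + p.2 * (l₀ - f p.1)) • n p.1) ''
      (univ ×ˢ Ioo 0 1)) := by
  refine (isPreconnected_univ.prod isPreconnected_Ioo).image _ (Continuous.continuousOn ?_)
  have := G.tube.param.smooth.continuous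
  have := G.tube.normal_smooth.continuous
  have := G.smooth.continuous
  fun_prop

/-- Each normal segment between the graph and the inner edge of the tube is parametrized affinely by
`(0, 1)`. The collar is thus a continuous image of a strip, hence connected, although nothing is
known about the rest of the region. -/
lemma collar_inner : {x | |sdist Ω x| < R} ∩ innerRegion Ω R h =
    (fun p : ℝ × ℝ => γ p.1 + (f p.1 + p.2 * (R - f p.1)) • n p.1) '' (univ ×ˢ Ioo 0 1) := by
  ext x
  constructor
  · rintro ⟨hx, hx'⟩
    rw [G.mem_innerRegion_iff hx] at hx'
    obtain ⟨u, -, l, hl, rfl, -⟩ := G.exists_coord hx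
    rw [G.level_coord u hl] at hx'
    have h1 : 0 < R - f u := sub_pos.2 (G.mem_Ioo u).2
    refine ⟨(u, (l - f u) / (R - f u)), ⟨mem_univ _, div_pos hx' h1, ?_⟩, ?_⟩
    · rw [div_lt_one h1]; linarith [hl.2]
    · change γ u + (f u + (l - f u) / (R - f u) * (R - f u)) • n u = _
      rw [div_mul_cancel₀ _ h1.ne', add_sub_cancel]
  · rintro ⟨⟨u, s⟩, ⟨-, hs⟩, rfl⟩
    change γ u + (f u + s * (R - f u)) • n u ∈ _
    have h1 : 0 < R - f u := sub_pos.2 (G.mem_Ioo u).2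
    have hl : f u + s * (R - f u) ∈ Ioo (-R) R := by
      have := G.mem_Ioo u
      constructor <;> nlinarith [this.1, this.2, hs.1, hs.2]
    have hx : |sdist Ω (γ u + (f u + s * (R - f u)) • n u)| < R := by
      rw [G.tube.sdist_eq u _ hl]; exact abs_lt.2 hl
    refine ⟨hx, (G.mem_innerRegion_iff hx).2 ?_⟩
    rw [G.level_coord u hl]
    nlinarith [hs.1]

lemma collar_outer : {x | |sdist Ω x| < R} ∩ outerRegion Ω R h =
    (fun p : ℝ × ℝ => γ p.1 + (f p.1 + p.2 * (-R - f p.1)) • n p.1) '' (univ ×ˢ Ioo 0 1) := by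
  ext x
  constructor
  · rintro ⟨hx, hx'⟩
    rw [G.mem_outerRegion_iff hx] at hx'
    obtain ⟨u, -, l, hl, rfl, -⟩ := G.exists_coord hx
    rw [G.level_coord u hl] at hx'
    have h1 : -R - f u < 0 := sub_neg.2 (G.mem_Ioo u).1
    refine ⟨(u, (l - f u) / (-R - f u)), ⟨mem_univ _, div_pos_of_neg_of_neg hx' h1, ?_⟩, ?_⟩
    · rw [div_lt_one_of_neg h1]; linarith [hl.1]
    · change γ u + (f u + (l - f u) / (-R - f u) * (-R - f u)) • n u = _
      rw [div_mul_cancel₀ _ h1.ne, add_sub_cancel]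
  · rintro ⟨⟨u, s⟩, ⟨-, hs⟩, rfl⟩
    change γ u + (f u + s * (-R - f u)) • n u ∈ _
    have h1 : -R - f u < 0 := sub_neg.2 (G.mem_Ioo u).1
    have hl : f u + s * (-R - f u) ∈ Ioo (-R) R := by
      have := G.mem_Ioo u
      constructor <;> nlinarith [this.1, this.2, hs.1, hs.2]
    have hx : |sdist Ω (γ u + (f u + s * (-R - f u)) • n u)| < R := by
      rw [G.tube.sdist_eq u _ hl]; exact abs_lt.2 hl
    refine ⟨hx, (G.mem_outerRegion_iff hx).2 ?_⟩
    rw [G.level_coord u hl]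
    nlinarith [hs.1]

/-- The region contains all points of signed distance above `R / 2` and only points of signed
distance at least `-(R / 8)`, so its frontier is trapped between these values. -/
lemma frontier_innerRegion_subset : frontier (innerRegion Ω R h) ⊆ {x | |sdist Ω x| < R} := by
  rintro x ⟨hx, hx'⟩
  rw [G.isOpen_innerRegion.interior_eq] at hx'
  have h1 := closure_minimal G.innerRegion_subset
    (isClosed_le continuous_const continuous_sdist) hx
  have h2 : ¬ R / 2 < sdist Ω x := fun h0 => hx' (Or.inr h0)
  rw [mem_ofPred_eq] at h1
  rw [not_lt] at h2
  have := G.tube.width_pos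
  rw [mem_ofPred_eq, abs_lt]
  constructor <;> linarith

lemma frontier_outerRegion_subset : frontier (outerRegion Ω R h) ⊆ {x | |sdist Ω x| < R} := by
  rintro x ⟨hx, hx'⟩
  rw [G.isOpen_outerRegion.interior_eq] at hx'
  have h1 := closure_minimal G.outerRegion_subset
    (isClosed_le continuous_sdist continuous_const) hx
  have h2 : ¬ sdist Ω x < -(R / 2) := fun h0 => hx' (Or.inr h0)
  rw [mem_ofPred_eq] at h1
  rw [not_lt] at h2
  have := G.tube.width_pos
  rw [mem_ofPred_eq, abs_lt]
  constructor <;> linarith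

lemma graph_notMem {x : Plane} (hx : x ∈ graphCurve γ n f '' Ico 0 L) :
    x ∉ innerRegion Ω R h ∧ x ∉ outerRegion Ω R h := by
  obtain ⟨u, -, rfl⟩ := hx
  have h1 : |sdist Ω (graphCurve γ n f u)| < R := by
    rw [graphCurve, G.tube.sdist_eq u _ (G.mem_Ioo u)]; exact abs_lt.2 (G.mem_Ioo u)
  rw [G.mem_innerRegion_iff h1, G.mem_outerRegion_iff h1, graphCurve, G.level_coord u (G.mem_Ioo u)]
  simp

/-- The image, under the differentiable tubular coordinates, of the graph of `f`, which is a null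
set of the parameter plane by Fubini. -/
lemma volume_graph : volume (graphCurve γ n f '' Ico 0 L) = 0 := by
  have h1 : volume {p : ℝ × ℝ | p.2 = f p.1} = 0 := by
    have := G.smooth.continuous
    rw [Measure.volume_eq_prod, Measure.measure_prod_null
      (isClosed_eq continuous_snd (by fun_prop)).measurableSet]
    refine Eventually.of_forall fun u => ?_
    change volume {l : ℝ | l = f u} = 0
    simp
  choose f' hf' _ using G.tube.hasFDerivAt_cartesian_coord
  have h2 := addHaar_image_eq_zero_of_differentiableOn_of_addHaar_eq_zero volume
    (fun p _ => (hf' p).differentiableAt.differentiableWithinAt) h1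
  rw [← image_image cartesian, ← measurePreserving_cartesian.measure_preimage_emb
      measurableEmbedding_cartesian, preimage_image_eq _ measurableEmbedding_cartesian.injective] at h2
  refine measure_mono_null ?_ h2
  rintro _ ⟨u, -, rfl⟩
  exact ⟨(u, f u), rfl, rfl⟩

/-- The region contains the complement of a bounded set. This lets finite area decide on which side
the phase lies. -/
lemma volume_outerRegion : volume (outerRegion Ω R h) = ⊤ := by
  have hb : Bornology.IsBounded {x | -(R / 2) ≤ sdist Ω x} := by
    refine (G.tube.bounded.thickening (δ := R)).subset fun x hx => ?_
    by_cases hxΩ : x ∈ Ω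
    · exact Metric.self_subset_thickening G.tube.width_pos Ω hxΩ
    · rw [mem_ofPred_eq, sdist, Metric.infDist_zero_of_mem (show x ∈ Ωᶜ from hxΩ)] at hx
      rw [Metric.mem_thickening_iff_infDist_lt G.tube.nonempty]
      linarith [G.tube.width_pos]
  have h1 : volume {x | -(R / 2) ≤ sdist Ω x}ᶜ = ⊤ := by
    have := measure_add_measure_compl (μ := (volume : Measure Plane))
      (isClosed_le continuous_const (continuous_sdist (Ω := Ω)) : IsClosed {x | -(R / 2) ≤ sdist Ω x}).measurableSet
    rw [measure_univ_of_isAddLeftInvariant] at this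
    exact (ENNReal.add_eq_top.1 this).resolve_left hb.measure_lt_top.ne
  refine eq_top_mono (measure_mono fun x hx => Or.inr ?_) h1
  simpa using hx

/-- A finite area phase whose reduced boundary is the graph is the domain inside of it. -/
theorem phase_ae_eq {χ : Plane → ℝ} (hχ : Measurable χ) (hb : ∀ x, χ x = 0 ∨ χ x = 1)
    (hp : HasFinitePerimeter χ) (hI : redBdry χ = graphCurve γ n f '' Ico 0 L)
    (hfin : volume {x | χ x = 1} < ⊤) :
    χ =ᵐ[volume] (innerRegion Ω R h).indicator 1 := by
  have hcl := G.isCompact_graph.isClosed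
  -- Away from the closed graph there is a ball that misses the reduced boundary, hence carries no
  -- perimeter, and there the phase is locally constant.
  have hloc (x : Plane) (hx : x ∉ graphCurve γ n f '' Ico 0 L) :
      x ∈ locallyEq χ 0 ∪ locallyEq χ 1 := by
    obtain ⟨ρ, hρ, hsub⟩ := Metric.isOpen_iff.1 hcl.isOpen_compl x hx
    have hnull : perim χ (Metric.ball x ρ) = 0 := by
      refine measure_mono_null (fun y hy => ?_) (ae_iff.1 hp.ae_mem_redBdry)
      rw [mem_ofPred_eq, hI]
      exact hsub hy
    obtain ⟨y, hy⟩ := hp.isPolarGradient.ae_const_on_ball hχ hb hρ hnull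
    rcases hb y with h0 | h0
    · exact Or.inl ⟨ρ / 2, half_pos hρ, by rwa [h0] at hy⟩
    · exact Or.inr ⟨ρ / 2, half_pos hρ, by rwa [h0] at hy⟩
  have hdis := disjoint_locallyEq (f := χ) zero_ne_one
  have hc0 : graphCurve γ n f 0 ∈ graphCurve γ n f '' Ico 0 L :=
    ⟨0, ⟨le_rfl, G.tube.param.pos⟩, rfl⟩
  have hgr := G.graph_notMem hc0
  have hin := subset_or_subset_of_collar G.isOpen_innerRegion (isOpen_abs_sdist_lt Ω R)
    G.frontier_innerRegion_subset (by rw [G.collar_inner]; exact G.isPreconnected_collar R)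
    (isOpen_locallyEq χ 0) (isOpen_locallyEq χ 1) hdis
    (fun x hx => hloc x fun h0 => (G.graph_notMem h0).1 hx) (fun h0 => hgr.1 (h0 ▸ mem_univ _))
  have hout := subset_or_subset_of_collar G.isOpen_outerRegion (isOpen_abs_sdist_lt Ω R)
    G.frontier_outerRegion_subset (by rw [G.collar_outer]; exact G.isPreconnected_collar (-R))
    (isOpen_locallyEq χ 0) (isOpen_locallyEq χ 1) hdis
    (fun x hx => hloc x fun h0 => (G.graph_notMem h0).2 hx) (fun h0 => hgr.2 (h0 ▸ mem_univ _))
  -- The value `1` on the outer region would give the phase infinite area.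
  have hout0 : volume (outerRegion Ω R h ∩ {x | χ x ≠ 0}) = 0 := by
    rcases hout with h0 | h0
    · exact ae_eq_of_subset_locallyEq h0
    · exfalso
      have h1 := ae_eq_of_subset_locallyEq h0
      have h2 : volume (outerRegion Ω R h) ≤
          volume {x | χ x = 1} + volume (outerRegion Ω R h ∩ {x | χ x ≠ 1}) := by
        refine (measure_mono fun x hx => ?_).trans (measure_union_le _ _)
        by_cases hx1 : χ x = 1
        · exact Or.inl hx1
        · exact Or.inr ⟨hx, hx1⟩
      rw [h1, add_zero, G.volume_outerRegion] at h2
      exact absurd hfin (not_lt.2 h2)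
  have hg0 := G.volume_graph
  -- The value `0` on the inner region as well would make the phase null, so its reduced boundary
  -- would be empty, while it is the nonempty graph.
  have hin1 : volume (innerRegion Ω R h ∩ {x | χ x ≠ 1}) = 0 := by
    rcases hin with h0 | h0
    · exfalso
      have h1 := ae_eq_of_subset_locallyEq h0
      have h2 : χ =ᵐ[volume] 0 := by
        refine measure_mono_null (fun x hx => ?_)
          (measure_union_null (measure_union_null h1 hout0) hg0)
        have hx' : χ x ≠ 0 := hx
        rcases G.mem_regions x with h | h | h
        · exact Or.inl (Or.inl ⟨h, hx'⟩)
        · exact Or.inl (Or.inr ⟨h, hx'⟩)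
        · exact Or.inr h
      rw [← hI, redBdry_eq_empty h2] at hc0
      exact hc0
    · exact ae_eq_of_subset_locallyEq h0
  refine measure_mono_null (fun x hx => ?_)
    (measure_union_null (measure_union_null hin1 hout0) hg0)
  have hx' : χ x ≠ (innerRegion Ω R h).indicator 1 x := hx
  rcases G.mem_regions x with h | h | h
  · exact Or.inl (Or.inl ⟨h, by rwa [indicator_of_mem h] at hx'⟩)
  · refine Or.inl (Or.inr ⟨h, ?_⟩)
    rwa [indicator_of_notMem fun h' => Set.disjoint_left.1 G.disjoint_regions h' h] at hx'
  · exact Or.inr h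

end NormalGraph

end CircMCF

namespace CircMCF

/-! ### The perimeter of the domain inside of a normal graph -/

open Real (smoothTransition)

lemma continuous_deriv_smoothTransition : Continuous (deriv smoothTransition) :=
  (Real.smoothTransition.contDiff (n := 1)).continuous_deriv (by simp)

lemma deriv_smoothTransition_eq_zero {s : ℝ} (hs : s ∉ Icc (0 : ℝ) 1) :
    deriv smoothTransition s = 0 := by
  rw [mem_Icc, not_and_or, not_le, not_le] at hs
  rcases hs with hs | hs
  · have : smoothTransition =ᶠ[𝓝 s] fun _ => 0 := by
      filter_upwards [Iio_mem_nhds hs] with x hx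
      exact Real.smoothTransition.zero_of_nonpos (le_of_lt hx)
    rw [this.deriv_eq, deriv_const]
  · have : smoothTransition =ᶠ[𝓝 s] fun _ => 1 := by
      filter_upwards [Ioi_mem_nhds hs] with x hx
      exact Real.smoothTransition.one_of_one_le (le_of_lt hx)
    rw [this.deriv_eq, deriv_const]

lemma integral_deriv_smoothTransition : ∫ s in (0 : ℝ)..1, deriv smoothTransition s = 1 := by
  rw [intervalIntegral.integral_deriv_eq_sub]
  · simp
  · intro x _
    exact (Real.smoothTransition.contDiff (n := 1)).differentiable (by simp) x
  · exact continuous_deriv_smoothTransition.intervalIntegrable _ _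

/-- Rescaling of an integral against a mollifier. -/
lemma integral_rescale_smoothTransition {K : ℝ → ℝ} {ε y R : ℝ} (hε : 0 < ε) (h1 : -R < y)
    (h2 : y + ε < R) :
    ∫ l in Ioo (-R) R, ε⁻¹ * deriv smoothTransition ((l - y) / ε) * K l =
      ∫ s in (0 : ℝ)..1, deriv smoothTransition s * K (y + ε * s) := by
  rw [setIntegral_eq_integral_of_forall_compl_eq_zero, intervalIntegral.integral_of_le zero_le_one,
    ← integral_Icc_eq_integral_Ioc, setIntegral_eq_integral_of_forall_compl_eq_zero,
    ← integral_add_right_eq_self _ y]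
  · have := Measure.integral_comp_mul_left
      (fun l => ε⁻¹ * deriv smoothTransition ((l + y - y) / ε) * K (l + y)) ε
    rw [abs_of_pos (inv_pos.2 hε), smul_eq_mul, eq_inv_mul_iff_mul_eq₀ hε.ne'] at this
    rw [← this, ← integral_const_mul]
    refine integral_congr_ae (Eventually.of_forall fun s => ?_)
    have h5 : (ε * s + y - y) / ε = s := by field_simp; ring
    simp only [h5]
    rw [add_comm (ε * s) y]
    field_simp
  · intro s hs
    rw [deriv_smoothTransition_eq_zero hs, zero_mul]
  · intro l hl
    rw [deriv_smoothTransition_eq_zero, mul_zero, zero_mul]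
    rintro ⟨h3, h4⟩
    rw [div_nonneg_iff] at h3
    rw [div_le_one hε] at h4
    apply hl
    constructor
    · rcases h3 with h3 | h3 <;> linarith [h3.1, h3.2]
    · linarith

open Classical in
/-- A smooth approximation of the indicator function of the domain inside of a graph. -/
def smoothRegion (Ω : Set Plane) (R : ℝ) (h : Plane → ℝ) (ε : ℝ) (x : Plane) : ℝ :=
  if |sdist Ω x| < R then smoothTransition (level Ω h x / ε) else if 0 < sdist Ω x then 1 else 0

lemma smoothRegion_eventuallyEq_of_lt {Ω : Set Plane} {R : ℝ} {h : Plane → ℝ} (ε : ℝ) {x : Plane} (hx : |sdist Ω x| < R) :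
    smoothRegion Ω R h ε =ᶠ[𝓝 x] fun y => smoothTransition (level Ω h y / ε) := by
  filter_upwards [(isOpen_abs_sdist_lt Ω R).mem_nhds hx] with y hy
  rw [smoothRegion, if_pos hy]

namespace NormalGraph

variable {Ω : Set Plane} {γ n : ℝ → Plane} {k f : ℝ → ℝ} {L R : ℝ} {h : Plane → ℝ}
variable (G : NormalGraph Ω R γ n k L h f)
include G

/-- Near points outside the tube, signed distances exceed `R / 2` in absolute value, while the graph
has height at most `R / 8` and `ε ≤ R / 4`. The transition layer is therefore not met, and the two
branches of the definition fit together smoothly. -/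
lemma smoothRegion_eventuallyEq {ε : ℝ} (hε : 0 < ε) (hεR : ε ≤ R / 4) {x : Plane}
    (hx : R ≤ |sdist Ω x|) : ∃ c : ℝ, smoothRegion Ω R h ε =ᶠ[𝓝 x] fun _ => c := by
  have hR := G.tube.width_pos
  rcases le_abs.1 hx with h0 | h0
  · refine ⟨1, ?_⟩
    have ho : IsOpen {y | R / 2 < sdist Ω y} := isOpen_lt continuous_const continuous_sdist
    filter_upwards [ho.mem_nhds (show R / 2 < sdist Ω x by linarith)] with y hy
    rw [smoothRegion, if_pos (show 0 < sdist Ω y by linarith)]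
    split_ifs with h1
    · obtain ⟨u, -, l, hl, rfl, hs⟩ := G.exists_coord h1
      rw [G.level_coord u hl]
      refine Real.smoothTransition.one_of_one_le ((one_le_div hε).2 ?_)
      linarith [abs_le.1 (G.le u)]
    · rfl
  · refine ⟨0, ?_⟩
    have ho : IsOpen {y | sdist Ω y < -(R / 2)} := isOpen_lt continuous_sdist continuous_const
    filter_upwards [ho.mem_nhds (show sdist Ω x < -(R / 2) by linarith)] with y hy
    rw [smoothRegion, if_neg (show ¬ 0 < sdist Ω y by linarith)]
    split_ifs with h1
    · obtain ⟨u, -, l, hl, rfl, hs⟩ := G.exists_coord h1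
      rw [G.level_coord u hl]
      refine Real.smoothTransition.zero_of_nonpos (div_nonpos_of_nonpos_of_nonneg ?_ hε.le)
      linarith [abs_le.1 (G.le u)]
    · rfl

lemma contDiff_smoothRegion {ε : ℝ} (hε : 0 < ε) (hεR : ε ≤ R / 4) :
    ContDiff ℝ 1 (smoothRegion Ω R h ε) := by
  refine contDiff_iff_contDiffAt.2 fun x => ?_
  by_cases hx : |sdist Ω x| < R
  · refine ContDiffAt.congr_of_eventuallyEq ?_ (smoothRegion_eventuallyEq_of_lt ε hx)
    exact (Real.smoothTransition.contDiff (n := 1)).contDiffAt.comp x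
      ((G.contDiffAt_level hx).div_const ε)
  · obtain ⟨c, hc⟩ := G.smoothRegion_eventuallyEq hε hεR (not_lt.1 hx)
    exact contDiffAt_const.congr_of_eventuallyEq hc

/-- Multiplying by the Jacobian `1 - k l` clears the denominator in the gradient of the level
function. The remaining flux density is continuous in the tubular coordinates, which allows the
limit `ε → 0`. -/
lemma fderiv_smoothRegion {ε : ℝ} (u : ℝ) {l : ℝ} (hl : l ∈ Ioo (-R) R) (v : Plane) :
    (1 - k u * l) • fderiv ℝ (smoothRegion Ω R h ε) (γ u + l • n u) v =
      ε⁻¹ * deriv smoothTransition ((l - f u) / ε) *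
        ⟪(1 - k u * l) • n u - deriv f u • deriv γ u, v⟫_ℝ := by
  have hx : |sdist Ω (γ u + l • n u)| < R := by
    rw [G.tube.sdist_eq u l hl]; exact abs_lt.2 hl
  have h1 : HasDerivAt smoothTransition (deriv smoothTransition (level Ω h (γ u + l • n u) / ε))
      (level Ω h (γ u + l • n u) / ε) :=
    ((Real.smoothTransition.contDiff (n := 1)).differentiable (by simp) _).hasDerivAt
  have h2 := h1.comp_hasFDerivAt (γ u + l • n u) ((G.hasFDerivAt_level u hl).mul_const ε⁻¹)
  simp only [div_eq_mul_inv] at h2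
  have h3 : HasFDerivAt (smoothRegion Ω R h ε) _ (γ u + l • n u) :=
    h2.congr_of_eventuallyEq (by
      filter_upwards [smoothRegion_eventuallyEq_of_lt ε hx] with y hy
      rw [hy, div_eq_mul_inv]; rfl)
  rw [h3.fderiv, G.level_coord u hl]
  have := (G.pos u l hl).ne'
  simp only [smul_apply, sub_apply, smul_eq_mul, innerSL_apply_apply, inner_sub_left,
    inner_smul_left, RCLike.conj_to_real, div_eq_mul_inv]
  field_simp

/-- The flux density of a vector field through the level sets over the graph is continuous. -/
lemma continuous_flux {φ : Plane → Plane} (hφ : Continuous φ) :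
    Continuous fun p : ℝ × ℝ => ⟪(1 - k p.1 * p.2) • n p.1 - deriv f p.1 • deriv γ p.1,
      φ (γ p.1 + p.2 • n p.1)⟫_ℝ := by
  have c2 := G.tube.param.smooth.continuous
  have c3 := G.tube.normal_smooth.continuous
  have c4 := G.tube.curv_smooth.continuous
  have c5 := G.smooth.continuous_deriv (by simp)
  have c6 : Continuous (deriv γ) := G.tube.param.smooth_deriv.continuous
  refine Continuous.inner ?_ (hφ.comp ?_)
  · fun_prop
  · fun_prop

/-- The Gauss-Green formula in the domain inside of the graph. -/
lemma integral_indicator_mul_divg {φ : Plane → Plane} (hφ : ContDiff ℝ 1 φ)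
    (hc : HasCompactSupport φ) :
    ∫ x, (innerRegion Ω R h).indicator 1 x * divg φ x =
      -∫ u in (0 : ℝ)..L, ⟪(1 - k u * f u) • n u - deriv f u • deriv γ u,
        φ (graphCurve γ n f u)⟫_ℝ := by
  have hR := G.tube.width_pos
  obtain ⟨K, hK⟩ : ∃ K : ℝ → ℝ → ℝ, ∀ u l, K u l =
    ⟪(1 - k u * l) • n u - deriv f u • deriv γ u, φ (γ u + l • n u)⟫_ℝ := ⟨_, fun _ _ => rfl⟩
  have c7 := G.smooth.continuous
  have c8 := continuous_deriv_smoothTransition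
  have hKc : Continuous fun p : ℝ × ℝ => K p.1 p.2 := by
    simp only [hK]; exact G.continuous_flux hφ.continuous
  -- The flux averaged over the transition layer, in rescaled layer coordinates. It is continuous up
  -- to `ε = 0`, where it becomes the flux through the graph.
  set Q : ℝ → ℝ := fun ε => ∫ u in (0 : ℝ)..L, ∫ s in (0 : ℝ)..1,
    deriv smoothTransition s * K u (f u + ε * s) with hQ
  have hQc : Continuous Q := by
    refine intervalIntegral.continuous_parametric_intervalIntegral_of_continuous' ?_ _ _
    refine intervalIntegral.continuous_parametric_intervalIntegral_of_continuous'
      (f := fun (p : ℝ × ℝ) s => deriv smoothTransition s * K p.2 (f p.2 + p.1 * s)) ?_ _ _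
    exact (by fun_prop : Continuous fun q : (ℝ × ℝ) × ℝ => deriv smoothTransition q.2).mul
      (hKc.comp (by fun_prop : Continuous fun q : (ℝ × ℝ) × ℝ =>
        ((q.1.2, f q.1.2 + q.1.1 * q.2) : ℝ × ℝ)))
  have hQ0 : Q 0 = ∫ u in (0 : ℝ)..L, K u (f u) := by
    simp only [hQ, zero_mul, add_zero, intervalIntegral.integral_mul_const,
      integral_deriv_smoothTransition, one_mul]
  -- Integration by parts moves the derivative to the smoothed indicator, tubular coordinates turn
  -- the integral into one over a rectangle, and the normal variable is rescaled by `ε`.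
  have hQε {ε : ℝ} (hε : 0 < ε) (hεR : ε ≤ R / 4) :
      ∫ x, smoothRegion Ω R h ε x * divg φ x = -Q ε := by
    rw [integral_mul_divg (G.contDiff_smoothRegion hε hεR) hφ hc, neg_inj,
      ← setIntegral_eq_integral_of_forall_compl_eq_zero (s := {x | |sdist Ω x| < R}),
      G.tube.integral_tube G.pos]
    · have e1 : ∫ p in Ico 0 L ×ˢ Ioo (-R) R, (1 - k p.1 * p.2) •
          fderiv ℝ (smoothRegion Ω R h ε) (γ p.1 + p.2 • n p.1) (φ (γ p.1 + p.2 • n p.1)) =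
          ∫ p in Ico 0 L ×ˢ Ioo (-R) R, ε⁻¹ * deriv smoothTransition ((p.2 - f p.1) / ε) *
            K p.1 p.2 :=
        setIntegral_congr_fun (measurableSet_Ico.prod measurableSet_Ioo) fun p hp =>
          (G.fderiv_smoothRegion p.1 hp.2 _).trans (by rw [hK])
      have hcont : Continuous fun p : ℝ × ℝ =>
          ε⁻¹ * deriv smoothTransition ((p.2 - f p.1) / ε) * K p.1 p.2 :=
        (by fun_prop : Continuous fun p : ℝ × ℝ =>
          ε⁻¹ * deriv smoothTransition ((p.2 - f p.1) / ε)).mul hKc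
      rw [e1, Measure.volume_eq_prod, setIntegral_prod]
      · simp only [hQ]
        rw [intervalIntegral.integral_of_le G.tube.param.pos.le, ← integral_Icc_eq_integral_Ioc,
          integral_Icc_eq_integral_Ico]
        refine setIntegral_congr_fun measurableSet_Ico fun u _ => ?_
        have := abs_le.1 (G.le u)
        exact integral_rescale_smoothTransition hε (by linarith) (by linarith)
      · rw [← Measure.volume_eq_prod]
        exact (hcont.continuousOn.integrableOn_compact (isCompact_Icc.prod isCompact_Icc)).mono_set
          (prod_mono Ico_subset_Icc_self Ioo_subset_Icc_self)
    · intro x hx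
      obtain ⟨c, hc⟩ := G.smoothRegion_eventuallyEq hε hεR (not_lt.1 hx)
      rw [hc.fderiv_eq]; simp
  let ε : ℕ → ℝ := fun j => R / 4 / (j + 1)
  have hε (j : ℕ) : 0 < ε j := by positivity
  have hεR (j : ℕ) : ε j ≤ R / 4 :=
    div_le_self (by positivity) (by linarith [(Nat.cast_nonneg j : (0 : ℝ) ≤ j)])
  have hε0 : Tendsto ε atTop (𝓝 0) := Tendsto.div_atTop tendsto_const_nhds
    (tendsto_atTop_add_const_right _ _ tendsto_natCast_atTop_atTop)
  have hlim1 : Tendsto (fun j => ∫ x, smoothRegion Ω R h (ε j) x * divg φ x) atTop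
      (𝓝 (-∫ u in (0 : ℝ)..L, K u (f u))) := by
    simp only [fun j => hQε (hε j) (hεR j), ← hQ0]
    exact ((hQc.tendsto 0).comp hε0).neg
  simp only [graphCurve, ← hK]
  have hdc := continuous_divg hφ
  have hlim2 : Tendsto (fun j => ∫ x, smoothRegion Ω R h (ε j) x * divg φ x) atTop
      (𝓝 (∫ x, (innerRegion Ω R h).indicator 1 x * divg φ x)) := by
    refine tendsto_integral_of_dominated_convergence (fun x => ‖divg φ x‖) (fun j => ?_) ?_
      (fun j => Eventually.of_forall fun x => ?_) (Eventually.of_forall fun x => ?_)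
    · exact ((G.contDiff_smoothRegion (hε j) (hεR j)).continuous.mul hdc).aestronglyMeasurable
    · exact (hdc.integrable_of_hasCompactSupport (hasCompactSupport_divg hc)).norm
    · rw [norm_mul]
      refine mul_le_of_le_one_left (norm_nonneg _) ?_
      rw [smoothRegion]
      split_ifs
      · rw [Real.norm_eq_abs, abs_of_nonneg (Real.smoothTransition.nonneg _)]
        exact Real.smoothTransition.le_one _
      · simp
      · simp
    · refine Tendsto.mul_const _ (tendsto_const_nhds.congr' ?_)
      by_cases hx : |sdist Ω x| < R
      · by_cases h0 : 0 < level Ω h x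
        · rw [indicator_of_mem ((G.mem_innerRegion_iff hx).2 h0)]
          filter_upwards [hε0.eventually (gt_mem_nhds h0)] with j hj
          rw [smoothRegion, if_pos hx,
            Real.smoothTransition.one_of_one_le ((one_le_div (hε j)).2 hj.le), Pi.one_apply]
        · rw [indicator_of_notMem (fun h1 => h0 ((G.mem_innerRegion_iff hx).1 h1))]
          refine Eventually.of_forall fun j => ?_
          change _ = smoothRegion Ω R h (ε j) x
          rw [smoothRegion, if_pos hx, Real.smoothTransition.zero_of_nonpos
            (div_nonpos_of_nonpos_of_nonneg (not_lt.1 h0) (hε j).le)]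
      · refine Eventually.of_forall fun j => ?_
        change _ = smoothRegion Ω R h (ε j) x
        rw [smoothRegion, if_neg hx]
        rcases le_abs.1 (not_lt.1 hx) with h0 | h0
        · have hm : x ∈ innerRegion Ω R h := Or.inr (show R / 2 < sdist Ω x by linarith)
          rw [if_pos (by linarith)]
          exact indicator_of_mem hm _
        · change (innerRegion Ω R h).indicator 1 x = _
          rw [if_neg (by linarith), indicator_of_notMem]
          intro h1
          have := G.innerRegion_subset h1
          rw [mem_ofPred_eq] at this
          linarith
  exact tendsto_nhds_unique hlim2 hlim1

end NormalGraph

end CircMCF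

/-! ### The unit normal and the perimeter measure of a graph -/

namespace CircMCF

/-- The unit normal of a graph. -/
def graphNormal (γ n : ℝ → Plane) (k f : ℝ → ℝ) (u : ℝ) : Plane :=
  ‖deriv (graphCurve γ n f) u‖⁻¹ • ((1 - k u * f u) • n u - deriv f u • deriv γ u)

/-- The extension of the unit normal of a graph which is normal to the level sets. -/
def levelNormal (Ω : Set Plane) (h : Plane → ℝ) (x : Plane) : Plane :=
  ‖gradient (level Ω h) x‖⁻¹ • gradient (level Ω h) x

lemma measurable_levelNormal (Ω : Set Plane) (h : Plane → ℝ) : Measurable (levelNormal Ω h) := by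
  have : Measurable (gradient (level Ω h)) :=
    (InnerProductSpace.toDual ℝ Plane).symm.continuous.measurable.comp (measurable_fderiv ℝ _)
  exact this.norm.inv.smul this

namespace NormalGraph

variable {Ω : Set Plane} {γ n : ℝ → Plane} {k f : ℝ → ℝ} {L R : ℝ} {h : Plane → ℝ}
variable (G : NormalGraph Ω R γ n k L h f)
include G

lemma norm_sq_frame (u a b : ℝ) : ‖a • deriv γ u + b • n u‖ ^ 2 = a ^ 2 + b ^ 2 := by
  have h0 := G.tube.orth u
  rw [norm_add_sq_real, norm_smul, norm_smul, inner_smul_left, inner_smul_right, h0,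
    G.tube.norm_tangent, G.tube.norm_normal, mul_one, mul_one, Real.norm_eq_abs, Real.norm_eq_abs,
    sq_abs, sq_abs]
  simp

lemma stretch_pos (u : ℝ) : 0 < 1 - k u * f u := G.pos u _ (G.mem_Ioo u)

lemma norm_sq_deriv_graphCurve (u : ℝ) :
    ‖deriv (graphCurve γ n f) u‖ ^ 2 = (1 - k u * f u) ^ 2 + deriv f u ^ 2 := by
  rw [(G.hasDerivAt_graphCurve u).deriv, G.norm_sq_frame]

lemma norm_deriv_graphCurve_pos (u : ℝ) : 0 < ‖deriv (graphCurve γ n f) u‖ := by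
  have h1 := G.norm_sq_deriv_graphCurve u
  have h2 := G.stretch_pos u
  refine (norm_nonneg _).lt_of_ne fun h0 => ?_
  rw [← h0] at h1
  nlinarith [sq_nonneg (deriv f u)]

lemma norm_conormal (u : ℝ) :
    ‖(1 - k u * f u) • n u - deriv f u • deriv γ u‖ = ‖deriv (graphCurve γ n f) u‖ := by
  rw [← sq_eq_sq₀ (norm_nonneg _) (norm_nonneg _), G.norm_sq_deriv_graphCurve,
    show (1 - k u * f u) • n u - deriv f u • deriv γ u =
      (-deriv f u) • deriv γ u + (1 - k u * f u) • n u by module, G.norm_sq_frame]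
  ring

lemma norm_graphNormal (u : ℝ) : ‖graphNormal γ n k f u‖ = 1 := by
  rw [graphNormal, norm_smul, G.norm_conormal, norm_inv, norm_norm,
    inv_mul_cancel₀ (G.norm_deriv_graphCurve_pos u).ne']

lemma norm_smul_graphNormal (u : ℝ) : ‖deriv (graphCurve γ n f) u‖ • graphNormal γ n k f u =
    (1 - k u * f u) • n u - deriv f u • deriv γ u := by
  rw [graphNormal, smul_smul, mul_inv_cancel₀ (G.norm_deriv_graphCurve_pos u).ne', one_smul]

lemma gradient_level (u : ℝ) : gradient (level Ω h) (graphCurve γ n f u) =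
    (1 - k u * f u)⁻¹ • ((1 - k u * f u) • n u - deriv f u • deriv γ u) := by
  rw [gradient, graphCurve, (G.hasFDerivAt_level u (G.mem_Ioo u)).fderiv]
  refine ext_inner_right ℝ fun v => ?_
  rw [InnerProductSpace.toDual_symm_apply]
  have := (G.stretch_pos u).ne'
  simp only [sub_apply, smul_apply, smul_eq_mul, innerSL_apply_apply, inner_smul_left,
    inner_sub_left, RCLike.conj_to_real]
  field_simp

lemma levelNormal_graphCurve (u : ℝ) :
    levelNormal Ω h (graphCurve γ n f u) = graphNormal γ n k f u := by
  have h1 := G.stretch_pos u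
  rw [levelNormal, G.gradient_level, norm_smul, G.norm_conormal, norm_inv, Real.norm_eq_abs,
    abs_of_pos h1, graphNormal, smul_smul, mul_inv, inv_inv, mul_right_comm, mul_inv_cancel₀ h1.ne',
    one_mul]

lemma continuousAt_levelNormal (u : ℝ) :
    ContinuousAt (levelNormal Ω h) (graphCurve γ n f u) := by
  have hx : |sdist Ω (graphCurve γ n f u)| < R := by
    rw [graphCurve, G.tube.sdist_eq u _ (G.mem_Ioo u)]; exact abs_lt.2 (G.mem_Ioo u)
  have h1 : ContinuousAt (gradient (level Ω h)) (graphCurve γ n f u) :=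
    (InnerProductSpace.toDual ℝ Plane).symm.continuous.continuousAt.comp
      ((G.contDiffAt_level hx).continuousAt_fderiv (by simp))
  refine ContinuousAt.smul (h1.norm.inv₀ ?_) h1
  rw [G.gradient_level, norm_smul, G.norm_conormal]
  have := G.norm_deriv_graphCurve_pos u
  have h2 := inv_pos.2 (G.stretch_pos u)
  exact mul_ne_zero (norm_ne_zero_iff.2 h2.ne') this.ne'

lemma isFiniteMeasure_graph : IsFiniteMeasure (μH[1].restrict (graphCurve γ n f '' Ico 0 L)) := by
  refine ⟨?_⟩
  rw [Measure.restrict_apply_univ, hausdorffMeasure_image_eq G.contDiff_graphCurve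
    G.injOn_graphCurve Subset.rfl measurableSet_Ico]
  have hc : Continuous (deriv (graphCurve γ n f)) := G.contDiff_graphCurve.continuous_deriv (by simp)
  have := (hc.continuousOn.integrableOn_compact (μ := volume) (isCompact_Icc (a := 0) (b := L))).mono_set
    Ico_subset_Icc_self
  exact this.2

lemma integral_graph {F : Type*} [NormedAddCommGroup F] [NormedSpace ℝ F] (g : Plane → F) :
    ∫ x in graphCurve γ n f '' Ico 0 L, g x ∂μH[1] =
      ∫ u in (0 : ℝ)..L, ‖deriv (graphCurve γ n f) u‖ • g (graphCurve γ n f u) := by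
  rw [integral_curve G.contDiff_graphCurve G.injOn_graphCurve,
    intervalIntegral.integral_of_le G.tube.param.pos.le, ← integral_Icc_eq_integral_Ioc,
    integral_Icc_eq_integral_Ico]

/-- The flux in `integral_indicator_mul_divg` is taken against the speed times the unit normal, so
the area formula turns it into an integral over the graph with respect to `μH[1]`. -/
theorem isPolarGradient : IsPolarGradient ((innerRegion Ω R h).indicator 1)
    (μH[1].restrict (graphCurve γ n f '' Ico 0 L)) (levelNormal Ω h) where
  finite := G.isFiniteMeasure_graph
  measurable := measurable_levelNormal Ω h
  unit := by
    filter_upwards [ae_restrict_mem G.isCompact_graph.measurableSet] with x hx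
    obtain ⟨u, -, rfl⟩ := hx
    rw [G.levelNormal_graphCurve, G.norm_graphNormal]
  gauss_green φ hφ hc := by
    rw [G.integral_indicator_mul_divg hφ hc, G.integral_graph]
    refine congrArg Neg.neg (intervalIntegral.integral_congr fun u _ => ?_)
    rw [G.levelNormal_graphCurve, smul_eq_mul, ← inner_smul_right, G.norm_smul_graphNormal,
      real_inner_comm]

lemma mem_graph (u : ℝ) : graphCurve γ n f u ∈ graphCurve γ n f '' Ico 0 L := by
  rw [G.image_graphCurve]; exact mem_range_self u

/-- The perimeter measure and the normal of a phase whose reduced boundary is the graph. -/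
theorem perim_eq {χ : Plane → ℝ} (hχ : χ =ᵐ[volume] (innerRegion Ω R h).indicator 1) :
    perim χ = μH[1].restrict (graphCurve γ n f '' Ico 0 L) :=
  (G.isPolarGradient.congr hχ.symm).perim_eq

/-- Near the graph the density has the representative `levelNormal`, which is continuous at points
of the graph, so the averages over small balls converge at every such point and not only at almost
every one. -/
theorem measNormal_eq {χ : Plane → ℝ} (hχ : χ =ᵐ[volume] (innerRegion Ω R h).indicator 1)
    (hI : redBdry χ = graphCurve γ n f '' Ico 0 L) (u : ℝ) :
    measNormal χ (graphCurve γ n f u) = graphNormal γ n k f u := by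
  have hp := G.isPolarGradient.congr hχ.symm
  have hpos := (hp.mem_redBdry_iff.1 (hI ▸ G.mem_graph u)).1
  have := G.isFiniteMeasure_graph
  refine hp.measNormal_eq (Metric.nhds_basis_closedBall.tendsto_right_iff.2 fun ε hε => ?_)
  obtain ⟨δ, hδ, hsub⟩ := Metric.continuousAt_iff.1 (G.continuousAt_levelNormal u) ε hε
  rw [G.levelNormal_graphCurve] at hsub
  filter_upwards [Ioo_mem_nhdsGT hδ] with r hr
  refine (convex_closedBall _ _).set_average_mem Metric.isClosed_closedBall (hpos r hr.1).ne'
    (measure_ne_top _ _) ?_ ?_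
  · filter_upwards [ae_restrict_mem Metric.isOpen_ball.measurableSet] with y hy
    exact (hsub (lt_trans hy hr.2)).le
  · exact (Integrable.of_bound hp.measurable.aestronglyMeasurable 1
      (hp.unit.mono fun x hx => hx.le)).integrableOn

/-- The graph is closed and carries the measure, and points of the reduced boundary charge every
ball. This matches the support used in the unit density condition. -/
theorem support_perim_eq {χ : Plane → ℝ} (hχ : χ =ᵐ[volume] (innerRegion Ω R h).indicator 1)
    (hI : redBdry χ = graphCurve γ n f '' Ico 0 L) :
    (perim χ).support = graphCurve γ n f '' Ico 0 L := by
  have hp := G.isPolarGradient.congr hχ.symm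
  rw [G.perim_eq hχ]
  refine Subset.antisymm ?_ fun x hx => ?_
  · refine Measure.support_subset_of_isClosed G.isCompact_graph.isClosed ?_
    exact ae_restrict_mem G.isCompact_graph.measurableSet
  · rw [← hI] at hx
    have := (hp.mem_redBdry_iff.1 hx).1
    rw [Metric.nhds_basis_ball.mem_measureSupport]
    exact fun r hr => this r hr

end NormalGraph

end CircMCF

namespace CircMCF

/-! ### Integration by parts for functions with integrable second derivatives -/

/-- An absolutely continuous `p` is bounded, so the points `(u, p u)` stay in a compact convex set,
on which the `C¹` function `F` is Lipschitz. -/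
lemma absolutelyContinuousOnInterval_comp {F : ℝ × ℝ → ℝ} (hF : ContDiff ℝ 1 F) {p : ℝ → ℝ}
    {a b : ℝ} (hp : AbsolutelyContinuousOnInterval p a b) :
    AbsolutelyContinuousOnInterval (fun u => F (u, p u)) a b := by
  obtain ⟨M, hM⟩ := hp.exists_bound
  obtain ⟨K, hK⟩ := (hF.contDiffOn (s := uIcc a b ×ˢ Icc (-M) M)).exists_lipschitzOnWith (by simp)
    ((convex_uIcc a b).prod (convex_Icc _ _)) (isCompact_uIcc.prod isCompact_Icc)
  have hid : AbsolutelyContinuousOnInterval (fun u : ℝ => u) a b :=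
    (LipschitzWith.id.lipschitzOnWith (s := uIcc a b)).absolutelyContinuousOnInterval
  have hmem {u : ℝ} (hu : u ∈ uIcc a b) : (u, p u) ∈ uIcc a b ×ˢ Icc (-M) M :=
    ⟨hu, abs_le.1 (hM u hu)⟩
  refine squeeze_zero' (Eventually.of_forall fun E => Finset.sum_nonneg fun _ _ => dist_nonneg) ?_
    (by simpa using (Tendsto.add hid hp).const_mul (K : ℝ))
  filter_upwards [mem_inf_of_right (mem_principal_self _)] with E hE
  rw [← Finset.sum_add_distrib, Finset.mul_sum]
  refine Finset.sum_le_sum fun i hi => ?_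
  obtain ⟨h1, h2⟩ := hE.1 i hi
  refine (hK.dist_le_mul _ (hmem h1) _ (hmem h2)).trans ?_
  gcongr
  rw [Prod.dist_eq]
  exact max_le_add_of_nonneg dist_nonneg dist_nonneg

/-- The fundamental theorem of calculus for `F(u, p(u))` if `p` has the weak derivative `g`. -/
lemma integral_eq_sub_of_comp {F : ℝ × ℝ → ℝ} (hF : ContDiff ℝ 1 F) {p g D : ℝ → ℝ} {a b : ℝ}
    (hg : IntervalIntegrable g volume a b) (hp : ∀ a b, p b - p a = ∫ s in a..b, g s)
    (hD : ∀ u, HasDerivAt p (g u) u → HasDerivAt (fun w => F (w, p w)) (D u) u) :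
    ∫ u in a..b, D u = F (b, p b) - F (a, p a) := by
  have hpe : p = fun u => p a + ∫ s in a..u, g s := funext fun u => by rw [← hp a u]; ring
  have h1 := hg.absolutelyContinuousOnInterval_intervalIntegral (c := a) left_mem_uIcc
  have hac : AbsolutelyContinuousOnInterval p a b := by
    rw [hpe]
    have hc : AbsolutelyContinuousOnInterval (fun _ : ℝ => p a) a b :=
      ((LipschitzWith.const (p a)).lipschitzOnWith (s := uIcc a b)).absolutelyContinuousOnInterval
    exact hc.add h1
  rw [← (absolutelyContinuousOnInterval_comp hF hac).integral_deriv_eq_sub]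
  refine intervalIntegral.integral_congr_ae ?_
  filter_upwards [hg.ae_hasDerivAt_integral] with u hu hm
  have h2 := (hu (uIoc_subset_uIcc hm) a left_mem_uIcc).const_add (p a)
  rw [← hpe] at h2
  exact (hD u h2).deriv.symm

end CircMCF

namespace CircMCF

/-! ### The mean curvature of a normal graph -/

/-- In the orthonormal frame `v`, `J v` only the `v` component of the composition survives. The
factor `s ^ 2` admits a tangent of any length and either orientation. -/
lemma trace_lineOf {v w : Plane} (hv : ‖v‖ = 1) {s : ℝ} (hw : w = s • v) (A : Plane →L[ℝ] Plane) :
    s ^ 2 * LinearMap.trace ℝ Plane (((lineOf v).1 ∘L A : Plane →L[ℝ] Plane) : Plane →ₗ[ℝ] Plane) =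
      ⟪w, A w⟫_ℝ := by
  have h1 : (lineOf v).1 = lineProj v := by rw [lineOf, dif_pos hv]
  have h2 := inner_rotJ_self v
  have h2' : ⟪rotJ v, v⟫_ℝ = 0 := by rw [real_inner_comm]; exact h2
  rw [h1, trace_plane hv (by rw [norm_rotJ, hv]) h2, hw]
  simp only [lineProj, ContinuousLinearMap.coe_coe, ContinuousLinearMap.comp_apply,
    ContinuousLinearMap.smulRight_apply, innerSL_apply_apply, inner_smul_right, map_smul,
    inner_smul_left, real_inner_self_eq_norm_sq, hv, RCLike.conj_to_real, h2']
  ring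

namespace NormalGraph

variable {Ω : Set Plane} {γ n : ℝ → Plane} {k f g : ℝ → ℝ} {L R : ℝ} {h : Plane → ℝ}
variable (G : NormalGraph Ω R γ n k L h f)
include G

lemma ae_graph {P : Plane → Prop}
    (hP : ∀ᵐ x ∂(μH[1].restrict (graphCurve γ n f '' Ico 0 L)), P x) :
    ∀ᵐ u ∂(volume.restrict (Ico 0 L)), P (graphCurve γ n f u) := by
  rw [← map_curve_eq G.contDiff_graphCurve G.injOn_graphCurve] at hP
  have h1 := ae_of_ae_map G.contDiff_graphCurve.continuous.measurable.aemeasurable hP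
  rw [ae_withDensity_iff
    (G.contDiff_graphCurve.continuous_deriv (by simp)).measurable.enorm] at h1
  filter_upwards [h1] with u hu
  exact hu (by simpa using (G.norm_deriv_graphCurve_pos u).ne')

/-- The sign of `s` may be left open, because the line spanned by the tangent does not depend on its
orientation. -/
lemma rotJ_graphNormal (u : ℝ) : ∃ s : ℝ, s ^ 2 = ‖deriv (graphCurve γ n f) u‖ ^ 2 ∧
    deriv (graphCurve γ n f) u = s • rotJ (graphNormal γ n k f u) := by
  have h1 := G.norm_graphNormal u
  have h2 : ⟪graphNormal γ n k f u, deriv (graphCurve γ n f) u⟫_ℝ = 0 := by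
    have h0 := G.tube.orth u
    have h0' : ⟪n u, deriv γ u⟫_ℝ = 0 := by rw [real_inner_comm]; exact h0
    rw [(G.hasDerivAt_graphCurve u).deriv, graphNormal, inner_smul_left]
    simp only [inner_sub_left, inner_add_right, inner_smul_left, inner_smul_right, h0, h0',
      real_inner_self_eq_norm_sq, G.tube.norm_tangent, G.tube.norm_normal, RCLike.conj_to_real]
    ring
  have h3 := eq_smul_of_inner_eq_zero h1 (n := rotJ (graphNormal γ n k f u))
    (by rw [norm_rotJ, h1]) (inner_rotJ_self _) h2
  refine ⟨_, ?_, h3⟩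
  conv_rhs => rw [h3]
  rw [norm_smul, norm_rotJ, h1, mul_one, Real.norm_eq_abs, sq_abs]

/-- The first variation of the unit density varifold of the graph. -/
theorem firstVariation {N : Plane → Plane} {V : Measure (Plane × Gr)}
    (hV : V = (μH[1].restrict (graphCurve γ n f '' Ico 0 L)).map fun x => (x, lineOf (rotJ (N x))))
    (hN : ∀ u, N (graphCurve γ n f u) = graphNormal γ n k f u) (hV0 : V ≠ 0) :
    V.fst = μH[1].restrict (graphCurve γ n f '' Ico 0 L) ∧
    ∀ B : Plane → Plane, ContDiff ℝ 1 B →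
      ∫ p, LinearMap.trace ℝ Plane ((p.2.1 ∘L fderiv ℝ B p.1 : Plane →L[ℝ] Plane) :
        Plane →ₗ[ℝ] Plane) ∂V =
      ∫ u in (0 : ℝ)..L, ‖deriv (graphCurve γ n f) u‖⁻¹ *
        ⟪deriv (graphCurve γ n f) u,
          fderiv ℝ B (graphCurve γ n f u) (deriv (graphCurve γ n f) u)⟫_ℝ := by
  -- `Measure.map` of a map which is not almost everywhere measurable is zero, so `V ≠ 0` supplies
  -- measurability.
  have hm : AEMeasurable (fun x => (x, lineOf (rotJ (N x))))
      (μH[1].restrict (graphCurve γ n f '' Ico 0 L)) := by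
    by_contra h0
    rw [Measure.map_of_not_aemeasurable h0] at hV
    exact hV0 hV
  constructor
  · rw [hV, Measure.fst, AEMeasurable.map_map_of_aemeasurable measurable_fst.aemeasurable hm]
    exact Measure.map_id
  · intro B hB
    have hBc := hB.continuous_fderiv (by simp)
    have htr : Continuous fun A : Plane →L[ℝ] Plane => LinearMap.trace ℝ Plane (A : Plane →ₗ[ℝ] Plane) :=
      ((LinearMap.trace ℝ Plane).comp (ContinuousLinearMap.coeLM ℝ)).continuous_of_finiteDimensional
    have hcont : Continuous fun p : Plane × Gr => LinearMap.trace ℝ Plane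
        ((p.2.1 ∘L fderiv ℝ B p.1 : Plane →L[ℝ] Plane) : Plane →ₗ[ℝ] Plane) :=
      htr.comp ((continuous_subtype_val.comp continuous_snd).clm_comp (hBc.comp continuous_fst))
    rw [hV, integral_map hm hcont.aestronglyMeasurable, G.integral_graph]
    refine intervalIntegral.integral_congr fun u _ => ?_
    obtain ⟨s, hs, hds⟩ := G.rotJ_graphNormal u
    have h1 := trace_lineOf (by rw [norm_rotJ, G.norm_graphNormal]) hds
      (fderiv ℝ B (graphCurve γ n f u))
    have h2 := (G.norm_deriv_graphCurve_pos u).ne'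
    simp only [hN, smul_eq_mul]
    rw [← h1, hs]
    field_simp

/-- The derivative of the tangent, in terms of the weak second derivative `g` of the height. -/
lemma hasDerivAt_deriv_graphCurve {u g : ℝ} (hu : HasDerivAt (deriv f) g u) :
    HasDerivAt (deriv (graphCurve γ n f))
      ((-(deriv k u * f u + k u * deriv f u) - k u * deriv f u) • deriv γ u +
        ((1 - k u * f u) * k u + g) • n u) u := by
  have e : deriv (graphCurve γ n f) = fun u => (1 - k u * f u) • deriv γ u + deriv f u • n u :=
    funext fun u => (G.hasDerivAt_graphCurve u).deriv
  rw [e]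
  have h1 := (((G.tube.hasDerivAt_curv u).mul (G.hasDerivAt u)).const_sub 1).smul
    (G.tube.hasDerivAt_tangent u)
  have h2 := hu.smul (G.tube.hasDerivAt_normal u)
  refine (h1.add h2).congr_deriv ?_
  simp only [Pi.mul_apply]
  module

/-- The mean curvature vector of the graph. -/
theorem curvature_ae (hg : ∀ a b, IntervalIntegrable g volume a b)
    (hfg : ∀ a b, deriv f b - deriv f a = ∫ s in a..b, g s) {H : Plane → Plane}
    (hH : Integrable H (μH[1].restrict (graphCurve γ n f '' Ico 0 L)))
    (hmc : ∀ B : Plane → Plane, ContDiff ℝ ∞ B → HasCompactSupport B →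
      -∫ x in graphCurve γ n f '' Ico 0 L, ⟪H x, B x⟫_ℝ ∂μH[1] =
        ∫ u in (0 : ℝ)..L, ‖deriv (graphCurve γ n f) u‖⁻¹ *
          ⟪deriv (graphCurve γ n f) u,
            fderiv ℝ B (graphCurve γ n f u) (deriv (graphCurve γ n f) u)⟫_ℝ) :
    ∀ᵐ u ∂(volume.restrict (Ico 0 L)),
      ‖deriv (graphCurve γ n f) u‖ * ⟪H (graphCurve γ n f u), graphNormal γ n k f u⟫_ℝ =
        k u + (g u * (1 - k u * f u) + (deriv k u * f u + k u * deriv f u) * deriv f u) /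
          ‖deriv (graphCurve γ n f) u‖ ^ 2 := by
  set c := graphCurve γ n f with hc
  -- `W'` is the derivative of the tangent `c'`, and `T'` is the derivative of the unit tangent `c'
  -- / ‖c'‖`, at parameters where `f'` has the derivative `g`.
  set W' : ℝ → Plane := fun u => (-(deriv k u * f u + k u * deriv f u) - k u * deriv f u) •
    deriv γ u + ((1 - k u * f u) * k u + g u) • n u with hW'
  set T' : ℝ → Plane := fun u => ‖deriv c u‖⁻¹ • W' u -
    (⟪deriv c u, W' u⟫_ℝ / ‖deriv c u‖ ^ 3) • deriv c u with hT'
  have c1 : Continuous (deriv c) := G.contDiff_graphCurve.continuous_deriv (by simp)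
  have c2 := G.tube.param.smooth.continuous
  have c3 := G.tube.normal_smooth.continuous
  have c4 := G.tube.curv_smooth.continuous
  have c5 := G.smooth.continuous_deriv (by simp)
  have c6 : Continuous (deriv γ) := G.tube.param.smooth_deriv.continuous
  have c7 := G.smooth.continuous
  have c8 : Continuous (deriv k) := G.tube.curv_smooth.continuous_deriv (by simp)
  have hpos := G.norm_deriv_graphCurve_pos
  have hinv : Continuous fun u => ‖deriv c u‖⁻¹ := c1.norm.inv₀ fun u => (hpos u).ne'
  have hgI : IntegrableOn g (Ico 0 L) := by
    have := (intervalIntegrable_iff_integrableOn_Ico_of_le G.tube.param.pos.le).1 (hg 0 L)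
    exact this
  -- `T'` depends affinely on `g`, with continuous coefficients `P` and `Q`.
  have hT'I : IntegrableOn T' (Ico 0 L) := by
    set P : ℝ → Plane := fun u => ‖deriv c u‖⁻¹ • (W' u - g u • n u) -
      (⟪deriv c u, W' u - g u • n u⟫_ℝ * ‖deriv c u‖⁻¹ ^ 3) • deriv c u with hP
    set Q : ℝ → Plane := fun u => ‖deriv c u‖⁻¹ • n u -
      (⟪deriv c u, n u⟫_ℝ * ‖deriv c u‖⁻¹ ^ 3) • deriv c u with hQ
    have e1 : ∀ u, W' u - g u • n u = (-(deriv k u * f u + k u * deriv f u) -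
        k u * deriv f u) • deriv γ u + ((1 - k u * f u) * k u) • n u := by
      intro u; simp only [hW']; module
    have hPc : Continuous P := by
      simp only [hP, e1]
      fun_prop
    have hQc : Continuous Q := by
      simp only [hQ]
      fun_prop
    have e2 : T' = fun u => P u + g u • Q u := by
      funext u
      simp only [hT', hP, hQ, inner_sub_right, inner_smul_right, div_eq_mul_inv, inv_pow]
      module
    rw [e2]
    refine IntegrableOn.add ((hPc.continuousOn.integrableOn_compact isCompact_Icc).mono_set
      Ico_subset_Icc_self) ?_
    obtain ⟨C, hC⟩ := (isCompact_Icc (a := (0 : ℝ)) (b := L)).exists_bound_of_continuousOn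
      hQc.continuousOn
    refine Integrable.mono' (hgI.norm.mul_const C)
      (hgI.aestronglyMeasurable.smul hQc.aestronglyMeasurable) ?_
    filter_upwards [ae_restrict_mem measurableSet_Ico] with u hu
    rw [norm_smul]
    exact mul_le_mul_of_nonneg_left (hC u (Ico_subset_Icc_self hu)) (norm_nonneg _)
  -- The curvature vector of the graph as a function on the curve itself; injectivity of the
  -- parametrization makes it well defined.
  obtain ⟨X, hX⟩ : ∃ X : Plane → Plane, ∀ u ∈ Ico 0 L, X (c u) = ‖deriv c u‖⁻¹ • T' u := by
    refine ⟨fun x => ‖deriv c (Function.invFunOn c (Ico 0 L) x)‖⁻¹ •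
      T' (Function.invFunOn c (Ico 0 L) x), fun u hu => ?_⟩
    have e : Function.invFunOn c (Ico 0 L) (c u) = u := G.injOn_graphCurve.leftInvOn_invFunOn hu
    simp only [e]
  have hX' : ∀ u ∈ Ico 0 L, ‖deriv c u‖ • X (c u) = T' u := fun u hu => by
    rw [hX u hu, smul_smul, mul_inv_cancel₀ (hpos u).ne', one_smul]
  have hXI : IntegrableOn X (c '' Ico 0 L) μH[1] := by
    rw [integrableOn_curve G.contDiff_graphCurve G.injOn_graphCurve]
    exact (integrableOn_congr_fun hX' measurableSet_Ico).2 hT'I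
  have key (B : Plane → Plane) (hB : ContDiff ℝ ∞ B) (hBc : HasCompactSupport B) :
      ∫ x in c '' Ico 0 L, ⟪H x, B x⟫_ℝ ∂μH[1] = ∫ x in c '' Ico 0 L, ⟪X x, B x⟫_ℝ ∂μH[1] := by
    have hBcont := hB.continuous
    have hB' := hB.continuous_fderiv (by simp)
    have c9 : Continuous c := G.contDiff_graphCurve.continuous
    have hW : ∀ u p : ℝ, (1 - k u * f u) • deriv γ u + p • n u ≠ 0 := by
      intro u p h0
      have h1 := G.norm_sq_frame u (1 - k u * f u) p
      rw [h0] at h1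
      have h2 := G.stretch_pos u
      simp only [norm_zero] at h1
      nlinarith [sq_nonneg p]
    -- The unit tangent paired with the test field, as a `C¹` function of the parameter and of `p =
    -- f'`. Freeing `p` allows `integral_eq_sub_of_comp`, since `f'` has only a weak derivative;
    -- `hW` keeps the tangent nonzero for every `p`.
    set F : ℝ × ℝ → ℝ := fun q =>
      ⟪‖(1 - k q.1 * f q.1) • deriv γ q.1 + q.2 • n q.1‖⁻¹ •
        ((1 - k q.1 * f q.1) • deriv γ q.1 + q.2 • n q.1), B (c q.1)⟫_ℝ with hF
    have hFs : ContDiff ℝ 1 F := by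
      have s1 : ContDiff ℝ 1 (deriv γ) := G.tube.param.smooth_deriv.of_le (by simp)
      have s2 : ContDiff ℝ 1 n := G.tube.normal_smooth.of_le (by simp)
      have s3 : ContDiff ℝ 1 k := G.tube.curv_smooth.of_le (by simp)
      have s4 := G.smooth
      have s5 : ContDiff ℝ 1 (fun q : ℝ × ℝ => (1 - k q.1 * f q.1) • deriv γ q.1 + q.2 • n q.1) := by
        fun_prop
      have s6 : ContDiff ℝ 1 (fun q : ℝ × ℝ => B (c q.1)) :=
        (hB.of_le (by simp)).comp (G.contDiff_graphCurve.comp contDiff_fst)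
      refine ContDiff.inner ℝ (ContDiff.smul (ContDiff.inv (s5.norm ℝ fun q => hW _ _)
        fun q => norm_ne_zero_iff.2 (hW _ _)) s5) s6
    have hFc : ∀ u, F (u, deriv f u) = ⟪‖deriv c u‖⁻¹ • deriv c u, B (c u)⟫_ℝ := fun u => by
      simp only [hF]
      rw [hc, (G.hasDerivAt_graphCurve u).deriv]
    have hFTC := integral_eq_sub_of_comp hFs (D := fun u => ⟪T' u, B (c u)⟫_ℝ +
        ‖deriv c u‖⁻¹ * ⟪deriv c u, fderiv ℝ B (c u) (deriv c u)⟫_ℝ) (hg 0 L) hfg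
      (fun u hu => by
        simp only [hFc]
        have h1 : HasDerivAt (deriv c) (W' u) u := G.hasDerivAt_deriv_graphCurve hu
        have h2 := (h1.norm_sq.sqrt (by positivity [hpos u])).inv (by
          rw [Real.sqrt_sq (norm_nonneg _)]; exact (hpos u).ne')
        simp only [Real.sqrt_sq (norm_nonneg _)] at h2
        have h3 : HasDerivAt (fun w => B (c w)) (fderiv ℝ B (c u) (deriv c u)) u :=
          ((hB.differentiable (by simp) (c u)).hasFDerivAt).comp_hasDerivAt u
            ((G.contDiff_graphCurve.differentiable (by simp) u).hasDerivAt)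
        refine ((h2.smul h1).inner ℝ h3).congr_deriv ?_
        have h4 : ‖deriv c u‖ ≠ 0 := (hpos u).ne'
        simp only [hT', inner_smul_left, inner_sub_left, inner_add_left, RCLike.conj_to_real,
          Pi.smul_apply', Pi.inv_apply]
        field_simp
        ring)
    rw [hFc, hFc] at hFTC
    have hper : c L = c 0 := by
      have := G.periodic_graphCurve 0; rwa [zero_add] at this
    have hper' : deriv c L = deriv c 0 := by
      have h1 : (fun w => c (w + L)) = c := funext G.periodic_graphCurve
      have h2 := deriv_comp_add_const c L 0
      rw [h1, zero_add] at h2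
      exact h2.symm
    rw [hper, hper', sub_self, intervalIntegral.integral_add] at hFTC
    · rw [integral_curve G.contDiff_graphCurve G.injOn_graphCurve (fun x => ⟪X x, B x⟫_ℝ)]
      have h1 := hmc B hB hBc
      have h2 : ∫ u in Ico 0 L, ‖deriv c u‖ • ⟪X (c u), B (c u)⟫_ℝ =
          ∫ u in (0 : ℝ)..L, ⟪T' u, B (c u)⟫_ℝ := by
        rw [intervalIntegral.integral_of_le G.tube.param.pos.le, ← integral_Icc_eq_integral_Ioc,
          integral_Icc_eq_integral_Ico]
        refine setIntegral_congr_fun measurableSet_Ico fun u hu => ?_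
        simp only [← hX' u hu, inner_smul_left, smul_eq_mul, RCLike.conj_to_real]
      rw [h2]
      linarith
    · rw [intervalIntegrable_iff_integrableOn_Ico_of_le G.tube.param.pos.le]
      obtain ⟨C, hC⟩ := hBc.exists_bound_of_continuous hBcont
      refine Integrable.mono' (hT'I.norm.mul_const C)
        (hT'I.aestronglyMeasurable.inner (hBcont.comp c9).aestronglyMeasurable) ?_
      refine Eventually.of_forall fun u => (norm_inner_le_norm _ _).trans ?_
      exact mul_le_mul_of_nonneg_left (hC _) (norm_nonneg _)
    · exact (hinv.mul (c1.inner ((hB'.comp c9).clm_apply c1))).intervalIntegrable _ _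
  have := G.isFiniteMeasure_graph
  -- Both fields give the same first variation, so they agree almost everywhere with respect to the
  -- length measure of the graph.
  have hae := ae_eq_of_integral_contDiff_smul_eq hH.locallyIntegrable hXI.locallyIntegrable
    (fun ψ hψ hψc => by
      have gi {w : Plane → Plane} (hw : Integrable w (μH[1].restrict (c '' Ico 0 L))) :
          Integrable (fun x => ψ x • w x) (μH[1].restrict (c '' Ico 0 L)) := by
        obtain ⟨C, hC⟩ := hψc.exists_bound_of_continuous hψ.continuous
        exact hw.bdd_smul C hψ.continuous.aestronglyMeasurable (Eventually.of_forall hC)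
      refine ext_inner_left ℝ fun e => ?_
      rw [← integral_inner (gi hH), ← integral_inner (gi hXI)]
      have := key (fun x => ψ x • e) (hψ.smul contDiff_const) hψc.smul_right
      simp only [inner_smul_right] at this ⊢
      simpa only [real_inner_comm e] using this)
  filter_upwards [G.ae_graph hae, ae_restrict_mem measurableSet_Ico] with u hu hm
  have h1 := G.tube.orth u
  have h1' : ⟪n u, deriv γ u⟫_ℝ = 0 := by rw [real_inner_comm]; exact h1
  have h2 : ‖deriv c u‖ ≠ 0 := (hpos u).ne'
  have h3 := G.norm_sq_deriv_graphCurve u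
  have h4 : ⟪deriv c u, (1 - k u * f u) • n u - deriv f u • deriv γ u⟫_ℝ = 0 := by
    rw [hc, (G.hasDerivAt_graphCurve u).deriv]
    simp only [inner_sub_right, inner_add_left, inner_smul_left, inner_smul_right, h1, h1',
      real_inner_self_eq_norm_sq, G.tube.norm_tangent, G.tube.norm_normal, RCLike.conj_to_real]
    ring
  have h5 : ⟪W' u, (1 - k u * f u) • n u - deriv f u • deriv γ u⟫_ℝ =
      k u * ‖deriv c u‖ ^ 2 + (g u * (1 - k u * f u) +
        (deriv k u * f u + k u * deriv f u) * deriv f u) := by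
    rw [h3]
    simp only [hW', inner_sub_right, inner_add_left, inner_smul_left, inner_smul_right, h1, h1',
      real_inner_self_eq_norm_sq, G.tube.norm_tangent, G.tube.norm_normal, RCLike.conj_to_real]
    ring
  rw [hu, hX u hm, graphNormal, ← hc, inner_smul_left, inner_smul_right]
  simp only [hT', inner_sub_left (_ • W' u), inner_smul_left, h4, h5, RCLike.conj_to_real]
  field_simp
  ring

end NormalGraph

end CircMCF

namespace CircMCF

/-! ### Translations -/

section Translation

variable {A : Set Plane} {γ n : ℝ → Plane} {k : ℝ → ℝ} {L R : ℝ}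

lemma infDist_translate (A : Set Plane) (z x : Plane) :
    Metric.infDist x {x | x - z ∈ A} = Metric.infDist (x - z) A := by
  rw [← Metric.infDist_image (IsometryEquiv.subRight z).isometry (x := x)]
  congr 1
  exact image_preimage_eq A (IsometryEquiv.subRight z).surjective

lemma sdist_translate (A : Set Plane) (z x : Plane) :
    sdist {x | x - z ∈ A} x = sdist A (x - z) := by
  rw [sdist, infDist_translate, sdist, ← infDist_translate Aᶜ]
  rfl

lemma nrm_translate (A : Set Plane) (z x : Plane) :
    nrm {x | x - z ∈ A} x = nrm A (x - z) := by
  rw [nrm, nrm, gradient, gradient, funext (sdist_translate A z), sub_eq_add_neg x z]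
  simp only [sub_eq_add_neg]
  rw [fderiv_comp_add_right]

lemma frontier_translate (A : Set Plane) (z : Plane) :
    frontier {x | x - z ∈ A} = {x | x - z ∈ frontier A} :=
  ((IsometryEquiv.subRight z).toHomeomorph.preimage_frontier A).symm

lemma IsArcLengthParam.sub_const {z : Plane} (h : IsArcLengthParam (frontier {x | x - z ∈ A}) γ L) :
    IsArcLengthParam (frontier A) (fun u => γ u - z) L where
  pos := h.pos
  smooth := h.smooth.sub contDiff_const
  periodic u := by simp only [h.periodic u]
  unit_speed u := by rw [deriv_sub_const]; exact h.unit_speed u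
  inj u hu v hv huv := h.inj hu hv (sub_left_injective huv)
  range_eq := by
    have h1 := h.range_eq
    rw [frontier_translate] at h1
    ext y
    constructor
    · rintro ⟨u, rfl⟩
      have : γ u ∈ range γ := mem_range_self u
      rw [h1] at this
      exact this
    · intro hy
      have : y + z ∈ range γ := by rw [h1]; simpa using hy
      obtain ⟨u, hu⟩ := this
      exact ⟨u, by simp [hu]⟩

lemma Tube.translate {z : Plane} (T : Tube A R (fun u => γ u - z) n k L) (hA : IsOpen {x | x - z ∈ A})
    (hγ : IsArcLengthParam (frontier {x | x - z ∈ A}) γ L) : Tube {x | x - z ∈ A} R γ n k L where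
  isOpen := hA
  bounded := by
    have h := (T.bounded.vadd z)
    refine h.subset fun x hx => ⟨x - z, hx, ?_⟩
    simp
  param := hγ
  width_pos := T.width_pos
  normal_smooth := T.normal_smooth
  normal_periodic := T.normal_periodic
  norm_normal := T.norm_normal
  orth u := by rw [← T.orth u, deriv_sub_const]
  curv_smooth := T.curv_smooth
  curv_periodic := T.curv_periodic
  hasDerivAt_tangent u := by
    have h := T.hasDerivAt_tangent u
    rwa [show deriv (fun u => γ u - z) = deriv γ from funext fun u => deriv_sub_const _] at h
  hasDerivAt_normal u := by
    have h := T.hasDerivAt_normal u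
    rwa [deriv_sub_const] at h
  inj p hp q hq h := T.inj hp hq (by
    simp only at h ⊢
    rw [sub_add_eq_add_sub, sub_add_eq_add_sub, h])
  sdist_eq u l hl := by
    rw [sdist_translate, ← sub_add_eq_add_sub]
    exact T.sdist_eq u l hl
  surj x hx := by
    rw [sdist_translate] at hx
    obtain ⟨u, hu, h⟩ := T.surj _ hx
    refine ⟨u, hu, ?_⟩
    rw [sdist_translate, ← sub_left_inj (a := z), ← sub_add_eq_add_sub]
    exact h

end Translation

/-- By the area formula with unit speed. The period is thus determined by the curve, independently
of the parametrization. -/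
lemma IsArcLengthParam.hausdorffMeasure_eq {Γ : Set Plane} {γ : ℝ → Plane} {L : ℝ}
    (h : IsArcLengthParam Γ γ L) : μH[1] Γ = ENNReal.ofReal L := by
  have h1 : Γ = γ '' Ico 0 L := by
    ext x
    constructor
    · intro hx
      obtain ⟨u, hu, rfl⟩ := h.exists_mem_Ico 0 hx
      exact ⟨u, by simpa using hu, rfl⟩
    · rintro ⟨u, -, rfl⟩
      exact h.mem u
  rw [h1, hausdorffMeasure_image_eq (h.smooth.of_le (by simp)) h.inj Subset.rfl measurableSet_Ico]
  have : ∀ u, ‖deriv γ u‖ₑ = 1 := fun u => by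
    rw [← ofReal_norm, h.unit_speed u, ENNReal.ofReal_one]
  simp [this]

/-- The average over a closed curve. -/
lemma IsArcLengthParam.setAverage_eq {Γ : Set Plane} {γ : ℝ → Plane} {L : ℝ}
    (h : IsArcLengthParam Γ γ L) {F : Type*} [NormedAddCommGroup F] [NormedSpace ℝ F]
    (g : Plane → F) : ⨍ x in Γ, g x ∂μH[1] = L⁻¹ • ∫ u in Ico 0 L, g (γ u) := by
  have h1 : Γ = γ '' Ico 0 L := by
    ext x
    constructor
    · intro hx
      obtain ⟨u, hu, rfl⟩ := h.exists_mem_Ico 0 hx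
      exact ⟨u, by simpa using hu, rfl⟩
    · rintro ⟨u, -, rfl⟩
      exact h.mem u
  rw [MeasureTheory.setAverage_eq, measureReal_def, h.hausdorffMeasure_eq, ENNReal.toReal_ofReal h.pos.le]
  congr 1
  conv_lhs => rw [h1]
  rw [integral_curve (h.smooth.of_le (by simp)) h.inj]
  simp only [h.unit_speed, one_smul]

/-! ### Integrals of the difference of two phases -/

/-- The jump is `-1` between `0` and `f` if `f > 0`, and `1` between `f` and `0` if `f < 0`; the
orientation convention of interval integrals covers both cases with one sign. -/
lemma integral_jump {R f : ℝ} (hf : f ∈ Ioo (-R) R) {ψ : ℝ → ℝ}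
    (hψ : IntervalIntegrable ψ volume (-R) R) {j : ℝ → ℝ}
    (hj : j =ᵐ[volume.restrict (Ioo (-R) R)]
      fun l => (Ioi f).indicator 1 l - (Ioi 0).indicator 1 l) :
    ∫ l in Ioo (-R) R, j l * ψ l = -∫ l in (0 : ℝ)..f, ψ l := by
  have hR : -R ≤ R := (hf.1.trans hf.2).le
  have hR0 : (0 : ℝ) ∈ Ioo (-R) R := by
    have := hf.1.trans hf.2
    constructor <;> linarith
  have hI : IntegrableOn ψ (Ioo (-R) R) :=
    ((intervalIntegrable_iff_integrableOn_Ioc_of_le hR).1 hψ).mono_set Ioo_subset_Ioc_self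
  have key (a : ℝ) (ha : a ∈ Ioo (-R) R) : ∫ l in Ioo (-R) R, (Ioi a).indicator ψ l =
      ∫ l in a..R, ψ l := by
    rw [setIntegral_indicator measurableSet_Ioi, intervalIntegral.integral_of_le ha.2.le,
      integral_Ioc_eq_integral_Ioo]
    congr 2
    ext l
    simp only [mem_inter_iff, mem_Ioo, mem_Ioi]
    constructor
    · rintro ⟨⟨-, h2⟩, h3⟩; exact ⟨h3, h2⟩
    · rintro ⟨h1, h2⟩; exact ⟨⟨ha.1.trans h1, h2⟩, h1⟩
  have h1 : ∫ l in Ioo (-R) R, j l * ψ l =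
      ∫ l in Ioo (-R) R, ((Ioi f).indicator ψ l - (Ioi 0).indicator ψ l) := by
    refine integral_congr_ae ?_
    filter_upwards [hj] with l hl
    rw [hl]
    by_cases h1 : f < l <;> by_cases h2 : 0 < l <;> simp [indicator, h1, h2]
  have hii (a b : ℝ) (ha : a ∈ Icc (-R) R) (hb : b ∈ Icc (-R) R) : IntervalIntegrable ψ volume a b :=
    hψ.mono_set (by
      rw [uIcc_of_le hR]
      exact uIcc_subset_Icc ha hb)
  rw [h1, integral_sub (hI.indicator measurableSet_Ioi) (hI.indicator measurableSet_Ioi),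
    key f hf, key 0 hR0]
  have h3 := intervalIntegral.integral_add_adjacent_intervals
    (hii 0 f (Ioo_subset_Icc_self hR0) (Ioo_subset_Icc_self hf))
    (hii f R (Ioo_subset_Icc_self hf) ⟨hR, le_rfl⟩)
  linarith

namespace NormalGraph

variable {Ω : Set Plane} {γ n : ℝ → Plane} {k f : ℝ → ℝ} {L R : ℝ} {h : Plane → ℝ}
variable (G : NormalGraph Ω R γ n k L h f)
include G

lemma nonempty : Ω.Nonempty := G.tube.nonempty

lemma indicator_coord (u : ℝ) {l : ℝ} (hl : l ∈ Ioo (-R) R) :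
    Ω.indicator (1 : Plane → ℝ) (γ u + l • n u) = (Ioi 0).indicator 1 l ∧
    (innerRegion Ω R h).indicator (1 : Plane → ℝ) (γ u + l • n u) = (Ioi (f u)).indicator 1 l := by
  have h1 := G.tube.sdist_eq u l hl
  have h2 := sdist_pos_iff G.tube.ne_univ G.nonempty G.tube.isOpen
    (G.tube.param.range_eq ▸ range_nonempty γ) (x := γ u + l • n u)
  have h3 := G.mem_innerRegion_iff (x := γ u + l • n u) (by rw [h1]; exact abs_lt.2 hl)
  rw [h1] at h2
  rw [G.level_coord u hl, sub_pos] at h3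
  constructor
  · by_cases h0 : 0 < l
    · rw [indicator_of_mem (h2.1 h0), indicator_of_mem (mem_Ioi.2 h0)]; rfl
    · rw [indicator_of_notMem (fun h => h0 (h2.2 h)), indicator_of_notMem (s := Ioi _) h0]
  · by_cases h0 : f u < l
    · rw [indicator_of_mem (h3.2 h0), indicator_of_mem (mem_Ioi.2 h0)]; rfl
    · rw [indicator_of_notMem (fun h => h0 (h3.1 h)), indicator_of_notMem (s := Ioi _) h0]

lemma ae_jump {χ : Plane → ℝ} (hχ : χ =ᵐ[volume] (innerRegion Ω R h).indicator 1) :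
    ∀ᵐ u ∂(volume.restrict (Ico 0 L)),
      (fun l => χ (γ u + l • n u) - Ω.indicator 1 (γ u + l • n u))
        =ᵐ[volume.restrict (Ioo (-R) R)]
      fun l => (Ioi (f u)).indicator 1 l - (Ioi 0).indicator 1 l := by
  filter_upwards [G.tube.ae_coord G.pos hχ] with u hu
  filter_upwards [hu, ae_restrict_mem measurableSet_Ioo] with l hl hm
  rw [hl, (G.indicator_coord u hm).1, (G.indicator_coord u hm).2]

lemma ae_eq_indicator_of_le {χ : Plane → ℝ} (hχ : χ =ᵐ[volume] (innerRegion Ω R h).indicator 1) :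
    ∀ᵐ x, R ≤ |sdist Ω x| → χ x - Ω.indicator 1 x = 0 := by
  have hR := G.tube.width_pos
  filter_upwards [hχ] with x hx hs
  have h2 := sdist_pos_iff G.tube.ne_univ G.nonempty G.tube.isOpen
    (G.tube.param.range_eq ▸ range_nonempty γ) (x := x)
  rw [hx]
  rcases le_abs.1 hs with h0 | h0
  · have h3 : x ∈ innerRegion Ω R h := Or.inr (by rw [mem_ofPred_eq]; linarith)
    rw [indicator_of_mem h3, indicator_of_mem (h2.1 (by linarith)), sub_self]
  · have h3 : x ∉ innerRegion Ω R h := fun h3 => by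
      have := G.innerRegion_subset h3
      rw [mem_ofPred_eq] at this
      linarith
    rw [indicator_of_notMem h3, indicator_of_notMem (fun h => by linarith [h2.2 h]), sub_self]

/-- Integrals over the region between the graph and the reference curve. -/
theorem integral_jump_mul {χ : Plane → ℝ} (hχm : Measurable χ)
    (hχ : χ =ᵐ[volume] (innerRegion Ω R h).indicator 1)
    {F : Plane → ℝ} {φ : ℝ → ℝ → ℝ} (hφ : Continuous fun p : ℝ × ℝ => φ p.1 p.2)
    (hF : ∀ u, ∀ l, |l| ≤ R / 8 → F (γ u + l • n u) = φ u l) :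
    ∫ x, (χ x - Ω.indicator 1 x) * F x =
      -∫ u in (0 : ℝ)..L, ∫ l in (0 : ℝ)..f u, (1 - k u * l) * φ u l := by
  have hR := G.tube.width_pos
  have hkc := G.tube.curv_smooth.continuous
  have h1 : ∫ x, (χ x - Ω.indicator 1 x) * F x =
      ∫ x in {x | |sdist Ω x| < R}, (χ x - Ω.indicator 1 x) * F x := by
    rw [← integral_indicator (isOpen_abs_sdist_lt Ω R).measurableSet]
    refine integral_congr_ae ?_
    filter_upwards [G.ae_eq_indicator_of_le hχ] with x hx
    by_cases h0 : |sdist Ω x| < R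
    · rw [indicator_of_mem (s := {x | |sdist Ω x| < R}) h0]
    · rw [indicator_of_notMem (s := {x | |sdist Ω x| < R}) h0, hx (not_lt.1 h0), zero_mul]
  have hsm : MeasurableSet (Ico 0 L ×ˢ Ioo (-R) R) := measurableSet_Ico.prod measurableSet_Ioo
  set P : ℝ × ℝ → ℝ := fun p => (χ (γ p.1 + p.2 • n p.1) - Ω.indicator 1 (γ p.1 + p.2 • n p.1)) *
    ((1 - k p.1 * p.2) * φ p.1 p.2) with hP
  have hmP : Measurable P := by
    have hc : Measurable fun p : ℝ × ℝ => γ p.1 + p.2 • n p.1 := by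
      have := G.tube.param.smooth.continuous
      have := G.tube.normal_smooth.continuous
      exact Continuous.measurable (by fun_prop)
    have hΩ : Measurable (Ω.indicator (1 : Plane → ℝ)) :=
      measurable_one.indicator G.tube.isOpen.measurableSet
    have hc2 : Continuous fun p : ℝ × ℝ => (1 - k p.1 * p.2) * φ p.1 p.2 := by fun_prop
    exact ((hχm.comp hc).sub (hΩ.comp hc)).mul hc2.measurable
  have hbox : ∀ᵐ p ∂((volume.restrict (Ico 0 L)).prod (volume.restrict (Ioo (-R) R))),
      χ (γ p.1 + p.2 • n p.1) - Ω.indicator 1 (γ p.1 + p.2 • n p.1) =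
        (Ioi (f p.1)).indicator 1 p.2 - (Ioi 0).indicator 1 p.2 := by
    have hvol := G.tube.volume_preimage_coord G.pos
      (N := {x | ¬ χ x = (innerRegion Ω R h).indicator 1 x}) hχ
    have h2 : ∀ᵐ p ∂((volume.restrict (Ico 0 L)).prod (volume.restrict (Ioo (-R) R))),
        χ (γ p.1 + p.2 • n p.1) = (innerRegion Ω R h).indicator 1 (γ p.1 + p.2 • n p.1) := by
      rw [Measure.prod_restrict, ae_iff, Measure.restrict_apply' hsm]
      exact hvol
    rw [Measure.prod_restrict] at h2 ⊢
    filter_upwards [h2, ae_restrict_mem hsm] with p hp hm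
    rw [hp, (G.indicator_coord p.1 hm.2).1, (G.indicator_coord p.1 hm.2).2]
  have habs (a b l : ℝ) : |(Ioi a).indicator (1 : ℝ → ℝ) l - (Ioi b).indicator 1 l| ≤ 1 := by
    by_cases h1 : a < l <;> by_cases h2 : b < l <;> simp [indicator, h1, h2]
  -- Beyond height `R / 8` the two phases agree, so `φ` has to represent `F` only on a thinner tube,
  -- where the cutoffs of the calibration are inactive.
  have hzero (a l : ℝ) (ha : |a| ≤ R / 8) (hl : R / 8 < |l|) :
      (Ioi a).indicator (1 : ℝ → ℝ) l - (Ioi 0).indicator 1 l = 0 := by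
    obtain ⟨h1, h2⟩ := abs_le.1 ha
    rcases lt_abs.1 hl with h3 | h3
    · rw [indicator_of_mem (mem_Ioi.2 (by linarith)), indicator_of_mem (mem_Ioi.2 (by linarith))]
      simp
    · rw [indicator_of_notMem (by rw [mem_Ioi]; linarith),
        indicator_of_notMem (by rw [mem_Ioi]; linarith)]
      simp
  have hPI : Integrable P ((volume.restrict (Ico 0 L)).prod (volume.restrict (Ioo (-R) R))) := by
    have hc2 : Continuous fun p : ℝ × ℝ => (1 - k p.1 * p.2) * φ p.1 p.2 := by fun_prop
    obtain ⟨C, hC⟩ := ((isCompact_Icc (a := (0 : ℝ)) (b := L)).prod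
      (isCompact_Icc (a := -R) (b := R))).exists_bound_of_continuousOn hc2.continuousOn
    have hbox' := hbox
    rw [Measure.prod_restrict] at hbox' ⊢
    have hfin : IsFiniteMeasure ((volume : Measure (ℝ × ℝ)).restrict (Ico 0 L ×ˢ Ioo (-R) R)) := by
      refine ⟨?_⟩
      rw [Measure.restrict_apply_univ, Measure.volume_eq_prod, Measure.prod_prod]
      simp [ENNReal.mul_lt_top]
    refine Integrable.of_bound hmP.aestronglyMeasurable C ?_
    filter_upwards [hbox', ae_restrict_mem hsm] with p hp hm
    simp only [hP]
    rw [hp, norm_mul, Real.norm_eq_abs]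
    have h2 := hC p ⟨Ico_subset_Icc_self hm.1, Ioo_subset_Icc_self hm.2⟩
    nlinarith [habs (f p.1) 0 p.2, abs_nonneg ((Ioi (f p.1)).indicator (1 : ℝ → ℝ) p.2 -
      (Ioi 0).indicator 1 p.2), norm_nonneg ((1 - k p.1 * p.2) * φ p.1 p.2)]
  rw [h1, G.tube.integral_tube G.pos]
  have h2 : ∫ p in Ico 0 L ×ˢ Ioo (-R) R, (1 - k p.1 * p.2) •
      ((χ (γ p.1 + p.2 • n p.1) - Ω.indicator 1 (γ p.1 + p.2 • n p.1)) *
        F (γ p.1 + p.2 • n p.1)) =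
      ∫ p, P p ∂((volume.restrict (Ico 0 L)).prod (volume.restrict (Ioo (-R) R))) := by
    have hbox' := hbox
    rw [Measure.prod_restrict] at hbox' ⊢
    refine integral_congr_ae ?_
    filter_upwards [hbox', ae_restrict_mem hsm] with p hp hm
    simp only [hP, smul_eq_mul]
    rw [hp]
    by_cases h3 : |p.2| ≤ R / 8
    · rw [hF p.1 p.2 h3]; ring
    · rw [hzero _ _ (G.le p.1) (not_le.1 h3)]; ring
  rw [h2, integral_prod _ hPI, intervalIntegral.integral_of_le G.tube.param.pos.le,
    ← integral_Icc_eq_integral_Ioc, integral_Icc_eq_integral_Ico, ← integral_neg]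
  refine integral_congr_ae ?_
  filter_upwards [G.ae_jump hχ] with u hu
  exact integral_jump (G.mem_Ioo u) (Continuous.intervalIntegrable (by fun_prop) _ _) hu

end NormalGraph

end CircMCF

namespace CircMCF

/-! ### The weak solution at a time in the perturbative graph regime -/

/-- The data of the weak solution and of the shifted strong solution at the time `t`, in terms of an
arc-length parametrization `γ` of the interface of the latter, with normal `ν`, curvature `k`,
and a height function `f` with weak second derivative `g`. -/
structure GraphSlice {n : ℕ} (S : Setting n) (t δ ε : ℝ) (γ ν : ℝ → Plane) (k f g : ℝ → ℝ) (L : ℝ)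
    (h : Plane → ℝ) : Prop where
  radius_pos : 0 < S.rT t
  graph : NormalGraph (S.shiftedA t) (S.rT t / 2) γ ν k L h f
  tube : Tube (S.A (S.T t)) (S.rT t / 2) (fun u => γ u - S.z t) ν k L
  nrm_eq : ∀ u, nrm (S.A (S.T t)) (γ u - S.z t) = ν u
  curv_bound : ∀ u, |S.rT t * k u - 1| ≤ δ
  deriv_curv_bound : ∀ u, S.rT t ^ 2 * |deriv k u| ≤ δ
  length_bound : |L - 2 * Real.pi * S.rT t| ≤ δ * (2 * Real.pi * S.rT t)
  height_bound : ∀ u, |f u| ≤ ε * S.rT t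
  slope_bound : ∀ u, |deriv f u| ≤ ε
  memLp : MemLp g 2 (volume.restrict (Icc 0 L))
  intervalIntegrable : ∀ a b, IntervalIntegrable g volume a b
  deriv_sub : ∀ a b, deriv f b - deriv f a = ∫ s in a..b, g s
  phase : (fun x => S.χ 0 x t) =ᵐ[volume]
    (innerRegion (S.shiftedA t) (S.rT t / 2) h).indicator 1
  phase_last : (fun x => 1 - S.χ 0 x t) =ᵐ[volume] fun x => S.χ (Fin.last (n + 1)) x t
  redBdry_eq : redBdry (fun x => S.χ 0 x t) = graphCurve γ ν f '' Ico 0 L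
  curvature : ∀ᵐ u ∂(volume.restrict (Ico 0 L)),
    ‖deriv (graphCurve γ ν f) u‖ * ⟪S.H (graphCurve γ ν f u) t, graphNormal γ ν k f u⟫_ℝ =
      k u + (g u * (1 - k u * f u) + (deriv k u * f u + k u * deriv f u) * deriv f u) /
        ‖deriv (graphCurve γ ν f) u‖ ^ 2
  shift_center : HasDerivAt S.z ((6 / S.rT t ^ 2) • L⁻¹ • ∫ u in (0 : ℝ)..L, f u • ν u) t
  shift_time : HasDerivAt S.T (1 + 4 / S.rT t * (L⁻¹ * ∫ u in (0 : ℝ)..L, f u)) t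

lemma IsH2.contDiff {f : ℝ → ℝ} (hf : IsH2 f) : ContDiff ℝ 1 f := by
  obtain ⟨h1, g, hg, hfg⟩ := hf
  refine contDiff_one_iff_deriv.2 ⟨h1, ?_⟩
  have hi (a b : ℝ) : IntervalIntegrable g volume a b := by
    have := (hg (min a b) (max a b)).integrable one_le_two
    rw [intervalIntegrable_iff]
    exact IntegrableOn.mono_set this uIoc_subset_uIcc
  have : deriv f = fun b => deriv f 0 + ∫ s in (0 : ℝ)..b, g s := funext fun b => by
    rw [← hfg 0 b]; ring
  rw [this]
  exact continuous_const.add (intervalIntegral.continuous_primitive hi 0)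

/-- The length is the `μH[1]` measure of the boundary, hence the same as for the parametrization
provided by `CloseToCircle`. -/
lemma CloseToCircle.length_bound {δ r : ℝ} {Ω : Set Plane} (h : CloseToCircle δ r Ω) (hr : 0 < r)
    {γ : ℝ → Plane} {L : ℝ} (hγ : IsArcLengthParam (frontier Ω) γ L) :
    |L - 2 * Real.pi * r| ≤ δ * (2 * Real.pi * r) := by
  obtain ⟨γ₂, L₂, hγ₂, hL, -⟩ := h.param
  have h1 : L = L₂ := by
    have := hγ.hausdorffMeasure_eq.symm.trans hγ₂.hausdorffMeasure_eq
    rwa [ENNReal.ofReal_eq_ofReal_iff hγ.pos.le hγ₂.pos.le] at this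
  have hp : 0 < 2 * Real.pi * r := by positivity
  rw [one_div, inv_mul_le_iff₀ hp] at hL
  rw [h1]
  linarith

lemma fst_ne_zero_of_measure_ne_zero {μ : Measure Plane} {V : Measure (Plane × Gr)} (hμ : μ ≠ 0)
    (h : μ ≤ V.fst) : V ≠ 0 := by
  rintro rfl
  rw [Measure.fst_zero] at h
  exact hμ (le_antisymm h (Measure.zero_le _))

variable {n : ℕ} {S : Setting n} {t δ Cζ : ℝ}

lemma Setting.Standing.T_mem (hS : S.Standing δ Cζ) (ht : t ∈ Ioo 0 S.tχ) :
    S.T t ∈ Ioo 0 S.Text := hS.T_bij.mapsTo ht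

lemma Setting.r_pos {s : ℝ} (hs : s ∈ Ioo 0 S.Text) : 0 < S.r s :=
  Real.sqrt_pos.2 (by linarith [hs.2])

/-- The phases differ only between `0` and `f`, and there `ζ = 1` because `|f| ≤ r / (16 * Cζ)`. The
error height is therefore exactly `f`, with no correction from the cutoff. -/
lemma NormalGraph.height_integral {Ω : Set Plane} {γ ν : ℝ → Plane} {k f : ℝ → ℝ} {L r : ℝ}
    {h : Plane → ℝ} (G : NormalGraph Ω (r / 2) γ ν k L h f) (hr : 0 < r) {ζ : ℝ → ℝ}
    (hC : 0 < Cζ) (hζ : IsHeightCutoff Cζ ζ) {u : ℝ} (hf : |f u| ≤ r / (16 * Cζ)) {χ₀ χ₁ : ℝ → ℝ}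
    (hχ : (fun l => χ₀ l - χ₁ l) =ᵐ[volume.restrict (Ioo (-(r / 2)) (r / 2))]
      fun l => (Ioi (f u)).indicator 1 l - (Ioi 0).indicator 1 l) :
    (∫ l in (0 : ℝ)..(r / 2), (χ₁ l - χ₀ l) * ζ (l / r)) -
      ∫ l in (-(r / 2))..(0 : ℝ), (χ₀ l - χ₁ l) * ζ (l / r) = f u := by
  have hζc : Continuous fun l => ζ (l / r) := hζ.smooth.continuous.comp (by fun_prop)
  have hj := integral_jump (G.mem_Ioo u) (hζc.intervalIntegrable _ _) hχ
  have hle : -(r / 2) ≤ r / 2 := by linarith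
  have hI : IntegrableOn (fun l => (χ₀ l - χ₁ l) * ζ (l / r)) (Ioo (-(r / 2)) (r / 2)) := by
    have h1 : IntegrableOn (fun l => ((Ioi (f u)).indicator (1 : ℝ → ℝ) l -
        (Ioi 0).indicator 1 l) * ζ (l / r)) (Ioo (-(r / 2)) (r / 2)) := by
      have h2 : IntegrableOn (fun l => ζ (l / r)) (Ioo (-(r / 2)) (r / 2)) :=
        (hζc.continuousOn.integrableOn_compact isCompact_Icc).mono_set Ioo_subset_Icc_self
      refine ((h2.indicator (measurableSet_Ioi (a := f u))).sub
        (h2.indicator (measurableSet_Ioi (a := (0 : ℝ))))).congr (Eventually.of_forall fun l => ?_)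
      by_cases h1 : f u < l <;> by_cases h2 : 0 < l <;> simp [indicator, h1, h2]
    exact Integrable.congr h1 (hχ.mono fun l hl => by simp only [hl])
  have hII : IntervalIntegrable (fun l => (χ₀ l - χ₁ l) * ζ (l / r)) volume (-(r / 2)) (r / 2) :=
    (intervalIntegrable_iff_integrableOn_Ioo_of_le hle).2 hI
  have hs := intervalIntegral.integral_add_adjacent_intervals
    (hII.mono_set (c := -(r / 2)) (d := 0) (by
      rw [uIcc_of_le hle]; exact uIcc_subset_Icc ⟨le_rfl, hle⟩ ⟨by linarith, by linarith⟩))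
    (hII.mono_set (c := 0) (d := r / 2) (by
      rw [uIcc_of_le hle]; exact uIcc_subset_Icc ⟨by linarith, by linarith⟩ ⟨hle, le_rfl⟩))
  rw [intervalIntegral.integral_of_le hle, integral_Ioc_eq_integral_Ioo, hj] at hs
  have h1 : ∫ l in (0 : ℝ)..(r / 2), (χ₁ l - χ₀ l) * ζ (l / r) =
      -∫ l in (0 : ℝ)..(r / 2), (χ₀ l - χ₁ l) * ζ (l / r) := by
    rw [← intervalIntegral.integral_neg]
    refine intervalIntegral.integral_congr fun l _ => ?_
    ring
  have h2 : ∫ l in (0 : ℝ)..f u, ζ (l / r) = f u := by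
    have : ∀ l ∈ uIcc 0 (f u), ζ (l / r) = 1 := fun l hl => by
      refine hζ.eq_one _ ?_
      have h3 : |l| ≤ |f u| := by
        rcases mem_uIcc.1 hl with h | h
        · rw [abs_of_nonneg h.1, abs_of_nonneg (h.1.trans h.2)]; exact h.2
        · rw [abs_of_nonpos h.2, abs_of_nonpos (h.1.trans h.2)]; linarith
      rw [abs_div, abs_of_pos hr, div_le_iff₀ hr]
      refine (h3.trans hf).trans (le_of_eq ?_)
      field_simp
    rw [intervalIntegral.integral_congr this]
    simp
  rw [h1]
  linarith

/-- At times in the perturbative graph regime, everything is given in terms of a height function. -/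
theorem Setting.exists_graphSlice {C C' : ℝ} (hC : 1 ≤ C) (hCζ : 1 ≤ Cζ) (hδ : δ < 1)
    (hS : S.Standing δ Cζ) (ht : t ∈ Ioo 0 S.tχ)
    (hreg : IsRegularSlice (fun i x => S.χ i x t) (S.V t) fun x => S.H x t)
    (hfin : volume {x | S.χ 0 x t = 1} < ⊤) (hode : S.ShiftODE t)
    (hP : S.PerturbativeRegime C C' Cζ t) :
    ∃ γ ν k f g L h, GraphSlice S t δ (max (1 / (16 * C)) (1 / C')) γ ν k f g L h := by
  have hT := hS.T_mem ht
  have hr : 0 < S.rT t := S.r_pos hT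
  have hclose := hS.circular _ hT
  change CloseToCircle δ (S.rT t) (S.A (S.T t)) at hclose
  obtain ⟨h, hI, hh, γ, L, hγ, hf2, hslope⟩ := hP.graph
  have hγ' : IsArcLengthParam (frontier (S.A (S.T t))) (fun u => γ u - S.z t) L :=
    IsArcLengthParam.sub_const hγ
  have tube := hclose.tube_of_param hδ hr hγ'
  set ν : ℝ → Plane := fun u => nrm (S.A (S.T t)) (γ u - S.z t) with hν
  obtain ⟨k, hk⟩ : ∃ k : ℝ → ℝ, (fun u => ⟪deriv (deriv fun u => γ u - S.z t) u,
    nrm (S.A (S.T t)) (γ u - S.z t)⟫_ℝ) = k := ⟨_, rfl⟩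
  rw [hk] at tube
  have hopen : IsOpen (S.shiftedA t) := tube.isOpen.preimage (by fun_prop)
  have tube' : Tube (S.shiftedA t) (S.rT t / 2) γ ν k L := Tube.translate tube hopen hγ
  set f : ℝ → ℝ := fun u => h (γ u) with hfdef
  have hle (u : ℝ) : |f u| ≤ S.rT t / (16 * max C Cζ) := hh _ (hγ.mem u)
  have hmax : 1 ≤ max C Cζ := hC.trans (le_max_left _ _)
  have G : NormalGraph (S.shiftedA t) (S.rT t / 2) γ ν k L h f :=
    { tube := tube'
      pos := fun u l hl => hclose.one_sub_pos hδ hr tube (fun u => rfl) u hl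
      nrm_eq := fun u => nrm_translate _ _ _
      height := fun u => rfl
      smooth := hf2.contDiff
      -- The tube has width `R = r / 2`, so `R / 8 = r / 16`, and `max C Cζ ≥ 1`.
      le := fun u => (hle u).trans (by
        rw [div_div, div_le_div_iff_of_pos_left hr (by positivity) (by norm_num)]
        nlinarith) }
  obtain ⟨-, g, hg, hfg⟩ := hf2
  have hgi (a b : ℝ) : IntervalIntegrable g volume a b := by
    have := (hg (min a b) (max a b)).integrable one_le_two
    rw [intervalIntegrable_iff]
    exact IntegrableOn.mono_set this uIoc_subset_uIcc
  have hχm : Measurable fun x => S.χ 0 x t :=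
    (hS.weak.measurable_phase 0).comp (measurable_id.prodMk measurable_const)
  have hlast : (fun x => 1 - S.χ 0 x t) =ᵐ[volume] fun x => S.χ (Fin.last (n + 1)) x t := by
    have h1 : ∀ᵐ x, ∀ i, i ≠ 0 → i ≠ Fin.last (n + 1) → S.χ i x t = 0 := by
      rw [ae_all_iff]
      intro i
      by_cases h0 : i = 0
      · exact Eventually.of_forall fun x h => absurd h0 h
      by_cases h2 : i = Fin.last (n + 1)
      · exact Eventually.of_forall fun x _ h => absurd h2 h
      filter_upwards [hP.two_phase i h0 h2] with x hx _ _ using hx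
    filter_upwards [h1, hreg.partition] with x hx hsum
    have hne : (0 : Fin (n + 2)) ≠ Fin.last (n + 1) := (Fin.last_pos).ne
    rw [← Finset.add_sum_erase _ _ (Finset.mem_univ (0 : Fin (n + 2))),
      ← Finset.add_sum_erase _ _ (Finset.mem_erase.2 ⟨hne.symm, Finset.mem_univ (Fin.last (n + 1))⟩),
      Finset.sum_eq_zero (s := (Finset.univ.erase 0).erase _)] at hsum
    · linarith
    · intro i hi
      rw [Finset.mem_erase, Finset.mem_erase] at hi
      exact hx i hi.2.1 hi.1
  have hrb := redBdry_one_sub hχm (fun x => hS.weak.indicator 0 x t) (hreg.perimeter 0) hlast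
  have hred : redBdry (fun x => S.χ 0 x t) = graphCurve γ ν f '' Ico 0 L := by
    have h1 : S.iface 0 (Fin.last (n + 1)) t = redBdry (fun x => S.χ 0 x t) := by
      rw [Setting.iface, hrb.1, inter_self]
    rw [← h1, hI, G.image_graphCurve, ← hγ.range_eq, ← range_comp]
    congr 1
    funext u
    simp only [Function.comp_apply, graphCurve, G.nrm_eq u, hfdef]
  have hphase := G.phase_ae_eq hχm (fun x => hS.weak.indicator 0 x t) (hreg.perimeter 0) hred hfin
  have hfinm := G.isFiniteMeasure_graph
  -- The mass of the varifold dominates half the sum of the perimeters, and the perimeter of the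
  -- first phase is positive since its reduced boundary is nonempty.
  have hV0 : S.V t ≠ 0 := by
    refine fst_ne_zero_of_measure_ne_zero ?_ hreg.compatible
    intro h0
    have h1 := congrArg (fun m : Measure Plane => m univ) h0
    simp only [Measure.smul_apply, Measure.coe_zero, Pi.zero_apply, smul_eq_mul, mul_eq_zero] at h1
    rcases h1 with h1 | h1
    · norm_num at h1
    rw [Measure.finsetSum_apply, Finset.sum_eq_zero_iff] at h1
    have h2 := h1 0 (Finset.mem_univ _)
    obtain ⟨x, hx⟩ : (redBdry fun x => S.χ 0 x t).Nonempty := by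
      rw [hred]; exact ⟨_, G.mem_graph 0⟩
    have h3 := hx.1 1 one_pos
    exact h3.ne' (measure_mono_null (subset_univ _) h2)
  have hVeq := hP.unit_density
  rw [G.support_perim_eq hphase hred] at hVeq
  obtain ⟨hfst, hvar⟩ := G.firstVariation hVeq (fun u => G.measNormal_eq hphase hred u) hV0
  have hcurv := G.curvature_ae hgi hfg (H := fun x => S.H x t)
    (by
      have := hreg.curvature.1
      rw [hfst] at this
      exact this.integrable one_le_two)
    (fun B hB hBc => by
      have := hreg.curvature.2 B hB hBc
      rw [hfst, hvar B (hB.of_le (by simp))] at this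
      exact this)
  -- The averages in the shift equations can now be written with `f` in place of the error height.
  have hheight : ∀ᵐ u ∂(volume.restrict (Ico 0 L)), S.height (γ u) t = f u := by
    filter_upwards [G.ae_jump hphase] with u hu
    have h1 := G.height_integral hr (by linarith) hS.heightCutoff
      ((hle u).trans (by gcongr; exact le_max_right _ _)) hu
    rw [← h1, Setting.height, G.nrm_eq]
    rfl
  have hIoc : (volume.restrict (Ico 0 L)) = volume.restrict (Ioc 0 L) := restrict_Ico_eq_restrict_Ioc
  refine ⟨γ, ν, k, f, g, L, h, hr, G, tube, fun u => rfl, fun u => ?_, fun u => ?_,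
    hclose.length_bound hr hγ', fun u => ?_, fun u => (hslope u).trans (le_max_right _ _), hg 0 L,
    hgi, hfg, hphase, hlast, hred, hcurv, ?_, ?_⟩
  · have h1 := (hclose.curv_bounds tube (fun u => rfl) u).1
    have : S.rT t * k u - 1 = S.rT t * (k u - 1 / S.rT t) := by field_simp
    rwa [this, abs_mul, abs_of_pos hr]
  · exact (hclose.curv_bounds tube (fun u => rfl) u).2
  · refine (hle u).trans ?_
    have h1 : S.rT t / (16 * max C Cζ) ≤ 1 / (16 * C) * S.rT t := by
      rw [div_mul_eq_mul_div, one_mul]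
      gcongr
      exact le_max_left _ _
    exact h1.trans (mul_le_mul_of_nonneg_right (le_max_left _ _) hr.le)
  · have h1 := hode.1
    rw [hγ.setAverage_eq] at h1
    refine h1.congr_deriv ?_
    rw [intervalIntegral.integral_of_le hγ.pos.le, ← hIoc]
    congr 2
    refine integral_congr_ae ?_
    filter_upwards [hheight] with u hu
    rw [hu, G.nrm_eq]
  · have h1 := hode.2
    rw [hγ.setAverage_eq] at h1
    refine h1.congr_deriv ?_
    rw [intervalIntegral.integral_of_le hγ.pos.le, ← hIoc, smul_eq_mul]
    congr 3
    exact integral_congr_ae hheight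

end CircMCF

namespace CircMCF

/-! ### First order derivatives of the shifted calibration -/

lemma exists_comp_shift {E : Type*} [NormedAddCommGroup E] [NormedSpace ℝ E] {z : ℝ → Plane}
    {T : ℝ → ℝ} {zd : Plane} {Td t : ℝ} (hz : HasDerivAt z zd t) (hT : HasDerivAt T Td t) (x : Plane) :
    ∃ Φ' : Plane × ℝ →L[ℝ] Plane × ℝ, (∀ v w, Φ' (v, w) = (v - w • zd, w * Td)) ∧
      ∀ (F : Plane × ℝ → E) (F' : Plane × ℝ →L[ℝ] E), HasFDerivAt F F' (x - z t, T t) →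
        HasFDerivAt (fun p : Plane × ℝ => F (p.1 - z p.2, T p.2)) (F' ∘L Φ') (x, t) := by
  have h1 : HasFDerivAt (fun p : Plane × ℝ => z p.2) _ (x, t) :=
    HasFDerivAt.comp (x, t) hz.hasFDerivAt hasFDerivAt_snd
  have h2 : HasFDerivAt (fun p : Plane × ℝ => T p.2) _ (x, t) :=
    HasFDerivAt.comp (x, t) hT.hasFDerivAt hasFDerivAt_snd
  refine ⟨_, fun v w => ?_, fun F F' hF => HasFDerivAt.comp (x, t) hF
    ((hasFDerivAt_fst.sub h1).prodMk h2)⟩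
  simp

namespace GraphSlice

variable {n : ℕ} {S : Setting n} {t δ ε Cζ : ℝ} {γ ν : ℝ → Plane} {k f g : ℝ → ℝ} {L : ℝ}
  {h : Plane → ℝ}

/-- From `|r k| ≤ 2` and `|l| ≤ r / 16` follows `|k l| ≤ 1 / 8`. The uniform lower bound keeps the
denominators `1 - k l` away from zero. -/
lemma stretch_ge (G : GraphSlice S t δ ε γ ν k f g L h) (hδ : δ < 1) {u l : ℝ}
    (hl : |l| ≤ S.rT t / 16) : 7 / 8 ≤ 1 - k u * l := by
  have h1 := abs_le.1 (G.curv_bound u)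
  have hr := G.radius_pos
  have h2 : |k u * l| ≤ 1 / 8 := by
    have h3 : |S.rT t * k u| ≤ 2 := abs_le.2 ⟨by linarith, by linarith⟩
    rw [abs_mul, abs_of_pos hr] at h3
    rw [abs_mul]
    calc |k u| * |l| ≤ |k u| * (S.rT t / 16) := by gcongr
      _ ≤ 1 / 8 := by linarith
  linarith [(abs_le.1 h2).2]

/-- The shifted calibration in a neighborhood of the interface. -/
theorem hasFDerivAt_fields (G : GraphSlice S t δ ε γ ν k f g L h) (hδ : δ < 1)
    (hS : S.Standing δ Cζ) (ht : t ∈ Ioo 0 S.tχ) {zd : Plane} {Td : ℝ} (hz : HasDerivAt S.z zd t)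
    (hT : HasDerivAt S.T Td t) (u : ℝ) {l : ℝ} (hl : |l| ≤ S.rT t / 16) :
    ∃ X' B' : Plane × ℝ →L[ℝ] Plane, ∃ W' : Plane × ℝ →L[ℝ] ℝ,
      HasFDerivAt (fun p : Plane × ℝ => S.shift S.xi p.1 p.2) X' (γ u + l • ν u, t) ∧
      HasFDerivAt (fun p : Plane × ℝ => S.shift S.vel p.1 p.2) B' (γ u + l • ν u, t) ∧
      HasFDerivAt (fun p : Plane × ℝ => S.shift (S.weight 0) p.1 p.2) W' (γ u + l • ν u, t) ∧
      (∀ v w, X' (v, w) =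
        (-((k u * ⟪deriv γ u, v - w • zd⟫_ℝ + w * Td * deriv k u) / (1 - k u * l))) • deriv γ u) ∧
      (∀ v, B' (v, 0) = (⟪deriv γ u, v⟫_ℝ / (1 - k u * l)) •
        (deriv k u • ν u - k u ^ 2 • deriv γ u)) ∧
      (∀ v w, W' (v, w) = -(⟪ν u, v - w • zd⟫_ℝ - w * Td * k u) / S.rT t ^ 2 -
        w * (2 * l * Td / S.rT t ^ 4)) ∧
      S.shift S.xi (γ u + l • ν u) t = ν u ∧
      S.shift S.vel (γ u + l • ν u) t = k u • ν u ∧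
      S.shift (S.weight 0) (γ u + l • ν u) t = -l / S.rT t ^ 2 := by
  have hr := G.radius_pos
  have hTm := hS.T_mem ht
  have hlR : l ∈ Ioo (-(S.rT t / 2)) (S.rT t / 2) := abs_lt.1 (by linarith)
  obtain ⟨σ', κ', N', hσ, hκ, hN, hσ', hκ', hN'⟩ := hS.strong.hasFDerivAt hδ
    (fun s hs => S.r_pos hs) (by unfold Setting.r; fun_prop) hS.circular hTm G.tube G.nrm_eq u hlR
  have hdγ : deriv (fun u => γ u - S.z t) u = deriv γ u := deriv_sub_const _
  rw [hdγ] at hκ' hN'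
  have hx : γ u - S.z t + l • ν u = γ u + l • ν u - S.z t := by abel
  rw [hx] at hσ hκ hN
  set x := γ u + l • ν u with hxd
  obtain ⟨Φ', hΦ', hcomp⟩ := exists_comp_shift (E := ℝ) hz hT x
  obtain ⟨Ψ, hΨ, hcomp2⟩ := exists_comp_shift (E := Plane) hz hT x
  obtain rfl : Ψ = Φ' := by
    ext1 <;> ext1 <;> simp [hΦ', hΨ]
  have hσ2 := hcomp _ _ hσ
  have hκ2 := hcomp _ _ hκ
  have hN2 := hcomp2 _ _ hN
  simp only at hσ2 hκ2 hN2
  have hT2 : HasFDerivAt (fun p : Plane × ℝ => S.T p.2) _ (x, t) :=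
    HasFDerivAt.comp (x, t) hT.hasFDerivAt hasFDerivAt_snd
  have hs0 : sdist (S.A (S.T t)) (x - S.z t) = l := by
    rw [← hx]; exact G.tube.sdist_eq u l hlR
  have hrc : Continuous S.r := by unfold Setting.r; fun_prop
  have hrT : S.r (S.T t) = S.rT t := rfl
  -- Since `|l| / r ≤ 1 / 16 < 1 / 8`, near this point `η` equals `1` and the weight profile is
  -- linear, also at nearby times.
  have hsmall : ∀ᶠ p : Plane × ℝ in 𝓝 (x, t),
      |sdist (S.A (S.T p.2)) (p.1 - S.z p.2) / S.r (S.T p.2)| < 1 / 8 := by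
    have hc : ContinuousAt (fun p : Plane × ℝ =>
        sdist (S.A (S.T p.2)) (p.1 - S.z p.2) / S.r (S.T p.2)) (x, t) :=
      hσ2.continuousAt.div (hrc.continuousAt.comp hT2.continuousAt) (by simp only [hrT]; exact hr.ne')
    refine hc.abs.eventually (gt_mem_nhds ?_)
    simp only [hs0, hrT, abs_div, abs_of_pos hr]
    rw [div_lt_iff₀ hr]
    linarith
  have hbelow : ∀ᶠ p : Plane × ℝ in 𝓝 (x, t), S.T p.2 < S.Text :=
    hT2.continuousAt.eventually (gt_mem_nhds hTm.2)
  have hη := hS.calibrationCutoff.eq_one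
  have hw := hS.weightProfile.eq_neg
  have hXe : (fun p : Plane × ℝ => S.shift S.xi p.1 p.2) =ᶠ[𝓝 (x, t)] fun p =>
      nrm (S.A (S.T p.2)) (proj (S.A (S.T p.2)) (p.1 - S.z p.2)) := by
    filter_upwards [hsmall] with p hp
    rw [Setting.shift, Setting.xi, hη _ hp.le, one_smul]
  have hBe : (fun p : Plane × ℝ => S.shift S.vel p.1 p.2) =ᶠ[𝓝 (x, t)] fun p =>
      curv (S.A (S.T p.2)) (proj (S.A (S.T p.2)) (p.1 - S.z p.2)) •
        nrm (S.A (S.T p.2)) (proj (S.A (S.T p.2)) (p.1 - S.z p.2)) := by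
    filter_upwards [hsmall] with p hp
    rw [Setting.shift, Setting.vel, hη _ hp.le, one_smul]
  have hsq (s : ℝ) (hs : s < S.Text) : S.r s ^ 2 = 2 * (S.Text - s) :=
    Real.sq_sqrt (by linarith)
  -- Using `r² = 2 (Text - T)`, the weight becomes the signed distance divided by an affine function
  -- of `T`, so no square root has to be differentiated.
  have hWe : (fun p : Plane × ℝ => S.shift (S.weight 0) p.1 p.2) =ᶠ[𝓝 (x, t)] fun p =>
      -sdist (S.A (S.T p.2)) (p.1 - S.z p.2) * (2 * (S.Text - S.T p.2))⁻¹ := by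
    filter_upwards [hsmall, hbelow] with p hp hp2
    rw [Setting.shift, Setting.weight, if_pos rfl, hw _ (hp.le.trans (by norm_num)), ← hsq _ hp2]
    field_simp
  have hNv : nrm (S.A (S.T t)) (proj (S.A (S.T t)) (x - S.z t)) = ν u := by
    rw [← hx]
    exact G.tube.nrm_proj G.nrm_eq u hlR
  have hκv : curv (S.A (S.T t)) (proj (S.A (S.T t)) (x - S.z t)) = k u := by
    rw [← hx]
    exact G.tube.curv_proj G.nrm_eq u hlR
  have hr2 : S.rT t ^ 2 = 2 * (S.Text - S.T t) := hsq _ hTm.2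
  have hr4 : S.rT t ^ 4 = (2 * (S.Text - S.T t)) ^ 2 := by rw [← hr2]; ring
  have hne : 2 * (S.Text - S.T t) ≠ 0 := by rw [← hr2]; positivity
  have hinv : HasFDerivAt (fun p : Plane × ℝ => (2 * (S.Text - S.T p.2))⁻¹) _ (x, t) :=
    HasFDerivAt.comp (g := fun s => (2 * (S.Text - S.T s))⁻¹) (x, t) ((((hT.const_sub S.Text).const_mul 2).inv hne).hasFDerivAt)
      hasFDerivAt_snd
  refine ⟨_, _, _, hN2.congr_of_eventuallyEq hXe, (hκ2.smul hN2).congr_of_eventuallyEq hBe,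
    (hσ2.neg.mul hinv).congr_of_eventuallyEq hWe, fun v w => ?_, fun v => ?_, fun v w => ?_,
    hXe.self_of_nhds.trans hNv, ?_, ?_⟩
  · rw [ContinuousLinearMap.comp_apply, hΦ', hN']
  · have h1 : Ψ (v, 0) = (v, 0) := by rw [hΦ']; simp
    simp only [add_apply, smul_apply, ContinuousLinearMap.smulRight_apply,
      ContinuousLinearMap.comp_apply, h1, hN', hκ', hNv, hκv]
    module
  · simp only [add_apply, smul_apply, neg_apply, Pi.neg_apply, smul_eq_mul, ContinuousLinearMap.comp_apply,
      hΦ', hσ', hs0, ContinuousLinearMap.coe_snd', ContinuousLinearMap.toSpanSingleton_apply]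
    rw [hr2, hr4]
    field_simp
    ring
  · refine hBe.self_of_nhds.trans ?_
    simp only [hNv, hκv]
  · refine hWe.self_of_nhds.trans ?_
    simp only [hs0]
    rw [hr2, div_eq_mul_inv]

end GraphSlice

end CircMCF

namespace CircMCF

/-! ### The functionals of the relative energy method in terms of the height function -/

lemma hasFDerivAt_partials {E : Type*} [NormedAddCommGroup E] [NormedSpace ℝ E]
    {F : Plane → ℝ → E} {F' : Plane × ℝ →L[ℝ] E} {x : Plane} {t : ℝ}
    (hF : HasFDerivAt (fun p : Plane × ℝ => F p.1 p.2) F' (x, t)) :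
    HasFDerivAt (fun y => F y t) (F' ∘L ContinuousLinearMap.inl ℝ Plane ℝ) x ∧
      HasDerivAt (fun s => F x s) (F' (0, 1)) t := by
  have h1 : HasFDerivAt (fun y : Plane => (y, t)) (ContinuousLinearMap.inl ℝ Plane ℝ) x :=
    (hasFDerivAt_id x).prodMk (hasFDerivAt_const t x)
  have h2 : HasDerivAt (fun s : ℝ => (x, s)) ((0 : Plane), (1 : ℝ)) t :=
    (hasDerivAt_const t x).prodMk (hasDerivAt_id t)
  exact ⟨HasFDerivAt.comp (g := fun p : Plane × ℝ => F p.1 p.2) x hF h1,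
    HasFDerivAt.comp_hasDerivAt t hF h2⟩

lemma NormalGraph.inner_graphNormal {Ω : Set Plane} {γ n : ℝ → Plane} {k f : ℝ → ℝ} {L R : ℝ}
    {h : Plane → ℝ} (G : NormalGraph Ω R γ n k L h f) (u : ℝ) :
    ⟪deriv γ u, graphNormal γ n k f u⟫_ℝ = -deriv f u / ‖deriv (graphCurve γ n f) u‖ ∧
    ⟪n u, graphNormal γ n k f u⟫_ℝ = (1 - k u * f u) / ‖deriv (graphCurve γ n f) u‖ := by
  have h1 := G.tube.orth u
  have h1' : ⟪n u, deriv γ u⟫_ℝ = 0 := by rw [real_inner_comm]; exact h1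
  simp only [graphNormal, inner_smul_right, inner_sub_right, h1, h1', real_inner_self_eq_norm_sq,
    G.tube.norm_tangent, G.tube.norm_normal]
  constructor <;> ring

namespace GraphSlice

variable {n : ℕ} {S : Setting n} {t δ ε Cζ : ℝ} {γ ν : ℝ → Plane} {k f g : ℝ → ℝ} {L : ℝ}
  {h : Plane → ℝ}

/-- The values and derivatives of the shifted calibration close to the interface. -/
theorem fields (G : GraphSlice S t δ ε γ ν k f g L h) (hδ : δ < 1)
    (hS : S.Standing δ Cζ) (ht : t ∈ Ioo 0 S.tχ) {zd : Plane} {Td : ℝ} (hz : HasDerivAt S.z zd t)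
    (hT : HasDerivAt S.T Td t) (u : ℝ) {l : ℝ} (hl : |l| ≤ S.rT t / 16) :
    (DifferentiableAt ℝ (fun y => S.shift S.xi y t) (γ u + l • ν u) ∧
      DifferentiableAt ℝ (fun s => S.shift S.xi (γ u + l • ν u) s) t) ∧
    (S.shift S.xi (γ u + l • ν u) t = ν u ∧ S.shift S.vel (γ u + l • ν u) t = k u • ν u ∧
      S.shift (S.weight 0) (γ u + l • ν u) t = -l / S.rT t ^ 2) ∧
    (∀ v, fderiv ℝ (fun y => S.shift S.xi y t) (γ u + l • ν u) v =
      (-(k u * ⟪deriv γ u, v⟫_ℝ / (1 - k u * l))) • deriv γ u) ∧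
    deriv (fun s => S.shift S.xi (γ u + l • ν u) s) t =
      ((k u * ⟪deriv γ u, zd⟫_ℝ - Td * deriv k u) / (1 - k u * l)) • deriv γ u ∧
    (∀ v, fderiv ℝ (fun y => S.shift S.vel y t) (γ u + l • ν u) v =
      (⟪deriv γ u, v⟫_ℝ / (1 - k u * l)) • (deriv k u • ν u - k u ^ 2 • deriv γ u)) ∧
    divg (fun y => S.shift S.xi y t) (γ u + l • ν u) = -(k u / (1 - k u * l)) ∧
    divg (fun y => S.shift S.vel y t) (γ u + l • ν u) = -(k u ^ 2 / (1 - k u * l)) ∧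
    deriv (fun s => S.shift (S.weight 0) (γ u + l • ν u) s) t =
      (⟪ν u, zd⟫_ℝ + Td * k u) / S.rT t ^ 2 - 2 * l * Td / S.rT t ^ 4 ∧
    ∀ v, ⟪v, gradient (fun y => S.shift (S.weight 0) y t) (γ u + l • ν u)⟫_ℝ =
      -⟪ν u, v⟫_ℝ / S.rT t ^ 2 := by
  obtain ⟨X', B', W', hX, hB, hW, hX', hB', hW', hx, hb, hw⟩ :=
    G.hasFDerivAt_fields hδ hS ht hz hT u hl
  set x := γ u + l • ν u with hxd
  obtain ⟨hX1, hX2⟩ := hasFDerivAt_partials hX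
  obtain ⟨hB1, -⟩ := hasFDerivAt_partials hB
  obtain ⟨hW1, hW2⟩ := hasFDerivAt_partials hW
  have o1 := G.graph.tube.orth u
  have o2 : ⟪ν u, deriv γ u⟫_ℝ = 0 := by rw [real_inner_comm]; exact o1
  have n1 := G.graph.tube.norm_tangent u
  have n2 := G.graph.tube.norm_normal u
  have e1 (v : Plane) : fderiv ℝ (fun y => S.shift S.xi y t) x v =
      (-(k u * ⟪deriv γ u, v⟫_ℝ / (1 - k u * l))) • deriv γ u := by
    rw [hX1.fderiv, ContinuousLinearMap.comp_apply, ContinuousLinearMap.inl_apply, hX']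
    simp
  have e2 (v : Plane) : fderiv ℝ (fun y => S.shift S.vel y t) x v =
      (⟪deriv γ u, v⟫_ℝ / (1 - k u * l)) • (deriv k u • ν u - k u ^ 2 • deriv γ u) := by
    rw [hB1.fderiv, ContinuousLinearMap.comp_apply, ContinuousLinearMap.inl_apply, hB']
  refine ⟨⟨hX1.differentiableAt, hX2.differentiableAt⟩, ⟨hx, hb, hw⟩, e1, ?_, e2, ?_, ?_, ?_,
    fun v => ?_⟩
  · rw [hX2.deriv, hX']
    simp only [one_smul, zero_sub, inner_neg_right, one_mul]
    congr 1
    ring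
  · rw [divg, trace_plane n1 n2 o1]
    simp only [ContinuousLinearMap.coe_coe, e1, inner_smul_right, o1, o2,
      real_inner_self_eq_norm_sq, n1]
    ring
  · rw [divg, trace_plane n1 n2 o1]
    simp only [ContinuousLinearMap.coe_coe, e2, inner_smul_right, inner_sub_right, o1, o2,
      real_inner_self_eq_norm_sq, n1]
    ring
  · rw [hW2.deriv, hW']
    simp only [one_smul, zero_sub, inner_neg_right, one_mul]
    ring
  · rw [real_inner_comm, gradient, InnerProductSpace.toDual_symm_apply, hW1.fderiv,
      ContinuousLinearMap.comp_apply, ContinuousLinearMap.inl_apply, hW']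
    simp

/-- The interface with indices `i`, `j` is the graph, and `s` is its orientation. -/
structure IsOriented (S : Setting n) (t : ℝ) (γ ν : ℝ → Plane) (k f : ℝ → ℝ) (L : ℝ)
    (i j : Fin (n + 2)) (s : ℝ) : Prop where
  sign : s = 1 ∨ s = -1
  iface : S.iface i j t = graphCurve γ ν f '' Ico 0 L
  xi : ∀ x t', S.shift (S.xiPair i j) x t' = s • S.shift S.xi x t'
  normal : ∀ u, S.normal i (graphCurve γ ν f u) t = s • graphNormal γ ν k f u
  speed : ∀ u, S.speed i (graphCurve γ ν f u) t =
    s * ⟪S.H (graphCurve γ ν f u) t, graphNormal γ ν k f u⟫_ℝ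

/-- The two ordered pairs of phases give the same interface with opposite orientation. Recording the
orientation as a sign `s` lets one computation serve both, as every integrand is even in `s`. -/
lemma isOriented_zero_last (G : GraphSlice S t δ ε γ ν k f g L h) (hS : S.Standing δ Cζ)
    (hreg : IsRegularSlice (fun i x => S.χ i x t) (S.V t) fun x => S.H x t) :
    IsOriented S t γ ν k f L 0 (Fin.last (n + 1)) (-1) ∧
    IsOriented S t γ ν k f L (Fin.last (n + 1)) 0 1 := by
  have hχm : Measurable fun x => S.χ 0 x t :=
    (hS.weak.measurable_phase 0).comp (measurable_id.prodMk measurable_const)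
  obtain ⟨h1, h2, -⟩ := redBdry_one_sub hχm (fun x => hS.weak.indicator 0 x t)
    (hreg.perimeter 0) G.phase_last
  have hn (u : ℝ) := G.graph.measNormal_eq G.phase G.redBdry_eq u
  have hn' (u : ℝ) := h2 _ (by rw [G.redBdry_eq]; exact G.graph.mem_graph u)
  have hne : Fin.last (n + 1) ≠ 0 := Fin.last_pos.ne'
  constructor
  · refine ⟨Or.inr rfl, ?_, fun x t' => ?_, fun u => ?_, fun u => ?_⟩
    · rw [Setting.iface, h1, inter_self, G.redBdry_eq]
    · simp only [Setting.shift, Setting.xiPair, Setting.xiPhase, if_true, hne, if_false]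
      module
    · rw [Setting.normal, hn, neg_one_smul]
    · rw [Setting.speed, hn, neg_one_mul]
  · refine ⟨Or.inl rfl, ?_, fun x t' => ?_, fun u => ?_, fun u => ?_⟩
    · rw [Setting.iface, h1, inter_self, G.redBdry_eq]
    · simp only [Setting.shift, Setting.xiPair, Setting.xiPhase, if_true, hne, if_false]
      module
    · rw [Setting.normal, hn', hn, neg_neg, one_smul]
    · rw [Setting.speed, hn', hn, inner_neg_right, neg_neg, one_mul]

section

variable (G : GraphSlice S t δ ε γ ν k f g L h)
include G

lemma continuity : Continuous (deriv γ) ∧ Continuous ν ∧ Continuous k ∧ Continuous (deriv k) ∧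
    Continuous f ∧ Continuous (deriv f) ∧ Continuous fun u => ‖deriv (graphCurve γ ν f) u‖ :=
  ⟨G.graph.tube.param.smooth_deriv.continuous, G.graph.tube.normal_smooth.continuous,
    G.graph.tube.curv_smooth.continuous, G.graph.tube.curv_smooth.continuous_deriv (by simp),
    G.graph.smooth.continuous, G.graph.smooth.continuous_deriv (by simp),
    (G.graph.contDiff_graphCurve.continuous_deriv (by simp)).norm⟩

lemma continuous_inv : (Continuous fun u => ‖deriv (graphCurve γ ν f) u‖⁻¹) ∧
    Continuous fun u => (1 - k u * f u)⁻¹ := by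
  obtain ⟨-, -, c3, -, c5, -, c7⟩ := G.continuity
  exact ⟨c7.inv₀ fun u => (G.graph.norm_deriv_graphCurve_pos u).ne',
    Continuous.inv₀ (by fun_prop) fun u => (G.graph.stretch_pos u).ne'⟩

end

/-- The scalar curvature of the graph, times the area factor. -/
def curvDensity (γ ν : ℝ → Plane) (k f g : ℝ → ℝ) (u : ℝ) : ℝ :=
  k u + (g u * (1 - k u * f u) + (deriv k u * f u + k u * deriv f u) * deriv f u) /
    ‖deriv (graphCurve γ ν f) u‖ ^ 2

section

variable (G : GraphSlice S t δ ε γ ν k f g L h)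
include G

/-- The density is affine in the square integrable `g`, with continuous coefficients that are
bounded on a period. -/
lemma memLp_curvDensity : MemLp (curvDensity γ ν k f g) 2 (volume.restrict (Icc 0 L)) := by
  obtain ⟨-, -, c3, c4, c5, c6, c7⟩ := G.continuity
  obtain ⟨c8, c9⟩ := G.continuous_inv
  have e : curvDensity γ ν k f g = fun u => (k u + (deriv k u * f u + k u * deriv f u) * deriv f u *
      ‖deriv (graphCurve γ ν f) u‖⁻¹ ^ 2) + ((1 - k u * f u) *
        ‖deriv (graphCurve γ ν f) u‖⁻¹ ^ 2) * g u := by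
    funext u
    simp only [curvDensity, div_eq_mul_inv, inv_pow]
    ring
  have bdd {φ : ℝ → ℝ} (hφ : Continuous φ) :
      ∃ C, ∀ᵐ u ∂(volume.restrict (Icc 0 L)), ‖φ u‖ ≤ C := by
    obtain ⟨C, hC⟩ := (isCompact_Icc (a := (0 : ℝ)) (b := L)).exists_bound_of_continuousOn
      hφ.continuousOn
    exact ⟨C, (ae_restrict_mem measurableSet_Icc).mono fun u hu => hC u hu⟩
  rw [e]
  have k1 : Continuous fun u => k u + (deriv k u * f u + k u * deriv f u) * deriv f u *
      ‖deriv (graphCurve γ ν f) u‖⁻¹ ^ 2 := by fun_prop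
  have k2 : Continuous fun u => (1 - k u * f u) * ‖deriv (graphCurve γ ν f) u‖⁻¹ ^ 2 := by fun_prop
  obtain ⟨C1, hC1⟩ := bdd k1
  obtain ⟨C2, hC2⟩ := bdd k2
  refine (MemLp.of_bound k1.aestronglyMeasurable C1 hC1).add ?_
  exact G.memLp.mul (p := ∞) (MemLp.of_bound k2.aestronglyMeasurable C2 hC2)

lemma intervalIntegrable_curvDensity :
    IntervalIntegrable (curvDensity γ ν k f g) volume 0 L ∧
    IntervalIntegrable (fun u => curvDensity γ ν k f g u ^ 2) volume 0 L := by
  have hL := G.graph.tube.param.pos.le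
  rw [intervalIntegrable_iff_integrableOn_Icc_of_le hL,
    intervalIntegrable_iff_integrableOn_Icc_of_le hL]
  exact ⟨G.memLp_curvDensity.integrable one_le_two, G.memLp_curvDensity.integrable_sq⟩

lemma integral_congr_curvature {F₁ F₂ : ℝ → ℝ}
    (hF : ∀ u, ‖deriv (graphCurve γ ν f) u‖ *
      ⟪S.H (graphCurve γ ν f u) t, graphNormal γ ν k f u⟫_ℝ = curvDensity γ ν k f g u →
      F₁ u = F₂ u) : ∫ u in (0 : ℝ)..L, F₁ u = ∫ u in (0 : ℝ)..L, F₂ u := by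
  have hL := G.graph.tube.param.pos.le
  rw [intervalIntegral.integral_of_le hL, intervalIntegral.integral_of_le hL,
    ← restrict_Ico_eq_restrict_Ioc]
  exact integral_congr_ae (G.curvature.mono hF)

/-- On the graph `∇·ξ` is `-k/(1 - k f)` and `B·ξ` is `k` up to the orientation, and the normal
speed is the curvature density divided by the length element. Expanding the two squares leaves a
quadratic polynomial in that density. -/
theorem dissip_eq (hδ : δ < 1) (hε : ε ≤ 1 / 16)
    (hS : S.Standing δ Cζ) (ht : t ∈ Ioo 0 S.tχ) {zd : Plane} {Td : ℝ} (hz : HasDerivAt S.z zd t)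
    (hT : HasDerivAt S.T Td t) {i j : Fin (n + 2)} {s : ℝ} (O : IsOriented S t γ ν k f L i j s) :
    S.dissip i j t = ∫ u in (0 : ℝ)..L, (curvDensity γ ν k f g u ^ 2 *
      ‖deriv (graphCurve γ ν f) u‖⁻¹ - curvDensity γ ν k f g u * (k u / (1 - k u * f u) +
        k u * (1 - k u * f u) / ‖deriv (graphCurve γ ν f) u‖) +
      1 / 2 * ‖deriv (graphCurve γ ν f) u‖ * k u ^ 2 * (1 + ((1 - k u * f u)⁻¹) ^ 2)) := by
  have hfl (u : ℝ) : |f u| ≤ S.rT t / 16 := (G.height_bound u).trans (by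
    have := G.radius_pos; nlinarith)
  have hF (u : ℝ) := G.fields hδ hS ht hz hT u (hfl u)
  obtain ⟨-, -, c3, c4, c5, c6, c7⟩ := G.continuity
  obtain ⟨c8, c9⟩ := G.continuous_inv
  obtain ⟨i1, i2⟩ := G.intervalIntegrable_curvDensity
  have hdiv (u : ℝ) : divg (fun y => S.shift (S.xiPair i j) y t) (graphCurve γ ν f u) =
      s * -(k u / (1 - k u * f u)) := by
    rw [← (hF u).2.2.2.2.2.1, divg, show (fun y => S.shift (S.xiPair i j) y t) =
      s • fun y => S.shift S.xi y t from funext fun y => O.xi y t,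
      fderiv_const_smul (by exact (hF u).1.1)]
    simp [divg, graphCurve]
  have e1 : (∫ x in S.iface i j t, 1 / 2 * (S.speed i x t +
      divg (fun y => S.shift (S.xiPair i j) y t) x) ^ 2 ∂μH[1]) =
      ∫ u in (0 : ℝ)..L, (curvDensity γ ν k f g u ^ 2 * (1 / 2 * ‖deriv (graphCurve γ ν f) u‖⁻¹) -
        curvDensity γ ν k f g u * (k u * (1 - k u * f u)⁻¹) +
        1 / 2 * ‖deriv (graphCurve γ ν f) u‖ * k u ^ 2 * ((1 - k u * f u)⁻¹) ^ 2) := by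
    rw [O.iface, G.graph.integral_graph]
    refine G.integral_congr_curvature fun u hu => ?_
    have hJ := (G.graph.norm_deriv_graphCurve_pos u).ne'
    have ha := (G.graph.stretch_pos u).ne'
    rw [hdiv, O.speed, ← hu, smul_eq_mul]
    rcases O.sign with rfl | rfl <;> field_simp <;> ring
  have e2 : (∫ x in S.iface i j t, 1 / 2 * ‖S.speed i x t • S.normal i x t -
      ⟪S.shift S.vel x t, S.shift (S.xiPair i j) x t⟫_ℝ • S.shift (S.xiPair i j) x t‖ ^ 2 ∂μH[1]) =
      ∫ u in (0 : ℝ)..L, (curvDensity γ ν k f g u ^ 2 * (1 / 2 * ‖deriv (graphCurve γ ν f) u‖⁻¹) -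
        curvDensity γ ν k f g u * (k u * (1 - k u * f u) * ‖deriv (graphCurve γ ν f) u‖⁻¹) +
        1 / 2 * ‖deriv (graphCurve γ ν f) u‖ * k u ^ 2) := by
    rw [O.iface, G.graph.integral_graph]
    refine G.integral_congr_curvature fun u hu => ?_
    have hJ := (G.graph.norm_deriv_graphCurve_pos u).ne'
    have hb : S.shift S.vel (graphCurve γ ν f u) t = k u • ν u := (hF u).2.1.2.1
    have hx : S.shift S.xi (graphCurve γ ν f u) t = ν u := (hF u).2.1.1
    have h1 : ⟪graphNormal γ ν k f u, ν u⟫_ℝ = (1 - k u * f u) / ‖deriv (graphCurve γ ν f) u‖ := by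
      rw [real_inner_comm]; exact (G.graph.inner_graphNormal u).2
    rw [O.speed, O.normal, O.xi, hb, hx, ← hu, norm_sub_sq_real, smul_eq_mul]
    have n1 := G.graph.norm_graphNormal u
    have n2 := G.graph.tube.norm_normal u
    rcases O.sign with rfl | rfl <;>
    · simp only [inner_smul_left, inner_smul_right, norm_smul, n1, n2, h1, RCLike.conj_to_real,
        real_inner_self_eq_norm_sq, Real.norm_eq_abs, mul_pow, sq_abs]
      field_simp
  have h0 : S.dissip i j t = _ := congrArg₂ (· + ·) e1 e2
  rw [h0, ← intervalIntegral.integral_add]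
  · refine intervalIntegral.integral_congr fun u _ => ?_
    have hJ := (G.graph.norm_deriv_graphCurve_pos u).ne'
    have ha := (G.graph.stretch_pos u).ne'
    field_simp
    ring
  · exact ((i2.mul_continuousOn (Continuous.continuousOn (by fun_prop))).sub
      (i1.mul_continuousOn (Continuous.continuousOn (by fun_prop)))).add
      (Continuous.intervalIntegrable (by fun_prop) _ _)
  · exact ((i2.mul_continuousOn (Continuous.continuousOn (by fun_prop))).sub
      (i1.mul_continuousOn (Continuous.continuousOn (by fun_prop)))).add
      (Continuous.intervalIntegrable (by fun_prop) _ _)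

end

end GraphSlice

end CircMCF

/-! ### The interfacial right-hand side -/

namespace CircMCF
namespace GraphSlice

variable {n : ℕ} {S : Setting n} {t δ ε Cζ : ℝ} {γ ν : ℝ → Plane} {k f g : ℝ → ℝ} {L : ℝ}
  {h : Plane → ℝ}

section

variable (G : GraphSlice S t δ ε γ ν k f g L h)
include G

lemma integral_iface {i j : Fin (n + 2)} {s : ℝ} (O : IsOriented S t γ ν k f L i j s)
    {F : Plane → ℝ} (F' : ℝ → ℝ)
    (hF : ∀ u, ‖deriv (graphCurve γ ν f) u‖ * F (graphCurve γ ν f u) = F' u) :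
    ∫ x in S.iface i j t, F x ∂μH[1] = ∫ u in (0 : ℝ)..L, F' u := by
  rw [O.iface, G.graph.integral_graph]
  exact intervalIntegral.integral_congr fun u _ => hF u

/-- Near the graph `ξ` has unit length and is constant in normal direction, `B` is a multiple of
`ξ`, and `∂ₜξ` is tangential, so three of the eight integrals vanish. The terms with `(∇·ξ)(B·ξ)`
and with `∇·B` cancel, because `∇·B` equals their product `(∇·ξ)(B·ξ)`. -/
theorem rhsInt_eq (hδ : δ < 1) (hε : ε ≤ 1 / 16)
    (hS : S.Standing δ Cζ) (ht : t ∈ Ioo 0 S.tχ) {zd : Plane} {Td : ℝ} (hz : HasDerivAt S.z zd t)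
    (hT : HasDerivAt S.T Td t) {i j : Fin (n + 2)} {s : ℝ} (O : IsOriented S t γ ν k f L i j s) :
    S.rhsInt i j t = ∫ u in (0 : ℝ)..L,
      (deriv f u * (k u * ⟪deriv γ u, zd⟫_ℝ - (Td - 1) * deriv k u) / (1 - k u * f u) +
      1 / 2 * ‖deriv (graphCurve γ ν f) u‖ * (k u - k u / (1 - k u * f u)) ^ 2 +
      deriv f u / (1 - k u * f u) * (deriv k u *
        ((1 - k u * f u) / ‖deriv (graphCurve γ ν f) u‖ - 1) +
        k u ^ 2 * deriv f u / ‖deriv (graphCurve γ ν f) u‖)) := by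
  have hfl (u : ℝ) : |f u| ≤ S.rT t / 16 := (G.height_bound u).trans (by
    have := G.radius_pos; nlinarith)
  have hF (u : ℝ) := G.fields hδ hS ht hz hT u (hfl u)
  obtain ⟨c1, c2, c3, c4, c5, c6, c7⟩ := G.continuity
  obtain ⟨c8, c9⟩ := G.continuous_inv
  have hs : s * s = 1 := by rcases O.sign with rfl | rfl <;> norm_num
  have efun : (fun y => S.shift (S.xiPair i j) y t) = s • fun y => S.shift S.xi y t :=
    funext fun y => O.xi y t
  have hfd (u : ℝ) : fderiv ℝ (fun y => S.shift (S.xiPair i j) y t) (graphCurve γ ν f u) =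
      s • fderiv ℝ (fun y => S.shift S.xi y t) (graphCurve γ ν f u) := by
    rw [efun]
    exact fderiv_const_smul (hF u).1.1 s
  have hdiv (u : ℝ) : divg (fun y => S.shift (S.xiPair i j) y t) (graphCurve γ ν f u) =
      s * -(k u / (1 - k u * f u)) := by
    rw [← (hF u).2.2.2.2.2.1, divg, hfd]
    simp [divg, graphCurve]
  have hdt (u : ℝ) : deriv (fun t' => S.shift (S.xiPair i j) (graphCurve γ ν f u) t') t =
      s • ((k u * ⟪deriv γ u, zd⟫_ℝ - Td * deriv k u) / (1 - k u * f u)) • deriv γ u := by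
    rw [← (hF u).2.2.2.1, show (fun t' => S.shift (S.xiPair i j) (graphCurve γ ν f u) t') =
      s • fun t' => S.shift S.xi (γ u + f u • ν u) t' from funext fun y => O.xi _ y]
    exact deriv_const_smul s (hF u).1.2
  have hx (u : ℝ) : S.shift (S.xiPair i j) (graphCurve γ ν f u) t = s • ν u := by
    rw [O.xi]; exact congrArg _ (hF u).2.1.1
  have hb (u : ℝ) : S.shift S.vel (graphCurve γ ν f u) t = k u • ν u := (hF u).2.1.2.1
  have hDB (u : ℝ) (v : Plane) : fderiv ℝ (fun y => S.shift S.vel y t) (graphCurve γ ν f u) v = _ :=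
    (hF u).2.2.2.2.1 v
  have hdB (u : ℝ) : divg (fun y => S.shift S.vel y t) (graphCurve γ ν f u) = _ :=
    (hF u).2.2.2.2.2.2.1
  have o1 (u : ℝ) := G.graph.tube.orth u
  have o2 (u : ℝ) : ⟪ν u, deriv γ u⟫_ℝ = 0 := by rw [real_inner_comm]; exact o1 u
  have n1 (u : ℝ) := G.graph.tube.norm_tangent u
  have n2 (u : ℝ) := G.graph.tube.norm_normal u
  have n3 (u : ℝ) := G.graph.norm_graphNormal u
  have p1 (u : ℝ) := (G.graph.inner_graphNormal u).1
  have p2 (u : ℝ) := (G.graph.inner_graphNormal u).2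
  have p1' (u : ℝ) : ⟪graphNormal γ ν k f u, deriv γ u⟫_ℝ = _ :=
    (real_inner_comm _ _).trans (p1 u)
  have p2' (u : ℝ) : ⟪graphNormal γ ν k f u, ν u⟫_ℝ = _ := (real_inner_comm _ _).trans (p2 u)
  -- The advective part drops out: `B` points in normal direction, along which `ξ` does not change.
  have htr (u : ℝ) : deriv (fun t' => S.shift (S.xiPair i j) (graphCurve γ ν f u) t') t +
      fderiv ℝ (fun y => S.shift (S.xiPair i j) y t) (graphCurve γ ν f u)
        (S.shift S.vel (graphCurve γ ν f u) t) =
      s • ((k u * ⟪deriv γ u, zd⟫_ℝ - Td * deriv k u) / (1 - k u * f u)) • deriv γ u := by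
    have h1 : fderiv ℝ (fun y => S.shift S.xi y t) (graphCurve γ ν f u) (ν u) = 0 := by
      have := (hF u).2.2.1 (ν u)
      rw [o1] at this
      rw [graphCurve, this]
      simp
    rw [hdt, hb, hfd, smul_apply, map_smul, h1, smul_zero, smul_zero, add_zero]
  have hJ (u : ℝ) : ‖deriv (graphCurve γ ν f) u‖ ≠ 0 := (G.graph.norm_deriv_graphCurve_pos u).ne'
  have ha (u : ℝ) : 1 - k u * f u ≠ 0 := (G.graph.stretch_pos u).ne'
  have h0 : S.rhsInt i j t =
      -(∫ u in (0 : ℝ)..L, -(deriv f u * (k u * ⟪deriv γ u, zd⟫_ℝ - (Td - 1) * deriv k u) /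
        (1 - k u * f u))) - (∫ _ in (0 : ℝ)..L, 0) +
      (∫ u in (0 : ℝ)..L, 1 / 2 * ‖deriv (graphCurve γ ν f) u‖ *
        (k u - k u / (1 - k u * f u)) ^ 2) - (∫ _ in (0 : ℝ)..L, 0) -
      (∫ u in (0 : ℝ)..L, -((‖deriv (graphCurve γ ν f) u‖ - (1 - k u * f u)) * k u ^ 2 /
        (1 - k u * f u))) + (∫ _ in (0 : ℝ)..L, 0) +
      (∫ u in (0 : ℝ)..L, -((‖deriv (graphCurve γ ν f) u‖ - (1 - k u * f u)) * k u ^ 2 /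
        (1 - k u * f u))) -
      ∫ u in (0 : ℝ)..L, -(deriv f u / (1 - k u * f u) * (deriv k u *
        ((1 - k u * f u) / ‖deriv (graphCurve γ ν f) u‖ - 1) +
        k u ^ 2 * deriv f u / ‖deriv (graphCurve γ ν f) u‖)) := by
    unfold Setting.rhsInt
    refine congrArg₂ (· - ·) (congrArg₂ (· + ·) (congrArg₂ (· + ·) (congrArg₂ (· - ·)
      (congrArg₂ (· - ·) (congrArg₂ (· + ·) (congrArg₂ (· - ·) (congrArg (- ·) ?_) ?_) ?_) ?_) ?_)
      ?_) ?_) ?_ <;>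
    refine G.integral_iface O _ fun u => ?_ <;>
    have hJu := hJ u <;> have hau := ha u <;> beta_reduce
    · rw [inner_add_left, ContinuousLinearMap.adjoint_inner_left, htr, hDB, hx, O.normal]
      simp only [inner_sub_right, inner_smul_left, inner_smul_right, o1, o2, p1,
        RCLike.conj_to_real, real_inner_self_eq_norm_sq, n2]
      field_simp
      linear_combination (-deriv f u * (k u * ⟪deriv γ u, zd⟫_ℝ - Td * deriv k u + deriv k u)) * hs
    · rw [htr, hx]
      simp only [inner_smul_left, inner_smul_right, o1]
      ring
    · rw [hdiv, hb, hx, inner_smul_left, inner_smul_right, real_inner_self_eq_norm_sq, n2,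
        RCLike.conj_to_real]
      linear_combination (1 / 2 * ‖deriv (graphCurve γ ν f) u‖ *
        (k u - k u / (1 - k u * f u)) ^ 2) * hs
    · rw [hx, norm_smul, n2, mul_one, Real.norm_eq_abs, sq_abs, pow_two s, hs, sub_self, mul_zero,
        mul_zero]
    · rw [hdiv, hb, hx, O.normal]
      simp only [inner_smul_left, inner_smul_right, p2', real_inner_self_eq_norm_sq, n2,
        RCLike.conj_to_real]
      rcases O.sign with rfl | rfl <;> field_simp
    · rw [hb, hx, O.normal, hdiv]
      simp only [inner_smul_left, inner_smul_right, inner_sub_left, p2, real_inner_self_eq_norm_sq,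
        n2, RCLike.conj_to_real]
      rcases O.sign with rfl | rfl <;> ring
    · rw [hdB, hx, O.normal]
      simp only [inner_smul_left, inner_smul_right, p2', RCLike.conj_to_real]
      rcases O.sign with rfl | rfl <;> field_simp
    · rw [hDB, hx, O.normal]
      simp only [inner_smul_left, inner_smul_right, inner_sub_left, inner_sub_right, o1, o2, p1,
        p1', p2', real_inner_self_eq_norm_sq, n2, RCLike.conj_to_real]
      rcases O.sign with rfl | rfl <;> field_simp <;> ring
  -- Divisions become products with inverses whose continuity is known, so integrability is
  -- automatic below.
  simp only [div_eq_mul_inv] at h0 ⊢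
  rw [h0, intervalIntegral.integral_add, intervalIntegral.integral_add]
  · simp only [intervalIntegral.integral_neg, intervalIntegral.integral_zero]
    ring
  all_goals exact Continuous.intervalIntegrable (by fun_prop) _ _

end

end GraphSlice

end CircMCF

/-! ### The bulk right-hand side -/

namespace CircMCF
namespace GraphSlice

variable {n : ℕ} {S : Setting n} {t δ ε Cζ : ℝ} {γ ν : ℝ → Plane} {k f g : ℝ → ℝ} {L : ℝ}
  {h : Plane → ℝ}

lemma sum_offDiag_eq {F : Fin (n + 2) × Fin (n + 2) → ℝ}
    (h0 : ∀ i, i ≠ 0 → i ≠ Fin.last (n + 1) → redBdry (fun x => S.χ i x t) = ∅)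
    (hF : ∀ p, S.iface p.1 p.2 t = ∅ → F p = 0) :
    ∑ p ∈ (Finset.univ : Finset (Fin (n + 2))).offDiag, F p =
      F (0, Fin.last (n + 1)) + F (Fin.last (n + 1), 0) := by
  have hne : (0 : Fin (n + 2)) ≠ Fin.last (n + 1) := (Fin.last_pos).ne
  rw [← Finset.sum_pair (f := F) (by simp [hne])]
  refine (Finset.sum_subset ?_ fun p hp hp' => hF p ?_).symm
  · intro p hp
    rw [Finset.mem_insert, Finset.mem_singleton] at hp
    rcases hp with rfl | rfl <;> simp [hne, hne.symm]
  · rw [Finset.mem_offDiag] at hp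
    have h2 := hp.2.2
    simp only [Finset.mem_insert, Finset.mem_singleton, Prod.ext_iff, not_or, not_and] at hp'
    rw [Setting.iface]
    by_cases h3 : p.1 = 0
    · rw [h0 p.2 (fun h => h2 (h3.trans h.symm)) (hp'.1 h3), inter_empty]
    by_cases h4 : p.1 = Fin.last (n + 1)
    · rw [h0 p.2 (hp'.2 h4) (fun h => h2 (h4.trans h.symm)), inter_empty]
    · rw [h0 p.1 h3 h4, empty_inter]

lemma integral_affine (k f A B : ℝ) : ∫ l in (0 : ℝ)..f, (1 - k * l) * (A - B * l) =
    A * (f - k * f ^ 2 / 2) - B * (f ^ 2 / 2 - k * f ^ 3 / 3) := by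
  have hd (l : ℝ) : HasDerivAt (fun l => A * (l - k * l ^ 2 / 2) - B * (l ^ 2 / 2 - k * l ^ 3 / 3))
      ((1 - k * l) * (A - B * l)) l := by
    have h1 := hasDerivAt_id' l
    have h2 := hasDerivAt_pow 2 l
    have h3 := hasDerivAt_pow 3 l
    refine (((h1.sub ((h2.const_mul k).div_const 2)).const_mul A).sub
      (((h2.div_const 2).sub ((h3.const_mul k).div_const 3)).const_mul B)).congr_deriv ?_
    push_cast
    ring
  rw [intervalIntegral.integral_eq_sub_of_hasDerivAt (fun l _ => hd l)
    (Continuous.intervalIntegrable (by fun_prop) _ _)]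
  ring

lemma mem_uIcc_zero_abs {f l : ℝ} (hl : l ∈ uIcc 0 f) : |l| ≤ |f| := by
  rcases mem_uIcc.1 hl with h | h
  · rw [abs_of_nonneg h.1, abs_of_nonneg (h.1.trans h.2)]; exact h.2
  · rw [abs_of_nonpos h.2, abs_of_nonpos (h.1.trans h.2)]; linarith

lemma shift_chiBar_zero (x : Plane) :
    S.shift (S.chiBar 0) x t = (S.shiftedA t).indicator 1 x := by
  rw [Setting.shift, Setting.chiBar, if_pos rfl]
  rfl

section

variable (G : GraphSlice S t δ ε γ ν k f g L h)
include G

/-- In the two interface integrals the length element cancels, leaving the curvature density minus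
`k (1 - k f)`. In the bulk the region between the curves is swept by normal segments, on which the
integrands are polynomials in the height once multiplied by the Jacobian. -/
theorem rhsBulk_zero_eq (hδ : δ < 1) (hε : ε ≤ 1 / 16)
    (hS : S.Standing δ Cζ) (ht : t ∈ Ioo 0 S.tχ) {zd : Plane} {Td : ℝ} (hz : HasDerivAt S.z zd t)
    (hT : HasDerivAt S.T Td t) (O : IsOriented S t γ ν k f L 0 (Fin.last (n + 1)) (-1))
    (h0 : ∀ i, i ≠ 0 → i ≠ Fin.last (n + 1) → redBdry (fun x => S.χ i x t) = ∅) :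
    S.rhsBulk 0 t = ∫ u in (0 : ℝ)..L,
      (f u / S.rT t ^ 2 * (curvDensity γ ν k f g u - k u * (1 - k u * f u)) -
        k u ^ 2 * f u ^ 2 / (2 * S.rT t ^ 2) -
        (⟪ν u, zd⟫_ℝ + (Td - 1) * k u) / S.rT t ^ 2 * (f u - k u * f u ^ 2 / 2) +
        2 * Td / S.rT t ^ 4 * (f u ^ 2 / 2 - k u * f u ^ 3 / 3)) := by
  have hr := G.radius_pos
  have hfl (u : ℝ) : |f u| ≤ S.rT t / 16 := (G.height_bound u).trans (by nlinarith)
  have hF (u l : ℝ) (hl : |l| ≤ S.rT t / 16) := G.fields hδ hS ht hz hT u hl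
  obtain ⟨c1, c2, c3, c4, c5, c6, c7⟩ := G.continuity
  obtain ⟨c8, c9⟩ := G.continuous_inv
  obtain ⟨i1, i2⟩ := G.intervalIntegrable_curvDensity
  have hsum (F : Fin (n + 2) → Plane → ℝ) :
      ∑ j ∈ (Finset.univ : Finset (Fin (n + 2))).erase 0, ∫ x in S.iface 0 j t, F j x ∂μH[1] =
        ∫ x in S.iface 0 (Fin.last (n + 1)) t, F (Fin.last (n + 1)) x ∂μH[1] := by
    refine Finset.sum_eq_single _ (fun j hj hjl => ?_) fun hl => ?_
    · rw [Setting.iface, h0 j (Finset.mem_erase.1 hj).1 hjl, inter_empty, Measure.restrict_empty,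
        integral_zero_measure]
    · exact absurd (Finset.mem_erase.2 ⟨Fin.last_pos.ne', Finset.mem_univ _⟩) hl
  have hχm : Measurable fun x => S.χ 0 x t :=
    (hS.weak.measurable_phase 0).comp (measurable_id.prodMk measurable_const)
  have hx (u : ℝ) : S.shift S.xi (graphCurve γ ν f u) t = ν u := (hF u _ (hfl u)).2.1.1
  have hb (u : ℝ) : S.shift S.vel (graphCurve γ ν f u) t = k u • ν u := (hF u _ (hfl u)).2.1.2.1
  have hw (u : ℝ) : S.shift (S.weight 0) (graphCurve γ ν f u) t = -f u / S.rT t ^ 2 :=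
    (hF u _ (hfl u)).2.1.2.2
  have n2 (u : ℝ) := G.graph.tube.norm_normal u
  have p2 (u : ℝ) := (G.graph.inner_graphNormal u).2
  have e1 : (∫ x in S.iface 0 (Fin.last (n + 1)) t, S.shift (S.weight 0) x t *
      (⟪S.shift S.vel x t, S.shift (S.xiPair 0 (Fin.last (n + 1))) x t⟫_ℝ - S.speed 0 x t) ∂μH[1]) =
      ∫ u in (0 : ℝ)..L, -f u / S.rT t ^ 2 *
        (curvDensity γ ν k f g u - k u * ‖deriv (graphCurve γ ν f) u‖) := by
    rw [O.iface, G.graph.integral_graph]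
    refine G.integral_congr_curvature fun u hu => ?_
    rw [O.speed, O.xi, hx, hb, hw, ← hu, smul_eq_mul]
    simp only [inner_smul_left, inner_smul_right, real_inner_self_eq_norm_sq, n2,
      RCLike.conj_to_real]
    ring
  have e2 : (∫ x in S.iface 0 (Fin.last (n + 1)) t, S.shift (S.weight 0) x t *
      ⟪S.shift S.vel x t, S.normal 0 x t - S.shift (S.xiPair 0 (Fin.last (n + 1))) x t⟫_ℝ ∂μH[1]) =
      ∫ u in (0 : ℝ)..L, -f u / S.rT t ^ 2 *
        (k u * (‖deriv (graphCurve γ ν f) u‖ - (1 - k u * f u))) := by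
    refine G.integral_iface O _ fun u => ?_
    have hJ := (G.graph.norm_deriv_graphCurve_pos u).ne'
    rw [O.normal, O.xi, hx, hb, hw]
    simp only [inner_smul_left, inner_smul_right, inner_sub_right, real_inner_self_eq_norm_sq, n2,
      RCLike.conj_to_real, p2]
    field_simp
    ring
  have e3 : (∫ x, (S.χ 0 x t - S.shift (S.chiBar 0) x t) * S.shift (S.weight 0) x t *
      divg (fun y => S.shift S.vel y t) x) =
      -∫ u in (0 : ℝ)..L, k u ^ 2 * f u ^ 2 / (2 * S.rT t ^ 2) := by
    simp only [mul_assoc, shift_chiBar_zero]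
    -- `integral_jump_mul` asks for a globally continuous integrand. Truncating the denominator at
    -- `1 / 2` achieves this and changes nothing for `|l| ≤ r / 16`, where the denominator is at
    -- least `7 / 8`.
    have hφ : Continuous fun p : ℝ × ℝ => -p.2 / S.rT t ^ 2 * -(k p.1 ^ 2 *
        (max (1 - k p.1 * p.2) (1 / 2))⁻¹) := by
      have : Continuous fun p : ℝ × ℝ => (max (1 - k p.1 * p.2) (1 / 2))⁻¹ :=
        Continuous.inv₀ (by fun_prop) fun p => (lt_max_of_lt_right (by norm_num)).ne'
      fun_prop
    have hmax (u l : ℝ) (hl : |l| ≤ S.rT t / 16) : max (1 - k u * l) (1 / 2) = 1 - k u * l := by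
      refine max_eq_left ?_
      linarith [G.stretch_ge hδ (u := u) hl]
    rw [G.graph.integral_jump_mul hχm G.phase (φ := fun u l => -l / S.rT t ^ 2 *
      -(k u ^ 2 * (max (1 - k u * l) (1 / 2))⁻¹)) hφ fun u l hl => ?_]
    · congr 1
      refine intervalIntegral.integral_congr fun u _ => ?_
      have h1 : ∫ l in (0 : ℝ)..f u, (1 - k u * l) * (-l / S.rT t ^ 2 *
          -(k u ^ 2 * (max (1 - k u * l) (1 / 2))⁻¹)) =
          ∫ l in (0 : ℝ)..f u, k u ^ 2 / S.rT t ^ 2 * l := by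
        refine intervalIntegral.integral_congr fun l hl => ?_
        have hl' := (mem_uIcc_zero_abs hl).trans (hfl u)
        have h2 : 1 - k u * l ≠ 0 := by linarith [G.stretch_ge hδ (u := u) hl']
        rw [hmax u l hl']
        field_simp
      rw [h1, intervalIntegral.integral_const_mul, integral_id]
      field_simp
      ring
    · have hl' : |l| ≤ S.rT t / 16 := by linarith
      beta_reduce
      rw [(hF u l hl').2.1.2.2, (hF u l hl').2.2.2.2.2.2.1, hmax u l hl', div_eq_mul_inv (k u ^ 2)]
  have e4 : (∫ x, (S.χ 0 x t - S.shift (S.chiBar 0) x t) *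
      (deriv (fun s => S.shift (S.weight 0) x s) t +
        ⟪S.shift S.vel x t, gradient (fun y => S.shift (S.weight 0) y t) x⟫_ℝ)) =
      -∫ u in (0 : ℝ)..L,
        ((⟪ν u, zd⟫_ℝ + (Td - 1) * k u) / S.rT t ^ 2 * (f u - k u * f u ^ 2 / 2) -
        2 * Td / S.rT t ^ 4 * (f u ^ 2 / 2 - k u * f u ^ 3 / 3)) := by
    simp only [shift_chiBar_zero]
    rw [G.graph.integral_jump_mul hχm G.phase (φ := fun u l =>
      (⟪ν u, zd⟫_ℝ + (Td - 1) * k u) / S.rT t ^ 2 - 2 * Td / S.rT t ^ 4 * l)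
      (by fun_prop) fun u l hl => ?_]
    · congr 1
      refine intervalIntegral.integral_congr fun u _ => ?_
      exact integral_affine _ _ _ _
    · have hl' : |l| ≤ S.rT t / 16 := by linarith
      rw [(hF u l hl').2.2.2.2.2.2.2.1, (hF u l hl').2.2.2.2.2.2.2.2, (hF u l hl').2.1.2.1,
        inner_smul_right, real_inner_self_eq_norm_sq, n2]
      ring
  have hB : S.rhsBulk 0 t =
      -(∫ u in (0 : ℝ)..L, -f u / S.rT t ^ 2 *
        (curvDensity γ ν k f g u - k u * ‖deriv (graphCurve γ ν f) u‖)) -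
      (∫ u in (0 : ℝ)..L, -f u / S.rT t ^ 2 *
        (k u * (‖deriv (graphCurve γ ν f) u‖ - (1 - k u * f u)))) +
      (-∫ u in (0 : ℝ)..L, k u ^ 2 * f u ^ 2 / (2 * S.rT t ^ 2)) +
      -∫ u in (0 : ℝ)..L,
        ((⟪ν u, zd⟫_ℝ + (Td - 1) * k u) / S.rT t ^ 2 * (f u - k u * f u ^ 2 / 2) -
        2 * Td / S.rT t ^ 4 * (f u ^ 2 / 2 - k u * f u ^ 3 / 3)) :=
    congrArg₂ (· + ·) (congrArg₂ (· + ·) (congrArg₂ (· - ·)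
      (congrArg (- ·) ((hsum _).trans e1)) ((hsum _).trans e2)) e3) e4
  have i3 : IntervalIntegrable (fun u => -f u / S.rT t ^ 2 * (curvDensity γ ν k f g u -
      k u * ‖deriv (graphCurve γ ν f) u‖)) volume 0 L :=
    (i1.sub (Continuous.intervalIntegrable (by fun_prop) _ _)).continuousOn_mul
      (Continuous.continuousOn (by fun_prop))
  rw [hB, ← intervalIntegral.integral_neg, ← intervalIntegral.integral_neg,
    ← intervalIntegral.integral_neg, ← intervalIntegral.integral_sub,
    ← intervalIntegral.integral_add, ← intervalIntegral.integral_add]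
  · refine intervalIntegral.integral_congr fun u _ => ?_
    beta_reduce
    ring
  · refine (i3.neg.sub ?_).add ?_ <;> exact Continuous.intervalIntegrable (by fun_prop) _ _
  · exact Continuous.intervalIntegrable (by fun_prop) _ _
  · refine i3.neg.sub ?_
    exact Continuous.intervalIntegrable (by fun_prop) _ _
  · exact Continuous.intervalIntegrable (by fun_prop) _ _
  · exact i3.neg
  · exact Continuous.intervalIntegrable (by fun_prop) _ _

end

end GraphSlice

end CircMCF

/-! ### The error functionals and the total density -/

namespace CircMCF
namespace GraphSlice

variable {n : ℕ} {S : Setting n} {t δ ε Cζ : ℝ} {γ ν : ℝ → Plane} {k f g : ℝ → ℝ} {L : ℝ}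
  {h : Plane → ℝ}

lemma rhsBulk_eq_zero {i : Fin (n + 2)} (hi : i ≠ 0) (hi' : i ≠ Fin.last (n + 1))
    (hχ : ∀ᵐ x, S.χ i x t = 0) : S.rhsBulk i t = 0 := by
  have h1 : redBdry (fun x => S.χ i x t) = ∅ := redBdry_eq_empty hχ
  have h2 (F : Fin (n + 2) → Plane → ℝ) : ∑ j ∈ (Finset.univ : Finset (Fin (n + 2))).erase i,
      ∫ x in S.iface i j t, F j x ∂μH[1] = 0 :=
    Finset.sum_eq_zero fun j _ => by
      rw [Setting.iface, h1, empty_inter, Measure.restrict_empty, integral_zero_measure]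
  have h3 (F : Plane → ℝ) : ∫ x, (S.χ i x t - S.shift (S.chiBar i) x t) * F x = 0 := by
    refine integral_eq_zero_of_ae (hχ.mono fun x hx => ?_)
    simp [hx, Setting.shift, Setting.chiBar, hi, hi']
  have h4 : S.rhsBulk i t = -0 - 0 + 0 + 0 := by
    refine congrArg₂ (· + ·) (congrArg₂ (· + ·) (congrArg₂ (· - ·)
      (congrArg (- ·) (h2 _)) (h2 _)) ?_) (h3 _)
    simp only [mul_assoc]
    exact h3 _
  rw [h4]
  ring

section

variable (G : GraphSlice S t δ ε γ ν k f g L h)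
include G

theorem errInt_eq (hδ : δ < 1) (hε : ε ≤ 1 / 16)
    (hS : S.Standing δ Cζ) (ht : t ∈ Ioo 0 S.tχ) {zd : Plane} {Td : ℝ} (hz : HasDerivAt S.z zd t)
    (hT : HasDerivAt S.T Td t) (O : IsOriented S t γ ν k f L 0 (Fin.last (n + 1)) (-1))
    (O' : IsOriented S t γ ν k f L (Fin.last (n + 1)) 0 1)
    (h0 : ∀ i, i ≠ 0 → i ≠ Fin.last (n + 1) → redBdry (fun x => S.χ i x t) = ∅) :
    S.errInt t = ∫ u in (0 : ℝ)..L, (‖deriv (graphCurve γ ν f) u‖ - (1 - k u * f u)) := by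
  have hr := G.radius_pos
  have hfl (u : ℝ) : |f u| ≤ S.rT t / 16 := (G.height_bound u).trans (by nlinarith)
  have key {i j : Fin (n + 2)} {s : ℝ} (O : IsOriented S t γ ν k f L i j s) :
      ∫ x in S.iface i j t, (1 - ⟪S.normal i x t, S.shift (S.xiPair i j) x t⟫_ℝ) ∂μH[1] =
      ∫ u in (0 : ℝ)..L, (‖deriv (graphCurve γ ν f) u‖ - (1 - k u * f u)) := by
    refine G.integral_iface O _ fun u => ?_
    have hx : S.shift S.xi (graphCurve γ ν f u) t = ν u :=
      (G.fields hδ hS ht hz hT u (hfl u)).2.1.1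
    have hJ := (G.graph.norm_deriv_graphCurve_pos u).ne'
    rw [O.normal, O.xi, hx, inner_smul_left, inner_smul_right, real_inner_comm,
      (G.graph.inner_graphNormal u).2, RCLike.conj_to_real]
    rcases O.sign with rfl | rfl <;> field_simp
  rw [Setting.errInt, sum_offDiag_eq h0 (fun p hp => by
    rw [hp, Measure.restrict_empty, integral_zero_measure, mul_zero]), key O, key O']
  ring

/-- The weight `-l / r²` has the sign of the phase difference: negative inside, where phase can only
be missing, and positive outside. The absolute values can therefore be dropped before passing to
tubular coordinates. -/
theorem errBulk_eq (hδ : δ < 1)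
    (hS : S.Standing δ Cζ) (ht : t ∈ Ioo 0 S.tχ) {zd : Plane} {Td : ℝ} (hz : HasDerivAt S.z zd t)
    (hT : HasDerivAt S.T Td t)
    (h0 : ∀ i, i ≠ 0 → i ≠ Fin.last (n + 1) → ∀ᵐ x, S.χ i x t = 0) :
    S.errBulk t = ∫ u in (0 : ℝ)..L, (f u ^ 2 / 2 - k u * f u ^ 3 / 3) / S.rT t ^ 2 := by
  have hr := G.radius_pos
  obtain ⟨c1, c2, c3, c4, c5, c6, c7⟩ := G.continuity
  have hχm : Measurable fun x => S.χ 0 x t :=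
    (hS.weak.measurable_phase 0).comp (measurable_id.prodMk measurable_const)
  have hF (u l : ℝ) (hl : |l| ≤ S.rT t / 16) := G.fields hδ hS ht hz hT u hl
  have h1 : S.errBulk t = ∫ x, |S.χ 0 x t - S.shift (S.chiBar 0) x t| *
      |S.shift (S.weight 0) x t| := by
    rw [Setting.errBulk]
    refine Finset.sum_eq_single _ (fun i hi hi0 => ?_) fun hl => ?_
    · have hil := (Finset.mem_erase.1 hi).1
      refine integral_eq_zero_of_ae ((h0 i hi0 hil).mono fun x hx => ?_)
      simp [hx, Setting.shift, Setting.chiBar, hi0, hil]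
    · exact absurd (Finset.mem_erase.2 ⟨Fin.last_pos.ne, Finset.mem_univ _⟩) hl
  have h2 : (∫ x, |S.χ 0 x t - S.shift (S.chiBar 0) x t| * |S.shift (S.weight 0) x t|) =
      ∫ x, (S.χ 0 x t - (S.shiftedA t).indicator 1 x) * S.shift (S.weight 0) x t := by
    refine integral_congr_ae ?_
    filter_upwards [G.phase, G.graph.ae_eq_indicator_of_le G.phase] with x hx hx'
    rw [shift_chiBar_zero]
    by_cases hs : |sdist (S.shiftedA t) x| < S.rT t / 2
    · obtain ⟨u, -, l, hl, rfl, -⟩ := G.graph.exists_coord hs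
      obtain ⟨e1, e2⟩ := G.graph.indicator_coord u hl
      rw [hx, e1, e2]
      have hfu := abs_le.1 (G.graph.le u)
      by_cases hl2 : |l| ≤ S.rT t / 16
      · rw [(hF u l hl2).2.1.2.2]
        have hr2 : 0 < S.rT t ^ 2 := by positivity
        by_cases h3 : f u < l <;> by_cases h4 : 0 < l <;>
          simp only [indicator, mem_Ioi, h3, h4, if_true, if_false, Pi.one_apply, sub_self,
            abs_zero, zero_mul, sub_zero, zero_sub, abs_neg, abs_one, one_mul, neg_mul]
        · rw [abs_of_nonneg]
          exact div_nonneg (by linarith) hr2.le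
        · rw [abs_of_nonpos]
          exact div_nonpos_of_nonpos_of_nonneg (by linarith) hr2.le
      · rcases lt_abs.1 (not_le.1 hl2) with h3 | h3
        · simp [indicator, show f u < l by linarith, show 0 < l by linarith]
        · simp [indicator, show ¬ f u < l by linarith, show ¬ 0 < l by linarith]
    · rw [hx' (not_lt.1 hs)]
      simp
  rw [h1, h2, G.graph.integral_jump_mul hχm G.phase (φ := fun _ l => -l / S.rT t ^ 2)
    (by fun_prop) fun u l hl => (hF u l (by linarith)).2.1.2.2, ← intervalIntegral.integral_neg]
  refine intervalIntegral.integral_congr fun u _ => ?_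
  have h3 : (fun l => (1 - k u * l) * (-l / S.rT t ^ 2)) =
      fun l => (1 - k u * l) * (0 - 1 / S.rT t ^ 2 * l) := by
    funext l
    ring
  rw [h3, integral_affine]
  ring

end

/-- The density of the relative energy inequality, with `κ` times the relative energy added. -/
def density (r κ : ℝ) (zd : Plane) (Td : ℝ) (γ ν : ℝ → Plane) (k f g : ℝ → ℝ) (u : ℝ) : ℝ :=
  -(curvDensity γ ν k f g u ^ 2 * ‖deriv (graphCurve γ ν f) u‖⁻¹) +
  curvDensity γ ν k f g u * (k u / (1 - k u * f u) +
    k u * (1 - k u * f u) / ‖deriv (graphCurve γ ν f) u‖ + f u / r ^ 2) +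
  (-(1 / 2 * ‖deriv (graphCurve γ ν f) u‖ * k u ^ 2 * (1 + ((1 - k u * f u)⁻¹) ^ 2)) +
  deriv f u * (k u * ⟪deriv γ u, zd⟫_ℝ - (Td - 1) * deriv k u) / (1 - k u * f u) +
  1 / 2 * ‖deriv (graphCurve γ ν f) u‖ * (k u - k u / (1 - k u * f u)) ^ 2 +
  deriv f u / (1 - k u * f u) * (deriv k u *
    ((1 - k u * f u) / ‖deriv (graphCurve γ ν f) u‖ - 1) +
    k u ^ 2 * deriv f u / ‖deriv (graphCurve γ ν f) u‖) -
  f u / r ^ 2 * (k u * (1 - k u * f u)) -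
  k u ^ 2 * f u ^ 2 / (2 * r ^ 2) -
  (⟪ν u, zd⟫_ℝ + (Td - 1) * k u) / r ^ 2 * (f u - k u * f u ^ 2 / 2) +
  2 * Td / r ^ 4 * (f u ^ 2 / 2 - k u * f u ^ 3 / 3) +
  κ * (‖deriv (graphCurve γ ν f) u‖ - (1 - k u * f u) +
    (f u ^ 2 / 2 - k u * f u ^ 3 / 3) / r ^ 2))

/-- Both orientations contribute equally, so the factor `1 / 2` disappears. Adding `κ` times the
error turns the claimed inequality, for suitable `κ`, into nonpositivity of one integral. -/
theorem relativeEnergy_eq (G : GraphSlice S t δ ε γ ν k f g L h) (hδ : δ < 1) (hε : ε ≤ 1 / 16)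
    (hS : S.Standing δ Cζ) (ht : t ∈ Ioo 0 S.tχ) {zd : Plane} {Td : ℝ} (hz : HasDerivAt S.z zd t)
    (hT : HasDerivAt S.T Td t)
    (hreg : IsRegularSlice (fun i x => S.χ i x t) (S.V t) fun x => S.H x t)
    (h0 : ∀ i, i ≠ 0 → i ≠ Fin.last (n + 1) → ∀ᵐ x, S.χ i x t = 0) (κ : ℝ) :
    IntervalIntegrable (density (S.rT t) κ zd Td γ ν k f g) volume 0 L ∧
    (∑ p ∈ (Finset.univ : Finset (Fin (n + 2))).offDiag,
        (1 / 2) * (-S.dissip p.1 p.2 t + S.rhsInt p.1 p.2 t))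
      + ∑ i ∈ (Finset.univ : Finset (Fin (n + 2))).erase (Fin.last (n + 1)), S.rhsBulk i t
      + κ * S.err t = ∫ u in (0 : ℝ)..L, density (S.rT t) κ zd Td γ ν k f g u := by
  obtain ⟨O, O'⟩ := G.isOriented_zero_last hS hreg
  have h0' (i : Fin (n + 2)) (hi : i ≠ 0) (hi' : i ≠ Fin.last (n + 1)) :
      redBdry (fun x => S.χ i x t) = ∅ := redBdry_eq_empty (h0 i hi hi')
  have hempty (p : Fin (n + 2) × Fin (n + 2)) (hp : S.iface p.1 p.2 t = ∅) :
      (1 / 2) * (-S.dissip p.1 p.2 t + S.rhsInt p.1 p.2 t) = 0 := by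
    simp [Setting.dissip, Setting.rhsInt, hp]
  have hbulk : ∑ i ∈ (Finset.univ : Finset (Fin (n + 2))).erase (Fin.last (n + 1)), S.rhsBulk i t =
      S.rhsBulk 0 t := by
    refine Finset.sum_eq_single _ (fun i hi hi0 => ?_) fun hl => ?_
    · have hil := (Finset.mem_erase.1 hi).1
      exact rhsBulk_eq_zero hi0 hil (h0 i hi0 hil)
    · exact absurd (Finset.mem_erase.2 ⟨Fin.last_pos.ne, Finset.mem_univ _⟩) hl
  obtain ⟨c1, c2, c3, c4, c5, c6, c7⟩ := G.continuity
  obtain ⟨c8, c9⟩ := G.continuous_inv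
  obtain ⟨i1, i2⟩ := G.intervalIntegrable_curvDensity
  rw [sum_offDiag_eq h0' hempty, hbulk, Setting.err, G.errInt_eq hδ hε hS ht hz hT O O' h0',
    G.errBulk_eq hδ hS ht hz hT h0, G.rhsBulk_zero_eq hδ hε hS ht hz hT O h0',
    G.dissip_eq hδ hε hS ht hz hT O, G.dissip_eq hδ hε hS ht hz hT O',
    G.rhsInt_eq hδ hε hS ht hz hT O, G.rhsInt_eq hδ hε hS ht hz hT O']
  have hc (φ : ℝ → ℝ) (hφ : Continuous φ) : IntervalIntegrable φ volume 0 L :=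
    hφ.intervalIntegrable _ _
  have m1 (φ : ℝ → ℝ) (hφ : Continuous φ) :
      IntervalIntegrable (fun u => curvDensity γ ν k f g u * φ u) volume 0 L :=
    i1.mul_continuousOn hφ.continuousOn
  have m2 (φ : ℝ → ℝ) (hφ : Continuous φ) :
      IntervalIntegrable (fun u => curvDensity γ ν k f g u ^ 2 * φ u) volume 0 L :=
    i2.mul_continuousOn hφ.continuousOn
  have m3 (φ : ℝ → ℝ) (hφ : Continuous φ) :
      IntervalIntegrable (fun u => φ u * curvDensity γ ν k f g u) volume 0 L :=
    i1.continuousOn_mul hφ.continuousOn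
  have I : IntervalIntegrable (density (S.rT t) κ zd Td γ ν k f g) volume 0 L := by
    unfold density
    simp only [div_eq_mul_inv]
    refine ((m2 _ (by fun_prop)).neg.add (m1 _ (by fun_prop))).add (hc _ (by fun_prop))
  refine ⟨I, ?_⟩
  set D : ℝ → ℝ := fun u => curvDensity γ ν k f g u ^ 2 *
      ‖deriv (graphCurve γ ν f) u‖⁻¹ - curvDensity γ ν k f g u * (k u / (1 - k u * f u) +
        k u * (1 - k u * f u) / ‖deriv (graphCurve γ ν f) u‖) +
      1 / 2 * ‖deriv (graphCurve γ ν f) u‖ * k u ^ 2 * (1 + ((1 - k u * f u)⁻¹) ^ 2) with hD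
  have iD : IntervalIntegrable D volume 0 L := by
    simp only [hD, div_eq_mul_inv]
    exact ((m2 _ (by fun_prop)).sub (m1 _ (by fun_prop))).add (hc _ (by fun_prop))
  set X : ℝ → ℝ := fun u =>
      deriv f u * (k u * ⟪deriv γ u, zd⟫_ℝ - (Td - 1) * deriv k u) / (1 - k u * f u) +
      1 / 2 * ‖deriv (graphCurve γ ν f) u‖ * (k u - k u / (1 - k u * f u)) ^ 2 +
      deriv f u / (1 - k u * f u) * (deriv k u *
        ((1 - k u * f u) / ‖deriv (graphCurve γ ν f) u‖ - 1) +
        k u ^ 2 * deriv f u / ‖deriv (graphCurve γ ν f) u‖) with hX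
  have iX : IntervalIntegrable X volume 0 L := by
    simp only [hX, div_eq_mul_inv]
    exact hc _ (by fun_prop)
  set Y : ℝ → ℝ := fun u => f u / S.rT t ^ 2 * (curvDensity γ ν k f g u - k u * (1 - k u * f u)) -
        k u ^ 2 * f u ^ 2 / (2 * S.rT t ^ 2) -
        (⟪ν u, zd⟫_ℝ + (Td - 1) * k u) / S.rT t ^ 2 * (f u - k u * f u ^ 2 / 2) +
        2 * Td / S.rT t ^ 4 * (f u ^ 2 / 2 - k u * f u ^ 3 / 3) with hY
  have iY : IntervalIntegrable Y volume 0 L := by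
    have e : Y = fun u => f u / S.rT t ^ 2 * curvDensity γ ν k f g u +
        (-(f u / S.rT t ^ 2 * (k u * (1 - k u * f u))) -
        k u ^ 2 * f u ^ 2 / (2 * S.rT t ^ 2) -
        (⟪ν u, zd⟫_ℝ + (Td - 1) * k u) / S.rT t ^ 2 * (f u - k u * f u ^ 2 / 2) +
        2 * Td / S.rT t ^ 4 * (f u ^ 2 / 2 - k u * f u ^ 3 / 3)) := by
      funext u
      simp only [hY]
      ring
    rw [e]
    exact (m3 _ (by fun_prop)).add (hc _ (by fun_prop))
  have iE1 := hc (fun u => ‖deriv (graphCurve γ ν f) u‖ - (1 - k u * f u)) (by fun_prop)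
  have iE2 := hc (fun u => (f u ^ 2 / 2 - k u * f u ^ 3 / 3) / S.rT t ^ 2) (by fun_prop)
  have e : ∀ u, density (S.rT t) κ zd Td γ ν k f g u = -D u + X u + Y u +
      κ * (‖deriv (graphCurve γ ν f) u‖ - (1 - k u * f u) +
        (f u ^ 2 / 2 - k u * f u ^ 3 / 3) / S.rT t ^ 2) := fun u => by
    simp only [density, hD, hX, hY]
    ring
  have iDn : IntervalIntegrable (fun u => -D u) volume 0 L := iD.neg
  simp only [e]
  rw [intervalIntegral.integral_add ((iDn.add iX).add iY) ((iE1.add iE2).const_mul κ),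
    intervalIntegral.integral_add (iDn.add iX) iY, intervalIntegral.integral_add iDn iX,
    intervalIntegral.integral_neg, intervalIntegral.integral_const_mul,
    intervalIntegral.integral_add iE1 iE2]
  ring

end GraphSlice

end CircMCF

namespace CircMCF

/-! ### The pointwise estimate -/

section Near

variable {σ x y m n : ℝ}

/-- Bookkeeping for quantities equal to `1` up to a multiple of `σ`; the condition `σ ≤ 1` returns
products of errors to first order. -/
lemma near_mul (hσ : 0 ≤ σ) (hσ1 : σ ≤ 1) (hm : 0 ≤ m) (hn : 0 ≤ n) (hx : |x - 1| ≤ m * σ)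
    (hy : |y - 1| ≤ n * σ) : |x * y - 1| ≤ (m + n + m * n) * σ := by
  have h1 : x * y - 1 = (x - 1) * (y - 1) + (x - 1) + (y - 1) := by ring
  have h2 : |(x - 1) * (y - 1)| ≤ m * n * σ := by
    rw [abs_mul]
    calc |x - 1| * |y - 1| ≤ (m * σ) * (n * σ) := by gcongr
      _ = m * n * σ * σ := by ring
      _ ≤ m * n * σ * 1 := by gcongr
      _ = m * n * σ := mul_one _
  rw [h1]
  refine (abs_add_three _ _ _).trans ?_
  linarith

lemma near_inv (hx : |x - 1| ≤ m * σ) (h : m * σ ≤ 1 / 2) : |x⁻¹ - 1| ≤ 2 * m * σ := by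
  obtain ⟨h1, h2⟩ := abs_le.1 hx
  have hx0 : 1 / 2 ≤ x := by linarith
  have h3 : x⁻¹ - 1 = (1 - x) * x⁻¹ := by
    have : x ≠ 0 := by linarith
    field_simp
  have h4 : |x⁻¹| ≤ 2 := by
    rw [abs_of_pos (by positivity)]
    exact inv_le_of_inv_le₀ (by norm_num) (by linarith)
  rw [h3, abs_mul, abs_sub_comm]
  nlinarith [abs_nonneg (x - 1), abs_nonneg x⁻¹]

/-- A coefficient close to `1` is replaced by `1` at the price of a small multiple of the total
square sum, which bounds `z`. -/
lemma mul_le_add_of_near {c z N s : ℝ} (hc : |c - 1| ≤ N * σ) (hz : |z| ≤ s) :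
    c * z ≤ z + N * σ * s := by
  have h1 : (c - 1) * z ≤ N * σ * s := by
    refine (le_abs_self _).trans ?_
    rw [abs_mul]
    exact mul_le_mul hc hz (abs_nonneg _) ((abs_nonneg _).trans hc)
  linarith

lemma mul_le_of_small {c z N s : ℝ} (hc : |c| ≤ N * σ) (hz : |z| ≤ s) : c * z ≤ N * σ * s := by
  refine (le_abs_self _).trans ?_
  rw [abs_mul]
  exact mul_le_mul hc hz (abs_nonneg _) ((abs_nonneg _).trans hc)

lemma abs_mul_le_of_le {a b A B : ℝ} (ha : |a| ≤ A) (hb : |b| ≤ B) : |a * b| ≤ A * B := by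
  rw [abs_mul]
  exact mul_le_mul ha hb (abs_nonneg _) ((abs_nonneg _).trans ha)

lemma abs_mul_le_of_sq_add_sq_le {u v s : ℝ} (h : u ^ 2 + v ^ 2 ≤ 2 * s) : |u * v| ≤ s := by
  rw [abs_le]
  constructor <;> nlinarith [sq_nonneg (u + v), sq_nonneg (u - v)]

end Near

variable {α σ K M y p q X W θ J a : ℝ}

/-- The dimensionless form of the density. -/
def scaledDensity (α K M y p q X W θ J a : ℝ) : ℝ :=
  -((K + (q * a + (M * y + K * p) * p) / J ^ 2) ^ 2 * J⁻¹) +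
  (K + (q * a + (M * y + K * p) * p) / J ^ 2) * (K / a + K * a / J + y) +
  (-(1 / 2 * J * K ^ 2 * (1 + (a⁻¹) ^ 2)) + p * (K * X - θ * M) / a +
  1 / 2 * J * (K - K / a) ^ 2 + p / a * (M * (a / J - 1) + K ^ 2 * p / J) - y * (K * a) -
  K ^ 2 * y ^ 2 / 2 - (W + θ * K) * (y - K * y ^ 2 / 2) +
  2 * (1 + θ) * (y ^ 2 / 2 - K * y ^ 3 / 3) +
  α * (1 + θ) * (J - a + (y ^ 2 / 2 - K * y ^ 3 / 3)))

/-- The terms of order zero and one have to cancel exactly before anything is estimated. The tools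
are `J - a = p² / (J + a)` and `K y = 1 - a`; afterwards each summand is visibly quadratic in `q`,
`p`, `y`, `X`, `W`, `θ`, has a factor that is small, or has a sign. -/
lemma scaledDensity_eq (ha : a = 1 - K * y) (ha0 : 0 < a) (hJ : 0 < J) (hJ2 : J ^ 2 = a ^ 2 + p ^ 2) :
    scaledDensity α K M y p q X W θ J a =
      -(((a * J⁻¹ * J⁻¹) * q + (M * y + K * p) * J⁻¹ * J⁻¹ * p) ^ 2 * J⁻¹) +
      ((a * J⁻¹ * J⁻¹) * q + (M * y + K * p) * J⁻¹ * J⁻¹ * p) *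
        (K * (p * (J + a)⁻¹) * a⁻¹ * J⁻¹ * p + (1 - K * K * J⁻¹) * y) -
      K ^ 2 * (J - a) ^ 2 / (2 * J * a ^ 2) - 1 / 2 * (K * K * (K * K) * J⁻¹ * y ^ 2) -
      1 / 2 * (K * K * J⁻¹ * p ^ 2) +
      1 / 2 * (K * K * y ^ 2) + K * a⁻¹ * (p * X) + (-M * a⁻¹) * (p * θ) +
      1 / 2 * (J * (K * K * (K * K)) * (a⁻¹ * a⁻¹) * y ^ 2) +
      (-M * (p * (J + a)⁻¹) * a⁻¹ * J⁻¹) * (p * p) + K * K * (a⁻¹ * J⁻¹) * p ^ 2 +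
      -(W * y) + K * y / 2 * (W * y) + K * -(θ * y) + K * K * y / 2 * (θ * y) +
      (1 + θ) * (1 - 2 / 3 * (K * y)) * y ^ 2 +
      1 / 2 * α * ((1 + θ) * ((J + a) / 2)⁻¹ * p ^ 2 +
        (1 + θ) * (1 - 2 / 3 * (K * y)) * y ^ 2) := by
  have hJa : J + a ≠ 0 := by positivity
  have hJ0 := hJ.ne'
  have ha' := ha0.ne'
  have he : J - a = p * (p * (J + a)⁻¹) := by
    field_simp
    linear_combination hJ2
  have hy : K * y = 1 - a := by rw [ha]; ring
  -- The coefficient of `K ^ 2` after expanding the scaled curvature as `K` plus a correction; it is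
  -- of second order in `y` and `p`.
  have hconst : -J⁻¹ + a⁻¹ + a * J⁻¹ - J / 2 - J * a⁻¹ ^ 2 / 2 =
      -((J - a) ^ 2 / (2 * J * a ^ 2)) - (K * y * (K * y) + p ^ 2) * J⁻¹ / 2 := by
    rw [hy]
    field_simp
    linear_combination (-a ^ 2) * hJ2
  -- The coefficient of `K` times the curvature correction. Its first order part `-K y / J` nearly
  -- cancels the `y` coming from the bulk weight, which leaves the small factor `1 - K K J⁻¹`.
  have hlin : -2 * J⁻¹ + a⁻¹ + a * J⁻¹ = p * (p * (J + a)⁻¹) * a⁻¹ * J⁻¹ - K * y * J⁻¹ := by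
    rw [← he, hy]
    field_simp
    ring
  have hKa : (K - K / a) ^ 2 = K * K * (K * K) * (a⁻¹ * a⁻¹) * y ^ 2 := by
    have : K - K / a = -(K * (K * y) * a⁻¹) := by
      rw [hy]
      field_simp
      ring
    rw [this]
    ring
  have hM : M * (a / J - 1) = -M * (p * (J + a)⁻¹) * J⁻¹ * p := by
    have : a / J - 1 = -(J - a) * J⁻¹ := by
      field_simp
      ring
    rw [this, he]
    ring
  have hc2 : ((J + a) / 2)⁻¹ = 2 * (J + a)⁻¹ := by
    field_simp
  unfold scaledDensity
  rw [hKa, hM, hc2]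
  simp only [div_eq_mul_inv] at hconst ⊢
  rw [← inv_pow]
  linear_combination K ^ 2 * hconst + K * (q * a * (J⁻¹ ^ 2) + (M * y + K * p) * p * (J⁻¹ ^ 2)) * hlin +
    α * (1 + θ) * he - K * y * hy

set_option maxHeartbeats 600000 in
/-- The density is a small perturbation of a quadratic form. -/
theorem scaledDensity_le (hα : 0 ≤ α) (hα5 : α ≤ 5) (hσ : σ ≤ 1 / 100) (hK : |K - 1| ≤ σ)
    (hM : |M| ≤ σ) (hy : |y| ≤ σ) (hp : |p| ≤ σ) (hθ : |θ| ≤ σ) (ha : a = 1 - K * y) (hJ : 0 < J)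
    (hJ2 : J ^ 2 = a ^ 2 + p ^ 2) :
    scaledDensity α K M y p q X W θ J a ≤ -q ^ 2 + (3 + α) / 2 * y ^ 2 + (1 + α) / 2 * p ^ 2 +
      p * X - W * y - θ * y +
      1000000 * σ * (q ^ 2 + p ^ 2 + y ^ 2 + X ^ 2 + W ^ 2 + θ ^ 2) := by
  have hσ0 : 0 ≤ σ := (abs_nonneg _).trans hy
  have hσ1 : σ ≤ 1 := by linarith
  have hσσ : σ * σ ≤ σ := by nlinarith
  have K1 : |K - 1| ≤ 1 * σ := by linarith
  have hK2 : |K| ≤ 2 := by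
    obtain ⟨h1, h2⟩ := abs_le.1 hK
    exact abs_le.2 ⟨by linarith, by linarith⟩
  have hKy : |K * y| ≤ 2 * σ := abs_mul_le_of_le hK2 hy
  have a1 : |a - 1| ≤ 2 * σ := by
    rw [ha, show 1 - K * y - 1 = -(K * y) by ring, abs_neg]; exact hKy
  obtain ⟨al, au⟩ := abs_le.1 a1
  have ha0 : 0 < a := by linarith
  have hJa : a ≤ J := by nlinarith [sq_nonneg p]
  have hJu : J ≤ a + |p| := by nlinarith [abs_nonneg p, sq_abs p]
  have J1 : |J - 1| ≤ 3 * σ := abs_le.2 ⟨by linarith, by linarith⟩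
  have i1 : |J⁻¹ - 1| ≤ 6 * σ := by
    have := near_inv J1 (by linarith only [hσ]); linarith only [this]
  have i2 : |a⁻¹ - 1| ≤ 4 * σ := by
    have := near_inv a1 (by linarith only [hσ]); linarith only [this]
  have i3 : |((J + a) / 2)⁻¹ - 1| ≤ 6 * σ := by
    have h1 : |(J + a) / 2 - 1| ≤ 3 * σ := by
      obtain ⟨h1, h2⟩ := abs_le.1 J1
      exact abs_le.2 ⟨by linarith, by linarith⟩
    have := near_inv h1 (by linarith only [hσ]); linarith only [this]
  have small_of_near {x N : ℝ} (hN : N * σ ≤ 1) (hx : |x - 1| ≤ N * σ) : |x| ≤ 2 := by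
    obtain ⟨h1, h2⟩ := abs_le.1 hx
    exact abs_le.2 ⟨by linarith, by linarith⟩
  have bJ : |J⁻¹| ≤ 2 := small_of_near (by linarith only [hσ]) i1
  have ba : |a⁻¹| ≤ 2 := small_of_near (by linarith only [hσ]) i2
  have be : |p * (J + a)⁻¹| ≤ σ := by
    have h1 : |(J + a)⁻¹| ≤ 1 := by
      rw [abs_of_pos (by positivity)]
      exact inv_le_one_of_one_le₀ (by linarith)
    have := abs_mul_le_of_le hp h1
    linarith only [this, hσ0, hσσ]
  have k2 := near_mul hσ0 hσ1 (by norm_num) (by norm_num) K1 K1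
  have k4 := near_mul hσ0 hσ1 (by norm_num) (by norm_num) k2 k2
  have ij := near_mul hσ0 hσ1 (by norm_num) (by norm_num) i2 i1
  have ii := near_mul hσ0 hσ1 (by norm_num) (by norm_num) i2 i2
  have A1 := near_mul hσ0 hσ1 (by norm_num) (by norm_num)
    (near_mul hσ0 hσ1 (by norm_num) (by norm_num) a1 i1) i1
  have bA : |a * J⁻¹ * J⁻¹| ≤ 8 := by
    have h0 : |a| ≤ 2 := small_of_near (by linarith only [hσ]) a1
    have := abs_mul_le_of_le (abs_mul_le_of_le h0 bJ) bJ
    linarith only [this, hσ0, hσσ]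
  have T1 := near_mul hσ0 hσ1 (by norm_num) (by norm_num) A1 A1
  have T1' := near_mul hσ0 hσ1 (by norm_num) (by norm_num) T1 i1
  have hb : |(M * y + K * p) * J⁻¹ * J⁻¹| ≤ 12 * σ := by
    have h1 : |M * y + K * p| ≤ 3 * σ := by
      refine (abs_add_le _ _).trans ?_
      have h2 := abs_mul_le_of_le hM hy
      have h3 := abs_mul_le_of_le hK2 hp
      linarith
    have := abs_mul_le_of_le (abs_mul_le_of_le h1 bJ) bJ
    linarith only [this, hσ0, hσσ]
  have hb1 : |K * (p * (J + a)⁻¹) * a⁻¹ * J⁻¹| ≤ 8 * σ := by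
    have := abs_mul_le_of_le (abs_mul_le_of_le (abs_mul_le_of_le hK2 be) ba) bJ
    linarith only [this, hσ0, hσσ]
  have kJ := near_mul hσ0 hσ1 (by norm_num) (by norm_num) k2 i1
  have hb2 : |1 - K * K * J⁻¹| ≤ 27 * σ := by
    rw [abs_sub_comm]; linarith only [kJ]
  have k4J := near_mul hσ0 hσ1 (by norm_num) (by norm_num) k4 i1
  have t7 := near_mul hσ0 hσ1 (by norm_num) (by norm_num)
    (near_mul hσ0 hσ1 (by norm_num) (by norm_num) J1 k4) ii
  have ka := near_mul hσ0 hσ1 (by norm_num) (by norm_num) K1 i2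
  have kij := near_mul hσ0 hσ1 (by norm_num) (by norm_num) k2 ij
  have θ1 : |1 + θ - 1| ≤ 1 * σ := by rw [add_sub_cancel_left]; linarith
  have c1 : |1 - 2 / 3 * (K * y) - 1| ≤ 2 * σ := by
    rw [show 1 - 2 / 3 * (K * y) - 1 = -(2 / 3 * (K * y)) by ring, abs_neg]
    have := abs_mul_le_of_le (show |(2 / 3 : ℝ)| ≤ 2 / 3 by norm_num) hKy
    linarith only [this, hσ0]
  have tc := near_mul hσ0 hσ1 (by norm_num) (by norm_num) θ1 c1
  have te := near_mul hσ0 hσ1 (by norm_num) (by norm_num) θ1 i3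
  set s := q ^ 2 + p ^ 2 + y ^ 2 + X ^ 2 + W ^ 2 + θ ^ 2 with hs
  have hprod (u v : ℝ) (h : u ^ 2 + v ^ 2 ≤ 2 * s) : |u * v| ≤ s := by
    exact abs_mul_le_of_sq_add_sq_le h
  have q0 := sq_nonneg q
  have p0 := sq_nonneg p
  have y0 := sq_nonneg y
  have X0 := sq_nonneg X
  have W0 := sq_nonneg W
  have θ0 := sq_nonneg θ
  have sq_le {u : ℝ} (h : u ^ 2 ≤ s) : |u ^ 2| ≤ s := by rwa [abs_of_nonneg (sq_nonneg u)]
  have sneg {u : ℝ} (h : u ^ 2 ≤ s) : |-u ^ 2| ≤ s := by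
    rw [abs_neg, abs_of_nonneg (sq_nonneg u)]; exact h
  have mq : q ^ 2 ≤ s := by linarith only [hs, q0, p0, y0, X0, W0, θ0]
  have mp : p ^ 2 ≤ s := by linarith only [hs, q0, p0, y0, X0, W0, θ0]
  have my : y ^ 2 ≤ s := by linarith only [hs, q0, p0, y0, X0, W0, θ0]
  -- From here each `e` treats one summand of `scaledDensity_eq`: coefficients near `1` are replaced
  -- by `1`, small ones cost a multiple of `σ * s`, and `e3` and `e8` discard terms of favorable
  -- sign. The final constant is generous.
  have e1 := mul_le_add_of_near T1' (sneg mq)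
  have e2 : -2 * (a * J⁻¹ * J⁻¹) * J⁻¹ * ((M * y + K * p) * J⁻¹ * J⁻¹) * (q * p) ≤
      2 * 8 * 2 * 12 * σ * s := by
    refine mul_le_of_small ?_ (hprod _ _ (by linarith only [hs, q0, p0, y0, X0, W0, θ0]))
    have h0 : |(-2 : ℝ)| ≤ 2 := by norm_num
    have := abs_mul_le_of_le (abs_mul_le_of_le (abs_mul_le_of_le h0 bA) bJ) hb
    linarith only [this, hσ0, hσσ]
  have e3 : 0 ≤ ((M * y + K * p) * J⁻¹ * J⁻¹ * p) ^ 2 * J⁻¹ := by positivity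
  have e4 : (a * J⁻¹ * J⁻¹) * (K * (p * (J + a)⁻¹) * a⁻¹ * J⁻¹) * (q * p) ≤ 8 * 8 * σ * s := by
    refine mul_le_of_small ?_ (hprod _ _ (by linarith only [hs, q0, p0, y0, X0, W0, θ0]))
    have := abs_mul_le_of_le bA hb1
    linarith only [this, hσ0, hσσ]
  have e5 : (a * J⁻¹ * J⁻¹) * (1 - K * K * J⁻¹) * (q * y) ≤ 8 * 27 * σ * s := by
    refine mul_le_of_small ?_ (hprod _ _ (by linarith only [hs, q0, p0, y0, X0, W0, θ0]))
    have := abs_mul_le_of_le bA hb2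
    linarith only [this, hσ0, hσσ]
  have e6 : ((M * y + K * p) * J⁻¹ * J⁻¹) * (K * (p * (J + a)⁻¹) * a⁻¹ * J⁻¹) * p ^ 2 ≤
      12 * 8 * σ * s := by
    refine mul_le_of_small ?_ (sq_le mp)
    have := abs_mul_le_of_le hb hb1
    linarith only [this, hσ0, hσσ]
  have e7 : ((M * y + K * p) * J⁻¹ * J⁻¹) * (1 - K * K * J⁻¹) * (p * y) ≤ 12 * 27 * σ * s := by
    refine mul_le_of_small ?_ (hprod _ _ (by linarith only [hs, q0, p0, y0, X0, W0, θ0]))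
    have := abs_mul_le_of_le hb hb2
    linarith only [this, hσ0, hσσ]
  have e8 : 0 ≤ K ^ 2 * (J - a) ^ 2 / (2 * J * a ^ 2) := by positivity
  have e9 := mul_le_add_of_near k4J (sneg my)
  have e10 := mul_le_add_of_near kJ (sneg mp)
  have e11 := mul_le_add_of_near k2 (sq_le my)
  have e12 := mul_le_add_of_near ka (hprod p X (by linarith only [hs, q0, p0, y0, X0, W0, θ0]))
  have e13 : (-M * a⁻¹) * (p * θ) ≤ 2 * σ * s := by
    refine mul_le_of_small ?_ (hprod _ _ (by linarith only [hs, q0, p0, y0, X0, W0, θ0]))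
    have := abs_mul_le_of_le ((abs_neg M).trans_le hM) ba
    linarith only [this, hσ0, hσσ]
  have e14 := mul_le_add_of_near t7 (sq_le my)
  have e15 : (-M * (p * (J + a)⁻¹) * a⁻¹ * J⁻¹) * (p * p) ≤ 4 * σ * s := by
    refine mul_le_of_small ?_ (hprod _ _ (by linarith only [hs, q0, p0, y0, X0, W0, θ0]))
    have := abs_mul_le_of_le (abs_mul_le_of_le (abs_mul_le_of_le ((abs_neg M).trans_le hM) be) ba) bJ
    linarith only [this, hσ0, hσσ]
  have e16 := mul_le_add_of_near kij (sq_le mp)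
  have e17 : K * y / 2 * (W * y) ≤ 1 * σ * s := by
    refine mul_le_of_small ?_ (hprod _ _ (by linarith only [hs, q0, p0, y0, X0, W0, θ0]))
    rw [abs_div, abs_of_pos (two_pos (α := ℝ))]
    linarith only [hKy]
  have e18 := mul_le_add_of_near K1 ((abs_neg (θ * y)).trans_le (hprod θ y (by linarith only [hs, q0, p0, y0, X0, W0, θ0])))
  have e19 : K * K * y / 2 * (θ * y) ≤ 2 * σ * s := by
    refine mul_le_of_small ?_ (hprod _ _ (by linarith only [hs, q0, p0, y0, X0, W0, θ0]))
    rw [abs_div, abs_of_pos (two_pos (α := ℝ)), mul_assoc]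
    have := abs_mul_le_of_le hK2 hKy
    linarith only [this, hσ0, hσσ]
  have e20 := mul_le_add_of_near tc (sq_le my)
  have e21 := mul_le_add_of_near te (sq_le mp)
  have e22 : 1 / 2 * α * ((1 + θ) * ((J + a) / 2)⁻¹ * p ^ 2 +
      (1 + θ) * (1 - 2 / 3 * (K * y)) * y ^ 2) ≤
      1 / 2 * α * (p ^ 2 + y ^ 2) + 1 / 2 * 5 * (((1 + 6 + 1 * 6) * σ * s) +
        (1 + 2 + 1 * 2) * σ * s) := by
    have h0 : 0 ≤ σ * s := by positivity
    have h1 := mul_le_mul_of_nonneg_left (add_le_add e21 e20) hα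
    have h2 := mul_le_mul_of_nonneg_right hα5 h0
    linarith only [h1, h2]
  rw [scaledDensity_eq ha ha0 hJ hJ2]
  have h0 : 0 ≤ σ * s := by positivity
  linarith only [h0, hs, e1, e2, e3, e4, e5, e6, e7, e8, e9, e10, e11, e12, e13, e14, e15, e16, e17,
    e18, e19, e20, e22]

end CircMCF

namespace CircMCF

/-! ### Scaling -/

/-- Scaling by the radius makes all variables dimensionless: `k` and `z'` are multiplied by `r`,
`k'` by `r²`, `f` is divided by `r`, and `f''` is multiplied by `r`. -/
lemma sq_mul_density {r : ℝ} (hr : r ≠ 0) (α : ℝ) (zd : Plane) (Td : ℝ) (γ ν : ℝ → Plane)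
    (k f g : ℝ → ℝ) (u : ℝ) (hJ : ‖deriv (graphCurve γ ν f) u‖ ≠ 0) (ha : 1 - k u * f u ≠ 0) :
    r ^ 2 * GraphSlice.density r (α / r ^ 2 * Td) zd Td γ ν k f g u =
      scaledDensity α (r * k u) (r ^ 2 * deriv k u) (f u / r) (deriv f u) (r * g u)
        (r * ⟪deriv γ u, zd⟫_ℝ) (r * ⟪ν u, zd⟫_ℝ) (Td - 1) ‖deriv (graphCurve γ ν f) u‖
        (1 - k u * f u) := by
  unfold GraphSlice.density GraphSlice.curvDensity scaledDensity
  generalize ‖deriv (graphCurve γ ν f) u‖ = J at *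
  generalize ⟪deriv γ u, zd⟫_ℝ = x
  generalize ⟪ν u, zd⟫_ℝ = w
  generalize deriv k u = k'
  generalize deriv f u = p
  generalize k u = κ at *
  generalize f u = y at *
  generalize g u = q
  generalize hA : 1 - κ * y = A at *
  field_simp
  ring

end CircMCF

namespace CircMCF

/-! ### Fourier series of periodic functions -/

/-- The squared modulus of the `n`-th Fourier coefficient of `f` on `[0, L]`. -/
def fourierSq (L : ℝ) (f : ℝ → ℝ) (n : ℤ) : ℝ :=
  (L⁻¹ * ∫ u in (0 : ℝ)..L, Real.cos (2 * Real.pi * n / L * u) * f u) ^ 2 +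
  (L⁻¹ * ∫ u in (0 : ℝ)..L, Real.sin (2 * Real.pi * n / L * u) * f u) ^ 2

lemma norm_sq_fourierCoeffOn {L : ℝ} (hL : 0 < L) {f : ℝ → ℝ} (hf : IntervalIntegrable f volume 0 L)
    (n : ℤ) : ‖fourierCoeffOn hL (fun u => (f u : ℂ)) n‖ ^ 2 = fourierSq L f n := by
  have h1 (u : ℝ) : fourier (-n) (u : AddCircle (L - 0)) • (f u : ℂ) =
      ((Real.cos (2 * Real.pi * n / L * u) * f u : ℝ) : ℂ) +
        (-Complex.I) * ((Real.sin (2 * Real.pi * n / L * u) * f u : ℝ) : ℂ) := by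
    have h2 : (2 * Real.pi * Complex.I * ((-n : ℤ) : ℂ) * u / ((L - 0 : ℝ) : ℂ)) =
        ((-(2 * Real.pi * n / L * u) : ℝ) : ℂ) * Complex.I := by
      push_cast
      ring
    rw [fourier_coe_apply, h2, Complex.exp_mul_I, ← Complex.ofReal_cos, ← Complex.ofReal_sin,
      Real.cos_neg, Real.sin_neg, smul_eq_mul]
    push_cast
    ring
  have i1 : IntervalIntegrable (fun u => Real.cos (2 * Real.pi * n / L * u) * f u) volume 0 L :=
    hf.continuousOn_mul (by fun_prop)
  have i2 : IntervalIntegrable (fun u => Real.sin (2 * Real.pi * n / L * u) * f u) volume 0 L :=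
    hf.continuousOn_mul (by fun_prop)
  have j1 : IntervalIntegrable (fun u => ((Real.cos (2 * Real.pi * n / L * u) * f u : ℝ) : ℂ))
      volume 0 L := ⟨i1.1.ofReal, i1.2.ofReal⟩
  have j2 : IntervalIntegrable (fun u => ((Real.sin (2 * Real.pi * n / L * u) * f u : ℝ) : ℂ))
      volume 0 L := ⟨i2.1.ofReal, i2.2.ofReal⟩
  rw [fourierCoeffOn_eq_integral]
  simp_rw [h1]
  rw [intervalIntegral.integral_add j1 (j2.const_mul _),
    intervalIntegral.integral_const_mul, intervalIntegral.integral_ofReal,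
    intervalIntegral.integral_ofReal, fourierSq]
  generalize (∫ u in (0 : ℝ)..L, Real.cos (2 * Real.pi * n / L * u) * f u) = A
  generalize (∫ u in (0 : ℝ)..L, Real.sin (2 * Real.pi * n / L * u) * f u) = B
  rw [← Complex.normSq_eq_norm_sq, Complex.normSq_apply]
  simp
  ring

/-- Parseval's identity for the complex exponentials on the interval of length `L`. -/
lemma hasSum_fourierSq {L : ℝ} (hL : 0 < L) {f : ℝ → ℝ} (hf : MemLp f 2 (volume.restrict (Ioc 0 L))) :
    HasSum (fourierSq L f) (L⁻¹ * ∫ u in (0 : ℝ)..L, f u ^ 2) := by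
  have hi : IntervalIntegrable f volume 0 L := by
    rw [intervalIntegrable_iff_integrableOn_Ioc_of_le hL.le]
    exact hf.integrable one_le_two
  have h := hasSum_sq_fourierCoeffOn hL hf.ofReal
  have e : (fun i : ℤ => ‖fourierCoeffOn hL (fun u => (f u : ℂ)) i‖ ^ 2) = fourierSq L f :=
    funext fun n => norm_sq_fourierCoeffOn hL hi n
  have e2 : (L - 0)⁻¹ • ∫ u in (0 : ℝ)..L, ‖(f u : ℂ)‖ ^ 2 = L⁻¹ * ∫ u in (0 : ℝ)..L, f u ^ 2 := by
    rw [sub_zero, smul_eq_mul]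
    simp
  rw [← e2, ← e]
  exact h

/-- Integration by parts exchanges cosine and sine coefficients with the factor of the frequency,
and periodicity removes the boundary terms. It is done through `integral_eq_sub_of_comp`, so it also
covers the weak second derivative of the height. -/
lemma fourierSq_weakDeriv {L : ℝ} (hL : 0 < L) {p q : ℝ → ℝ} (hp : Continuous p)
    (hq : IntervalIntegrable q volume 0 L) (hpq : ∀ a b, p b - p a = ∫ u in a..b, q u)
    (hper : p L = p 0) (n : ℤ) :
    fourierSq L q n = (2 * Real.pi * n / L) ^ 2 * fourierSq L p n := by
  set w₀ := 2 * Real.pi * n / L with hw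
  have hcL : w₀ * L = n * (2 * Real.pi) := by
    rw [hw]
    field_simp
  have c1 : Real.cos (w₀ * L) = 1 := by rw [hcL, Real.cos_int_mul_two_pi]
  have s1 : Real.sin (w₀ * L) = 0 := by
    rw [hcL, ← mul_assoc, mul_comm _ Real.pi, mul_comm Real.pi]
    exact_mod_cast Real.sin_int_mul_pi (n * 2)
  have ic : IntervalIntegrable (fun u => Real.cos (w₀ * u) * q u) volume 0 L :=
    hq.continuousOn_mul (by fun_prop)
  have is : IntervalIntegrable (fun u => Real.sin (w₀ * u) * q u) volume 0 L :=
    hq.continuousOn_mul (by fun_prop)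
  have jc : IntervalIntegrable (fun u => Real.cos (w₀ * u) * p u) volume 0 L :=
    Continuous.intervalIntegrable (by fun_prop) _ _
  have js : IntervalIntegrable (fun u => Real.sin (w₀ * u) * p u) volume 0 L :=
    Continuous.intervalIntegrable (by fun_prop) _ _
  have dc (u : ℝ) : HasDerivAt (fun w => Real.cos (w₀ * w)) (-Real.sin (w₀ * u) * w₀) u := by
    simpa using ((hasDerivAt_id u).const_mul w₀).cos
  have ds (u : ℝ) : HasDerivAt (fun w => Real.sin (w₀ * w)) (Real.cos (w₀ * u) * w₀) u := by
    simpa using ((hasDerivAt_id u).const_mul w₀).sin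
  have hc : ∫ u in (0 : ℝ)..L, Real.cos (w₀ * u) * q u = w₀ * ∫ u in (0 : ℝ)..L, Real.sin (w₀ * u) * p u := by
    have h := integral_eq_sub_of_comp (F := fun x => Real.cos (w₀ * x.1) * x.2) (by fun_prop) hq hpq
      (D := fun u => Real.cos (w₀ * u) * q u - w₀ * (Real.sin (w₀ * u) * p u))
      (fun u hu => ((dc u).mul hu).congr_deriv (by ring))
    rw [intervalIntegral.integral_sub ic (js.const_mul _), intervalIntegral.integral_const_mul] at h
    simp only [c1, hper, mul_zero, Real.cos_zero] at h
    linarith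
  have hs : ∫ u in (0 : ℝ)..L, Real.sin (w₀ * u) * q u =
      -(w₀ * ∫ u in (0 : ℝ)..L, Real.cos (w₀ * u) * p u) := by
    have h := integral_eq_sub_of_comp (F := fun x => Real.sin (w₀ * x.1) * x.2) (by fun_prop) hq hpq
      (D := fun u => Real.sin (w₀ * u) * q u + w₀ * (Real.cos (w₀ * u) * p u))
      (fun u hu => ((ds u).mul hu).congr_deriv (by ring))
    rw [intervalIntegral.integral_add is (jc.const_mul _), intervalIntegral.integral_const_mul] at h
    simp only [s1, hper, mul_zero, Real.sin_zero] at h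
    linarith
  unfold fourierSq
  rw [← hw, hc, hs]
  ring

lemma fourierSq_zero (L : ℝ) (f : ℝ → ℝ) :
    fourierSq L f 0 = (L⁻¹ * ∫ u in (0 : ℝ)..L, f u) ^ 2 := by
  simp [fourierSq]

lemma fourierSq_nonneg (L : ℝ) (f : ℝ → ℝ) (n : ℤ) : 0 ≤ fourierSq L f n := by
  unfold fourierSq
  positivity

lemma fourierSq_neg (L : ℝ) (f : ℝ → ℝ) (n : ℤ) : fourierSq L f (-n) = fourierSq L f n := by
  unfold fourierSq
  have (u : ℝ) : 2 * Real.pi * ((-n : ℤ) : ℝ) / L * u = -(2 * Real.pi * n / L * u) := by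
    push_cast
    ring
  simp only [this, Real.cos_neg, Real.sin_neg, neg_mul, intervalIntegral.integral_neg]
  ring

end CircMCF

namespace CircMCF

/-! ### The first Fourier mode and the normal field -/

/-- The Cauchy–Schwarz inequality for averages, from nonnegativity of the integral of `(φ f - m)²`
with `m` the average of `φ f`. -/
lemma sq_average_le {L X : ℝ} (hL : 0 < L) {f φ : ℝ → ℝ} (hf : Continuous f) (hφ : Continuous φ)
    (hX : ∀ u ∈ Icc 0 L, |φ u| ≤ X) :
    (L⁻¹ * ∫ u in (0 : ℝ)..L, φ u * f u) ^ 2 ≤ X ^ 2 * (L⁻¹ * ∫ u in (0 : ℝ)..L, f u ^ 2) := by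
  set m := L⁻¹ * ∫ u in (0 : ℝ)..L, φ u * f u with hm
  have h1 : 0 ≤ ∫ u in (0 : ℝ)..L, (X ^ 2 * f u ^ 2 - 2 * m * (φ u * f u) + m ^ 2) := by
    refine intervalIntegral.integral_nonneg hL.le fun u hu => ?_
    have : φ u ^ 2 ≤ X ^ 2 := sq_le_sq' (abs_le.1 (hX u hu)).1 (abs_le.1 (hX u hu)).2
    nlinarith [sq_nonneg (φ u * f u - m), sq_nonneg (f u), mul_le_mul_of_nonneg_right this (sq_nonneg (f u))]
  rw [intervalIntegral.integral_add (Continuous.intervalIntegrable (by fun_prop) _ _)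
    (Continuous.intervalIntegrable (by fun_prop) _ _),
    intervalIntegral.integral_sub (Continuous.intervalIntegrable (by fun_prop) _ _)
    (Continuous.intervalIntegrable (by fun_prop) _ _), intervalIntegral.integral_const_mul,
    intervalIntegral.integral_const_mul, intervalIntegral.integral_const] at h1
  have h2 : ∫ u in (0 : ℝ)..L, φ u * f u = L * m := by
    rw [hm]
    field_simp
  rw [h2, sub_zero, smul_eq_mul] at h1
  have h3 := mul_nonneg (inv_nonneg.2 hL.le) h1
  have h4 : L⁻¹ * (X ^ 2 * (∫ u in (0 : ℝ)..L, f u ^ 2) - 2 * m * (L * m) + L * m ^ 2) =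
      X ^ 2 * (L⁻¹ * ∫ u in (0 : ℝ)..L, f u ^ 2) - m ^ 2 := by
    field_simp
    ring
  linarith

lemma inner_average {L : ℝ} {f : ℝ → ℝ} {ν : ℝ → Plane} (hf : Continuous f) (hν : Continuous ν)
    (e : Plane) : ⟪L⁻¹ • ∫ u in (0 : ℝ)..L, f u • ν u, e⟫_ℝ =
      L⁻¹ * ∫ u in (0 : ℝ)..L, ⟪ν u, e⟫_ℝ * f u := by
  rw [real_inner_smul_left, real_inner_comm, ← innerSL_apply_apply ℝ,
    ← ContinuousLinearMap.intervalIntegral_comp_comm _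
      (Continuous.intervalIntegrable (by fun_prop) _ _)]
  congr 1
  refine intervalIntegral.integral_congr fun u _ => ?_
  simp only [innerSL_apply_apply, real_inner_smul_right, real_inner_comm e]
  ring

lemma sq_add_sq_inner_le {e τ m : Plane} (he : ‖e‖ = 1) (hτ : ‖τ‖ = 1) (h : ⟪τ, e⟫_ℝ = 0) :
    ⟪m, e⟫_ℝ ^ 2 + ⟪m, τ⟫_ℝ ^ 2 ≤ ‖m‖ ^ 2 := by
  have h1 := real_inner_self_nonneg (x := m - ⟪m, e⟫_ℝ • e - ⟪m, τ⟫_ℝ • τ)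
  have h2 : ⟪e, e⟫_ℝ = 1 := by rw [real_inner_self_eq_norm_sq, he]; norm_num
  have h3 : ⟪τ, τ⟫_ℝ = 1 := by rw [real_inner_self_eq_norm_sq, hτ]; norm_num
  have h4 : ⟪e, τ⟫_ℝ = 0 := by rw [real_inner_comm, h]
  simp only [inner_sub_left, inner_sub_right, real_inner_smul_left, real_inner_smul_right, h2, h3, h,
    h4, real_inner_self_eq_norm_sq m] at h1
  rw [real_inner_comm m e, real_inner_comm m τ] at h1
  nlinarith

/-- Rotate the Frenet frame back with constant speed `w`: both vectors then have derivatives of norm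
`|w - k|`, so they drift by at most `β * L`. Rotating forward again recovers the normal and adds up
the two drifts. -/
lemma Tube.norm_rotating_sub_le {Ω : Set Plane} {R L : ℝ} {γ ν : ℝ → Plane} {k : ℝ → ℝ}
    (hT : Tube Ω R γ ν k L) {w β : ℝ} (hβ : ∀ u, |w - k u| ≤ β) {u : ℝ} (hu : u ∈ Icc 0 L) :
    ‖ν u - (Real.cos (w * u) • ν 0 - Real.sin (w * u) • deriv γ 0)‖ ≤ 2 * (β * L) := by
  have dc (u : ℝ) : HasDerivAt (fun v => Real.cos (w * v)) (-Real.sin (w * u) * w) u := by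
    simpa using ((hasDerivAt_id u).const_mul w).cos
  have ds (u : ℝ) : HasDerivAt (fun v => Real.sin (w * v)) (Real.cos (w * u) * w) u := by
    simpa using ((hasDerivAt_id u).const_mul w).sin
  have hβ0 : 0 ≤ β := (abs_nonneg _).trans (hβ 0)
  have nsq (a b : ℝ) (h : a ^ 2 + b ^ 2 = 1) (v : ℝ) : ‖a • ν v + b • deriv γ v‖ = 1 := by
    have h1 : ‖a • ν v + b • deriv γ v‖ ^ 2 = 1 := by
      rw [@norm_add_sq_real, real_inner_smul_left, real_inner_smul_right,
        real_inner_comm, hT.orth, norm_smul, norm_smul, hT.norm_normal, hT.param.unit_speed]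
      simpa using h
    nlinarith [norm_nonneg (a • ν v + b • deriv γ v)]
  have cs (v : ℝ) := Real.sin_sq_add_cos_sq (w * v)
  have bound (G : ℝ → Plane) (D : ℝ → Plane) (hG : ∀ v, HasDerivAt G ((w - k v) • D v) v)
      (hD : ∀ v, ‖D v‖ = 1) : ‖G u - G 0‖ ≤ β * L := by
    have h := (convex_Icc (0 : ℝ) L).norm_image_sub_le_of_norm_hasDerivWithin_le (f := G) (C := β)
      (fun v _ => (hG v).hasDerivWithinAt) (fun v _ => by
        rw [norm_smul, hD, mul_one]
        exact hβ v) (left_mem_Icc.2 hT.param.pos.le) hu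
    refine h.trans (mul_le_mul_of_nonneg_left ?_ hβ0)
    rw [sub_zero, Real.norm_of_nonneg hu.1]
    exact hu.2
  have b1 := bound (fun v => Real.cos (w * v) • ν v + Real.sin (w * v) • deriv γ v)
    (fun v => (-Real.sin (w * v)) • ν v + Real.cos (w * v) • deriv γ v)
    (fun v => (((dc v).smul (hT.hasDerivAt_normal v)).add
      ((ds v).smul (hT.hasDerivAt_tangent v))).congr_deriv (by module))
    (fun v => nsq _ _ (by rw [neg_sq, cs]) v)
  have b2 := bound (fun v => (-Real.sin (w * v)) • ν v + Real.cos (w * v) • deriv γ v)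
    (fun v => (-Real.cos (w * v)) • ν v + (-Real.sin (w * v)) • deriv γ v)
    (fun v => (((ds v).fun_neg.smul (hT.hasDerivAt_normal v)).add
      ((dc v).smul (hT.hasDerivAt_tangent v))).congr_deriv (by module))
    (fun v => nsq _ _ (by rw [neg_sq, neg_sq, add_comm, cs]) v)
  simp only [mul_zero, Real.cos_zero, Real.sin_zero, zero_smul, one_smul, neg_zero, add_zero,
    zero_add] at b1 b2
  have e : ν u - (Real.cos (w * u) • ν 0 - Real.sin (w * u) • deriv γ 0) =
      Real.cos (w * u) • (Real.cos (w * u) • ν u + Real.sin (w * u) • deriv γ u - ν 0) -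
      Real.sin (w * u) • ((-Real.sin (w * u)) • ν u + Real.cos (w * u) • deriv γ u - deriv γ 0) := by
    have h1 : ν u = (Real.sin (w * u) ^ 2 + Real.cos (w * u) ^ 2) • ν u := by rw [cs, one_smul]
    nth_rewrite 1 [h1]
    module
  rw [e]
  refine (norm_sub_le _ _).trans ?_
  rw [norm_smul, norm_smul, Real.norm_eq_abs, Real.norm_eq_abs]
  have h1 := mul_le_mul (Real.abs_cos_le_one (w * u)) b1 (norm_nonneg _) zero_le_one
  have h2 := mul_le_mul (Real.abs_sin_le_one (w * u)) b2 (norm_nonneg _) zero_le_one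
  linarith

/-- The difference of squares is `(A - B)(A + B)`; by `sq_average_le` the first factor is of size
`η` and the second of size `2`, each times the root mean square of `f`. -/
lemma sq_le_sq_add_of_average {L η : ℝ} (hL : 0 < L) (hη : 0 ≤ η) {f φ ψ : ℝ → ℝ}
    (hf : Continuous f) (hφ : Continuous φ) (hψ : Continuous ψ) (h1 : ∀ u, |φ u| ≤ 1)
    (h2 : ∀ u, |ψ u| ≤ 1) (h : ∀ u ∈ Icc 0 L, |φ u - ψ u| ≤ η) :
    (L⁻¹ * ∫ u in (0 : ℝ)..L, φ u * f u) ^ 2 ≤ (L⁻¹ * ∫ u in (0 : ℝ)..L, ψ u * f u) ^ 2 +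
      2 * η * (L⁻¹ * ∫ u in (0 : ℝ)..L, f u ^ 2) := by
  have b1 := sq_average_le hL hf (hφ.sub hψ) h
  have b2 := sq_average_le hL hf (hφ.add hψ) (X := 2) fun u _ =>
    (abs_add_le _ _).trans (by linarith [h1 u, h2 u])
  simp only [Pi.sub_apply, Pi.add_apply, sub_mul, add_mul] at b1 b2
  rw [intervalIntegral.integral_sub (Continuous.intervalIntegrable (by fun_prop) _ _)
    (Continuous.intervalIntegrable (by fun_prop) _ _)] at b1
  rw [intervalIntegral.integral_add (Continuous.intervalIntegrable (by fun_prop) _ _)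
    (Continuous.intervalIntegrable (by fun_prop) _ _)] at b2
  rw [mul_sub] at b1
  rw [mul_add] at b2
  have hF : 0 ≤ L⁻¹ * ∫ u in (0 : ℝ)..L, f u ^ 2 :=
    mul_nonneg (inv_nonneg.2 hL.le) (intervalIntegral.integral_nonneg hL.le fun u _ => sq_nonneg _)
  generalize L⁻¹ * ∫ u in (0 : ℝ)..L, f u ^ 2 = F at *
  generalize L⁻¹ * ∫ u in (0 : ℝ)..L, φ u * f u = A at *
  generalize L⁻¹ * ∫ u in (0 : ℝ)..L, ψ u * f u = B at *
  have h3 : ((A - B) * (A + B)) ^ 2 ≤ (2 * η * F) ^ 2 := by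
    calc ((A - B) * (A + B)) ^ 2 = (A - B) ^ 2 * (A + B) ^ 2 := by ring
      _ ≤ (η ^ 2 * F) * (2 ^ 2 * F) := mul_le_mul b1 b2 (sq_nonneg _) (by positivity)
      _ = _ := by ring
  have h4 := abs_le_of_sq_le_sq h3 (by positivity)
  nlinarith [le_of_abs_le h4]

/-- The first Fourier mode is controlled by the average of `f ν`, for an almost rotating `ν`. -/
lemma Tube.fourierSq_one_le {Ω : Set Plane} {R L : ℝ} {γ ν : ℝ → Plane} {k f : ℝ → ℝ}
    (hT : Tube Ω R γ ν k L) (hf : Continuous f) {β : ℝ}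
    (hβ : ∀ u, |2 * Real.pi / L - k u| ≤ β) :
    fourierSq L f 1 ≤ ‖L⁻¹ • ∫ u in (0 : ℝ)..L, f u • ν u‖ ^ 2 +
      8 * (β * L) * (L⁻¹ * ∫ u in (0 : ℝ)..L, f u ^ 2) := by
  have hL := hT.param.pos
  have hν := hT.normal_smooth.continuous
  have hβ0 : 0 ≤ β := (abs_nonneg _).trans (hβ 0)
  have orth := hT.orth 0
  have n1 := hT.norm_normal 0
  have n2 := hT.param.unit_speed 0
  have key (e : Plane) (he : ‖e‖ = 1) (u : ℝ) (hu : u ∈ Icc 0 L) := by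
    exact (abs_real_inner_le_norm
      (ν u - (Real.cos (2 * Real.pi / L * u) • ν 0 - Real.sin (2 * Real.pi / L * u) • deriv γ 0)) e).trans
      ((by rw [he, mul_one]; exact hT.norm_rotating_sub_le hβ hu :
        _ * ‖e‖ ≤ 2 * (β * L)))
  have le1 (e : Plane) (he : ‖e‖ = 1) (u : ℝ) : |⟪ν u, e⟫_ℝ| ≤ 1 := by
    simpa [he, hT.norm_normal u] using abs_real_inner_le_norm (ν u) e
  -- The cosine is compared with `⟪ν, ν 0⟫` and the sine with `-⟪ν, γ' 0⟫`. The resulting averages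
  -- are components of the average of `f ν` in an orthonormal frame, so their squares are bounded by
  -- its squared norm.
  have a1 := sq_le_sq_add_of_average hL (η := 2 * (β * L)) (by positivity) hf
    (φ := fun u => Real.cos (2 * Real.pi / L * u)) (ψ := fun u => ⟪ν u, ν 0⟫_ℝ) (by fun_prop)
    (by fun_prop) (fun u => Real.abs_cos_le_one _) (le1 _ n1) fun u hu => by
      have := key _ n1 u hu
      rw [abs_sub_comm]
      simpa [inner_sub_left, real_inner_smul_left, n1, orth] using this
  have a2 := sq_le_sq_add_of_average hL (η := 2 * (β * L)) (by positivity) hf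
    (φ := fun u => Real.sin (2 * Real.pi / L * u)) (ψ := fun u => -⟪ν u, deriv γ 0⟫_ℝ) (by fun_prop)
    (by fun_prop) (fun u => Real.abs_sin_le_one _) (fun u => by
      rw [abs_neg]
      exact le1 _ n2 u) fun u hu => by
      have := key _ n2 u hu
      rw [real_inner_comm] at orth
      simpa [inner_sub_left, real_inner_smul_left, n2, orth, add_comm] using this
  simp only [neg_mul, intervalIntegral.integral_neg, mul_neg, neg_sq] at a2
  have hB := sq_add_sq_inner_le (m := L⁻¹ • ∫ u in (0 : ℝ)..L, f u • ν u) n1 n2 orth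
  rw [inner_average hf hν, inner_average hf hν] at hB
  have e : fourierSq L f 1 = (L⁻¹ * ∫ u in (0 : ℝ)..L, Real.cos (2 * Real.pi / L * u) * f u) ^ 2 +
      (L⁻¹ * ∫ u in (0 : ℝ)..L, Real.sin (2 * Real.pi / L * u) * f u) ^ 2 := by
    simp [fourierSq]
  rw [e]
  linarith

end CircMCF

namespace CircMCF

/-! ### The spectral gap -/

/-- A comparison mode by mode: `c n` is the squared Fourier coefficient, `ρ * n` the scaled
frequency. With `x = (ρ n)²` the symbol is `-(x + 1)(x - (3 + α) / 2)`. It is below `4` at `n = 0`,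
below `6` at `n = ±1` and negative for `|n| ≥ 2`, in each case with room of order `5 - α` for `η`
and `δ`. -/
lemma spectral_gap {α δ η ρ Y P Q : ℝ} {c : ℤ → ℝ} (hα : 1 < α) (hα5 : α < 5) (hδ : 0 ≤ δ)
    (hη : 0 ≤ η) (hδα : δ ≤ (5 - α) / 1000) (hηα : η ≤ (5 - α) / 100) (hρ : |ρ - 1| ≤ 2 * δ)
    (hc : ∀ n, 0 ≤ c n) (hY : HasSum c Y) (hP : HasSum (fun n : ℤ => (ρ * n) ^ 2 * c n) P)
    (hQ : HasSum (fun n : ℤ => (ρ * n) ^ 2 * ((ρ * n) ^ 2 * c n)) Q) :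
    -Q + (3 + α) / 2 * Y + (1 + α) / 2 * P + η * (Q + P + Y) ≤
      6 * (c 1 + c (-1)) + 4 * c 0 := by
  have hb : HasSum (fun n : ℤ => (if n = 0 then 4 else if n = 1 ∨ n = -1 then 6 else 0) * c n)
      (6 * (c 1 + c (-1)) + 4 * c 0) := by
    have h := hasSum_sum_of_ne_finset_zero (s := ({0, 1, -1} : Finset ℤ))
      (f := fun n : ℤ => (if n = 0 then (4 : ℝ) else if n = 1 ∨ n = -1 then 6 else 0) * c n)
      (L := .unconditional ℤ) fun n hn => by
        simp only [Finset.mem_insert, Finset.mem_singleton, not_or] at hn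
        simp [hn.1, hn.2.1, hn.2.2]
    have e : ∑ n ∈ ({0, 1, -1} : Finset ℤ),
        (if n = 0 then (4 : ℝ) else if n = 1 ∨ n = -1 then 6 else 0) * c n =
        6 * (c 1 + c (-1)) + 4 * c 0 := by
      rw [Finset.sum_insert (by decide), Finset.sum_insert (by decide), Finset.sum_singleton]
      norm_num
      ring
    rwa [e] at h
  have ht := (((hQ.neg.add (hY.mul_left ((3 + α) / 2))).add (hP.mul_left ((1 + α) / 2))).add
    (((hQ.add hP).add hY).mul_left η))
  refine hasSum_le (fun n => ?_) ht hb
  obtain ⟨hρ1, hρ2⟩ := abs_le.1 hρ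
  have hcn := hc n
  generalize c n = d at hcn
  have key : ∀ x b : ℝ, -(x * x) + (3 + α) / 2 + (1 + α) / 2 * x + η * (x * x + x + 1) ≤ b →
      -(x * (x * d)) + (3 + α) / 2 * d + (1 + α) / 2 * (x * d) + η * (x * (x * d) + x * d + d) ≤
        b * d := fun x b h => by
    have := mul_le_mul_of_nonneg_right h hcn
    linarith
  refine key ((ρ * n) ^ 2) _ ?_
  split_ifs with h0 h1
  · subst h0
    simp
    linarith
  · have hn : ((n : ℝ)) ^ 2 = 1 := by
      rcases h1 with rfl | rfl <;> norm_num
    rw [mul_pow, hn, mul_one]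
    have l1 : ρ ^ 2 ≤ 1 + 5 * δ := by nlinarith
    have l2 : 1 - 4 * δ ≤ ρ ^ 2 := by nlinarith
    have l3 : (1 - 4 * δ) * (1 - 4 * δ) ≤ ρ ^ 2 * ρ ^ 2 :=
      mul_le_mul l2 l2 (by linarith) (sq_nonneg _)
    have l4 : ρ ^ 2 * ρ ^ 2 ≤ 2 := by nlinarith
    nlinarith
  · have hn : (4 : ℝ) ≤ ((n : ℝ)) ^ 2 := by
      have h2 : (4 : ℤ) ≤ n ^ 2 := by
        push Not at h1
        have : 2 ≤ n ∨ n ≤ -2 := by omega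
        rcases this with h | h <;> nlinarith
      exact_mod_cast h2
    have l2 : 1 - 4 * δ ≤ ρ ^ 2 := by nlinarith
    have l3 : 4 - 16 * δ ≤ (ρ * n) ^ 2 := by
      rw [mul_pow]
      nlinarith
    generalize (ρ * n) ^ 2 = x at l3
    -- Multiplied by `x + 1`, this bounds `η (x² + x + 1) ≤ η (x + 1)²` by the negative of the
    -- factored symbol. It uses that `x - (3 + α) / 2` is at least `(5 - α) / 2 - 16 δ`.
    have l4 : η * (x + 1) ≤ x - (3 + α) / 2 := by nlinarith
    have l5 : 0 ≤ x := by linarith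
    nlinarith [mul_le_mul_of_nonneg_left l4 (by linarith : (0 : ℝ) ≤ x + 1), mul_nonneg hη l5]

end CircMCF

/-! ### Averages: translation terms and the quadratic form -/

namespace CircMCF

lemma hasSum_congr_fun {a b : ℤ → ℝ} {s : ℝ} (h : HasSum a s) (hab : ∀ i, b i = a i) : HasSum b s := by
  rwa [funext hab]

namespace GraphSlice

variable {n : ℕ} {S : Setting n} {t δ ε L : ℝ} {γ ν : ℝ → Plane} {k f g : ℝ → ℝ} {h : Plane → ℝ}

lemma frequency_near (G : GraphSlice S t δ ε γ ν k f g L h) (hδ : δ ≤ 1 / 100) :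
    |S.rT t * (2 * Real.pi / L) - 1| ≤ 2 * δ := by
  have hr := G.radius_pos
  have hL := G.graph.tube.param.pos
  have hpi := Real.pi_pos
  have hδ0 : 0 ≤ δ := (abs_nonneg _).trans (G.curv_bound 0)
  have e : S.rT t * (2 * Real.pi / L) - 1 = -(L - 2 * Real.pi * S.rT t) / L := by
    field_simp
    ring
  obtain ⟨h1, h2⟩ := abs_le.1 G.length_bound
  rw [e, abs_div, abs_neg, abs_of_pos hL, div_le_iff₀ hL]
  refine G.length_bound.trans ?_
  have : 0 < 2 * Real.pi * S.rT t := by positivity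
  nlinarith

/-- Test the average `m` of `f ν` with itself: `‖m‖²` is the average of `⟪ν, m⟫ f`, and
`sq_average_le` with `|⟪ν, m⟫| ≤ ‖m‖` allows one factor `‖m‖²` to be divided out. -/
lemma normal_average_sq_le (G : GraphSlice S t δ ε γ ν k f g L h) :
    ‖L⁻¹ • ∫ u in (0 : ℝ)..L, f u • ν u‖ ^ 2 ≤ L⁻¹ * ∫ u in (0 : ℝ)..L, f u ^ 2 := by
  have hf := G.graph.smooth.continuous
  have hν := G.graph.tube.normal_smooth.continuous
  have hL := G.graph.tube.param.pos
  have e := inner_average (L := L) hf hν (L⁻¹ • ∫ u in (0 : ℝ)..L, f u • ν u)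
  generalize (L⁻¹ • ∫ u in (0 : ℝ)..L, f u • ν u) = m at *
  have h1 := sq_average_le hL hf (φ := fun u => ⟪ν u, m⟫_ℝ) (X := ‖m‖) (by fun_prop) fun u _ => by
    simpa [G.graph.tube.norm_normal u] using abs_real_inner_le_norm (ν u) m
  rw [← e, real_inner_self_eq_norm_sq] at h1
  by_contra! hc
  have h0 : 0 ≤ L⁻¹ * ∫ u in (0 : ℝ)..L, f u ^ 2 :=
    mul_nonneg (inv_nonneg.2 hL.le) (intervalIntegral.integral_nonneg hL.le fun u _ => sq_nonneg _)
  nlinarith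

/-- Integrating `f' ⟪γ', z⟫` by parts gives `-k f ⟪ν, z⟫`, which after scaling is close to `-f ⟪ν,
z⟫` since `r k` is close to `1`. The two terms therefore reinforce each other, and the factor `6` of
the shift equation becomes `12`. -/
lemma transport_average_le (G : GraphSlice S t δ ε γ ν k f g L h) (hδ : 0 ≤ δ) :
    S.rT t * (L⁻¹ * ∫ u in (0 : ℝ)..L, deriv f u *
        ⟪deriv γ u, (6 / S.rT t ^ 2) • L⁻¹ • ∫ u in (0 : ℝ)..L, f u • ν u⟫_ℝ) -
      L⁻¹ * ∫ u in (0 : ℝ)..L, ⟪ν u, (6 / S.rT t ^ 2) • L⁻¹ • ∫ u in (0 : ℝ)..L, f u • ν u⟫_ℝ * f u ≤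
      -(12 / S.rT t ^ 2) * ‖L⁻¹ • ∫ u in (0 : ℝ)..L, f u • ν u‖ ^ 2 +
        6 / S.rT t ^ 2 * δ * (L⁻¹ * ∫ u in (0 : ℝ)..L, f u ^ 2) := by
  have hr := G.radius_pos
  have hf := G.graph.smooth.continuous
  have hf' : Continuous (deriv f) := G.graph.smooth.continuous_deriv le_rfl
  have hν := G.graph.tube.normal_smooth.continuous
  have hk := G.graph.tube.curv_smooth.continuous
  have hγ : Continuous (deriv γ) := G.graph.tube.param.smooth.continuous_deriv (by simp)
  have hL := G.graph.tube.param.pos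
  have hm := G.normal_average_sq_le
  have e1 := inner_average (L := L) hf hν
    ((6 / S.rT t ^ 2) • L⁻¹ • ∫ u in (0 : ℝ)..L, f u • ν u)
  rw [← e1]
  set m := L⁻¹ • ∫ u in (0 : ℝ)..L, f u • ν u with hmdef
  set z := (6 / S.rT t ^ 2) • m with hz
  set F := L⁻¹ * ∫ u in (0 : ℝ)..L, f u ^ 2
  have hF : 0 ≤ F := (sq_nonneg _).trans hm
  have e2 : ⟪m, z⟫_ℝ = 6 / S.rT t ^ 2 * ‖m‖ ^ 2 := by
    rw [hz, real_inner_smul_right, real_inner_self_eq_norm_sq]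
  have hzn : ‖z‖ = 6 / S.rT t ^ 2 * ‖m‖ := by
    rw [hz, norm_smul, Real.norm_of_nonneg (by positivity)]
  -- The integrand is the derivative of the periodic function `f ⟪γ', z⟫`, by `γ'' = k ν`.
  have parts : ∫ u in (0 : ℝ)..L, (deriv f u * ⟪deriv γ u, z⟫_ℝ + f u * (k u * ⟪ν u, z⟫_ℝ)) = 0 := by
    rw [intervalIntegral.integral_eq_sub_of_hasDerivAt (f := fun u => f u * ⟪deriv γ u, z⟫_ℝ)
      (fun u _ => ?_) (Continuous.intervalIntegrable (by fun_prop) _ _)]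
    · have h1 : deriv γ L = deriv γ 0 := by
        simpa using G.graph.tube.param.periodic_deriv 0
      have h2 : f L = f 0 := by simpa using G.graph.periodic 0
      rw [h1, h2, sub_self]
    · have d1 := (G.graph.smooth.differentiable one_ne_zero u).hasDerivAt
      have d2 := (G.graph.tube.hasDerivAt_tangent u).inner ℝ (hasDerivAt_const u z)
      refine (d1.mul d2).congr_deriv ?_
      rw [inner_zero_right, real_inner_smul_left, zero_add]
  rw [intervalIntegral.integral_add (Continuous.intervalIntegrable (by fun_prop) _ _)
    (Continuous.intervalIntegrable (by fun_prop) _ _)] at parts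
  have b := sq_average_le hL hf (φ := fun u => (S.rT t * k u - 1) * ⟪ν u, z⟫_ℝ) (X := δ * ‖z‖)
    (by fun_prop) fun u _ => abs_mul_le_of_le (G.curv_bound u) (by
      simpa [G.graph.tube.norm_normal u] using abs_real_inner_le_norm (ν u) z)
  have e3 : (∫ u in (0 : ℝ)..L, (S.rT t * k u - 1) * ⟪ν u, z⟫_ℝ * f u) =
      S.rT t * (∫ u in (0 : ℝ)..L, f u * (k u * ⟪ν u, z⟫_ℝ)) - ∫ u in (0 : ℝ)..L, ⟪ν u, z⟫_ℝ * f u := by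
    rw [← intervalIntegral.integral_const_mul, ← intervalIntegral.integral_sub
      (Continuous.intervalIntegrable (by fun_prop) _ _)
      (Continuous.intervalIntegrable (by fun_prop) _ _)]
    congr 1
    funext u
    ring
  rw [e3, mul_sub, ← e1, hzn] at b
  have e4 : S.rT t * (L⁻¹ * ∫ u in (0 : ℝ)..L, deriv f u * ⟪deriv γ u, z⟫_ℝ) =
      -(L⁻¹ * (S.rT t * ∫ u in (0 : ℝ)..L, f u * (k u * ⟪ν u, z⟫_ℝ))) := by
    rw [eq_neg_of_add_eq_zero_left parts]
    ring
  rw [e4]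
  generalize L⁻¹ * (S.rT t * ∫ u in (0 : ℝ)..L, f u * (k u * ⟪ν u, z⟫_ℝ)) = A at *
  rw [e2] at b ⊢
  have b2 : (A - 6 / S.rT t ^ 2 * ‖m‖ ^ 2) ^ 2 ≤ (6 / S.rT t ^ 2 * δ * F) ^ 2 := by
    refine b.trans ?_
    calc (δ * (6 / S.rT t ^ 2 * ‖m‖)) ^ 2 * F = (6 / S.rT t ^ 2 * δ) ^ 2 * (‖m‖ ^ 2 * F) := by ring
      _ ≤ (6 / S.rT t ^ 2 * δ) ^ 2 * (F * F) := by gcongr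
      _ = _ := by ring
  have b3 := (abs_le.1 (abs_le_of_sq_le_sq b2 (by positivity))).1
  have e5 : 12 / S.rT t ^ 2 = 2 * (6 / S.rT t ^ 2) := by ring
  rw [e5]
  linarith

/-- The Fourier decomposition of the quadratic form. -/
lemma quadratic_le (G : GraphSlice S t δ ε γ ν k f g L h) {α η : ℝ} (hα : 1 < α) (hα5 : α < 5)
    (hδα : δ ≤ (5 - α) / 1000) (hη : 0 ≤ η) (hηα : η ≤ (5 - α) / 100) :
    -(S.rT t ^ 2 * (L⁻¹ * ∫ u in (0 : ℝ)..L, g u ^ 2)) +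
        (3 + α) / 2 * ((L⁻¹ * ∫ u in (0 : ℝ)..L, f u ^ 2) / S.rT t ^ 2) +
        (1 + α) / 2 * (L⁻¹ * ∫ u in (0 : ℝ)..L, deriv f u ^ 2) +
        η * (S.rT t ^ 2 * (L⁻¹ * ∫ u in (0 : ℝ)..L, g u ^ 2) +
          L⁻¹ * (∫ u in (0 : ℝ)..L, deriv f u ^ 2) +
          (L⁻¹ * ∫ u in (0 : ℝ)..L, f u ^ 2) / S.rT t ^ 2) ≤
      12 * (‖L⁻¹ • ∫ u in (0 : ℝ)..L, f u • ν u‖ ^ 2 / S.rT t ^ 2) +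
        2880 * δ * ((L⁻¹ * ∫ u in (0 : ℝ)..L, f u ^ 2) / S.rT t ^ 2) +
        4 * ((L⁻¹ * ∫ u in (0 : ℝ)..L, f u) ^ 2 / S.rT t ^ 2) := by
  have hr := G.radius_pos
  have hf := G.graph.smooth.continuous
  have hf' : Continuous (deriv f) := G.graph.smooth.continuous_deriv le_rfl
  have hL := G.graph.tube.param.pos
  have hδ0 : 0 ≤ δ := (abs_nonneg _).trans (G.curv_bound 0)
  have hδ1 : δ ≤ 1 / 100 := by linarith
  have hw := G.frequency_near hδ1
  have hfi (a b : ℝ) : f b - f a = ∫ u in a..b, deriv f u :=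
    (intervalIntegral.integral_eq_sub_of_hasDerivAt
      (fun u _ => (G.graph.smooth.differentiable one_ne_zero u).hasDerivAt)
      (hf'.intervalIntegrable _ _)).symm
  have hfL : f L = f 0 := by simpa using G.graph.periodic 0
  have hpL : deriv f L = deriv f 0 := by
    have h1 : deriv (fun u => f (u + L)) 0 = deriv f 0 := by rw [funext G.graph.periodic]
    simpa [deriv_comp_add_const] using h1
  have memc {φ : ℝ → ℝ} (hφ : Continuous φ) : MemLp φ 2 (volume.restrict (Ioc 0 L)) :=
    (memLp_two_iff_integrable_sq hφ.aestronglyMeasurable).2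
      (((hφ.pow 2).continuousOn.integrableOn_Icc).mono_set Ioc_subset_Icc_self)
  have sf := hasSum_fourierSq hL (memc hf)
  have sp := hasSum_fourierSq hL (memc hf')
  have sg := hasSum_fourierSq hL (G.memLp.mono_measure (Measure.restrict_mono Ioc_subset_Icc_self le_rfl))
  have cp := fourierSq_weakDeriv hL hf (hf'.intervalIntegrable _ _) hfi hfL
  have cg := fourierSq_weakDeriv hL hf' (G.intervalIntegrable _ _) G.deriv_sub hpL
  have gap := spectral_gap (c := fun i => fourierSq L f i / S.rT t ^ 2) hα hα5 hδ0 hη hδα hηα hw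
    (fun i => div_nonneg (fourierSq_nonneg L f i) (sq_nonneg _)) (sf.div_const _)
    (hasSum_congr_fun sp fun i => by
      rw [cp]
      field_simp)
    (hasSum_congr_fun (sg.mul_left (S.rT t ^ 2)) fun i => by
      rw [cg, cp]
      field_simp)
  refine gap.trans ?_
  rw [fourierSq_neg, fourierSq_zero]
  -- The defect `3 δ / r` of uniform rotation is `2 δ` from the length (`frequency_near`) plus `δ`
  -- from the curvature.
  have one := G.graph.tube.fourierSq_one_le hf (β := 3 * δ / S.rT t) fun u => by
    rw [le_div_iff₀ hr]
    nth_rewrite 1 [← abs_of_pos hr]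
    rw [← abs_mul]
    have e : (2 * Real.pi / L - k u) * S.rT t =
      (S.rT t * (2 * Real.pi / L) - 1) - (S.rT t * k u - 1) := by ring
    rw [e]
    exact (abs_sub _ _).trans (by linarith [G.curv_bound u])
  have hF : 0 ≤ L⁻¹ * ∫ u in (0 : ℝ)..L, f u ^ 2 :=
    mul_nonneg (inv_nonneg.2 hL.le) (intervalIntegral.integral_nonneg hL.le fun u _ => sq_nonneg _)
  -- Uses `L ≤ 10 r`. Then `8 * 30 = 240` is the error for one mode, and `12 * 240 = 2880` the one
  -- in the conclusion.
  have hβ : 3 * δ / S.rT t * L ≤ 30 * δ := by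
    have h1 := (abs_le.1 G.length_bound).2
    have hpi := Real.pi_lt_four
    have hpi0 := Real.pi_pos
    rw [div_mul_eq_mul_div, div_le_iff₀ hr]
    have : L ≤ 10 * S.rT t := by
      have : 2 * Real.pi * S.rT t * (1 + δ) ≤ 8 * S.rT t * (101 / 100) := by
        gcongr <;> linarith
      nlinarith
    nlinarith
  generalize L⁻¹ * ∫ u in (0 : ℝ)..L, f u ^ 2 = F at *
  have two : fourierSq L f 1 ≤ ‖L⁻¹ • ∫ u in (0 : ℝ)..L, f u • ν u‖ ^ 2 + 240 * δ * F :=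
    one.trans (by nlinarith)
  have three := div_le_div_of_nonneg_right two (sq_nonneg (S.rT t))
  rw [add_div, mul_div_assoc] at three
  linarith

end GraphSlice
end CircMCF

/-! ### The integrated estimate and its sign -/

namespace CircMCF
namespace GraphSlice

variable {n : ℕ} {S : Setting n} {t δ ε L : ℝ} {γ ν : ℝ → Plane} {k f g : ℝ → ℝ} {h : Plane → ℝ}

/-- The pointwise estimate in the original variables. In the error the tangential and normal parts
of the translation velocity are recombined to `‖zd‖²`, which no longer depends on the parameter. -/
lemma sq_mul_density_le (G : GraphSlice S t δ ε γ ν k f g L h) {α σ : ℝ} (hα : 0 ≤ α) (hα5 : α ≤ 5)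
    (hσ : σ ≤ 1 / 100) (hδσ : δ ≤ σ) (hεσ : ε ≤ σ) (zd : Plane) {θ : ℝ} (hθ : |θ| ≤ σ) (u : ℝ) :
    S.rT t ^ 2 * density (S.rT t) (α / S.rT t ^ 2 * (1 + θ)) zd (1 + θ) γ ν k f g u ≤
      (1000000 * σ - 1) * S.rT t ^ 2 * g u ^ 2 +
      ((3 + α) / 2 + 1000000 * σ) / S.rT t ^ 2 * f u ^ 2 +
      ((1 + α) / 2 + 1000000 * σ) * deriv f u ^ 2 + S.rT t * (deriv f u * ⟪deriv γ u, zd⟫_ℝ) -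
      ⟪ν u, zd⟫_ℝ * f u - θ / S.rT t * f u +
      1000000 * σ * (S.rT t ^ 2 * ‖zd‖ ^ 2 + θ ^ 2) := by
  have hr := G.radius_pos
  have hJ := G.graph.norm_deriv_graphCurve_pos u
  have ha := G.graph.stretch_pos u
  have hσ0 : 0 ≤ σ := (abs_nonneg _).trans hθ
  have hbound := scaledDensity_le (α := α) (σ := σ) (K := S.rT t * k u)
    (M := S.rT t ^ 2 * deriv k u) (y := f u / S.rT t) (p := deriv f u) (q := S.rT t * g u)
    (X := S.rT t * ⟪deriv γ u, zd⟫_ℝ) (W := S.rT t * ⟪ν u, zd⟫_ℝ) (θ := θ)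
    (J := ‖deriv (graphCurve γ ν f) u‖) (a := 1 - k u * f u) hα hα5 hσ
    ((G.curv_bound u).trans hδσ)
    (by
      rw [abs_mul, abs_of_nonneg (sq_nonneg _)]
      exact (G.deriv_curv_bound u).trans hδσ)
    (by
      rw [abs_div, abs_of_pos hr, div_le_iff₀ hr]
      exact (G.height_bound u).trans (by gcongr))
    ((G.slope_bound u).trans hεσ) hθ (by field_simp) hJ (G.graph.norm_sq_deriv_graphCurve u)
  have e := sq_mul_density hr.ne' α zd (1 + θ) γ ν k f g u hJ.ne' ha.ne'
  rw [add_sub_cancel_left] at e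
  rw [e]
  refine hbound.trans ?_
  have hB := sq_add_sq_inner_le (m := zd) (G.graph.tube.norm_normal u)
    (G.graph.tube.param.unit_speed u) (G.graph.tube.orth u)
  rw [real_inner_comm, real_inner_comm (deriv γ u)] at hB
  have hB2 := mul_le_mul_of_nonneg_left hB
    (by positivity : 0 ≤ 1000000 * σ * S.rT t ^ 2)
  have e1 : S.rT t * ⟪ν u, zd⟫_ℝ * (f u / S.rT t) = ⟪ν u, zd⟫_ℝ * f u := by field_simp
  have e2 : ((3 + α) / 2 + 1000000 * σ) / S.rT t ^ 2 * f u ^ 2 =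
    ((3 + α) / 2 + 1000000 * σ) * (f u / S.rT t) ^ 2 := by field_simp
  have e3 : θ / S.rT t * f u = θ * (f u / S.rT t) := by ring
  rw [e1, e2, e3]
  linarith

lemma average_sq_density_le (G : GraphSlice S t δ ε γ ν k f g L h) {α σ : ℝ} (hα : 0 ≤ α)
    (hα5 : α ≤ 5) (hσ : σ ≤ 1 / 100) (hδσ : δ ≤ σ) (hεσ : ε ≤ σ) (zd : Plane) {θ : ℝ} (hθ : |θ| ≤ σ)
    (hI : IntervalIntegrable
      (density (S.rT t) (α / S.rT t ^ 2 * (1 + θ)) zd (1 + θ) γ ν k f g) volume 0 L) :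
    S.rT t ^ 2 * (L⁻¹ * ∫ u in (0 : ℝ)..L,
        density (S.rT t) (α / S.rT t ^ 2 * (1 + θ)) zd (1 + θ) γ ν k f g u) ≤
      (1000000 * σ - 1) * S.rT t ^ 2 * (L⁻¹ * ∫ u in (0 : ℝ)..L, g u ^ 2) +
      ((3 + α) / 2 + 1000000 * σ) / S.rT t ^ 2 * (L⁻¹ * ∫ u in (0 : ℝ)..L, f u ^ 2) +
      ((1 + α) / 2 + 1000000 * σ) * (L⁻¹ * ∫ u in (0 : ℝ)..L, deriv f u ^ 2) +
      (S.rT t * (L⁻¹ * ∫ u in (0 : ℝ)..L, deriv f u * ⟪deriv γ u, zd⟫_ℝ) -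
      L⁻¹ * ∫ u in (0 : ℝ)..L, ⟪ν u, zd⟫_ℝ * f u) -
      θ / S.rT t * (L⁻¹ * ∫ u in (0 : ℝ)..L, f u) +
      1000000 * σ * (S.rT t ^ 2 * ‖zd‖ ^ 2 + θ ^ 2) := by
  have hf := G.graph.smooth.continuous
  have hf' : Continuous (deriv f) := G.graph.smooth.continuous_deriv le_rfl
  have hν := G.graph.tube.normal_smooth.continuous
  have hγ : Continuous (deriv γ) := G.graph.tube.param.smooth.continuous_deriv (by simp)
  have hL := G.graph.tube.param.pos
  have ig : IntervalIntegrable (fun u => g u ^ 2) volume 0 L := by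
    rw [intervalIntegrable_iff_integrableOn_Icc_of_le hL.le]
    exact G.memLp.integrable_sq
  have i1 : IntervalIntegrable (fun u => f u ^ 2) volume 0 L :=
    Continuous.intervalIntegrable (by fun_prop) _ _
  have i2 : IntervalIntegrable (fun u => deriv f u ^ 2) volume 0 L :=
    Continuous.intervalIntegrable (by fun_prop) _ _
  have i3 : IntervalIntegrable (fun u => deriv f u * ⟪deriv γ u, zd⟫_ℝ) volume 0 L :=
    Continuous.intervalIntegrable (by fun_prop) _ _
  have i4 : IntervalIntegrable (fun u => ⟪ν u, zd⟫_ℝ * f u) volume 0 L :=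
    Continuous.intervalIntegrable (by fun_prop) _ _
  have i5 : IntervalIntegrable f volume 0 L := hf.intervalIntegrable _ _
  have s1 := ig.const_mul ((1000000 * σ - 1) * S.rT t ^ 2)
  have s2 := s1.add (i1.const_mul (((3 + α) / 2 + 1000000 * σ) / S.rT t ^ 2))
  have s3 := s2.add (i2.const_mul ((1 + α) / 2 + 1000000 * σ))
  have s4 := s3.add (i3.const_mul (S.rT t))
  have s5 := s4.sub i4
  have s6 := s5.sub (i5.const_mul (θ / S.rT t))
  have s7 := s6.add (_root_.intervalIntegrable_const (c := 1000000 * σ * (S.rT t ^ 2 * ‖zd‖ ^ 2 + θ ^ 2)))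
  have hmono := intervalIntegral.integral_mono_on hL.le (hI.const_mul (S.rT t ^ 2)) s7
    fun u _ => G.sq_mul_density_le hα hα5 hσ hδσ hεσ zd hθ u
  rw [intervalIntegral.integral_add s6 _root_.intervalIntegrable_const,
    intervalIntegral.integral_sub s5 (i5.const_mul _), intervalIntegral.integral_sub s4 i4,
    intervalIntegral.integral_add s3 (i3.const_mul _),
    intervalIntegral.integral_add s2 (i2.const_mul _),
    intervalIntegral.integral_add s1 (i1.const_mul _)] at hmono
  simp only [intervalIntegral.integral_const_mul, intervalIntegral.integral_const, sub_zero,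
    smul_eq_mul] at hmono
  have h1 := mul_le_mul_of_nonneg_left hmono (inv_nonneg.2 hL.le)
  have h2 (b c : ℝ) : L⁻¹ * (b * (L * c)) = b * c := by field_simp
  generalize (∫ u in (0 : ℝ)..L,
    density (S.rT t) (α / S.rT t ^ 2 * (1 + θ)) zd (1 + θ) γ ν k f g u) = D at h1 ⊢
  rw [mul_add _ _ (1000000 * σ * (L * _)), h2] at h1
  linarith

/-- In the perturbative regime the density has a nonpositive integral. -/
theorem integral_density_nonpos (G : GraphSlice S t δ ε γ ν k f g L h) {α σ : ℝ} (hα : 1 < α)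
    (hα5 : α < 5) (hσ : σ ≤ (5 - α) / 10000000000) (hδσ : δ ≤ σ) (hεσ : 4 * ε ≤ σ)
    (hI : IntervalIntegrable (density (S.rT t)
      (α / S.rT t ^ 2 * (1 + 4 / S.rT t * (L⁻¹ * ∫ u in (0 : ℝ)..L, f u)))
      ((6 / S.rT t ^ 2) • L⁻¹ • ∫ u in (0 : ℝ)..L, f u • ν u)
      (1 + 4 / S.rT t * (L⁻¹ * ∫ u in (0 : ℝ)..L, f u)) γ ν k f g) volume 0 L) :
    ∫ u in (0 : ℝ)..L, density (S.rT t)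
      (α / S.rT t ^ 2 * (1 + 4 / S.rT t * (L⁻¹ * ∫ u in (0 : ℝ)..L, f u)))
      ((6 / S.rT t ^ 2) • L⁻¹ • ∫ u in (0 : ℝ)..L, f u • ν u)
      (1 + 4 / S.rT t * (L⁻¹ * ∫ u in (0 : ℝ)..L, f u)) γ ν k f g u ≤ 0 := by
  have hr := G.radius_pos
  have hf := G.graph.smooth.continuous
  have hL := G.graph.tube.param.pos
  have hδ0 : 0 ≤ δ := (abs_nonneg _).trans (G.curv_bound 0)
  have hε0 : 0 ≤ ε := (abs_nonneg _).trans (G.slope_bound 0)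
  have hσ0 : 0 ≤ σ := hδ0.trans hδσ
  have mean : (L⁻¹ * ∫ u in (0 : ℝ)..L, f u) ^ 2 ≤ L⁻¹ * ∫ u in (0 : ℝ)..L, f u ^ 2 := by
    simpa using sq_average_le hL hf (φ := fun _ => 1) (X := 1) continuous_const (by simp)
  have meanε : |L⁻¹ * ∫ u in (0 : ℝ)..L, f u| ≤ ε * S.rT t := by
    have h1 := intervalIntegral.norm_integral_le_of_norm_le_const (a := 0) (b := L) (f := f)
      (C := ε * S.rT t) fun u _ => G.height_bound u
    rw [sub_zero, Real.norm_eq_abs, abs_of_pos hL] at h1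
    rw [abs_mul, abs_of_pos (inv_pos.2 hL), inv_mul_le_iff₀ hL]
    linarith
  -- The time shift is at most `4 ε` by the equation for `T` and `|f| ≤ ε r`; this is the reason for
  -- requiring `4 * ε ≤ σ`.
  have hθ : |4 / S.rT t * (L⁻¹ * ∫ u in (0 : ℝ)..L, f u)| ≤ σ := by
    rw [abs_mul, abs_of_pos (by positivity : 0 < 4 / S.rT t)]
    refine le_trans ?_ hεσ
    calc 4 / S.rT t * |L⁻¹ * ∫ u in (0 : ℝ)..L, f u| ≤ 4 / S.rT t * (ε * S.rT t) := by gcongr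
      _ = 4 * ε := by field_simp
  have main := G.average_sq_density_le (α := α) (by linarith) hα5.le (by linarith) hδσ
    (by linarith) _ hθ hI
  have trans := G.transport_average_le hδ0
  -- The reserve `η` has to exceed the pointwise error `10⁶ σ`, including its shift terms with the
  -- factors `36` and `16`, and the terms with `δ ≤ σ`. The bound on `σ` keeps it below `(5 - α) /
  -- 100`.
  have quad := G.quadratic_le (η := 100000000 * σ) hα hα5 (by linarith) (by positivity) (by linarith)
  have hm := G.normal_average_sq_le
  generalize (∫ u in (0 : ℝ)..L, density (S.rT t)
      (α / S.rT t ^ 2 * (1 + 4 / S.rT t * (L⁻¹ * ∫ u in (0 : ℝ)..L, f u)))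
      ((6 / S.rT t ^ 2) • L⁻¹ • ∫ u in (0 : ℝ)..L, f u • ν u)
      (1 + 4 / S.rT t * (L⁻¹ * ∫ u in (0 : ℝ)..L, f u)) γ ν k f g u) = D at *
  have hz : ‖(6 / S.rT t ^ 2) • L⁻¹ • ∫ u in (0 : ℝ)..L, f u • ν u‖ ^ 2 =
      36 / S.rT t ^ 4 * ‖L⁻¹ • ∫ u in (0 : ℝ)..L, f u • ν u‖ ^ 2 := by
    rw [norm_smul (6 / S.rT t ^ 2), Real.norm_of_nonneg (by positivity)]
    field_simp
    ring
  rw [hz] at main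
  have main2 := main.trans (add_le_add_left (sub_le_sub_right (add_le_add_right trans _) _) _)
  have hG : 0 ≤ L⁻¹ * ∫ u in (0 : ℝ)..L, g u ^ 2 :=
    mul_nonneg (inv_nonneg.2 hL.le) (intervalIntegral.integral_nonneg hL.le fun u _ => sq_nonneg _)
  have hP : 0 ≤ L⁻¹ * ∫ u in (0 : ℝ)..L, deriv f u ^ 2 :=
    mul_nonneg (inv_nonneg.2 hL.le) (intervalIntegral.integral_nonneg hL.le fun u _ => sq_nonneg _)
  have hF : 0 ≤ L⁻¹ * ∫ u in (0 : ℝ)..L, f u ^ 2 := (sq_nonneg _).trans hm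
  clear main trans hz hI
  generalize L⁻¹ * ∫ u in (0 : ℝ)..L, g u ^ 2 = Q at *
  generalize L⁻¹ * ∫ u in (0 : ℝ)..L, deriv f u ^ 2 = P at *
  generalize L⁻¹ * ∫ u in (0 : ℝ)..L, f u ^ 2 = F at *
  generalize L⁻¹ * ∫ u in (0 : ℝ)..L, f u = m at *
  generalize ‖L⁻¹ • ∫ u in (0 : ℝ)..L, f u • ν u‖ ^ 2 = M at *
  generalize S.rT t = r at *
  have hr2 : 0 < r ^ 2 := by positivity
  have hY := div_nonneg hF hr2.le
  have hMY : M / r ^ 2 ≤ F / r ^ 2 := by gcongr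
  have hmY : m ^ 2 / r ^ 2 ≤ F / r ^ 2 := by gcongr
  have hQ := mul_nonneg hr2.le hG
  have e : r ^ 2 * (L⁻¹ * D) ≤ (1000000 * σ - 1) * (r ^ 2 * Q) +
      ((3 + α) / 2 + 1000000 * σ) * (F / r ^ 2) + ((1 + α) / 2 + 1000000 * σ) * P +
      (-12 * (M / r ^ 2) + 6 * δ * (F / r ^ 2)) - 4 * (m ^ 2 / r ^ 2) +
      1000000 * σ * (36 * (M / r ^ 2) + 16 * (m ^ 2 / r ^ 2)) := by
    refine main2.trans_eq ?_
    field_simp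
    ring
  have hle : r ^ 2 * (L⁻¹ * D) ≤ 0 := by
    clear main2
    generalize r ^ 2 * Q = q at *
    generalize F / r ^ 2 = Y at *
    generalize M / r ^ 2 = N at *
    generalize m ^ 2 / r ^ 2 = c at *
    have p1 := mul_le_mul_of_nonneg_left hMY hσ0
    have p2 := mul_le_mul_of_nonneg_left hmY hσ0
    have p3 := mul_nonneg hσ0 hY
    have p4 := mul_nonneg hσ0 hP
    have p5 := mul_nonneg hσ0 hQ
    have p6 := mul_le_mul_of_nonneg_right hδσ hY
    linarith only [e, quad, p1, p2, p3, p4, p5, p6]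
  by_contra! hc
  have : 0 < r ^ 2 * (L⁻¹ * D) := by positivity
  linarith

end GraphSlice
end CircMCF

end

/-! ### Choice of the constants and conclusion -/

theorem mainTheorem5 (α : ℝ) (hα : α ∈ Set.Ioo (1 : ℝ) 5) :
    ∃ C₀ ≥ (1 : ℝ), ∃ C₀' ≥ (1 : ℝ), ∃ δ₀ ∈ Set.Ioo (0 : ℝ) (1 / 2), ∃ Cζ₀ ≥ (1 : ℝ),
      ∀ C ≥ C₀, ∀ C' ≥ C₀', ∀ δasymp ∈ Set.Ioc (0 : ℝ) δ₀, ∀ Cζ ≥ Cζ₀,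
      ∀ (n : ℕ) (S : Setting n), S.Standing δasymp Cζ →
      ∀ t ∈ Set.Ioo 0 S.tχ,
        IsRegularSlice (fun i x => S.χ i x t) (S.V t) (fun x => S.H x t) →
        volume {x | S.χ 0 x t = 1} < ⊤ →
        S.ShiftODE t →
        S.PerturbativeRegime C C' Cζ t →
        (∑ p ∈ (Finset.univ : Finset (Fin (n + 2))).offDiag,
            (1 / 2) * (-S.dissip p.1 p.2 t + S.rhsInt p.1 p.2 t))
          + ∑ i ∈ (Finset.univ : Finset (Fin (n + 2))).erase (Fin.last (n + 1)), S.rhsBulk i t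
        ≤ -(α / S.rT t ^ 2) * (1 + deriv (fun s => S.T s - s) t) * S.err t := by
  obtain ⟨hα1, hα5⟩ := hα
  set σ := (5 - α) / 10000000000 with hσ
  have hσ0 : 0 < σ := by
    rw [hσ]
    linarith
  have hσ1 : σ ≤ 1 / 100 := by
    rw [hσ]
    linarith
  have one_le : 1 ≤ 4 / σ := by
    rw [le_div_iff₀ hσ0]
    linarith
  -- With `C, C' ≥ 4 / σ` both the relative height `1 / (16 C)` and the slope `1 / C'` are at most
  -- `σ / 4`. No lower bound on `Cζ` beyond `1` is needed, as the height condition already contains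
  -- it.
  refine ⟨4 / σ, one_le, 4 / σ, one_le, σ, ⟨hσ0, by linarith⟩, 1, le_rfl, ?_⟩
  intro C hC C' hC' δ hδ Cζ hCζ n S hS t ht hreg hfin hode hP
  have small {c : ℝ} (hc : 4 / σ ≤ c) : 1 / c ≤ σ / 4 := by
    rw [div_le_iff₀ hσ0] at hc
    have hc0 : 0 < c := by
      by_contra! h
      nlinarith
    rw [div_le_iff₀ hc0]
    linarith
  obtain ⟨γ, ν, k, f, g, L, h, G⟩ := Setting.exists_graphSlice (one_le.trans hC) hCζ
    (by linarith [hδ.2]) hS ht hreg hfin hode hP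
  have hε : max (1 / (16 * C)) (1 / C') ≤ σ / 4 :=
    max_le (small (by linarith)) (small hC')
  have hT := G.shift_time
  have hd : deriv (fun s => S.T s - s) t =
      4 / S.rT t * (L⁻¹ * ∫ u in (0 : ℝ)..L, f u) := by
    rw [(hT.fun_sub (hasDerivAt_id' t)).deriv]
    ring
  -- The multiplier `κ` is the claimed rate, with `1 + 𝔗'` replaced by its value from the shift
  -- equation.
  obtain ⟨hI, he⟩ := G.relativeEnergy_eq (by linarith [hδ.2]) (by linarith) hS ht G.shift_center hT
    hreg hP.two_phase
    (α / S.rT t ^ 2 * (1 + 4 / S.rT t * (L⁻¹ * ∫ u in (0 : ℝ)..L, f u)))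
  have hle := G.integral_density_nonpos hα1 hα5 hσ.le hδ.2 (by linarith) hI
  rw [hd]
  linarith
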